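/- **Setting.** Let $\Theta\subset\mathbb R^{N_\theta}$ be compact and consider the SDE $dX_t=V_0(X_t,\theta)\,dt+\sum_{l=1}^d V_l(X_t,\theta)\,dB_{l,t}$ in $\mathbb R^N$, $N\ge 1$, $\theta\in\Theta$, with generator $\mathscr L_\theta\varphi(x)=\sum_i V_0^i(x,\theta)\partial_i\varphi(x)+\frac12\sum_{i_1,i_2}a_{i_1i_2}(x,\theta)\,\partial_{i_1}\partial_{i_2}\varphi(x)$, $a=\sum_{l=1}^d V_lV_l^\top$. Fix an initial state $x\in\mathbb R^N$. Assume: * $V_l(\cdot,\theta)\in C^\infty$ for all $\theta\in\Theta$, and $\theta\mapsto V_l(y,\theta)$ is continuous on $\Theta$ for every $y$ ($0\le l\le d$); * $|x|+|V_0(x,\theta)|\le\kappa$ for all $\theta\in\Theta$, for some $\kappa>0$; the $V_l$ with $1\le l\le d$ are bounded on $\mathbb R^N\times\Theta$; and for each multi-index $\alpha$ with $|\alpha|\ge1$ the derivatives $\partial_y^\alpha V_l(y,\theta)$, $0\le l\le d$, are bounded on $\mathbb R^N\times\Theta$; * one of the following two cases holds: * (E) (elliptic) $a(y,\theta)$ is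 positive definite for all $(y,\theta)\in\mathbb R^N\times\Theta$. Put $m(\mathrm E)=N$. * (H) (hypo-elliptic) $\mathbb R^N=\mathbb R^{N_S}\times\mathbb R^{N_R}$ with $N_S=N_R=d\ge1$, and $V_l=(0,V_{R,l})$ for $1\le l\le d$; for all $(y,\theta)$ the vectors $V_{R,l}(y,\theta)$, $1\le l\le d$, span $\mathbb R^{N_R}$, and the vectors $V_l(y,\theta)$, $[\widetilde V_0,V_l](y,\theta)$, $1\le l\le d$, span $\mathbb R^N$, where $\widetilde V_0=V_0-\frac12\sum_{l=1}^d\sum_i V_l^i\,\partial_iV_l$. Put $m(\mathrm H)=4d$. For $z\in\mathbb R^N$ let $A_{z,\theta}=[\partial_kV_0^i(z,\theta)]_{i,k}$ and $b_{z,\theta}=V_0(z,\theta)-A_{z,\theta}z$. Let $\mathscr L^{0,z}_\theta\varphi(\xi)=\sum_i[A_{z,\theta}\xi+b_{z,\theta}]_i\partial_i\varphi(\xi)+\frac12\sum_{i_1,i_2}a_{i_1i_2}(z,\theta)\,\partial_{i_1}\partial_{i_2}\varphi(\xi)$ be the generator of the linearised (LDL) equation frozen at $z$, let $\eta\mapsto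 p^z_t(\xi,\eta;\theta)$ be its Gaussian transition density, with mean $e^{tA_{z,\theta}}\bigl(\xi+\int_0^te^{-sA_{z,\theta}}b_{z,\theta}\,ds\bigr)$ and covariance $e^{tA_{z,\theta}}\int_0^te^{-sA_{z,\theta}}a(z,\theta)e^{-sA_{z,\theta}^\top}ds\;e^{tA_{z,\theta}^\top}$, and let $\bar P^z_t\varphi(\xi)=\int\varphi(\eta)\,p^z_t(\xi,\eta;\theta)\,d\eta$. Put $\widetilde{\mathscr L}^z_\theta=\mathscr L_\theta-\mathscr L^{0,z}_\theta$, let $\mathrm{ad}_{D_1}(D_2)=D_1D_2-D_2D_1$, and for $\alpha\in\mathbb Z_{\ge0}^j$ let $\mathscr D^{z,\theta}_\alpha=\mathrm{ad}^{\alpha_j}_{\mathscr L^{0,z}_\theta}(\widetilde{\mathscr L}^z_\theta)\cdots\mathrm{ad}^{\alpha_1}_{\mathscr L^{0,z}_\theta}(\widetilde{\mathscr L}^z_\theta)$. For $j\ge1$, $\beta\in\mathbb Z_{\ge0}^j$ and $\Delta\in(0,1)$ let $$\mathscr R_2^{j,\beta}(\Delta,x,y,\theta)=\int_{0\le s_j\le\cdots\le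 s_1\le\Delta}\mathscr E^{\beta}_{s_{1:j}}(\Delta,x,y;\theta)\,ds_j\cdots ds_1,$$ where $\mathscr E^\beta_{s_{1:j}}$ is the residual of the Taylor expansion of the semigroup composition, $$\mathscr E^{\beta}_{s_{1:j}}(\Delta,x,y;\theta)=\Bigl[\bar P^z_{s_j}\widetilde{\mathscr L}^z_\theta\bar P^z_{s_{j-1}-s_j}\cdots\widetilde{\mathscr L}^z_\theta\bar P^z_{s_1-s_2}\widetilde{\mathscr L}^z_\theta\,p^z_{\Delta-s_1}(\cdot,y;\theta)(x)-\sum_{\alpha\le\beta}\frac{\prod_{k=1}^js_k^{\alpha_k}}{\alpha!}\,\mathscr D^{z,\theta}_\alpha\{p^z_\Delta(\cdot,y;\theta)\}(x)\Bigr]_{z=x}.$$ **Theorem 2.** Let $w\in\{\mathrm E,\mathrm H\}$ be the case under consideration, $j\ge1$ and $\beta\in\mathbb Z_{\ge0}^j$. Then all the integrals above converge absolutely (those defining the semigroup: for $0<s_j<\cdots<s_1<\Delta$, with the operators acting on smooth functions), and there exist a function $\mathscr G^{(w)}:(0,\infty)\times\mathbb R^N\times\mathbb R^N\times\Theta\to\mathbb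 R$ that satisfies, for some $C,c>0$ and all $(t,x',y',\theta)$, $$|\mathscr G^{(\mathrm E)}(t,x',y',\theta)|\le C\,t^{-\frac{m(\mathrm E)}2}e^{-c\frac{|y'-x'|^2}{t}},\qquad |\mathscr G^{(\mathrm H)}(t,x',y',\theta)|\le C\,t^{-\frac{m(\mathrm H)}2}e^{-c\left(\frac{|y'_S-x'_S-V_{S,0}(x',\theta)t|^2}{t^3}+\frac{|y'_R-x'_R|^2}{t}\right)}$$ (where $V_{S,0}$ is the $\mathbb R^{N_S}$-component of $V_0$), and constants $C_1,C_2>0$, such that for all $(\Delta,y,\theta)\in(0,1)\times\mathbb R^N\times\Theta$ $$\bigl|\mathscr R_2^{j,\beta}(\Delta,x,y,\theta)\bigr|\le C_1\Delta^{K^{w}(\beta)}\bigl|\mathscr G^{(w)}(\Delta,x,y,\theta)\bigr|\le C_2\Delta^{K^{w}(\beta)-\frac{m(w)}2},$$ where $$K^{\mathrm E}(\beta)=\min_{1\le i\le j}\tfrac{\beta_i}2+\tfrac j2,\qquad K^{\mathrm H}(\beta)=\min_{1\le i\le j}\tfrac12\bigl(\lfloor\tfrac{\beta_i}2\rfloor-\mathbf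 1_{\beta_i\ge2}\bigr)+\tfrac j2 .$$ -/

import Mathlib

open Set MeasureTheory
open scoped Matrix ContDiff

noncomputable section

namespace LDL

/-- The coefficients of the SDE `dX = V₀(X, θ) dt + ∑ⱼ Vⱼ(X, θ) dBⱼ` with state space `ℝ^ι`,
`d` Brownian motions and parameter `θ ∈ ℝ^Nθ`. -/
structure SDE (ι : Type) (d Nθ : ℕ) where
  /-- the drift `V₀` -/
  V0 : EuclideanSpace ℝ ι → EuclideanSpace ℝ (Fin Nθ) → EuclideanSpace ℝ ι
  /-- the diffusion vector fields `V₁, …, V_d` -/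
  V : Fin d → EuclideanSpace ℝ ι → EuclideanSpace ℝ (Fin Nθ) → EuclideanSpace ℝ ι

/-- The partial derivative `∂ᵢ φ (x)`. -/
def pd {ι : Type} [Fintype ι] [DecidableEq ι] (i : ι) (φ : EuclideanSpace ℝ ι → ℝ)
    (x : EuclideanSpace ℝ ι) : ℝ :=
  fderiv ℝ φ x (EuclideanSpace.single i 1)

/-- Operators acting on functions `ℝ^ι → ℝ`. -/
abbrev Op (ι : Type) : Type := (EuclideanSpace ℝ ι → ℝ) → (EuclideanSpace ℝ ι → ℝ)

/-- The commutator `ad_{D₁}(D₂) = D₁ D₂ - D₂ D₁`. -/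
def ad {ι : Type} (D₁ D₂ : Op ι) : Op ι := fun φ => D₁ (D₂ φ) - D₂ (D₁ φ)

/-- The iterated commutator `ad^k_{D₁}(D₂)`. -/
def adIter {ι : Type} (D₁ : Op ι) : ℕ → Op ι → Op ι
  | 0, D₂ => D₂
  | k + 1, D₂ => ad D₁ (adIter D₁ k D₂)

/-- The times `s₀ = Δ, s₁, …, s_j, s_{j+1} = 0`, where `s₁, …, s_j` are the entries of `s`. -/
def timeAt {j : ℕ} (Δ : ℝ) (s : Fin j → ℝ) (k : ℕ) : ℝ :=
  if k = 0 then Δ else if h : k - 1 < j then s ⟨k - 1, h⟩ else 0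

/-- The simplex `0 ≤ s_j ≤ ⋯ ≤ s₁ ≤ Δ`. -/
def simplex (j : ℕ) (Δ : ℝ) : Set (Fin j → ℝ) :=
  {s | Antitone s ∧ ∀ k, 0 ≤ s k ∧ s k ≤ Δ}

/-- The open simplex `0 < s_j < ⋯ < s₁ < Δ`. -/
def openSimplex (j : ℕ) (Δ : ℝ) : Set (Fin j → ℝ) :=
  {s | StrictAnti s ∧ ∀ k, 0 < s k ∧ s k < Δ}

namespace SDE

variable {ι : Type} [Fintype ι] [DecidableEq ι] {d Nθ : ℕ}

/-- The diffusion matrix `a = σ σᵀ`, `σ = [V₁, …, V_d]`. -/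
def a (S : SDE ι d Nθ) (x : EuclideanSpace ℝ ι) (θ : EuclideanSpace ℝ (Fin Nθ)) :
    Matrix ι ι ℝ :=
  Matrix.of fun i k => ∑ l, S.V l x θ i * S.V l x θ k

/-- The generator of the SDE. -/
def gen (S : SDE ι d Nθ) (θ : EuclideanSpace ℝ (Fin Nθ)) : Op ι := fun φ x =>
  ∑ i, S.V0 x θ i * pd i φ x
    + 1 / 2 * ∑ i₁, ∑ i₂, ∑ l, S.V l x θ i₁ * S.V l x θ i₂ * pd i₁ (pd i₂ φ) x

/-- The Jacobian matrix `A_{z,θ} = [∂_j V₀^i (z, θ)]_{i,j}` of the drift. -/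
def A (S : SDE ι d Nθ) (z : EuclideanSpace ℝ ι) (θ : EuclideanSpace ℝ (Fin Nθ)) :
    Matrix ι ι ℝ :=
  Matrix.of fun i k => pd k (fun x => S.V0 x θ i) z

/-- The vector `b_{z,θ} = V₀(z, θ) - A_{z,θ} z`. -/
def b (S : SDE ι d Nθ) (z : EuclideanSpace ℝ ι) (θ : EuclideanSpace ℝ (Fin Nθ)) : ι → ℝ :=
  fun i => S.V0 z θ i - (S.A z θ *ᵥ z.ofLp) i

/-- The generator of the linear SDE whose coefficients are frozen at `z`
(local drift linearisation, LDL). -/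
def gen0 (S : SDE ι d Nθ) (z : EuclideanSpace ℝ ι) (θ : EuclideanSpace ℝ (Fin Nθ)) : Op ι :=
  fun φ x =>
    ∑ i, ((S.A z θ *ᵥ x.ofLp) i + S.b z θ i) * pd i φ x
      + 1 / 2 * ∑ i₁, ∑ i₂, ∑ l, S.V l z θ i₁ * S.V l z θ i₂ * pd i₁ (pd i₂ φ) x

/-- The difference of the two generators. -/
def genDiff (S : SDE ι d Nθ) (z : EuclideanSpace ℝ ι) (θ : EuclideanSpace ℝ (Fin Nθ)) : Op ι :=
  fun φ => S.gen θ φ - S.gen0 z θ φ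

/-- The mean `e^{tA} (x + ∫₀ᵗ e^{-sA} b ds)` of the frozen LDL scheme at time `t`,
started from `x`, with `A = A_{z,θ}`, `b = b_{z,θ}`. -/
def mean (S : SDE ι d Nθ) (z : EuclideanSpace ℝ ι) (θ : EuclideanSpace ℝ (Fin Nθ))
    (t : ℝ) (x : EuclideanSpace ℝ ι) : ι → ℝ :=
  NormedSpace.exp (t • S.A z θ) *ᵥ
    fun i => x i + ∫ s in (0 : ℝ)..t, (NormedSpace.exp ((-s) • S.A z θ) *ᵥ S.b z θ) i

/-- The matrix `∫₀ᵗ e^{-sA} a e^{-sAᵀ} ds`, with `A = A_{z,θ}`, `a = a(z, θ)`. -/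
def covHat (S : SDE ι d Nθ) (z : EuclideanSpace ℝ ι) (θ : EuclideanSpace ℝ (Fin Nθ))
    (t : ℝ) : Matrix ι ι ℝ :=
  Matrix.of fun i k => ∫ s in (0 : ℝ)..t,
    (NormedSpace.exp ((-s) • S.A z θ) * S.a z θ * NormedSpace.exp ((-s) • (S.A z θ)ᵀ)) i k

/-- The covariance matrix of the frozen LDL scheme at time `t`. -/
def cov (S : SDE ι d Nθ) (z : EuclideanSpace ℝ ι) (θ : EuclideanSpace ℝ (Fin Nθ))
    (t : ℝ) : Matrix ι ι ℝ :=
  NormedSpace.exp (t • S.A z θ) * S.covHat z θ t * NormedSpace.exp (t • (S.A z θ)ᵀ)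

/-- The Gaussian transition density `y ↦ p_t(x, y; θ)` of the LDL scheme frozen at `z`. -/
def kernel (S : SDE ι d Nθ) (z : EuclideanSpace ℝ ι) (θ : EuclideanSpace ℝ (Fin Nθ))
    (t : ℝ) (x y : EuclideanSpace ℝ ι) : ℝ :=
  (√((2 * Real.pi) ^ Fintype.card ι * (S.cov z θ t).det))⁻¹ *
    Real.exp (-(1 / 2) *
      ((y.ofLp - S.mean z θ t x) ⬝ᵥ ((S.cov z θ t)⁻¹ *ᵥ (y.ofLp - S.mean z θ t x))))

/-- The semigroup of the LDL scheme frozen at `z`. -/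
def semigroup (S : SDE ι d Nθ) (z : EuclideanSpace ℝ ι) (θ : EuclideanSpace ℝ (Fin Nθ))
    (t : ℝ) : Op ι :=
  fun φ x => ∫ y, φ y * S.kernel z θ t x y

/-- With `L̃` the difference of generators, `P̄` the semigroup and `p` the density of the LDL scheme
frozen at `z`, this is the function
`P̄_{s_k - s_{k+1}} L̃ P̄_{s_{k-1} - s_k} ⋯ L̃ P̄_{s₁ - s₂} L̃ p_{Δ - s₁}(·, y; θ)`
(for `k = 0` it is `p_{Δ - s₁}(·, y; θ)`); recall that `s_{j+1} = 0`. -/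
def chain (S : SDE ι d Nθ) {j : ℕ} (z : EuclideanSpace ℝ ι)
    (θ : EuclideanSpace ℝ (Fin Nθ)) (Δ : ℝ) (s : Fin j → ℝ) (y : EuclideanSpace ℝ ι) :
    ℕ → EuclideanSpace ℝ ι → ℝ
  | 0 => fun ξ => S.kernel z θ (timeAt Δ s 0 - timeAt Δ s 1) ξ y
  | k + 1 => S.semigroup z θ (timeAt Δ s (k + 1) - timeAt Δ s (k + 2))
      (S.genDiff z θ (S.chain z θ Δ s y k))

/-- The composition
`P̄_{s_j} L̃ P̄_{s_{j-1} - s_j} ⋯ L̃ P̄_{s₁ - s₂} L̃ p_{Δ - s₁}(·, y; θ) (x)` at `z = x`. -/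
def T (S : SDE ι d Nθ) {j : ℕ} (s : Fin j → ℝ) (Δ : ℝ) (x y : EuclideanSpace ℝ ι)
    (θ : EuclideanSpace ℝ (Fin Nθ)) : ℝ :=
  S.chain x θ Δ s y j x

/-- The operator `ad^{α_j}_{L⁰}(L̃) ad^{α_{j-1}}_{L⁰}(L̃) ⋯ ad^{α₁}_{L⁰}(L̃)`
(the rightmost factor, with index `α₁`, acts first). -/
def D (S : SDE ι d Nθ) {j : ℕ} (α : Fin j → ℕ) (z : EuclideanSpace ℝ ι)
    (θ : EuclideanSpace ℝ (Fin Nθ)) : Op ι :=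
  fun φ => Fin.foldl j (fun ψ k => adIter (S.gen0 z θ) (α k) (S.genDiff z θ) ψ) φ

/-- The residual of the Taylor expansion of the composition `T` in powers of `s₁, …, s_j`,
with orders `β = (β₁, …, β_j)`. -/
def E (S : SDE ι d Nθ) {j : ℕ} (β : Fin j → ℕ) (s : Fin j → ℝ) (Δ : ℝ)
    (x y : EuclideanSpace ℝ ι) (θ : EuclideanSpace ℝ (Fin Nθ)) : ℝ :=
  S.T s Δ x y θ -
    ∑ α ∈ Finset.Iic β, (∏ k, s k ^ α k) / (∏ k, ((α k).factorial : ℝ)) *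
      S.D α x θ (fun ξ => S.kernel x θ Δ ξ y) x

/-- The remainder `R₂^{j,β}(Δ, x, y, θ)`. -/
def R2 (S : SDE ι d Nθ) {j : ℕ} (β : Fin j → ℕ) (Δ : ℝ)
    (x y : EuclideanSpace ℝ ι) (θ : EuclideanSpace ℝ (Fin Nθ)) : ℝ :=
  ∫ s in simplex j Δ, S.E β s Δ x y θ

/-- All the objects that enter `R₂^{j,β}(Δ, x, y, θ)` make sense: in the interior of the simplex
the operators act on smooth functions and the integrals that define the semigroup converge
absolutely, and the integral over the simplex converges absolutely. -/
def R2WellDefined (S : SDE ι d Nθ) {j : ℕ} (β : Fin j → ℕ) (Δ : ℝ)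
    (x y : EuclideanSpace ℝ ι) (θ : EuclideanSpace ℝ (Fin Nθ)) : Prop :=
  (∀ s ∈ openSimplex j Δ, ∀ k < j, ContDiff ℝ ∞ (S.chain x θ Δ s y k) ∧
    ∀ ξ, Integrable fun η => S.genDiff x θ (S.chain x θ Δ s y k) η *
      S.kernel x θ (timeAt Δ s (k + 1) - timeAt Δ s (k + 2)) ξ η) ∧
  IntegrableOn (fun s => S.E β s Δ x y θ) (simplex j Δ)

/-- Smoothness of the coefficients in the state variable. -/
def IsSmooth (S : SDE ι d Nθ) (Θ : Set (EuclideanSpace ℝ (Fin Nθ))) : Prop :=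
  ∀ θ ∈ Θ, ContDiff ℝ ∞ (fun x => S.V0 x θ) ∧ ∀ l, ContDiff ℝ ∞ (fun x => S.V l x θ)

/-- Compactness of the parameter space, and continuity of the coefficients in the parameter. -/
def ParamRegular (S : SDE ι d Nθ) (Θ : Set (EuclideanSpace ℝ (Fin Nθ))) : Prop :=
  IsCompact Θ ∧ ∀ x, ContinuousOn (fun θ => S.V0 x θ) Θ ∧
    ∀ l, ContinuousOn (fun θ => S.V l x θ) Θ

/-- Boundedness of the drift at the initial state `x`, uniform boundedness of the diffusion
coefficients, and uniform boundedness of the derivatives (of each order `n ≥ 1`) of all the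
coefficients. -/
def CoeffBounded (S : SDE ι d Nθ) (Θ : Set (EuclideanSpace ℝ (Fin Nθ)))
    (x : EuclideanSpace ℝ ι) : Prop :=
  (∃ κ > 0, ∀ θ ∈ Θ, ‖x‖ + ‖S.V0 x θ‖ ≤ κ) ∧
  (∃ C > 0, ∀ l y, ∀ θ ∈ Θ, ‖S.V l y θ‖ ≤ C) ∧
  (∀ n : ℕ, 1 ≤ n → ∃ C > 0, ∀ y, ∀ θ ∈ Θ,
    ‖iteratedFDeriv ℝ n (fun x => S.V0 x θ) y‖ +
      ∑ l, ‖iteratedFDeriv ℝ n (fun x => S.V l x θ) y‖ ≤ C)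

/-- Class (E): the diffusion matrix is positive definite everywhere. -/
def IsElliptic (S : SDE ι d Nθ) (Θ : Set (EuclideanSpace ℝ (Fin Nθ))) : Prop :=
  ∀ x, ∀ θ ∈ Θ, (S.a x θ).PosDef

/-- The drift of the Stratonovich form of the SDE. -/
def stratDrift (S : SDE ι d Nθ) (θ : EuclideanSpace ℝ (Fin Nθ)) (x : EuclideanSpace ℝ ι) :
    EuclideanSpace ℝ ι :=
  S.V0 x θ - (1 / 2 : ℝ) • ∑ l, fderiv ℝ (fun x' => S.V l x' θ) x (S.V l x θ)

/-- The rough component `V_{R,l}` of the diffusion vector field `V_l`, where the state space is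
`ℝ^{N_S} × ℝ^{N_R}`. -/
def VR {NS NR : ℕ} (S : SDE (Fin NS ⊕ Fin NR) d Nθ) (l : Fin d)
    (x : EuclideanSpace ℝ (Fin NS ⊕ Fin NR)) (θ : EuclideanSpace ℝ (Fin Nθ)) :
    EuclideanSpace ℝ (Fin NR) :=
  WithLp.toLp 2 fun i => S.V l x θ (Sum.inr i)

/-- Class (H): the smooth component is not driven by the Brownian motion, the vector fields
`V_{R,l}` span `ℝ^{N_R}` and the vector fields `V_l`, `[Ṽ₀, V_l]` span `ℝ^N`, where `Ṽ₀` is the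
Stratonovich drift. -/
def IsHypoelliptic {NS NR : ℕ} (S : SDE (Fin NS ⊕ Fin NR) d Nθ)
    (Θ : Set (EuclideanSpace ℝ (Fin Nθ))) : Prop :=
  ∀ x, ∀ θ ∈ Θ,
    (∀ l i, S.V l x θ (Sum.inl i) = 0) ∧
    Submodule.span ℝ (range fun l => S.VR l x θ) = ⊤ ∧
    Submodule.span ℝ ((range fun l => S.V l x θ) ∪
      range fun l => VectorField.lieBracket ℝ (S.stratDrift θ) (fun x' => S.V l x' θ) x) = ⊤

/-- `G` satisfies the Gaussian bound that characterises the functions `𝒢` in class (E), where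
`m(E) = N`. -/
def GaussianBoundE {N : ℕ} (Θ : Set (EuclideanSpace ℝ (Fin Nθ)))
    (G : ℝ → EuclideanSpace ℝ (Fin N) → EuclideanSpace ℝ (Fin N) →
      EuclideanSpace ℝ (Fin Nθ) → ℝ) : Prop :=
  ∃ C > 0, ∃ c > 0, ∀ t > 0, ∀ x y, ∀ θ ∈ Θ,
    |G t x y θ| ≤ C * t ^ (-((N : ℝ) / 2)) * Real.exp (-c * (‖y - x‖ ^ 2 / t))

/-- `G` satisfies the Gaussian bound that characterises the functions `𝒢` in class (H), where
`m(H) = 4 d`. -/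
def GaussianBoundH {NS NR : ℕ} (S : SDE (Fin NS ⊕ Fin NR) d Nθ)
    (Θ : Set (EuclideanSpace ℝ (Fin Nθ)))
    (G : ℝ → EuclideanSpace ℝ (Fin NS ⊕ Fin NR) → EuclideanSpace ℝ (Fin NS ⊕ Fin NR) →
      EuclideanSpace ℝ (Fin Nθ) → ℝ) : Prop :=
  ∃ C > 0, ∃ c > 0, ∀ t > 0, ∀ x y, ∀ θ ∈ Θ,
    |G t x y θ| ≤ C * t ^ (-((4 * d : ℝ) / 2)) * Real.exp (-c *
      ((∑ i, (y (Sum.inl i) - x (Sum.inl i) - S.V0 x θ (Sum.inl i) * t) ^ 2) / t ^ 3 +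
        (∑ i, (y (Sum.inr i) - x (Sum.inr i)) ^ 2) / t))

end SDE

/-- The exponent `K` in class (E): `min_i β_i / 2 + j / 2`. -/
def expE {j : ℕ} (β : Fin j → ℕ) : ℝ := (⨅ i, (β i : ℝ) / 2) + (j : ℝ) / 2

/-- The exponent `K` in class (H): `min_i (⌊β_i / 2⌋ - 1_{β_i ≥ 2}) / 2 + j / 2`. -/
def expH {j : ℕ} (β : Fin j → ℕ) : ℝ :=
  (⨅ i, 1 / 2 * ((⌊(β i : ℝ) / 2⌋ : ℝ) - if 2 ≤ β i then 1 else 0)) + (j : ℝ) / 2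

end LDL

end

/-! Write `δ = √Δ`, `G` for the frozen generator, `P` for its semigroup and `Q` for the difference
of the two generators. Testing in `y` against a smooth compactly supported `φ` turns the composition
of kernels into `P_{s_j} Q P_{s_{j-1} - s_j} ⋯ Q P_{Δ - s_1} φ (x)`. The derivative of `u ↦ P_u Q
P_{τ - u}` is `P_u (ad_G Q) P_{τ - u}`. Taylor's formula in `s_j`, then in `s_{j-1}`, and so on,
therefore produces the sum over `α ≤ β` together with remainders that contain one factor `ad_G^{β_i
+ 1} Q` each (`conj_taylor`, `wtaylor_bound`).

It remains to bound such words by the integral of `|φ|` against a Gaussian density. The times `s_k -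
s_{k+1}` can be arbitrarily short, so no derivative may be paid for by the smoothing of an
intermediate semigroup. Instead, evaluation at `x` is composed with one factor of the word after the
other, from the left, and stays in the class `Fn` of functionals `ψ ↦ ∫ Φ(z) δ^{|γ|} ∂^γ ψ (m + L
z)` with `z` standard Gaussian: coefficients pass derivatives by Leibniz' rule, a semigroup step
adds an independent Gaussian block, and derivatives pass through a semigroup because its mean is
affine in the starting point. Once the total time `Δ = δ²` is reached, the covariance is
nondegenerate, and one Gaussian integration by parts per derivative removes them all
(`Fn.exists_bound`). The bound is uniform in `s`; being valid for all `φ`, it holds pointwise in `y`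
(`resid_bound`).

The powers of `δ` are counted with weights: a direction has weight `1`, or `3` if it is a smooth
coordinate of class (H), so that its standard deviation at time `δ²` is of order `δ` or `δ³`. If `f`
vanishes to order `m` at `x`, then `f ∂^γ` costs `δ^{m - |γ|}`. In this sense `Q` costs `δ^{-1}` and
each commutator with `G` costs `δ^{-2}`, which a factor `s ≤ δ²` compensates. The gain lies in the
remainders and comes from a second count: if weight `3` is counted as `2`, then `Q` has at most `2`
and each commutator adds at most `1` (`DO.ad_gen`). In class (E) the operator `ad_G^{β+1} Q` thus
has at most `β + 3` derivatives and costs `δ^{-(β+3)}` instead of `δ^{-(2β+3)}`, a gain of `δ^β`. In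
class (H) the weight is at most `3/2` of the reduced weight, and the gain is `⌊β/2⌋ - 1` (or `0` if
this is negative). With gain `g` the residual is `O(δ^{g - j})` times the Gaussian density, the
simplex has volume at most `δ^{2j}`, and the result is `Δ^{(j + g)/2}`.

The lower bound of the covariance (`Frozen.exists_nondeg`) rests on the nondegeneracy of `a` in the
rough directions and, in class (H), on the bracket condition, which says that the linearised drift
carries the rough directions onto the smooth ones. Compactness of `Θ` makes both uniform. Together
with upper bounds for the covariance this gives the explicit Gaussian estimates. -/

noncomputable section

set_option linter.unusedSectionVars false

namespace LDL


/-! ### Families of functions with uniform polynomial growth. -/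

section UTG

variable {Λ M : Type} {D E F G H Z : Type}
  [NormedAddCommGroup D] [NormedSpace ℝ D]
  [NormedAddCommGroup E] [NormedSpace ℝ E] [NormedAddCommGroup F] [NormedSpace ℝ F]
  [NormedAddCommGroup G] [NormedSpace ℝ G] [NormedAddCommGroup H] [NormedSpace ℝ H]

/-- A family of functions with a common polynomial bound. -/
def UB (f : Λ → E → F) : Prop :=
  ∃ C : ℝ, ∃ k : ℕ, 0 ≤ C ∧ ∀ l x, ‖f l x‖ ≤ C * (1 + ‖x‖) ^ k

/-- A family of `n` times continuously differentiable functions whose derivatives up to order `n`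
have common polynomial bounds. -/
def UTGn {Λ E : Type} [NormedAddCommGroup E] [NormedSpace ℝ E] :
    ℕ → ∀ {F : Type} [NormedAddCommGroup F] [NormedSpace ℝ F], (Λ → E → F) → Prop
  | 0, _, _, _, f => (∀ l, Continuous (f l)) ∧ UB f
  | n + 1, _, _, _, f => (∀ l, Differentiable ℝ (f l)) ∧ UB f ∧ UTGn n fun l => fderiv ℝ (f l)

/-- A family of smooth functions whose derivatives of each order have common polynomial bounds. -/
def UTG (f : Λ → E → F) : Prop := ∀ n, UTGn n f

lemma one_le_growth (x : E) (k : ℕ) : 1 ≤ (1 + ‖x‖) ^ k :=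
  one_le_pow₀ (by linarith [norm_nonneg x])

lemma UB.exists_common {f : Λ → E → F} {g : M → E → G} (hf : UB f) (hg : UB g) :
    ∃ C : ℝ, ∃ k : ℕ, 0 ≤ C ∧ (∀ l x, ‖f l x‖ ≤ C * (1 + ‖x‖) ^ k) ∧
      ∀ l x, ‖g l x‖ ≤ C * (1 + ‖x‖) ^ k := by
  obtain ⟨C, k, hC, h⟩ := hf
  obtain ⟨C', k', hC', h'⟩ := hg
  refine ⟨max C C', max k k', le_max_of_le_left hC, fun l x => (h l x).trans ?_,
    fun l x => (h' l x).trans ?_⟩ <;>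
  · have : 1 ≤ 1 + ‖x‖ := by linarith [norm_nonneg x]
    gcongr
    all_goals first | exact this | simp

lemma UB.of_bound {f : Λ → E → F} {C : ℝ} (h : ∀ l x, ‖f l x‖ ≤ C) : UB f :=
  ⟨|C|, 0, abs_nonneg _, fun l x => by simpa using (h l x).trans (le_abs_self C)⟩

lemma UB.add {f g : Λ → E → F} (hf : UB f) (hg : UB g) : UB fun l x => f l x + g l x := by
  obtain ⟨C, k, hC, h, h'⟩ := hf.exists_common hg
  refine ⟨C + C, k, by positivity, fun l x => (norm_add_le _ _).trans ?_⟩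
  rw [add_mul]
  exact add_le_add (h l x) (h' l x)

lemma UB.bilin (B : F →L[ℝ] G →L[ℝ] H) {f : Λ → E → F} {g : Λ → E → G} (hf : UB f) (hg : UB g) :
    UB fun l x => B (f l x) (g l x) := by
  obtain ⟨C, k, hC, h⟩ := hf
  obtain ⟨C', k', hC', h'⟩ := hg
  refine ⟨‖B‖ * C * C', k + k', by positivity, fun l x => (B.le_opNorm₂ _ _).trans ?_⟩
  calc ‖B‖ * ‖f l x‖ * ‖g l x‖
      ≤ ‖B‖ * (C * (1 + ‖x‖) ^ k) * (C' * (1 + ‖x‖) ^ k') := by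
        gcongr
        exacts [h l x, h' l x]
    _ = _ := by ring

lemma UB.comp {f : Λ → E → F} {g : Λ → D → E} (hf : UB f) (hg : UB g) :
    UB fun l x => f l (g l x) := by
  obtain ⟨C, k, hC, h⟩ := hf
  obtain ⟨C', k', hC', h'⟩ := hg
  refine ⟨C * (1 + C') ^ k, k' * k, by positivity, fun l x => (h l _).trans ?_⟩
  have h1 : 1 + ‖g l x‖ ≤ (1 + C') * (1 + ‖x‖) ^ k' := by
    have := h' l x
    have := one_le_growth x k'
    nlinarith
  calc C * (1 + ‖g l x‖) ^ k ≤ C * ((1 + C') * (1 + ‖x‖) ^ k') ^ k := by gcongr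
    _ = _ := by rw [mul_pow, pow_mul]; ring

lemma UTGn.ub {n : ℕ} {f : Λ → E → F} (h : UTGn n f) : UB f := by
  cases n with
  | zero => exact h.2
  | succ n => exact h.2.1

lemma UTGn.cont {n : ℕ} {f : Λ → E → F} (h : UTGn n f) (l : Λ) : Continuous (f l) := by
  cases n with
  | zero => exact h.1 l
  | succ n => exact (h.1 l).continuous

lemma UTGn.pred {n : ℕ} : ∀ {F : Type} [NormedAddCommGroup F] [NormedSpace ℝ F] {f : Λ → E → F},
    UTGn (n + 1) f → UTGn n f := by
  induction n with
  | zero => exact fun h => ⟨h.cont, h.ub⟩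
  | succ n ih => exact fun h => ⟨h.1, h.2.1, ih h.2.2⟩

lemma UTGn.reindex {n : ℕ} (φ : M → Λ) : ∀ {F : Type} [NormedAddCommGroup F] [NormedSpace ℝ F]
    {f : Λ → E → F}, UTGn n f → UTGn n fun m => f (φ m) := by
  have aux : ∀ {F : Type} [NormedAddCommGroup F] [NormedSpace ℝ F] {f : Λ → E → F},
      UB f → UB fun m => f (φ m) := fun ⟨C, k, hC, h⟩ => ⟨C, k, hC, fun m x => h _ x⟩
  induction n with
  | zero => exact fun h => ⟨fun m => h.1 _, aux h.2⟩
  | succ n ih => exact fun h => ⟨fun m => h.1 _, aux h.2.1, ih h.2.2⟩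

lemma UTG.reindex (φ : M → Λ) {f : Λ → E → F} (h : UTG f) : UTG fun m => f (φ m) :=
  fun n => (h n).reindex φ

lemma UTG.ub {f : Λ → E → F} (h : UTG f) : UB f := (h 0).ub

lemma UTG.cont {f : Λ → E → F} (h : UTG f) (l : Λ) : Continuous (f l) := (h 0).cont l

lemma UTG.diff {f : Λ → E → F} (h : UTG f) (l : Λ) : Differentiable ℝ (f l) := (h 1).1 l

lemma UTG.fderiv {f : Λ → E → F} (h : UTG f) : UTG fun l => fderiv ℝ (f l) :=
  fun n => (h (n + 1)).2.2

lemma UTGn.contDiff {n : ℕ} : ∀ {F : Type} [NormedAddCommGroup F] [NormedSpace ℝ F]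
    {f : Λ → E → F}, UTGn n f → ∀ l, ContDiff ℝ n (f l) := by
  induction n with
  | zero => exact fun h l => contDiff_zero.2 (h.1 l)
  | succ n ih =>
    intro F _ _ f h l
    have := ih h.2.2 l
    rw [Nat.cast_add, Nat.cast_one, contDiff_succ_iff_fderiv]
    exact ⟨h.1 l, by simp, this⟩

lemma UTG.contDiff {f : Λ → E → F} (h : UTG f) (l : Λ) : ContDiff ℝ ∞ (f l) :=
  contDiff_infty.2 fun n => (h n).contDiff l

/-- Integration along segments from the origin turns a polynomial bound of the derivative into one
of the function, of degree one higher. Regularity of a family is thereby reduced to a formula for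
its derivative. -/
lemma UTG.of_fderiv {f : Λ → E → F} (hd : ∀ l, Differentiable ℝ (f l)) {C : ℝ}
    (h0 : ∀ l, ‖f l 0‖ ≤ C) (h : UTG fun l => _root_.fderiv ℝ (f l)) : UTG f := by
  have hub : UB f := by
    obtain ⟨C', k, hC', h'⟩ := h.ub
    refine ⟨|C| + C', k + 1, by positivity, fun l x => ?_⟩
    have h1 : ‖f l x - f l 0‖ ≤ C' * (1 + ‖x‖) ^ k * ‖x - 0‖ := by
      refine (convex_closedBall (0 : E) ‖x‖).norm_image_sub_le_of_norm_fderiv_le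
        (f := f l) (fun y _ => hd l y) (fun y hy => (h' l y).trans ?_) (by simp) (by simp)
      have : ‖y‖ ≤ ‖x‖ := by simpa using hy
      gcongr
    have h2 := norm_sub_norm_le (f l x) (f l 0)
    have h3 := (h0 l).trans (le_abs_self C)
    have h4 := one_le_growth x k
    have h5 : 1 ≤ 1 + ‖x‖ := by linarith [norm_nonneg x]
    rw [sub_zero] at h1
    have h6 : C' * (1 + ‖x‖) ^ k * ‖x‖ ≤ C' * (1 + ‖x‖) ^ (k + 1) := by
      rw [pow_succ, ← mul_assoc]; gcongr; linarith
    have h7 : |C| * 1 ≤ |C| * (1 + ‖x‖) ^ (k + 1) := by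
      gcongr; exact one_le_growth x _
    linarith
  intro n
  cases n with
  | zero => exact ⟨fun l => (hd l).continuous, hub⟩
  | succ n => exact ⟨hd, hub, h n⟩

lemma UTGn.zero {n : ℕ} : ∀ {F : Type} [NormedAddCommGroup F] [NormedSpace ℝ F],
    UTGn n (fun (_ : Λ) (_ : E) => (0 : F)) := by
  have aux : ∀ {F : Type} [NormedAddCommGroup F] [NormedSpace ℝ F],
      UB (fun (_ : Λ) (_ : E) => (0 : F)) := UB.of_bound (C := 0) (by simp)
  induction n with
  | zero => exact ⟨fun _ => continuous_const, aux⟩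
  | succ n ih =>
    intro F _ _
    refine ⟨fun _ => differentiable_const _, aux, ?_⟩
    simp only [fderiv_fun_const]
    exact ih

lemma UTG.const {c : Λ → F} {C : ℝ} (h : ∀ l, ‖c l‖ ≤ C) : UTG fun l (_ : E) => c l := by
  refine UTG.of_fderiv (fun _ => differentiable_const _) h ?_
  simp only [fderiv_fun_const]
  exact fun n => UTGn.zero

lemma UTG.const' (c : F) : UTG fun (_ : Λ) (_ : E) => c := UTG.const (C := ‖c‖) fun _ => le_rfl

lemma UTG.clm {L : Λ → E →L[ℝ] F} {C : ℝ} (h : ∀ l, ‖L l‖ ≤ C) : UTG fun l x => L l x := by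
  refine UTG.of_fderiv (C := 0) (fun l => (L l).differentiable) (by simp) ?_
  rw [show (fun l => _root_.fderiv ℝ fun x => L l x) = fun l _ => L l from
    funext₂ fun l _ => (L l).fderiv]
  exact UTG.const h

lemma UTG.clm' (L : E →L[ℝ] F) : UTG fun (_ : Λ) x => L x := UTG.clm (C := ‖L‖) fun _ => le_rfl

lemma UTGn.add {n : ℕ} : ∀ {F : Type} [NormedAddCommGroup F] [NormedSpace ℝ F]
    {f g : Λ → E → F}, UTGn n f → UTGn n g → UTGn n fun l x => f l x + g l x := by
  induction n with
  | zero => exact fun hf hg => ⟨fun l => (hf.1 l).add (hg.1 l), hf.2.add hg.2⟩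
  | succ n ih =>
    intro F _ _ f g hf hg
    refine ⟨fun l => (hf.1 l).add (hg.1 l), hf.2.1.add hg.2.1, ?_⟩
    convert ih hf.2.2 hg.2.2 using 3 with l x
    exact fderiv_fun_add (hf.1 l x) (hg.1 l x)

lemma UTG.add {f g : Λ → E → F} (hf : UTG f) (hg : UTG g) : UTG fun l x => f l x + g l x :=
  fun n => (hf n).add (hg n)

lemma UTG.sum {κ : Type} (s : Finset κ) {f : κ → Λ → E → F} (h : ∀ i ∈ s, UTG (f i)) :
    UTG fun l x => ∑ i ∈ s, f i l x := by
  classical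
  induction s using Finset.induction_on with
  | empty => simpa using UTG.const' (0 : F)
  | insert a s ha ih =>
    simp only [Finset.sum_insert ha]
    exact (h a (by simp)).add (ih fun i hi => h i (by simp [hi]))

/-- All product rules at once. The derivative of a bilinear expression is a sum of two bilinear
expressions with values in spaces of linear maps, which is why the induction quantifies over the
codomains. -/
lemma UTGn.bilin {n : ℕ} : ∀ {F G H : Type} [NormedAddCommGroup F] [NormedSpace ℝ F]
    [NormedAddCommGroup G] [NormedSpace ℝ G] [NormedAddCommGroup H] [NormedSpace ℝ H]
    (B : F →L[ℝ] G →L[ℝ] H) {f : Λ → E → F} {g : Λ → E → G}, UTGn n f → UTGn n g →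
    UTGn n fun l x => B (f l x) (g l x) := by
  induction n with
  | zero =>
    exact fun B f g hf hg => ⟨fun l => (B.continuous.comp (hf.1 l)).clm_apply (hg.1 l),
      hf.2.bilin B hg.2⟩
  | succ n ih =>
    intro F G H _ _ _ _ _ _ B f g hf hg
    refine ⟨fun l => (B.differentiable.comp (hf.1 l)).clm_apply (hg.1 l), hf.2.1.bilin B hg.2.1, ?_⟩
    convert (ih (B.precompR E) hf.pred hg.2.2).add (ih (B.precompL E) hf.2.2 hg.pred) using 3
      with l x
    exact (B.hasFDerivAt_of_bilinear (hf.1 l x).hasFDerivAt (hg.1 l x).hasFDerivAt).fderiv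

lemma UTG.bilin (B : F →L[ℝ] G →L[ℝ] H) {f : Λ → E → F} {g : Λ → E → G} (hf : UTG f)
    (hg : UTG g) : UTG fun l x => B (f l x) (g l x) := fun n => (hf n).bilin B (hg n)

lemma UTG.smul {f : Λ → E → ℝ} {g : Λ → E → F} (hf : UTG f) (hg : UTG g) :
    UTG fun l x => f l x • g l x := hf.bilin (ContinuousLinearMap.lsmul ℝ ℝ) hg

lemma UTG.mul {f g : Λ → E → ℝ} (hf : UTG f) (hg : UTG g) : UTG fun l x => f l x * g l x :=
  hf.smul hg

lemma UTG.left (L : F →L[ℝ] G) {f : Λ → E → F} (hf : UTG f) : UTG fun l x => L (f l x) :=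
  (UTG.const' L).bilin (ContinuousLinearMap.id ℝ (F →L[ℝ] G)) hf

lemma UTG.neg {f : Λ → E → F} (hf : UTG f) : UTG fun l x => -f l x := by
  simpa using hf.left (-ContinuousLinearMap.id ℝ F)

lemma UTG.sub {f g : Λ → E → F} (hf : UTG f) (hg : UTG g) : UTG fun l x => f l x - g l x := by
  simpa only [sub_eq_add_neg] using hf.add hg.neg

lemma UTG.app {f : Λ → E → F →L[ℝ] G} {g : Λ → E → F} (hf : UTG f) (hg : UTG g) :
    UTG fun l x => f l x (g l x) := hf.bilin (ContinuousLinearMap.id ℝ (F →L[ℝ] G)) hg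

lemma UTG.const_mul {c : Λ → ℝ} {C : ℝ} (hc : ∀ l, |c l| ≤ C) {f : Λ → E → ℝ} (hf : UTG f) :
    UTG fun l x => c l * f l x := (UTG.const hc).mul hf

lemma UTG.id : UTG fun (_ : Λ) (x : E) => x := UTG.clm' (ContinuousLinearMap.id ℝ E)

lemma UTGn.comp {n : ℕ} : ∀ {F : Type} [NormedAddCommGroup F] [NormedSpace ℝ F]
    {f : Λ → E → F} {g : Λ → D → E}, UTGn n f → UTGn n g → UTGn n fun l x => f l (g l x) := by
  induction n with
  | zero => exact fun hf hg => ⟨fun l => (hf.1 l).comp (hg.1 l), hf.2.comp hg.2⟩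
  | succ n ih =>
    intro F _ _ f g hf hg
    refine ⟨fun l => (hf.1 l).comp (hg.1 l), hf.2.1.comp hg.2.1, ?_⟩
    convert (ih hf.2.2 hg.pred).bilin (ContinuousLinearMap.compL ℝ D E F) hg.2.2 using 3 with l x
    exact fderiv_comp x (hf.1 l _) (hg.1 l x)

lemma UTG.comp {f : Λ → E → F} {g : Λ → D → E} (hf : UTG f) (hg : UTG g) :
    UTG fun l x => f l (g l x) := fun n => (hf n).comp (hg n)

lemma UTG.prodMk {f : Λ → E → F} {g : Λ → E → G} (hf : UTG f) (hg : UTG g) :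
    UTG fun l x => (f l x, g l x) := by
  simpa using (hf.left (ContinuousLinearMap.inl ℝ F G)).add
    (hg.left (ContinuousLinearMap.inr ℝ F G))

lemma UTG.fst {f : Λ → E → F × G} (hf : UTG f) : UTG fun l x => (f l x).1 :=
  hf.left (ContinuousLinearMap.fst ℝ F G)

lemma UTG.snd {f : Λ → E → F × G} (hf : UTG f) : UTG fun l x => (f l x).2 :=
  hf.left (ContinuousLinearMap.snd ℝ F G)

lemma UTG.of_iteratedFDeriv {f : Λ → E → F} (hf : ∀ l, ContDiff ℝ ∞ (f l))
    (h : ∀ n : ℕ, ∃ C : ℝ, ∃ k : ℕ, 0 ≤ C ∧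
      ∀ l x, ‖iteratedFDeriv ℝ n (f l) x‖ ≤ C * (1 + ‖x‖) ^ k) : UTG f := by
  intro n
  induction n generalizing F with
  | zero => exact ⟨fun l => (hf l).continuous, by simpa [UB] using h 0⟩
  | succ n ih =>
    refine ⟨fun l => (hf l).differentiable (by simp), by simpa [UB] using h 0, ih ?_ ?_⟩
    · exact fun l => (hf l).fderiv_right (by simp)
    · intro n
      simpa only [norm_iteratedFDeriv_fderiv] using h (n + 1)

/-- A measure all of whose moments are finite. -/
def Mom {Z : Type} [NormedAddCommGroup Z] [MeasurableSpace Z] (ν : Measure Z) : Prop :=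
  ∀ k : ℕ, Integrable (fun z => (1 + ‖z‖) ^ k) ν

/-! ### Integrals that depend on a parameter. -/

section Integral

variable [NormedAddCommGroup Z] [NormedSpace ℝ Z] [MeasurableSpace Z] [BorelSpace Z]
  [SecondCountableTopology Z] {ν : Measure Z}

lemma growth_prod_le (x : E) (z : Z) (k : ℕ) :
    (1 + ‖(x, z)‖) ^ k ≤ (1 + ‖x‖) ^ k * (1 + ‖z‖) ^ k := by
  rw [← mul_pow]
  have h1 : ‖(x, z)‖ ≤ ‖x‖ + ‖z‖ := by
    rw [Prod.norm_def]; exact max_le (by simp) (by simp)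
  have := mul_nonneg (norm_nonneg x) (norm_nonneg z)
  gcongr
  nlinarith

lemma UB.integrable_of_cont (hν : Mom ν) {f : Λ → Z → F} (hf : UB f) (hc : ∀ l, Continuous (f l))
    (l : Λ) : Integrable (f l) ν := by
  obtain ⟨C, k, hC, h⟩ := hf
  exact ((hν k).const_mul C).mono' (hc l).aestronglyMeasurable (.of_forall (h l))

lemma UTG.integrable (hν : Mom ν) {f : Λ → Z → F} (hf : UTG f) (l : Λ) : Integrable (f l) ν :=
  hf.ub.integrable_of_cont hν hf.cont l

lemma UB.slice_cont {f : Λ → E × Z → F} (hc : ∀ l, Continuous (f l)) (l : Λ) (x : E) :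
    Continuous fun z => f l (x, z) := (hc l).comp (by fun_prop)

lemma UB.integrable_slice (hν : Mom ν) {f : Λ → E × Z → F} (hf : UB f)
    (hc : ∀ l, Continuous (f l)) (l : Λ) (x : E) : Integrable (fun z => f l (x, z)) ν := by
  obtain ⟨C, k, hC, h⟩ := hf
  refine ((hν k).const_mul (C * (1 + ‖x‖) ^ k)).mono'
    (UB.slice_cont hc l x).aestronglyMeasurable (.of_forall fun z => (h l _).trans ?_)
  rw [mul_assoc]
  gcongr
  exact growth_prod_le x z k

lemma UB.integral (hν : Mom ν) {f : Λ → E × Z → F} (hf : UB f) (hc : ∀ l, Continuous (f l)) :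
    UB fun l x => ∫ z, f l (x, z) ∂ν := by
  have hi := hf.integrable_slice hν hc
  obtain ⟨C, k, hC, h⟩ := hf
  refine ⟨C * ∫ z, (1 + ‖z‖) ^ k ∂ν, k, by positivity, fun l x => ?_⟩
  calc ‖∫ z, f l (x, z) ∂ν‖ ≤ ∫ z, C * (1 + ‖x‖) ^ k * (1 + ‖z‖) ^ k ∂ν := by
        refine norm_integral_le_of_norm_le ((hν k).const_mul _) (.of_forall fun z =>
          (h l _).trans ?_)
        rw [mul_assoc]
        gcongr
        exact growth_prod_le x z k
    _ = _ := by rw [integral_const_mul]; ring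

/-- The partial derivative of a function on a product in the first variable. -/
def fderiv₁ (f : Λ → E × Z → F) : Λ → E × Z → E →L[ℝ] F :=
  fun l p => (_root_.fderiv ℝ (f l) p).comp (ContinuousLinearMap.inl ℝ E Z)

lemma hasFDerivAt_slice {f : E × Z → F} (hf : Differentiable ℝ f) (x : E) (z : Z) :
    HasFDerivAt (fun x => f (x, z)) ((_root_.fderiv ℝ f (x, z)).comp
      (ContinuousLinearMap.inl ℝ E Z)) x :=
  (hf (x, z)).hasFDerivAt.comp x (hasFDerivAt_prodMk_left x z)

lemma UTGn.fderiv₁ {n : ℕ} {f : Λ → E × Z → F} (hf : UTGn (n + 1) f) : UTGn n (fderiv₁ f) :=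
  UTGn.bilin (ContinuousLinearMap.id ℝ _)
    ((UTG.const' ((ContinuousLinearMap.compL ℝ E (E × Z) F).flip
      (ContinuousLinearMap.inl ℝ E Z))) n) hf.2.2

lemma UTGn.hasFDerivAt_integral (hν : Mom ν) {f : Λ → E × Z → F} (hf : UTGn 1 f) (l : Λ) (x : E) :
    HasFDerivAt (fun x => ∫ z, f l (x, z) ∂ν) (∫ z, LDL.fderiv₁ f l (x, z) ∂ν) x := by
  have h1 : UTGn 0 (LDL.fderiv₁ f) := hf.fderiv₁
  obtain ⟨C, k, hC, h⟩ := h1.2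
  refine hasFDerivAt_integral_of_dominated_of_fderiv_le
    (F := fun x z => f l (x, z)) (F' := fun x z => LDL.fderiv₁ f l (x, z))
    (bound := fun z => C * ((2 + ‖x‖) ^ k * (1 + ‖z‖) ^ k))
    (Metric.ball_mem_nhds x one_pos) ?_ ?_ ?_ ?_ ?_ ?_
  · exact .of_forall fun y => (UB.slice_cont hf.cont l y).aestronglyMeasurable
  · exact hf.ub.integrable_slice hν hf.cont l x
  · exact (UB.slice_cont h1.1 l x).aestronglyMeasurable
  · refine .of_forall fun z y hy => (h l _).trans ?_
    have hy' : ‖y‖ ≤ 1 + ‖x‖ := by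
      have := norm_sub_norm_le y x
      rw [mem_ball_iff_norm] at hy
      linarith
    refine mul_le_mul_of_nonneg_left ((growth_prod_le y z k).trans ?_) hC
    gcongr ?_ ^ k * _
    linarith
  · exact ((hν k).const_mul _).const_mul _
  · exact .of_forall fun z y _ => hasFDerivAt_slice (hf.1 l) y z

/-- The moments of `ν` dominate a polynomial bound locally uniformly in `x`, so derivatives pass
under the integral. The order lost here is harmless, because `UTG` asks for all orders. -/
lemma UTGn.integral (hν : Mom ν) {n : ℕ} : ∀ {F : Type} [NormedAddCommGroup F] [NormedSpace ℝ F]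
    {f : Λ → E × Z → F}, UTGn n f → UTGn (n - 1) fun l x => ∫ z, f l (x, z) ∂ν := by
  induction n with
  | zero =>
    intro F _ _ f hf
    refine ⟨fun l => ?_, hf.2.integral hν hf.1⟩
    obtain ⟨C, k, hC, h⟩ := hf.2
    refine continuous_iff_continuousAt.2 fun x => ?_
    refine continuousAt_of_dominated (bound := fun z => C * ((2 + ‖x‖) ^ k * (1 + ‖z‖) ^ k))
      (.of_forall fun y => (UB.slice_cont hf.1 l y).aestronglyMeasurable) ?_
      (((hν k).const_mul _).const_mul _)
      (.of_forall fun z => ((hf.1 l).comp (by fun_prop : Continuous fun y => (y, z))).continuousAt)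
    filter_upwards [Metric.ball_mem_nhds x one_pos] with y hy
    refine .of_forall fun z => (h l _).trans ?_
    have hy' : ‖y‖ ≤ 1 + ‖x‖ := by
      have := norm_sub_norm_le y x
      rw [mem_ball_iff_norm] at hy
      linarith
    refine mul_le_mul_of_nonneg_left ((growth_prod_le y z k).trans ?_) hC
    gcongr ?_ ^ k * _
    linarith
  | succ n ih =>
    intro F _ _ f hf
    cases n with
    | zero => exact ⟨fun l => continuous_iff_continuousAt.2 fun x =>
        (hf.hasFDerivAt_integral hν l x).continuousAt, hf.ub.integral hν hf.cont⟩
    | succ n =>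
      have h1 : UTGn 1 f := by
        have aux : ∀ m, UTGn (m + 1) f → UTGn 1 f := by
          intro m
          induction m with
          | zero => exact fun h => h
          | succ m ih => exact fun h => ih h.pred
        exact aux _ hf
      refine ⟨fun l x => (h1.hasFDerivAt_integral hν l x).differentiableAt,
        hf.ub.integral hν hf.cont, ?_⟩
      have h2 := ih hf.fderiv₁
      have h3 : (fun l => _root_.fderiv ℝ fun x => ∫ z, f l (x, z) ∂ν) =
          fun l x => ∫ z, LDL.fderiv₁ f l (x, z) ∂ν :=
        funext₂ fun l x => (h1.hasFDerivAt_integral hν l x).fderiv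
      rw [h3]
      exact h2

lemma UTG.integral (hν : Mom ν) {f : Λ → E × Z → F} (hf : UTG f) :
    UTG fun l x => ∫ z, f l (x, z) ∂ν := fun n => (hf (n + 1)).integral hν

lemma UTG.fderiv_integral (hν : Mom ν) {f : Λ → E × Z → F} (hf : UTG f) (l : Λ) (x : E) :
    _root_.fderiv ℝ (fun x => ∫ z, f l (x, z) ∂ν) x =
      ∫ z, _root_.fderiv ℝ (fun x => f l (x, z)) x ∂ν := by
  rw [((hf 1).hasFDerivAt_integral hν l x).fderiv]
  congr with z
  rw [(hasFDerivAt_slice (hf.diff l) x z).fderiv]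
  rfl

end Integral

lemma mom_unitInterval : Mom (volume.restrict (Icc (0 : ℝ) 1)) := fun k =>
  (Continuous.continuousOn (by fun_prop)).integrableOn_compact isCompact_Icc

/-- Division by a variable on whose zero set a family vanishes. -/
lemma UTG.exists_div {f : Λ → ℝ × E → F} [CompleteSpace F] (hf : UTG f)
    (h0 : ∀ l x, f l (0, x) = 0) :
    ∃ g : Λ → ℝ × E → F, UTG g ∧ (∀ l δ x, f l (δ, x) = δ • g l (δ, x)) ∧
      ∀ l x, g l (0, x) = _root_.fderiv ℝ (f l) (0, x) (1, 0) := by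
  -- Hadamard's formula: `f(δ, x) = δ ∫₀¹ ∂₁f(rδ, x) dr`.
  refine ⟨fun l p => ∫ r in Icc (0 : ℝ) 1, _root_.fderiv ℝ (f l) (r * p.1, p.2) (1, 0), ?_, ?_, ?_⟩
  · have h1 : UTG fun (l : Λ) (q : (ℝ × E) × ℝ) => (q.2 * q.1.1, q.1.2) :=
      (UTG.id.snd.mul UTG.id.fst.fst).prodMk UTG.id.fst.snd
    exact ((hf.fderiv.comp h1).app (UTG.const' _)).integral mom_unitInterval
  · intro l δ x
    have hd : ∀ r : ℝ, HasDerivAt (fun r : ℝ => f l (r * δ, x))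
        (δ • _root_.fderiv ℝ (f l) (r * δ, x) (1, 0)) r := by
      intro r
      have h2 : HasDerivAt (fun r : ℝ => (r * δ, x)) (δ, 0) r :=
        (by simpa using (hasDerivAt_id r).mul_const δ : HasDerivAt (fun r : ℝ => r * δ) δ r).prodMk
          (hasDerivAt_const r x)
      have h3 := (hf.diff l (r * δ, x)).hasFDerivAt.comp_hasDerivAt r h2
      rw [← map_smul]
      simpa [Function.comp_def] using h3
    have hc : Continuous fun r : ℝ => _root_.fderiv ℝ (f l) (r * δ, x) (1, 0) :=
      ((hf.fderiv.cont l).comp (by fun_prop)).clm_apply continuous_const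
    have h4 := intervalIntegral.integral_eq_sub_of_hasDerivAt (a := 0) (b := 1)
      (fun r _ => hd r) ((hc.const_smul δ).intervalIntegrable 0 1)
    simp only [one_mul, zero_mul, h0, sub_zero] at h4
    rw [← h4, intervalIntegral.integral_smul, intervalIntegral.integral_of_le zero_le_one,
      ← integral_Icc_eq_integral_Ioc]
  · intro l x
    simp

end UTG


/-! ### The standard Gaussian measure and its linear images. -/

section Gaussian

open ProbabilityTheory

variable {κ κ' ι : Type} [Fintype κ] [Fintype κ'] [Fintype ι]

/-- The standard Gaussian measure on `ℝ^κ`. -/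
def gs (κ : Type) [Fintype κ] : Measure (κ → ℝ) := Measure.pi fun _ => gaussianReal 0 1

instance : IsProbabilityMeasure (gs κ) := by unfold gs; infer_instance

/-- The density of the standard Gaussian measure. -/
def gsd (z : κ → ℝ) : ℝ := ∏ k, gaussianPDFReal 0 1 (z k)

lemma gsd_eq (z : κ → ℝ) :
    gsd z = ((√(2 * Real.pi)) ^ Fintype.card κ)⁻¹ * Real.exp (-(1 / 2) * (z ⬝ᵥ z)) := by
  simp only [gsd, gaussianPDFReal, NNReal.coe_one, mul_one, sub_zero, Finset.prod_mul_distrib,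
    Finset.prod_const, Finset.card_univ, ← Real.exp_sum, inv_pow, dotProduct, Finset.mul_sum]
  congr 2
  exact Finset.sum_congr rfl fun i _ => by ring

lemma gsd_nonneg (z : κ → ℝ) : 0 ≤ gsd z := by rw [gsd_eq]; positivity

lemma continuous_gsd : Continuous (gsd : (κ → ℝ) → ℝ) := by
  rw [funext gsd_eq]
  exact continuous_const.mul (Real.continuous_exp.comp
    (continuous_const.mul (continuous_id.dotProduct continuous_id)))

lemma gs_eq : gs κ = (volume : Measure (κ → ℝ)).withDensity fun z => ENNReal.ofReal (gsd z) := by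
  refine Measure.pi_eq fun s hs => ?_
  have hms : MeasurableSet (univ.pi s) := MeasurableSet.univ_pi hs
  rw [withDensity_apply _ hms]
  have hi : Integrable (gsd : (κ → ℝ) → ℝ) :=
    Integrable.fintype_prod (f := fun _ => gaussianPDFReal 0 1)
      (fun _ => integrable_gaussianPDFReal 0 1)
  rw [← ofReal_integral_eq_lintegral_ofReal hi.integrableOn (.of_forall gsd_nonneg)]
  have hr : (volume : Measure (κ → ℝ)).restrict (univ.pi s) =
      Measure.pi fun i => (volume : Measure ℝ).restrict (s i) := by
    rw [volume_pi, Measure.restrict_pi_pi]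
  rw [hr]
  unfold gsd
  rw [integral_fintype_prod_eq_prod (fun _ => gaussianPDFReal 0 1),
    ENNReal.ofReal_prod_of_nonneg
      (fun i _ => integral_nonneg fun x => gaussianPDFReal_nonneg 0 1 x)]
  exact Finset.prod_congr rfl fun i _ =>
    (gaussianReal_apply_eq_integral 0 (by simp) (s i)).symm

lemma integral_gs (f : (κ → ℝ) → ℝ) : ∫ z, f z ∂gs κ = ∫ z, gsd z * f z := by
  rw [gs_eq, integral_withDensity_eq_integral_toReal_smul
    (continuous_gsd.measurable.ennreal_ofReal) (by simp)]
  exact integral_congr_ae (.of_forall fun z => by simp [ENNReal.toReal_ofReal (gsd_nonneg z)])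

lemma integrable_gs_iff (f : (κ → ℝ) → ℝ) :
    Integrable f (gs κ) ↔ Integrable fun z => gsd z * f z := by
  rw [gs_eq, integrable_withDensity_iff_integrable_smul'
    (continuous_gsd.measurable.ennreal_ofReal) (by simp)]
  exact integrable_congr (.of_forall fun z => by simp [ENNReal.toReal_ofReal (gsd_nonneg z)])

lemma one_add_pow_le_exp {t : ℝ} (ht : 0 ≤ t) (k : ℕ) :
    (1 + t) ^ k ≤ k.factorial * Real.exp (1 + t) := by
  have := Real.pow_div_factorial_le_exp (1 + t) (by linarith) k
  rw [div_le_iff₀ (by positivity)] at this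
  linarith

/-- A bound by a product of functions of one variable, so that moments of a product measure
factorise. -/
lemma norm_le_prod (z : κ → ℝ) : 1 + ‖z‖ ≤ ∏ k, (1 + |z k|) := by
  classical
  have h0 : ∀ s : Finset κ, (1 : ℝ) ≤ ∏ k ∈ s, (1 + |z k|) := fun s => by
    simpa using Finset.prod_le_prod (s := s) (f := fun _ => (1 : ℝ)) (fun _ _ => zero_le_one)
      fun i _ => (by linarith [abs_nonneg (z i)] : (1 : ℝ) ≤ 1 + |z i|)
  have h1 : ∀ k, 1 + |z k| ≤ ∏ k, (1 + |z k|) := fun k => by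
    rw [← Finset.mul_prod_erase _ _ (Finset.mem_univ k)]
    exact le_mul_of_one_le_right (by positivity) (h0 _)
  have h0 := h0 Finset.univ
  have : ‖z‖ ≤ ∏ k, (1 + |z k|) - 1 := by
    refine (pi_norm_le_iff_of_nonneg (by linarith)).2 fun k => ?_
    rw [Real.norm_eq_abs]; linarith [h1 k]
  linarith

lemma mom_gs : Mom (gs κ) := by
  intro k
  have h1 : Integrable (fun t : ℝ => (1 + |t|) ^ k) (gaussianReal 0 1) := by
    refine (((integrable_exp_mul_gaussianReal (μ := 0) (v := 1) 1).add
      (integrable_exp_mul_gaussianReal (μ := 0) (v := 1) (-1))).const_mul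
      (k.factorial * Real.exp 1)).mono' (Continuous.aestronglyMeasurable (by fun_prop))
      (.of_forall fun t => ?_)
    rw [Real.norm_of_nonneg (by positivity)]
    refine (one_add_pow_le_exp (abs_nonneg t) k).trans ?_
    rw [Real.exp_add, ← mul_assoc]
    gcongr
    simp only [Pi.add_apply, one_mul, neg_mul]
    rcases abs_cases t with h | h <;> rw [h.1] <;>
      linarith [Real.exp_pos t, Real.exp_pos (-t)]
  refine (Integrable.fintype_prod (μ := fun _ : κ => gaussianReal 0 1)
    (f := fun _ t => (1 + |t|) ^ k) fun _ => h1).mono'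
    (Continuous.aestronglyMeasurable (by fun_prop)) (.of_forall fun z => ?_)
  rw [Real.norm_of_nonneg (by positivity), Finset.prod_pow]
  gcongr
  exact norm_le_prod z

/-- The linear map `ℝ^κ → ℝ^ι` of a matrix. -/
def mv (L : Matrix ι κ ℝ) : (κ → ℝ) →L[ℝ] EuclideanSpace ℝ ι :=
  (EuclideanSpace.equiv ι ℝ).symm.toContinuousLinearMap.comp
    (LinearMap.toContinuousLinearMap (Matrix.mulVecLin L))

@[simp] lemma mv_ofLp (L : Matrix ι κ ℝ) (z : κ → ℝ) : (mv L z).ofLp = L *ᵥ z := rfl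

lemma mv_apply (L : Matrix ι κ ℝ) (z : κ → ℝ) (i : ι) : mv L z i = ∑ k, L i k * z k := rfl

lemma norm_mv_le {L : Matrix ι κ ℝ} {B : ℝ} (h : ∀ i k, |L i k| ≤ B) :
    ‖mv L‖ ≤ Fintype.card ι * (Fintype.card κ * |B|) := by
  refine ContinuousLinearMap.opNorm_le_bound _ (by positivity) fun z => ?_
  have h1 : ∀ i, ‖(mv L z) i‖ ≤ Fintype.card κ * |B| * ‖z‖ := by
    intro i
    rw [mv_apply]
    refine (norm_sum_le _ _).trans ((Finset.sum_le_card_nsmul _ _ (|B| * ‖z‖) fun k _ => ?_).trans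
      (by simp [mul_assoc]))
    rw [norm_mul]
    exact mul_le_mul ((h i k).trans (le_abs_self B)) (norm_le_pi_norm z k) (norm_nonneg _)
      (abs_nonneg _)
  calc ‖mv L z‖ ≤ ∑ i, ‖(mv L z) i‖ := by
        rw [EuclideanSpace.norm_eq]
        refine Real.sqrt_le_iff.2 ⟨by positivity, ?_⟩
        exact Finset.sum_sq_le_sq_sum_of_nonneg fun i _ => norm_nonneg _
    _ ≤ Fintype.card ι * (Fintype.card κ * |B| * ‖z‖) := by
        refine (Finset.sum_le_card_nsmul _ _ _ fun i _ => h1 i).trans (by simp)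
    _ = _ := by ring

lemma charFun_map_mv (L : Matrix ι κ ℝ) (t : EuclideanSpace ℝ ι) :
    charFun ((gs κ).map (mv L)) t =
      Complex.exp (-((t.ofLp ⬝ᵥ ((L * Lᵀ) *ᵥ t.ofLp) : ℝ) : ℂ) / 2) := by
  have h1 : charFun ((gs κ).map (mv L)) t =
      charFun ((gs κ).map (WithLp.toLp 2)) (WithLp.toLp 2 (Lᵀ *ᵥ t.ofLp)) := by
    rw [charFun_apply, charFun_apply, integral_map (by fun_prop) (by fun_prop),
      integral_map (by fun_prop) (by fun_prop)]
    congr with z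
    congr 3
    simp only [EuclideanSpace.inner_eq_star_dotProduct, mv_ofLp, star_trivial]
    rw [Matrix.dotProduct_mulVec, ← Matrix.mulVec_transpose]
  rw [h1, gs, map_pi_eq_stdGaussian, charFun_stdGaussian, ← Complex.ofReal_pow,
    EuclideanSpace.real_norm_sq_eq]
  congr 4
  rw [← Matrix.mulVec_mulVec, Matrix.dotProduct_mulVec, ← Matrix.mulVec_transpose, dotProduct]
  simp [sq]

/-- The law of a linear image of a standard Gaussian vector is determined by its covariance. -/
lemma map_mv_eq {L : Matrix ι κ ℝ} {L' : Matrix ι κ' ℝ} (h : L * Lᵀ = L' * L'ᵀ) :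
    (gs κ).map (mv L) = (gs κ').map (mv L') := by
  have := Measure.isProbabilityMeasure_map (μ := gs κ) (f := mv L) (by fun_prop)
  have := Measure.isProbabilityMeasure_map (μ := gs κ') (f := mv L') (by fun_prop)
  refine Measure.ext_of_charFun (funext fun t => ?_)
  rw [charFun_map_mv, charFun_map_mv, h]

lemma integral_mv_congr {L : Matrix ι κ ℝ} {L' : Matrix ι κ' ℝ} (h : L * Lᵀ = L' * L'ᵀ)
    {f : EuclideanSpace ℝ ι → ℝ} (hf : Continuous f) :
    ∫ z, f (mv L z) ∂gs κ = ∫ z, f (mv L' z) ∂gs κ' := by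
  rw [← integral_map (φ := mv L) (by fun_prop) hf.aestronglyMeasurable, map_mv_eq h,
    integral_map (by fun_prop) hf.aestronglyMeasurable]

/-- The density of the centred Gaussian law with covariance matrix `Σ`. -/
def gker [DecidableEq ι] (Q : Matrix ι ι ℝ) (v : ι → ℝ) : ℝ :=
  (√((2 * Real.pi) ^ Fintype.card ι * Q.det))⁻¹ * Real.exp (-(1 / 2) * (v ⬝ᵥ (Q⁻¹ *ᵥ v)))

lemma gker_nonneg [DecidableEq ι] (Q : Matrix ι ι ℝ) (v : ι → ℝ) : 0 ≤ gker Q v := by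
  unfold gker; positivity

lemma continuous_gker [DecidableEq ι] (Q : Matrix ι ι ℝ) : Continuous (gker Q) := by
  unfold gker
  exact continuous_const.mul (Real.continuous_exp.comp
    (continuous_const.mul (continuous_id.dotProduct
      ((Matrix.mulVecLin Q⁻¹).continuous_of_finiteDimensional))))

/-- The change of variables `y = C z`: the quadratic form of `(C Cᵀ)⁻¹` at `C z` is that of the
identity at `z`, and `|det C|` cancels the determinant in the normalisation. -/
lemma gker_mulVec [DecidableEq ι] {C : Matrix ι ι ℝ} (hC : C.det ≠ 0) (z : ι → ℝ) :
    |C.det| * gker (C * Cᵀ) (C *ᵥ z) = gsd z := by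
  have h1 : (C *ᵥ z) ⬝ᵥ ((C * Cᵀ)⁻¹ *ᵥ (C *ᵥ z)) = z ⬝ᵥ z := by
    have hu : IsUnit C.det := isUnit_iff_ne_zero.2 hC
    have hu' : IsUnit Cᵀ.det := by rwa [Matrix.det_transpose]
    rw [Matrix.mul_inv_rev, Matrix.mulVec_mulVec, Matrix.mul_assoc, Matrix.nonsing_inv_mul _ hu,
      Matrix.mul_one, Matrix.dotProduct_mulVec, ← Matrix.mulVec_transpose, Matrix.mulVec_mulVec,
      Matrix.transpose_nonsing_inv, Matrix.transpose_transpose, Matrix.nonsing_inv_mul _ hu,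
      Matrix.one_mulVec]
  rw [gker, gsd_eq, h1, Matrix.det_mul, Matrix.det_transpose, ← mul_assoc]
  congr 1
  rw [Real.sqrt_mul (by positivity), Real.sqrt_mul_self_eq_abs, mul_inv, mul_comm, mul_assoc,
    inv_mul_cancel₀ (abs_ne_zero.2 hC), mul_one]
  congr 1
  rw [Real.sqrt_eq_iff_mul_self_eq (by positivity) (by positivity), ← mul_pow,
    Real.mul_self_sqrt (by positivity)]

/-- The density of a nondegenerate Gaussian law. -/
lemma map_add_mv [DecidableEq ι] {C : Matrix ι ι ℝ} (hC : C.det ≠ 0) (m : EuclideanSpace ℝ ι) :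
    (gs ι).map (fun z => m + mv C z) =
      volume.withDensity fun y => ENNReal.ofReal (gker (C * Cᵀ) (y.ofLp - m.ofLp)) := by
  have hk : Measurable fun y : EuclideanSpace ℝ ι => gker (C * Cᵀ) (y.ofLp - m.ofLp) :=
    ((continuous_gker _).comp (by fun_prop)).measurable
  ext s hs
  have hcont : Continuous fun z => m + mv C z := by fun_prop
  rw [Measure.map_apply hcont.measurable hs, withDensity_apply _ hs, gs_eq,
    withDensity_apply _ (hcont.measurable hs), ← lintegral_indicator hs,
    ← lintegral_indicator (hcont.measurable hs)]
  have hF : Measurable (s.indicator fun y : EuclideanSpace ℝ ι =>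
      ENNReal.ofReal (gker (C * Cᵀ) (y.ofLp - m.ofLp))) := hk.ennreal_ofReal.indicator hs
  rw [← lintegral_add_left_eq_self _ m, ← (PiLp.volume_preserving_toLp ι).lintegral_comp
    (f := fun x => s.indicator (fun a => ENNReal.ofReal (gker (C * Cᵀ) (a.ofLp - m.ofLp))) (m + x))
    (hF.comp (measurable_const_add m))]
  have hF' : Measurable fun a : ι → ℝ => s.indicator
      (fun a => ENNReal.ofReal (gker (C * Cᵀ) (a.ofLp - m.ofLp))) (m + WithLp.toLp 2 a) :=
    (hF.comp (measurable_const_add m)).comp (by fun_prop)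
  have hm := Real.map_matrix_volume_pi_eq_smul_volume_pi hC
  -- Lebesgue measure is the image of itself under `C`, up to the factor `|det C|` that
  -- `gker_mulVec` requires.
  have hv : (volume : Measure (ι → ℝ)) =
      ENNReal.ofReal |C.det| • Measure.map (Matrix.toLin' C) volume := by
    rw [hm, smul_smul, ← ENNReal.ofReal_mul (abs_nonneg _), ← abs_mul, mul_inv_cancel₀ hC]
    simp
  conv_rhs => rw [hv]
  rw [lintegral_smul_measure, lintegral_map hF'
    (Matrix.toLin' C).continuous_of_finiteDimensional.measurable, smul_eq_mul,
    ← lintegral_const_mul]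
  · refine lintegral_congr fun z => ?_
    have he : m + WithLp.toLp 2 (Matrix.toLin' C z) = m + mv C z := rfl
    rw [he]
    by_cases hz : m + mv C z ∈ s
    · rw [indicator_of_mem hz, indicator_of_mem (show z ∈ _ from hz),
        ← ENNReal.ofReal_mul (abs_nonneg _), ← gker_mulVec hC]
      simp
    · rw [indicator_of_notMem hz, indicator_of_notMem (show z ∉ _ from hz), mul_zero]
  · exact hF'.comp
      (Matrix.toLin' C).continuous_of_finiteDimensional.measurable

lemma integral_add_mv [DecidableEq ι] {C : Matrix ι ι ℝ} (hC : C.det ≠ 0)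
    (m : EuclideanSpace ℝ ι) {f : EuclideanSpace ℝ ι → ℝ} (hf : Continuous f) :
    ∫ z, f (m + mv C z) ∂gs ι = ∫ y, f y * gker (C * Cᵀ) (y.ofLp - m.ofLp) := by
  have hk : Measurable fun y : EuclideanSpace ℝ ι => gker (C * Cᵀ) (y.ofLp - m.ofLp) :=
    ((continuous_gker _).comp (by fun_prop)).measurable
  rw [← integral_map (φ := fun z => m + mv C z) (Continuous.aemeasurable (by fun_prop))
    hf.aestronglyMeasurable, map_add_mv hC,
    integral_withDensity_eq_integral_toReal_smul hk.ennreal_ofReal (by simp)]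
  exact integral_congr_ae (.of_forall fun y => by
    simp [ENNReal.toReal_ofReal (gker_nonneg _ _), mul_comm])

lemma integrable_mul_gker [DecidableEq ι] {C : Matrix ι ι ℝ} (hC : C.det ≠ 0)
    (m : EuclideanSpace ℝ ι) {f : EuclideanSpace ℝ ι → ℝ} (hf : Continuous f)
    (hi : Integrable (fun z => f (m + mv C z)) (gs ι)) :
    Integrable fun y => f y * gker (C * Cᵀ) (y.ofLp - m.ofLp) := by
  have hk : Measurable fun y : EuclideanSpace ℝ ι => gker (C * Cᵀ) (y.ofLp - m.ofLp) :=
    ((continuous_gker _).comp (by fun_prop)).measurable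
  have h2 : Integrable f ((gs ι).map fun z => m + mv C z) :=
    (integrable_map_measure hf.aestronglyMeasurable (Continuous.aemeasurable (by fun_prop))).2 hi
  rw [map_add_mv hC, integrable_withDensity_iff_integrable_smul' hk.ennreal_ofReal (by simp)] at h2
  refine h2.congr (.of_forall fun y => ?_)
  simp [ENNReal.toReal_ofReal (gker_nonneg _ _), mul_comm]

lemma hasFDerivAt_gsd (z : κ → ℝ) :
    HasFDerivAt (gsd : (κ → ℝ) → ℝ) (-gsd z • ∑ k, z k •
      (ContinuousLinearMap.proj (R := ℝ) (φ := fun _ : κ => ℝ) k)) z := by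
  have h1 : HasFDerivAt (fun z : κ → ℝ => z ⬝ᵥ z)
      (∑ k, (z k • ContinuousLinearMap.proj (R := ℝ) (φ := fun _ : κ => ℝ) k +
        z k • ContinuousLinearMap.proj (R := ℝ) (φ := fun _ : κ => ℝ) k)) z := by
    unfold dotProduct
    exact HasFDerivAt.fun_sum fun k _ => (hasFDerivAt_apply k z).mul (hasFDerivAt_apply k z)
  have h2 := ((h1.const_mul (-(1 / 2))).exp).const_mul ((√(2 * Real.pi)) ^ Fintype.card κ)⁻¹
  rw [funext gsd_eq]
  refine h2.congr_fderiv ?_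
  rw [← funext gsd_eq, gsd_eq, Finset.sum_add_distrib, ← two_smul ℝ, smul_smul, smul_smul,
    smul_smul]
  congr 1
  ring

/-- Gaussian integration by parts. -/
lemma integral_fderiv_gs {f : Unit → (κ → ℝ) → ℝ} (hf : UTG f) (h : κ → ℝ) :
    ∫ z, fderiv ℝ (f ()) z h ∂gs κ = ∫ z, (h ⬝ᵥ z) * f () z ∂gs κ := by
  have hd : ∀ z, fderiv ℝ (gsd : (κ → ℝ) → ℝ) z h = -(gsd z * (h ⬝ᵥ z)) := fun z => by
    rw [(hasFDerivAt_gsd z).fderiv]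
    simp [dotProduct, mul_comm]
  have hlin : UTG fun (_ : Unit) (z : κ → ℝ) => h ⬝ᵥ z :=
    UTG.clm' (LinearMap.toContinuousLinearMap
      (dotProductBilin ℝ ℝ h))
  have hi1 : Integrable (fun z => fderiv ℝ (f ()) z h) (gs κ) :=
    (hf.fderiv.app (UTG.const' h)).integrable mom_gs ()
  have hi2 : Integrable (fun z => (h ⬝ᵥ z) * f () z) (gs κ) :=
    (hlin.mul hf).integrable mom_gs ()
  rw [integrable_gs_iff] at hi1 hi2
  have hi3 := (integrable_gs_iff _).1 (hf.integrable mom_gs ())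
  rw [integral_gs, integral_gs, integral_mul_fderiv_eq_neg_fderiv_mul_of_integrable
    (f := gsd) (g := f ()) (v := h) (μ := volume)]
  · rw [← integral_neg]
    congr with z
    rw [hd]; ring
  · refine hi2.neg.congr (.of_forall fun z => ?_)
    simp only [Pi.neg_apply, hd]; ring
  · exact hi1
  · exact hi3
  · exact fun z _ => (hasFDerivAt_gsd z).differentiableAt
  · exact fun z _ => hf.diff () z

lemma integral_coord_gs (k : κ) : ∫ z, z k ∂gs κ = 0 := by
  classical
  have := integral_fderiv_gs (UTG.const' (1 : ℝ)) (Pi.single k 1 : κ → ℝ)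
  simpa using this.symm

lemma integral_coord_mul_coord_gs [DecidableEq κ] (k l : κ) :
    ∫ z, z k * z l ∂gs κ = if k = l then 1 else 0 := by
  have h1 : UTG fun (_ : Unit) (z : κ → ℝ) => z l :=
    UTG.clm' (ContinuousLinearMap.proj (R := ℝ) (φ := fun _ : κ => ℝ) l)
  have := integral_fderiv_gs h1 (Pi.single k 1 : κ → ℝ)
  rw [show (fun z : κ → ℝ => z l) = ContinuousLinearMap.proj (R := ℝ) (φ := fun _ : κ => ℝ) l
    from rfl] at this
  simp only [ContinuousLinearMap.fderiv, ContinuousLinearMap.proj_apply, Pi.single_apply,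
    single_dotProduct, one_mul, integral_const, probReal_univ, smul_eq_mul] at this
  rw [← this]
  simp [eq_comm]

/-- A polynomial factor is absorbed by doubling the covariance. -/
lemma integral_growth_mul_le (κ : Type) [Fintype κ] (n : ℕ) : ∃ C : ℝ, 0 ≤ C ∧
    ∀ f : (κ → ℝ) → ℝ, Continuous f → (∀ z, 0 ≤ f z) →
      Integrable (fun z => f (√2 • z)) (gs κ) →
      ∫ z, (1 + ‖z‖) ^ n * f z ∂gs κ ≤ C * ∫ z, f (√2 • z) ∂gs κ := by
  -- Half of the Gaussian exponent absorbs the polynomial, since `1 + r - r²/4 ≤ 2`. The other half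
  -- is the Gaussian with doubled covariance.
  have hb : ∀ z : κ → ℝ, (1 + ‖z‖) ^ n * Real.exp (-(1 / 4) * (z ⬝ᵥ z)) ≤
      n.factorial * Real.exp 2 := by
    intro z
    have h1 : ‖z‖ ^ 2 ≤ z ⬝ᵥ z := by
      rcases isEmpty_or_nonempty κ with hκ | hκ
      · simp [Subsingleton.elim z 0]
      · obtain ⟨k, hk⟩ := Finite.exists_max fun k => ‖z k‖
        have : ‖z‖ ≤ ‖z k‖ := (pi_norm_le_iff_of_nonneg (norm_nonneg _)).2 hk
        calc ‖z‖ ^ 2 ≤ ‖z k‖ ^ 2 := by gcongr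
          _ = z k * z k := by rw [Real.norm_eq_abs, sq_abs, sq]
          _ ≤ _ := Finset.single_le_sum (f := fun k => z k * z k)
            (fun i _ => mul_self_nonneg _) (Finset.mem_univ k)
    calc _ ≤ n.factorial * Real.exp (1 + ‖z‖) * Real.exp (-(1 / 4) * (z ⬝ᵥ z)) := by
          gcongr; exact one_add_pow_le_exp (norm_nonneg z) n
      _ = n.factorial * Real.exp (1 + ‖z‖ + -(1 / 4) * (z ⬝ᵥ z)) := by
          rw [Real.exp_add (1 + ‖z‖), mul_assoc]
      _ ≤ _ := by
          gcongr
          nlinarith [sq_nonneg (‖z‖ - 2)]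
  refine ⟨n.factorial * Real.exp 2 * √2 ^ Fintype.card κ, by positivity, fun f hfc hf hfi => ?_⟩
  have hs : ∀ z : κ → ℝ, gsd z =
      Real.exp (-(1 / 4) * (z ⬝ᵥ z)) * gsd ((√2)⁻¹ • z) := by
    intro z
    have h2 : (√2)⁻¹ * ((√2)⁻¹ * (z ⬝ᵥ z)) = (1 / 2) * (z ⬝ᵥ z) := by
      rw [← mul_assoc, ← mul_inv, Real.mul_self_sqrt (by norm_num)]; ring
    rw [gsd_eq, gsd_eq, smul_dotProduct, dotProduct_smul, smul_eq_mul, smul_eq_mul, h2,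
      mul_left_comm, ← Real.exp_add]
    congr 2
    ring
  have hi := (integrable_gs_iff _).1 hfi
  have hcs : ∫ z, gsd z * f (√2 • z) = (√2 ^ Fintype.card κ)⁻¹ * ∫ z, gsd ((√2)⁻¹ • z) * f z := by
    have := Measure.integral_comp_smul (volume : Measure (κ → ℝ))
      (fun z => gsd ((√2)⁻¹ • z) * f z) (√2)
    simp only [Module.finrank_fintype_fun_eq_card, smul_eq_mul] at this
    rw [abs_of_nonneg (by positivity)] at this
    rw [← this]
    congr with z
    rw [smul_smul, inv_mul_cancel₀ (by positivity), one_smul]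
  have hi' : Integrable fun z : κ → ℝ => gsd ((√2)⁻¹ • z) * f z := by
    have := hi.comp_smul (R := (√2)⁻¹) (by positivity)
    refine this.congr (.of_forall fun z => ?_)
    simp only [smul_smul, mul_inv_cancel₀ (show √2 ≠ 0 by positivity), one_smul]
  rw [integral_gs, integral_gs, hcs]
  calc ∫ z, gsd z * ((1 + ‖z‖) ^ n * f z)
      ≤ ∫ z : κ → ℝ, n.factorial * Real.exp 2 * (gsd ((√2)⁻¹ • z) * f z) := by
        refine integral_mono_of_nonneg (.of_forall fun z => ?_) (hi'.const_mul _)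
          (.of_forall fun z => ?_)
        · exact mul_nonneg (gsd_nonneg z) (mul_nonneg (by positivity) (hf z))
        · dsimp only
          rw [hs]
          have := mul_le_mul_of_nonneg_right (hb z)
            (mul_nonneg (gsd_nonneg ((√2)⁻¹ • z)) (hf z))
          linarith
    _ = _ := by
        rw [integral_const_mul]
        field_simp

/-- Independence of the two blocks of a Gaussian vector. This is what merges consecutive semigroup
steps into a single Gaussian integral. -/
lemma integral_gs_sum {f : (κ ⊕ κ' → ℝ) → ℝ} (hf : Integrable f (gs (κ ⊕ κ'))) :
    ∫ z, f z ∂gs (κ ⊕ κ') = ∫ z, ∫ z', f (Sum.elim z z') ∂gs κ' ∂gs κ := by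
  have hm := measurePreserving_sumPiEquivProdPi_symm (X := fun _ : κ ⊕ κ' => ℝ)
    fun _ => gaussianReal 0 1
  have hm' : MeasurePreserving (MeasurableEquiv.sumPiEquivProdPi fun _ : κ ⊕ κ' => ℝ).symm
      ((gs κ).prod (gs κ')) (gs (κ ⊕ κ')) := hm
  have he : ∀ p : (κ → ℝ) × (κ' → ℝ),
      (MeasurableEquiv.sumPiEquivProdPi fun _ : κ ⊕ κ' => ℝ).symm p = Sum.elim p.1 p.2 := by
    rintro ⟨z, z'⟩
    funext i
    cases i <;> rfl
  have hi : Integrable (fun p : (κ → ℝ) × (κ' → ℝ) => f (Sum.elim p.1 p.2))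
      ((gs κ).prod (gs κ')) := by
    have := (hm'.integrable_comp_emb (MeasurableEquiv.measurableEmbedding _)).2 hf
    simpa only [Function.comp_def, he] using this
  rw [← hm'.integral_comp', ← integral_prod _ hi]
  simp only [he]

end Gaussian


/-! ### Flow, mean and covariance of the linear equation. -/

section LinearSystem

variable {ι : Type} [Fintype ι] [DecidableEq ι]

/-- The flow `e^{tA}`. -/
def fl (A : Matrix ι ι ℝ) (t : ℝ) : Matrix ι ι ℝ := NormedSpace.exp (t • A)

/-- The integrand `e^{rA} a e^{rAᵀ}` of the covariance. -/
def covIntegrand (A a : Matrix ι ι ℝ) (r : ℝ) : Matrix ι ι ℝ := fl A r * a * (fl A r)ᵀ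

/-- The mean `e^{tA} (ξ + ∫₀ᵗ e^{-sA} b ds)`. -/
def gmean (A : Matrix ι ι ℝ) (b : ι → ℝ) (t : ℝ) (ξ : EuclideanSpace ℝ ι) : EuclideanSpace ℝ ι :=
  WithLp.toLp 2 (NormedSpace.exp (t • A) *ᵥ
    fun i => ξ i + ∫ s in (0 : ℝ)..t, (NormedSpace.exp ((-s) • A) *ᵥ b) i)

/-- The covariance `e^{tA} ∫₀ᵗ e^{-sA} a e^{-sAᵀ} ds e^{tAᵀ}`. -/
def gcov (A a : Matrix ι ι ℝ) (t : ℝ) : Matrix ι ι ℝ :=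
  NormedSpace.exp (t • A) * (Matrix.of fun i k => ∫ s in (0 : ℝ)..t,
    (NormedSpace.exp ((-s) • A) * a * NormedSpace.exp ((-s) • Aᵀ)) i k) *
    NormedSpace.exp (t • Aᵀ)

section Norm

open scoped Matrix.Norms.Operator

lemma integral_sum_mul {g : ι → ℝ → ℝ} (hg : ∀ k, Continuous (g k)) (c : ι → ℝ) (s t : ℝ) :
    ∫ r in s..t, ∑ k, c k * g k r = ∑ k, c k * ∫ r in s..t, g k r := by
  rw [intervalIntegral.integral_finsetSum (f := fun k r => c k * g k r) fun k _ =>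
    ((hg k).const_mul (c k)).intervalIntegrable _ _]
  simp only [intervalIntegral.integral_const_mul]

variable (A a : Matrix ι ι ℝ)

lemma fl_zero : fl A 0 = 1 := by simp [fl]

lemma fl_add (s t : ℝ) : fl A (s + t) = fl A s * fl A t := by
  rw [fl, add_smul, Matrix.exp_add_of_commute]
  · rfl
  · exact ((Commute.refl A).smul_left s).smul_right t

lemma fl_transpose (t : ℝ) : NormedSpace.exp (t • Aᵀ) = (fl A t)ᵀ := by
  rw [← Matrix.transpose_smul, Matrix.exp_transpose]; rfl

lemma hasDerivAt_fl (t : ℝ) : HasDerivAt (fl A) (fl A t * A) t := hasDerivAt_exp_smul_const A t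

lemma continuous_fl : Continuous (fl A) :=
  continuous_iff_continuousAt.2 fun t => (hasDerivAt_fl A t).continuousAt

lemma continuous_covIntegrand : Continuous (covIntegrand A a) :=
  ((continuous_fl A).mul continuous_const).mul (continuous_fl A).matrix_transpose

lemma abs_entry_le (M : Matrix ι ι ℝ) (i k : ι) : |M i k| ≤ ‖M‖ := by
  rw [Matrix.linfty_opNorm_def]
  have h1 : ‖M i k‖₊ ≤ ∑ j, ‖M i j‖₊ :=
    Finset.single_le_sum (f := fun j => ‖M i j‖₊) (fun _ _ => zero_le) (Finset.mem_univ k)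
  have h2 : ∑ j, ‖M i j‖₊ ≤ Finset.univ.sup fun i => ∑ j, ‖M i j‖₊ :=
    Finset.le_sup (f := fun i => ∑ j, ‖M i j‖₊) (Finset.mem_univ i)
  have h3 := h1.trans h2
  rw [← NNReal.coe_le_coe] at h3
  simpa using h3

lemma norm_le_of_entry {M : Matrix ι ι ℝ} {B : ℝ} (h : ∀ i k, |M i k| ≤ B) :
    ‖M‖ ≤ Fintype.card ι * |B| := by
  rw [Matrix.linfty_opNorm_def]
  have : (Finset.univ.sup fun i => ∑ j, ‖M i j‖₊) ≤ Fintype.card ι * ‖B‖₊ := by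
    refine Finset.sup_le fun i _ => (Finset.sum_le_card_nsmul _ _ ‖B‖₊ fun j _ => ?_).trans
      (by simp)
    rw [← NNReal.coe_le_coe]
    simpa using (h i j).trans (le_abs_self B)
  rw [← NNReal.coe_le_coe] at this
  simpa using this

/-- The entry of a matrix as a continuous linear map. -/
def entryL (i k : ι) : Matrix ι ι ℝ →L[ℝ] ℝ :=
  LinearMap.toContinuousLinearMap (Matrix.entryLinearMap ℝ ℝ i k)

lemma entry_integral {f : ℝ → Matrix ι ι ℝ} (hf : Continuous f) (s t : ℝ) (i k : ι) :
    (∫ r in s..t, f r) i k = ∫ r in s..t, f r i k :=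
  ((entryL i k).intervalIntegral_comp_comm (hf.intervalIntegrable s t)).symm

/-- The substitution `s ↦ t - s` absorbs the outer exponentials and leaves an integrand that does
not depend on `t`. The later facts on the covariance are read off this form. -/
lemma gcov_eq_integral (t : ℝ) : gcov A a t = ∫ r in (0 : ℝ)..t, covIntegrand A a r := by
  have hc : Continuous fun s : ℝ => covIntegrand A a (-s) :=
    (continuous_covIntegrand A a).comp continuous_neg
  have h1 : (Matrix.of fun i k => ∫ s in (0 : ℝ)..t,
      (NormedSpace.exp ((-s) • A) * a * NormedSpace.exp ((-s) • Aᵀ)) i k) =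
      ∫ s in (0 : ℝ)..t, covIntegrand A a (-s) := by
    ext i k
    rw [entry_integral hc]
    simp only [Matrix.of_apply, fl_transpose]
    rfl
  have h2 : gcov A a t = ∫ s in (0 : ℝ)..t, fl A t * covIntegrand A a (-s) * (fl A t)ᵀ := by
    rw [gcov, h1, fl_transpose]
    have h3 := (((ContinuousLinearMap.mul ℝ (Matrix ι ι ℝ)).flip (fl A t)ᵀ).comp
      (ContinuousLinearMap.mul ℝ (Matrix ι ι ℝ) (fl A t))).intervalIntegral_comp_comm
      (hc.intervalIntegrable (μ := volume) 0 t)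
    exact h3.symm
  rw [h2]
  have h4 : ∀ s, fl A t * covIntegrand A a (-s) * (fl A t)ᵀ = covIntegrand A a (t - s) := by
    intro s
    rw [covIntegrand, covIntegrand, sub_eq_add_neg, fl_add, Matrix.transpose_mul]
    simp only [Matrix.mul_assoc]
  simp only [h4]
  rw [intervalIntegral.integral_comp_sub_left]
  simp

lemma gcov_entry (t : ℝ) (i k : ι) :
    gcov A a t i k = ∫ r in (0 : ℝ)..t, covIntegrand A a r i k := by
  rw [gcov_eq_integral, entry_integral (continuous_covIntegrand A a)]

lemma gcov_zero : gcov A a 0 = 0 := by simp [gcov_eq_integral]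

lemma continuous_gcov : Continuous (gcov A a) := by
  rw [funext (gcov_eq_integral A a)]
  exact intervalIntegral.continuous_primitive
    (fun s t => (continuous_covIntegrand A a).intervalIntegrable s t) 0

/-- The noise collected before a further step `u` is transported by `e^{uA}`, and the noise of the
step itself is added. -/
lemma gcov_add (t u : ℝ) : gcov A a (t + u) = gcov A a u + fl A u * gcov A a t * (fl A u)ᵀ := by
  have hc := continuous_covIntegrand A a
  have h3 := (((ContinuousLinearMap.mul ℝ (Matrix ι ι ℝ)).flip (fl A u)ᵀ).comp
      (ContinuousLinearMap.mul ℝ (Matrix ι ι ℝ) (fl A u))).intervalIntegral_comp_comm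
      (hc.intervalIntegrable (μ := volume) 0 t)
  have h3' : fl A u * (∫ r in (0 : ℝ)..t, covIntegrand A a r) * (fl A u)ᵀ =
      ∫ r in (0 : ℝ)..t, fl A u * covIntegrand A a r * (fl A u)ᵀ := h3.symm
  have h4 : ∀ s, fl A u * covIntegrand A a s * (fl A u)ᵀ = covIntegrand A a (s + u) := by
    intro s
    rw [covIntegrand, covIntegrand, add_comm s u, fl_add, Matrix.transpose_mul]
    simp only [Matrix.mul_assoc]
  rw [gcov_eq_integral, gcov_eq_integral, gcov_eq_integral, h3']
  simp only [h4]
  rw [intervalIntegral.integral_comp_add_right, zero_add,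
    intervalIntegral.integral_add_adjacent_intervals (hc.intervalIntegrable _ _)
      (hc.intervalIntegrable _ _)]

lemma covIntegrand_quadratic (r : ℝ) (u : ι → ℝ) :
    u ⬝ᵥ (covIntegrand A a r *ᵥ u) = ((fl A r)ᵀ *ᵥ u) ⬝ᵥ (a *ᵥ ((fl A r)ᵀ *ᵥ u)) := by
  rw [covIntegrand, ← Matrix.mulVec_mulVec, ← Matrix.mulVec_mulVec, Matrix.dotProduct_mulVec,
    ← Matrix.mulVec_transpose]

lemma gcov_quadratic (t : ℝ) (u : ι → ℝ) : u ⬝ᵥ (gcov A a t *ᵥ u) =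
    ∫ r in (0 : ℝ)..t, ((fl A r)ᵀ *ᵥ u) ⬝ᵥ (a *ᵥ ((fl A r)ᵀ *ᵥ u)) := by
  have hc : ∀ i k, Continuous fun r => covIntegrand A a r i k := fun i k =>
    (continuous_covIntegrand A a).matrix_elem i k
  have h1 : ∀ r, ((fl A r)ᵀ *ᵥ u) ⬝ᵥ (a *ᵥ ((fl A r)ᵀ *ᵥ u)) =
      ∑ i, u i * ∑ k, u k * covIntegrand A a r i k := fun r => by
    rw [← covIntegrand_quadratic]
    simp only [dotProduct, Matrix.mulVec, mul_comm]
  have h2 : u ⬝ᵥ (gcov A a t *ᵥ u) = ∑ i, u i * ∑ k, u k * gcov A a t i k := by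
    simp only [dotProduct, Matrix.mulVec, mul_comm]
  simp only [h1, h2, gcov_entry]
  rw [integral_sum_mul fun i => continuous_finsetSum _ fun k _ => (hc i k).const_mul (u k)]
  simp only [integral_sum_mul fun k => hc _ k]

variable {A a}

lemma gcov_symm (ha : aᵀ = a) (t : ℝ) : (gcov A a t)ᵀ = gcov A a t := by
  ext i k
  rw [Matrix.transpose_apply, gcov_entry, gcov_entry]
  have : ∀ r, (covIntegrand A a r)ᵀ = covIntegrand A a r := fun r => by
    rw [covIntegrand, Matrix.transpose_mul, Matrix.transpose_mul, ha, Matrix.transpose_transpose,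
      Matrix.mul_assoc]
  congr with r
  rw [← this r, Matrix.transpose_apply, this r]

lemma gcov_posSemidef (ha : a.PosSemidef) {t : ℝ} (ht : 0 ≤ t) : (gcov A a t).PosSemidef := by
  refine Matrix.PosSemidef.of_dotProduct_mulVec_nonneg ?_ fun u => ?_
  · rw [Matrix.IsHermitian, Matrix.conjTranspose_eq_transpose_of_trivial]
    refine gcov_symm ?_ t
    have := ha.isHermitian
    rwa [Matrix.IsHermitian, Matrix.conjTranspose_eq_transpose_of_trivial] at this
  · rw [star_trivial, gcov_quadratic]
    exact intervalIntegral.integral_nonneg ht fun r _ => by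
      simpa using ha.dotProduct_mulVec_nonneg ((fl A r)ᵀ *ᵥ u)

variable (A) (b : ι → ℝ)

/-- The drift contribution `∫₀ᵗ e^{rA} b dr` to the mean. -/
def driftInt (t : ℝ) : ι → ℝ := fun i => ∫ r in (0 : ℝ)..t, (fl A r *ᵥ b) i

lemma continuous_fl_mulVec (i : ι) : Continuous fun r => (fl A r *ᵥ b) i := by
  simp only [Matrix.mulVec, dotProduct]
  exact continuous_finsetSum _ fun k _ => ((continuous_fl A).matrix_elem i k).mul continuous_const

lemma fl_mulVec_integral (u s t : ℝ) (i : ι) :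
    (fl A u *ᵥ fun k => ∫ r in s..t, (fl A r *ᵥ b) k) i =
      ∫ r in s..t, (fl A (r + u) *ᵥ b) i := by
  have h1 : ∀ r, (fl A (r + u) *ᵥ b) i = ∑ k, fl A u i k * (fl A r *ᵥ b) k := fun r => by
    rw [add_comm, fl_add, ← Matrix.mulVec_mulVec]; rfl
  simp only [h1]
  rw [integral_sum_mul fun k => continuous_fl_mulVec A b k]
  rfl

lemma gmean_eq (t : ℝ) (ξ : EuclideanSpace ℝ ι) :
    (gmean A b t ξ).ofLp = fl A t *ᵥ ξ.ofLp + driftInt A b t := by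
  have h1 : (fun i => ξ i + ∫ s in (0 : ℝ)..t, (NormedSpace.exp ((-s) • A) *ᵥ b) i) =
      ξ.ofLp + fun i => ∫ r in (-t)..0, (fl A r *ᵥ b) i := by
    funext i
    have := intervalIntegral.integral_comp_neg (a := 0) (b := t) fun r => (fl A r *ᵥ b) i
    simp only [neg_zero] at this
    simp only [Pi.add_apply, ← this]
    rfl
  rw [gmean, h1]
  change fl A t *ᵥ _ = _
  rw [Matrix.mulVec_add]
  congr 1
  funext i
  rw [fl_mulVec_integral, intervalIntegral.integral_comp_add_right fun r => (fl A r *ᵥ b) i]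
  simp [driftInt]

lemma driftInt_add (t u : ℝ) :
    driftInt A b (t + u) = fl A u *ᵥ driftInt A b t + driftInt A b u := by
  funext i
  unfold driftInt
  rw [Pi.add_apply, fl_mulVec_integral,
    intervalIntegral.integral_comp_add_right fun r => (fl A r *ᵥ b) i, zero_add, add_comm t u,
    add_comm (∫ x in u..u + t, (fl A x *ᵥ b) i),
    intervalIntegral.integral_add_adjacent_intervals
      ((continuous_fl_mulVec A b i).intervalIntegrable _ _)
      ((continuous_fl_mulVec A b i).intervalIntegrable _ _)]

lemma gmean_gmean (t u : ℝ) (ξ : EuclideanSpace ℝ ι) :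
    gmean A b u (gmean A b t ξ) = gmean A b (t + u) ξ := by
  apply (WithLp.equiv 2 (ι → ℝ)).injective
  change (gmean A b u (gmean A b t ξ)).ofLp = (gmean A b (t + u) ξ).ofLp
  rw [gmean_eq, gmean_eq, gmean_eq, driftInt_add, Matrix.mulVec_add, Matrix.mulVec_mulVec, add_assoc,
    ← fl_add, add_comm u t]

lemma gmean_add (t : ℝ) (ξ η : EuclideanSpace ℝ ι) :
    gmean A b t (ξ + η) = gmean A b t ξ + mv (fl A t) η.ofLp := by
  apply (WithLp.equiv 2 (ι → ℝ)).injective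
  change (gmean A b t (ξ + η)).ofLp = (gmean A b t ξ).ofLp + _
  rw [gmean_eq, gmean_eq]
  simp only [WithLp.ofLp_add, Matrix.mulVec_add]
  change _ = _ + (fl A t *ᵥ η.ofLp)
  abel

lemma continuous_gmean : Continuous fun p : ℝ × EuclideanSpace ℝ ι => gmean A b p.1 p.2 := by
  have h : (fun p : ℝ × EuclideanSpace ℝ ι => gmean A b p.1 p.2) = fun p =>
      WithLp.toLp 2 (fl A p.1 *ᵥ p.2.ofLp + driftInt A b p.1) := by
    funext p
    rw [← gmean_eq]
  rw [h]
  refine (PiLp.continuous_toLp 2 _).comp (Continuous.add ?_ (continuous_pi fun i => ?_))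
  · exact ((continuous_fl A).comp continuous_fst).matrix_mulVec
      ((PiLp.continuous_ofLp 2 _).comp continuous_snd)
  · exact (intervalIntegral.continuous_primitive
      (fun s t => (continuous_fl_mulVec A b i).intervalIntegrable s t) 0).comp continuous_fst

/-- Uniformity in `A` comes from the boundedness of the exponential on a compact ball of matrices.
The estimates of first and second order follow from `(e^{tA})' = e^{tA} A` by the mean value
inequality. -/
lemma exists_fl_bounds (B : ℝ) : ∃ C : ℝ, 0 ≤ C ∧ ∀ A : Matrix ι ι ℝ, (∀ i k, |A i k| ≤ B) →
    ∀ t ∈ Icc (0 : ℝ) 1, ∀ i k, |fl A t i k| ≤ C ∧ |(fl A t - 1) i k| ≤ C * t ∧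
      |(fl A t - 1 - t • A) i k| ≤ C * t ^ 2 := by
  set B' : ℝ := Fintype.card ι * |B| with hB'
  have hB0 : 0 ≤ B' := by positivity
  obtain ⟨K, hK⟩ := (isCompact_closedBall (0 : Matrix ι ι ℝ) B').exists_bound_of_continuousOn
    (f := fun M => NormedSpace.exp M) (NormedSpace.exp_continuous.continuousOn)
  have hK0 : 0 ≤ K := (norm_nonneg _).trans (hK 0 (by simpa using hB0))
  refine ⟨K + K * B' + K * B' * B', by positivity, fun A hA t ht => ?_⟩
  have hAn : ‖A‖ ≤ B' := norm_le_of_entry hA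
  have h1 : ∀ r ∈ Icc (0 : ℝ) 1, ‖fl A r‖ ≤ K := fun r hr => hK _ (by
    rw [mem_closedBall_zero_iff, norm_smul, Real.norm_of_nonneg hr.1]
    exact (mul_le_of_le_one_left (norm_nonneg _) hr.2).trans hAn)
  have h2 : ∀ r ∈ Icc (0 : ℝ) 1, ‖fl A r - 1‖ ≤ K * B' * r := by
    intro r hr
    have := (convex_Icc (0 : ℝ) r).norm_image_sub_le_of_norm_hasDerivWithin_le (C := K * B')
      (f := fl A) (f' := fun s => fl A s * A) (x := 0) (y := r)
      (fun s _ => (hasDerivAt_fl A s).hasDerivWithinAt)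
      (fun s hs => (norm_mul_le _ _).trans
        (mul_le_mul (h1 s ⟨hs.1, hs.2.trans hr.2⟩) hAn (norm_nonneg _) hK0))
      ⟨le_rfl, hr.1⟩ ⟨hr.1, le_rfl⟩
    rwa [fl_zero, sub_zero, Real.norm_of_nonneg hr.1] at this
  have h3 : ‖fl A t - 1 - t • A‖ ≤ K * B' * B' * t ^ 2 := by
    have := (convex_Icc (0 : ℝ) t).norm_image_sub_le_of_norm_hasDerivWithin_le
      (C := K * B' * t * B')
      (f := fun s => fl A s - s • A) (f' := fun s => fl A s * A - (1 : ℝ) • A) (x := 0) (y := t)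
      (fun s _ => ((hasDerivAt_fl A s).sub
        ((hasDerivAt_id s).smul_const A)).hasDerivWithinAt)
      (fun s hs => by
        have h4 : fl A s * A - (1 : ℝ) • A = (fl A s - 1) * A := by
          rw [one_smul, sub_mul, one_mul]
        rw [h4]
        refine (norm_mul_le _ _).trans
          (mul_le_mul ((h2 s ⟨hs.1, hs.2.trans ht.2⟩).trans ?_) hAn (norm_nonneg _)
            (mul_nonneg (by positivity) ht.1))
        exact mul_le_mul_of_nonneg_left hs.2 (by positivity))
      ⟨le_rfl, ht.1⟩ ⟨ht.1, le_rfl⟩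
    simp only [fl_zero, zero_smul, sub_zero, Real.norm_of_nonneg ht.1] at this
    rw [show fl A t - 1 - t • A = fl A t - t • A - 1 by abel]
    linarith
  have e1 : 0 ≤ K * B' := by positivity
  have e2 : 0 ≤ K * B' * B' := by positivity
  have ht0 := ht.1
  refine fun i k => ⟨(abs_entry_le _ i k).trans ((h1 t ht).trans (by linarith)),
    (abs_entry_le _ i k).trans ((h2 t ht).trans ?_), (abs_entry_le _ i k).trans (h3.trans ?_)⟩
  · gcongr; linarith
  · gcongr; linarith

end Norm

lemma abs_mulVec_le {M : Matrix ι ι ℝ} {v : ι → ℝ} {B B' : ℝ} (hM : ∀ i k, |M i k| ≤ B)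
    (hv : ∀ i, |v i| ≤ B') (i : ι) : |(M *ᵥ v) i| ≤ Fintype.card ι * (B * B') := by
  rw [Matrix.mulVec, dotProduct]
  refine (Finset.abs_sum_le_sum_abs _ _).trans
    ((Finset.sum_le_card_nsmul _ _ (B * B') fun k _ => ?_).trans (by simp))
  rw [abs_mul]
  exact mul_le_mul (hM i k) (hv k) (abs_nonneg _) ((abs_nonneg _).trans (hM i k))

lemma abs_integral_le_of_le {f : ℝ → ℝ} {C t : ℝ} (ht : 0 ≤ t)
    (h : ∀ r ∈ Icc (0 : ℝ) t, |f r| ≤ C) : |∫ r in (0 : ℝ)..t, f r| ≤ C * t := by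
  have := intervalIntegral.norm_integral_le_of_norm_le_const (a := 0) (b := t) (C := C) (f := f)
    fun r hr => by rw [uIoc_of_le ht] at hr; exact h r ⟨hr.1.le, hr.2⟩
  simpa [abs_of_nonneg ht] using this

/-- Uniform small time estimates of the flow, the mean and the covariance. -/
lemma exists_small_time (B : ℝ) : ∃ C : ℝ, 0 ≤ C ∧ ∀ (A a : Matrix ι ι ℝ) (b : ι → ℝ),
    (∀ i k, |A i k| ≤ B) → (∀ i k, |a i k| ≤ B) → (∀ i, |b i| ≤ B) →
    ∀ t ∈ Icc (0 : ℝ) 1, ∀ i, |(driftInt A b t - t • b) i| ≤ C * t ^ 2 ∧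
      (∀ k, |(gcov A a t - t • a) i k| ≤ C * t ^ 2) ∧
      (∀ k, |fl A t i k| ≤ C ∧ |(fl A t - 1) i k| ≤ C * t ∧
        |(fl A t - 1 - t • A) i k| ≤ C * t ^ 2) ∧
      ((∀ k l, a k l ≠ 0 → k ≠ i ∧ l ≠ i) → |gcov A a t i i| ≤ C * t ^ 3) := by
  obtain ⟨K, hK0, hK⟩ := exists_fl_bounds (ι := ι) B
  set n : ℝ := (Fintype.card ι : ℝ)
  have hn : 0 ≤ n := Nat.cast_nonneg _
  refine ⟨K + n * (K * |B|) + n * (n * (K * |B|) * K) + n * (|B| * K) + n * (n * (K * |B|) * K),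
    by positivity, fun A a b hA ha hb t ht i => ?_⟩
  have hB0 : 0 ≤ |B| := abs_nonneg B
  have ha' : ∀ i k, |a i k| ≤ |B| := fun i k => (ha i k).trans (le_abs_self B)
  have hb' : ∀ i, |b i| ≤ |B| := fun i => (hb i).trans (le_abs_self B)
  have p1 : 0 ≤ n * (K * |B|) := by positivity
  have p2 : 0 ≤ n * (n * (K * |B|) * K) := by positivity
  have p3 : 0 ≤ n * (|B| * K) := by positivity
  have ht0 := ht.1
  have hsub : ∀ r ∈ Icc (0 : ℝ) t, r ∈ Icc (0 : ℝ) 1 := fun r hr => ⟨hr.1, hr.2.trans ht.2⟩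
  refine ⟨?_, fun k => ?_, fun k => ⟨?_, ?_, ?_⟩, fun h0 => ?_⟩
  · have e1 : (driftInt A b t - t • b) i = ∫ r in (0 : ℝ)..t, ((fl A r - 1) *ᵥ b) i := by
      simp only [Matrix.sub_mulVec, Matrix.one_mulVec, Pi.sub_apply]
      rw [intervalIntegral.integral_sub ((continuous_fl_mulVec A b i).intervalIntegrable _ _)
        (by simp)]
      simp [driftInt]
    rw [e1]
    refine (abs_integral_le_of_le (C := n * (K * t * |B|)) ht0 fun r hr =>
      abs_mulVec_le (fun i k => ?_) hb' i).trans ?_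
    · exact ((hK A hA r (hsub r hr) i k).2.1).trans (mul_le_mul_of_nonneg_left hr.2 hK0)
    · rw [show n * (K * t * |B|) * t = n * (K * |B|) * t ^ 2 by ring]
      gcongr; linarith
  · have e1 : (gcov A a t - t • a) i k = ∫ r in (0 : ℝ)..t, (covIntegrand A a r - a) i k := by
      simp only [Matrix.sub_apply]
      rw [intervalIntegral.integral_sub
        (((continuous_covIntegrand A a).matrix_elem i k).intervalIntegrable _ _) (by simp),
        ← gcov_entry]
      simp
    rw [e1]
    refine (abs_integral_le_of_le (C := n * (n * (K * |B|) * (K * t)) + n * (K * t * |B|)) ht0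
      fun r hr => ?_).trans ?_
    · have e2 : covIntegrand A a r - a = fl A r * a * (fl A r - 1)ᵀ + (fl A r - 1) * a := by
        rw [covIntegrand, Matrix.transpose_sub, Matrix.transpose_one]
        noncomm_ring
      have hr' : K * r ≤ K * t := mul_le_mul_of_nonneg_left hr.2 hK0
      have q1 : ∀ i k, |(fl A r * a : Matrix ι ι ℝ) i k| ≤ n * (K * |B|) := fun i k =>
        abs_mulVec_le (v := fun l => a l k) (fun i k => (hK A hA r (hsub r hr) i k).1)
          (fun l => ha' l k) i
      have q2 : |(fl A r * a * (fl A r - 1)ᵀ : Matrix ι ι ℝ) i k| ≤ n * (n * (K * |B|) * (K * t)) :=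
        abs_mulVec_le (v := fun l => (fl A r - 1)ᵀ l k) q1
          (fun l => ((hK A hA r (hsub r hr) k l).2.1).trans hr') i
      have q3 : |((fl A r - 1) * a : Matrix ι ι ℝ) i k| ≤ n * (K * t * |B|) :=
        abs_mulVec_le (v := fun l => a l k)
          (fun i k => ((hK A hA r (hsub r hr) i k).2.1).trans hr') (fun l => ha' l k) i
      rw [e2, Matrix.add_apply]
      exact (abs_add_le _ _).trans (add_le_add q2 q3)
    · rw [show (n * (n * (K * |B|) * (K * t)) + n * (K * t * |B|)) * t =
        (n * (n * (K * |B|) * K) + n * (K * |B|)) * t ^ 2 by ring]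
      exact mul_le_mul_of_nonneg_right (by linarith) (by positivity)
  · exact (hK A hA t ht i k).1.trans (by linarith)
  · exact (hK A hA t ht i k).2.1.trans (by gcongr; linarith)
  · exact (hK A hA t ht i k).2.2.trans (by gcongr; linarith)
  -- Direction `i` receives no noise directly, so only off-diagonal entries of the two factors
  -- `e^{rA}` contribute. Each of them is `O(r)`, and the integrand is `O(r²)`.
  · rw [gcov_entry]
    refine (abs_integral_le_of_le (C := n * (n * (K * t * |B|) * (K * t))) ht0
      fun r hr => ?_).trans ?_
    · have hr' : K * r ≤ K * t := mul_le_mul_of_nonneg_left hr.2 hK0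
      have hoff : ∀ k, k ≠ i → |fl A r i k| ≤ K * t := fun k hk => by
        have := (hK A hA r (hsub r hr) i k).2.1
        rw [Matrix.sub_apply, Matrix.one_apply_ne hk.symm, sub_zero] at this
        exact this.trans hr'
      have hkt : 0 ≤ K * t := by positivity
      have q1 : ∀ k, |(fl A r * a : Matrix ι ι ℝ) i k| ≤ n * (K * t * |B|) := fun k => by
        rw [Matrix.mul_apply]
        refine (Finset.abs_sum_le_sum_abs _ _).trans
          ((Finset.sum_le_card_nsmul _ _ (K * t * |B|) fun l _ => ?_).trans (by simp [n]))
        rw [abs_mul]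
        by_cases hl : a l k = 0
        · rw [hl, abs_zero, mul_zero]; positivity
        · exact mul_le_mul (hoff l (h0 l k hl).1) (ha' l k) (abs_nonneg _) hkt
      rw [covIntegrand, Matrix.mul_apply]
      refine (Finset.abs_sum_le_sum_abs _ _).trans
        ((Finset.sum_le_card_nsmul _ _ (n * (K * t * |B|) * (K * t)) fun l _ => ?_).trans
          (by simp [n]))
      rw [abs_mul, Matrix.transpose_apply]
      by_cases hl : l = i
      · have : (fl A r * a : Matrix ι ι ℝ) i l = 0 := by
          rw [Matrix.mul_apply]
          refine Finset.sum_eq_zero fun k _ => ?_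
          by_cases hk : a k l = 0
          · rw [hk, mul_zero]
          · exact absurd hl (h0 k l hk).2
        rw [this, abs_zero, zero_mul]
        positivity
      · exact mul_le_mul (q1 l) (hoff l hl) (abs_nonneg _) (by positivity)
    · rw [show n * (n * (K * t * |B|) * (K * t)) * t = n * (n * (K * |B|) * K) * t ^ 3 by ring]
      gcongr; linarith

end LinearSystem


/-! ### Differential operators, their weights and their commutators. -/

section Operators

variable {ι : Type} [Fintype ι] [DecidableEq ι] {Λ M : Type}

local notation "𝔼" => EuclideanSpace ℝ ι

lemma pd_smooth {ψ : 𝔼 → ℝ} (h : ContDiff ℝ ∞ ψ) (i : ι) : ContDiff ℝ ∞ (pd i ψ) :=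
  (h.fderiv_right (m := ∞) (by simp)).clm_apply contDiff_const

lemma smooth_diff {ψ : 𝔼 → ℝ} (h : ContDiff ℝ ∞ ψ) : Differentiable ℝ ψ :=
  h.differentiable (by simp)

lemma UTG.pd {f : Λ → 𝔼 → ℝ} (h : UTG f) (i : ι) : UTG fun l => pd i (f l) :=
  h.fderiv.app (UTG.const' _)

lemma pd_add {f g : 𝔼 → ℝ} (hf : ContDiff ℝ ∞ f) (hg : ContDiff ℝ ∞ g) (i : ι) :
    pd i (fun ξ => f ξ + g ξ) = fun ξ => pd i f ξ + pd i g ξ := by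
  funext ξ
  simp only [pd]
  rw [fderiv_fun_add (smooth_diff hf ξ) (smooth_diff hg ξ)]
  rfl

lemma pd_mul {f g : 𝔼 → ℝ} (hf : ContDiff ℝ ∞ f) (hg : ContDiff ℝ ∞ g) (i : ι) :
    pd i (fun ξ => f ξ * g ξ) = fun ξ => f ξ * pd i g ξ + pd i f ξ * g ξ := by
  funext ξ
  simp only [pd]
  rw [fderiv_fun_mul (smooth_diff hf ξ) (smooth_diff hg ξ)]
  simp [mul_comm]

lemma pd_const_mul {g : 𝔼 → ℝ} (c : ℝ) (hg : ContDiff ℝ ∞ g) (i : ι) :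
    pd i (fun ξ => c * g ξ) = fun ξ => c * pd i g ξ := by
  funext ξ
  simp only [pd]
  rw [fderiv_const_mul (smooth_diff hg ξ)]
  rfl

lemma pd_sum {κ : Type} (s : Finset κ) {f : κ → 𝔼 → ℝ} (hf : ∀ k ∈ s, ContDiff ℝ ∞ (f k)) (i : ι) :
    pd i (fun ξ => ∑ k ∈ s, f k ξ) = fun ξ => ∑ k ∈ s, pd i (f k) ξ := by
  funext ξ
  simp only [pd]
  rw [fderiv_fun_sum fun k hk => smooth_diff (hf k hk) ξ]
  simp

lemma pd_comm {ψ : 𝔼 → ℝ} (h : ContDiff ℝ ∞ ψ) (i k : ι) : pd i (pd k ψ) = pd k (pd i ψ) := by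
  have key : ∀ i k ξ, pd i (pd k ψ) ξ =
      fderiv ℝ (fderiv ℝ ψ) ξ (EuclideanSpace.single i 1) (EuclideanSpace.single k 1) := by
    intro i k ξ
    have hd : DifferentiableAt ℝ (fderiv ℝ ψ) ξ :=
      (h.fderiv_right (m := ∞) (by simp)).differentiable (by simp) ξ
    have := (hd.hasFDerivAt.clm_apply (hasFDerivAt_const (EuclideanSpace.single k (1 : ℝ)) ξ)).fderiv
    have h2 : pd i (pd k ψ) ξ = fderiv ℝ (fun y => fderiv ℝ ψ y (EuclideanSpace.single k 1)) ξ
      (EuclideanSpace.single i 1) := rfl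
    rw [h2, this]
    simp
  funext ξ
  rw [key, key]
  exact (h.contDiffAt.isSymmSndFDerivAt (by
    rw [minSmoothness_of_isRCLikeNormedField]; exact WithTop.coe_le_coe.2 (le_top : (2 : ℕ∞) ≤ ⊤))) _ _

/-- The iterated partial derivative along a list of indices. -/
def pdL : List ι → Op ι
  | [], ψ => ψ
  | i :: γ, ψ => pdL γ (pd i ψ)

lemma pdL_append (γ δ : List ι) (ψ : 𝔼 → ℝ) : pdL (γ ++ δ) ψ = pdL δ (pdL γ ψ) := by
  induction γ generalizing ψ with
  | nil => rfl
  | cons i γ ih => exact ih _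

lemma pdL_smooth (γ : List ι) {ψ : 𝔼 → ℝ} (h : ContDiff ℝ ∞ ψ) : ContDiff ℝ ∞ (pdL γ ψ) := by
  induction γ generalizing ψ with
  | nil => exact h
  | cons i γ ih => exact ih (pd_smooth h i)

/-- The recursion of `pdL` applies the head first. Symmetry of second derivatives allows it to be
applied last, as integration by parts will need. -/
lemma pdL_cons {ψ : 𝔼 → ℝ} (h : ContDiff ℝ ∞ ψ) (i : ι) (γ : List ι) :
    pdL (i :: γ) ψ = pd i (pdL γ ψ) := by
  induction γ generalizing ψ with
  | nil => rfl
  | cons k γ ih =>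
    change pdL γ (pd k (pd i ψ)) = pd i (pdL γ (pd k ψ))
    rw [← ih (pd_smooth h k), pd_comm h k i]
    rfl

lemma UTG.pdL {f : Λ → 𝔼 → ℝ} (h : UTG f) (γ : List ι) : UTG fun l => pdL γ (f l) := by
  induction γ generalizing f with
  | nil => exact h
  | cons i γ ih => exact ih (h.pd i)

lemma pdL_add {f g : 𝔼 → ℝ} (hf : ContDiff ℝ ∞ f) (hg : ContDiff ℝ ∞ g) (γ : List ι) :
    pdL γ (fun ξ => f ξ + g ξ) = fun ξ => pdL γ f ξ + pdL γ g ξ := by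
  induction γ generalizing f g with
  | nil => rfl
  | cons i γ ih => simp only [pdL]; rw [pd_add hf hg, ih (pd_smooth hf i) (pd_smooth hg i)]

lemma pdL_const_mul {g : 𝔼 → ℝ} (c : ℝ) (hg : ContDiff ℝ ∞ g) (γ : List ι) :
    pdL γ (fun ξ => c * g ξ) = fun ξ => c * pdL γ g ξ := by
  induction γ generalizing g with
  | nil => rfl
  | cons i γ ih => simp only [pdL]; rw [pd_const_mul c hg, ih (pd_smooth hg i)]

lemma pdL_sum {κ : Type} (s : Finset κ) {f : κ → 𝔼 → ℝ} (hf : ∀ k ∈ s, ContDiff ℝ ∞ (f k))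
    (γ : List ι) : pdL γ (fun ξ => ∑ k ∈ s, f k ξ) = fun ξ => ∑ k ∈ s, pdL γ (f k) ξ := by
  induction γ generalizing f with
  | nil => rfl
  | cons i γ ih => simp only [pdL]; rw [pd_sum s hf, ih fun k hk => pd_smooth (hf k hk) i]

/-- The generator of the linear equation with drift `Aξ + b` and diffusion matrix `a`. -/
def genL (A a : Matrix ι ι ℝ) (b : ι → ℝ) : Op ι := fun φ ξ =>
  ∑ i, ((A *ᵥ ξ.ofLp) i + b i) * pd i φ ξ + 1 / 2 * ∑ i, ∑ k, a i k * pd i (pd k φ) ξ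

section GenL

variable (A a : Matrix ι ι ℝ) (b : ι → ℝ)

lemma affine_smooth (i : ι) : ContDiff ℝ ∞ fun ξ : 𝔼 => (A *ᵥ ξ.ofLp) i + b i := by
  simp only [Matrix.mulVec, dotProduct]
  fun_prop

lemma pd_affine (i k : ι) :
    pd k (fun ξ : 𝔼 => (A *ᵥ ξ.ofLp) i + b i) = fun _ => A i k := by
  have : (fun ξ : 𝔼 => (A *ᵥ ξ.ofLp) i + b i) = fun ξ =>
      (∑ j, A i j • (EuclideanSpace.proj j : 𝔼 →L[ℝ] ℝ)) ξ + b i := by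
    funext ξ
    simp [Matrix.mulVec, dotProduct]
  funext ξ
  rw [this, pd, fderiv_add_const, ContinuousLinearMap.fderiv]
  simp

lemma genL_smooth {ψ : 𝔼 → ℝ} (h : ContDiff ℝ ∞ ψ) : ContDiff ℝ ∞ (genL A a b ψ) := by
  refine ContDiff.add (ContDiff.sum fun i _ => (affine_smooth A b i).mul (pd_smooth h i)) ?_
  exact contDiff_const.mul (ContDiff.sum fun i _ => ContDiff.sum fun k _ =>
    contDiff_const.mul (pd_smooth (pd_smooth h k) i))

lemma genL_add {f g : 𝔼 → ℝ} (hf : ContDiff ℝ ∞ f) (hg : ContDiff ℝ ∞ g) :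
    genL A a b (fun ξ => f ξ + g ξ) = fun ξ => genL A a b f ξ + genL A a b g ξ := by
  funext ξ
  simp only [genL, pd_add hf hg, pd_add (pd_smooth hf _) (pd_smooth hg _), mul_add,
    Finset.sum_add_distrib]
  ring

-- Leibniz' rule of second order. The last sum is the carré du champ, whose two halves coincide
-- because `a` is symmetric.
variable {a} in
lemma genL_mul (ha : ∀ i k, a i k = a k i) {f g : 𝔼 → ℝ} (hf : ContDiff ℝ ∞ f)
    (hg : ContDiff ℝ ∞ g) :
    genL A a b (fun ξ => f ξ * g ξ) = fun ξ => f ξ * genL A a b g ξ + genL A a b f ξ * g ξ +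
      ∑ i, ∑ k, a i k * (pd i f ξ * pd k g ξ) := by
  have h2 : ∀ i k, pd i (pd k fun ξ => f ξ * g ξ) = fun ξ => (f ξ * pd i (pd k g) ξ +
      pd i f ξ * pd k g ξ) + (pd k f ξ * pd i g ξ + pd i (pd k f) ξ * g ξ) := by
    intro i k
    rw [pd_mul hf hg, pd_add (hf.mul (pd_smooth hg k)) ((pd_smooth hf k).mul hg),
      pd_mul hf (pd_smooth hg k), pd_mul (pd_smooth hf k) hg]
  funext ξ
  have h3 : ∑ i, ∑ k, a i k * (pd k f ξ * pd i g ξ) = ∑ i, ∑ k, a i k * (pd i f ξ * pd k g ξ) := by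
    rw [Finset.sum_comm]
    exact Finset.sum_congr rfl fun i _ => Finset.sum_congr rfl fun k _ => by rw [ha]
  have h4 : genL A a b (fun ξ => f ξ * g ξ) ξ = ∑ i, ((A *ᵥ ξ.ofLp) i + b i) *
      (f ξ * pd i g ξ + pd i f ξ * g ξ) + 1 / 2 * ∑ i, ∑ k, a i k * ((f ξ * pd i (pd k g) ξ +
      pd i f ξ * pd k g ξ) + (pd k f ξ * pd i g ξ + pd i (pd k f) ξ * g ξ)) := by
    simp only [genL, h2]
    simp only [pd_mul hf hg]
  have h5 : ∑ i, ((A *ᵥ ξ.ofLp) i + b i) * (f ξ * pd i g ξ + pd i f ξ * g ξ) =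
      f ξ * (∑ i, ((A *ᵥ ξ.ofLp) i + b i) * pd i g ξ) +
      (∑ i, ((A *ᵥ ξ.ofLp) i + b i) * pd i f ξ) * g ξ := by
    rw [Finset.mul_sum, Finset.sum_mul, ← Finset.sum_add_distrib]
    exact Finset.sum_congr rfl fun i _ => by ring
  have h6 : ∑ i, ∑ k, a i k * ((f ξ * pd i (pd k g) ξ +
      pd i f ξ * pd k g ξ) + (pd k f ξ * pd i g ξ + pd i (pd k f) ξ * g ξ)) =
      f ξ * (∑ i, ∑ k, a i k * pd i (pd k g) ξ) + ∑ i, ∑ k, a i k * (pd i f ξ * pd k g ξ) +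
      ∑ i, ∑ k, a i k * (pd k f ξ * pd i g ξ) + (∑ i, ∑ k, a i k * pd i (pd k f) ξ) * g ξ := by
    simp only [Finset.mul_sum, Finset.sum_mul, ← Finset.sum_add_distrib]
    exact Finset.sum_congr rfl fun i _ => Finset.sum_congr rfl fun k _ => by ring
  rw [h4, h5, h6, h3]
  simp only [genL]
  ring

/-- The drift is affine and the diffusion matrix constant, so the commutator of a derivative with
the generator is of first order with constant coefficients: it only exchanges the index `i` for
other indices. -/
lemma pd_genL {ψ : 𝔼 → ℝ} (h : ContDiff ℝ ∞ ψ) (i : ι) :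
    pd i (genL A a b ψ) = fun ξ => genL A a b (pd i ψ) ξ + ∑ k, A k i * pd k ψ ξ := by
  have h1 : ∀ k ∈ (Finset.univ : Finset ι),
      ContDiff ℝ ∞ fun ξ : 𝔼 => ((A *ᵥ ξ.ofLp) k + b k) * pd k ψ ξ :=
    fun k _ => (affine_smooth A b k).mul (pd_smooth h k)
  have h2 : ∀ k l, ContDiff ℝ ∞ fun ξ : 𝔼 => a k l * pd k (pd l ψ) ξ :=
    fun k l => contDiff_const.mul (pd_smooth (pd_smooth h l) k)
  have h3 : ∀ k ∈ (Finset.univ : Finset ι), ContDiff ℝ ∞ fun ξ : 𝔼 =>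
      ∑ l, a k l * pd k (pd l ψ) ξ := fun k _ => ContDiff.sum fun l _ => h2 k l
  have e : genL A a b ψ = fun ξ => (∑ k, ((A *ᵥ ξ.ofLp) k + b k) * pd k ψ ξ) +
    1 / 2 * ∑ k, ∑ l, a k l * pd k (pd l ψ) ξ := rfl
  rw [e, pd_add (ContDiff.sum h1) (contDiff_const.mul (ContDiff.sum h3)), pd_sum _ h1,
    pd_const_mul _ (ContDiff.sum h3), pd_sum _ h3]
  funext ξ
  have e1 : ∀ k, pd i (fun ξ : 𝔼 => ((A *ᵥ ξ.ofLp) k + b k) * pd k ψ ξ) ξ =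
      ((A *ᵥ ξ.ofLp) k + b k) * pd k (pd i ψ) ξ + A k i * pd k ψ ξ := fun k => by
    rw [pd_mul (affine_smooth A b k) (pd_smooth h k), pd_affine, pd_comm h i k]
  have e2 : ∀ k, pd i (fun ξ : 𝔼 => ∑ l, a k l * pd k (pd l ψ) ξ) ξ =
      ∑ l, a k l * pd k (pd l (pd i ψ)) ξ := fun k => by
    rw [pd_sum _ fun l _ => h2 k l]
    refine Finset.sum_congr rfl fun l _ => ?_
    rw [pd_const_mul _ (pd_smooth (pd_smooth h l) k), pd_comm (pd_smooth h l) i k, pd_comm h i l]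
  simp only [e1, e2, genL, Finset.sum_add_distrib]
  ring

end GenL

/-- Families of functions that vanish to a given order at `x`. -/
def Van (x : 𝔼) : ℕ → (Λ → 𝔼 → ℝ) → Prop
  | 0, f => UTG f
  | m + 1, f => UTG f ∧ (∀ l, f l x = 0) ∧ ∀ i, Van x m fun l => pd i (f l)

section Van

variable {x : EuclideanSpace ℝ ι}

lemma Van.utg {m : ℕ} {f : Λ → 𝔼 → ℝ} (h : Van x m f) : UTG f := by
  cases m with
  | zero => exact h
  | succ m => exact h.1

lemma Van.pred {m : ℕ} {f : Λ → 𝔼 → ℝ} (h : Van x (m + 1) f) : Van x m f := by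
  induction m generalizing f with
  | zero => exact h.1
  | succ m ih => exact ⟨h.1, h.2.1, fun i => ih (h.2.2 i)⟩

lemma Van.pd {m : ℕ} {f : Λ → 𝔼 → ℝ} (h : Van x m f) (i : ι) :
    Van x (m - 1) fun l => pd i (f l) := by
  cases m with
  | zero => exact UTG.pd h i
  | succ m => exact h.2.2 i

lemma Van.add {m : ℕ} {f g : Λ → 𝔼 → ℝ} (hf : Van x m f) (hg : Van x m g) :
    Van x m fun l ξ => f l ξ + g l ξ := by
  induction m generalizing f g with
  | zero => exact UTG.add hf hg
  | succ m ih =>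
    refine ⟨hf.1.add hg.1, fun l => by simp [hf.2.1, hg.2.1], fun i => ?_⟩
    simp only [pd_add (hf.1.contDiff _) (hg.1.contDiff _)]
    exact ih (hf.2.2 i) (hg.2.2 i)

lemma Van.mul {m : ℕ} {f g : Λ → 𝔼 → ℝ} (hg : UTG g) (hf : Van x m f) :
    Van x m fun l ξ => g l ξ * f l ξ := by
  induction m generalizing f g with
  | zero => exact UTG.mul hg hf
  | succ m ih =>
    refine ⟨hg.mul hf.1, fun l => by simp [hf.2.1], fun i => ?_⟩
    simp only [pd_mul (hg.contDiff _) (hf.1.contDiff _)]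
    exact (ih hg (hf.2.2 i)).add (ih (hg.pd i) hf.pred)

lemma Van.reindex {m : ℕ} (φ : M → Λ) {f : Λ → 𝔼 → ℝ} (hf : Van x m f) :
    Van x m fun l => f (φ l) := by
  induction m generalizing f with
  | zero => exact UTG.reindex φ hf
  | succ m ih => exact ⟨hf.1.reindex φ, fun l => hf.2.1 _, fun i => ih (hf.2.2 i)⟩

end Van

/-- The weight of a list of indices. -/
def wt (ϖ : ι → ℕ) (γ : List ι) : ℕ := (γ.map ϖ).sum

lemma wt_append (ϖ : ι → ℕ) (γ δ : List ι) : wt ϖ (γ ++ δ) = wt ϖ γ + wt ϖ δ := by simp [wt]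

lemma wt_cons (ϖ : ι → ℕ) (i : ι) (γ : List ι) : wt ϖ (i :: γ) = ϖ i + wt ϖ γ := by simp [wt]

/-- The reduced weights: `1` for weight `1` and `2` for weight `3`. -/
def hw (ϖ : ι → ℕ) (i : ι) : ℕ := (ϖ i + 1) / 2

/-- Families of differential operators of degree `k`: sums of operators `f ∂^γ`, where `f` vanishes
to order `m` at `x` and the weights of `γ` are bounded in terms of `k` and `m`. -/
inductive DO (x : EuclideanSpace ℝ ι) (ϖ : ι → ℕ) (k : ℕ) : (Λ → Op ι) → Prop
  | term (f : Λ → EuclideanSpace ℝ ι → ℝ) (γ : List ι) (m : ℕ) (hf : Van x m f)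
      (h1 : wt ϖ γ ≤ 2 * k + m + 1) (h2 : wt (hw ϖ) γ ≤ k + 2) :
      DO x ϖ k fun l ψ ξ => f l ξ * pdL γ ψ ξ
  | add (Q Q' : Λ → Op ι) (h : DO x ϖ k Q) (h' : DO x ϖ k Q') :
      DO x ϖ k fun l ψ ξ => Q l ψ ξ + Q' l ψ ξ
  | congr (Q Q' : Λ → Op ι) (h : DO x ϖ k Q)
      (h' : ∀ l ψ, ContDiff ℝ ∞ ψ → Q' l ψ = Q l ψ) : DO x ϖ k Q'

section DO

variable {x : EuclideanSpace ℝ ι} {ϖ : ι → ℕ} {k : ℕ} {Q : Λ → Op ι}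

lemma DO.sum {κ : Type} (s : Finset κ) {Q : κ → Λ → Op ι} (h : ∀ i ∈ s, DO x ϖ k (Q i)) :
    DO x ϖ k fun l ψ ξ => ∑ i ∈ s, Q i l ψ ξ := by
  classical
  induction s using Finset.induction_on with
  | empty =>
    refine .congr _ _ (.term (fun _ _ => 0) [] 0 (UTG.const' 0) (by simp [wt]) (by simp [wt]))
      fun l ψ _ => ?_
    simp
  | insert a s ha ih =>
    refine .congr _ _ (.add _ _ (h a (by simp)) (ih fun i hi => h i (by simp [hi])))
      fun l ψ _ => ?_
    simp [Finset.sum_insert ha]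

lemma DO.smooth (h : DO x ϖ k Q) (l : Λ) {ψ : 𝔼 → ℝ} (hψ : ContDiff ℝ ∞ ψ) :
    ContDiff ℝ ∞ (Q l ψ) := by
  induction h with
  | term f γ m hf h1 h2 => exact (hf.utg.contDiff l).mul (pdL_smooth γ hψ)
  | add Q Q' h h' ih ih' => exact ih.add ih'
  | congr Q Q' h h' ih => rw [h' l ψ hψ]; exact ih

lemma DO.utg (h : DO x ϖ k Q) (φ : M → Λ) {ψ : M → 𝔼 → ℝ} (hψ : UTG ψ) :
    UTG fun m => Q (φ m) (ψ m) := by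
  induction h with
  | term f γ m hf h1 h2 => exact (hf.utg.reindex φ).mul (hψ.pdL γ)
  | add Q Q' h h' ih ih' => exact ih.add ih'
  | congr Q Q' h h' ih => simpa only [h' _ _ (hψ.contDiff _)] using ih

lemma DO.reindex (h : DO x ϖ k Q) (φ : M → Λ) : DO x ϖ k fun m => Q (φ m) := by
  induction h with
  | term f γ m hf h1 h2 => exact .term (fun l => f (φ l)) γ m (hf.reindex φ) h1 h2
  | add Q Q' h h' ih ih' => exact .add _ _ ih ih'
  | congr Q Q' h h' ih => exact .congr _ _ ih fun l ψ hψ => h' _ ψ hψ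

lemma DO.map_add (h : DO x ϖ k Q) (l : Λ) {f g : 𝔼 → ℝ} (hf : ContDiff ℝ ∞ f)
    (hg : ContDiff ℝ ∞ g) : Q l (fun ξ => f ξ + g ξ) = fun ξ => Q l f ξ + Q l g ξ := by
  induction h with
  | term c γ m hc h1 h2 => simp only [pdL_add hf hg]; funext ξ; ring
  | add Q Q' h h' ih ih' => simp only [ih, ih']; funext ξ; ring
  | congr Q Q' h h' ih => rw [h' l _ (hf.add hg), h' l _ hf, h' l _ hg, ih]

lemma DO.map_const_mul (h : DO x ϖ k Q) (l : Λ) (c : ℝ) {g : 𝔼 → ℝ} (hg : ContDiff ℝ ∞ g) :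
    Q l (fun ξ => c * g ξ) = fun ξ => c * Q l g ξ := by
  induction h with
  | term f γ m hf h1 h2 => simp only [pdL_const_mul c hg]; funext ξ; ring
  | add Q Q' h h' ih ih' => simp only [ih, ih']; funext ξ; ring
  | congr Q Q' h h' ih => rw [h' l _ (contDiff_const.mul hg), h' l _ hg, ih]

section Ad

variable {A a : Λ → Matrix ι ι ℝ} {b : Λ → ι → ℝ} {B : ℝ}

/-- The coefficients of the frozen generator: uniformly bounded, with a symmetric diffusion matrix
that acts on the directions of weight `1` only. -/
structure Frozen (ϖ : ι → ℕ) (A a : Λ → Matrix ι ι ℝ) (b : Λ → ι → ℝ) (B : ℝ) : Prop where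
  hϖ : ∀ i, ϖ i = 1 ∨ ϖ i = 3
  hA : ∀ l i k, |A l i k| ≤ B
  ha : ∀ l i k, |a l i k| ≤ B
  hb : ∀ l i, |b l i| ≤ B
  hpos : ∀ l, (a l).PosSemidef
  hdeg : ∀ l i k, a l i k ≠ 0 → ϖ i = 1 ∧ ϖ k = 1

lemma Frozen.symm (F : Frozen ϖ A a b B) (l : Λ) (i k : ι) : a l i k = a l k i := by
  have := (F.hpos l).isHermitian.apply k i
  simpa using this

lemma Frozen.reindex (F : Frozen ϖ A a b B) (φ : M → Λ) :
    Frozen ϖ (fun m => A (φ m)) (fun m => a (φ m)) (fun m => b (φ m)) B :=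
  ⟨F.hϖ, fun _ => F.hA _, fun _ => F.ha _, fun _ => F.hb _, fun _ => F.hpos _, fun _ => F.hdeg _⟩

lemma UTG.affine (hA : ∀ l i k, |A l i k| ≤ B) (hb : ∀ l i, |b l i| ≤ B) (i : ι) :
    UTG fun l (ξ : 𝔼) => (A l *ᵥ ξ.ofLp) i + b l i := by
  refine UTG.add (UTG.sum _ fun k _ => UTG.mul (UTG.const fun l => hA l i k)
    (UTG.clm' (EuclideanSpace.proj k : 𝔼 →L[ℝ] ℝ))) (UTG.const fun l => hb l i)

lemma UTG.genL (F : Frozen ϖ A a b B) {ψ : Λ → 𝔼 → ℝ} (hψ : UTG ψ) :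
    UTG fun l => genL (A l) (a l) (b l) (ψ l) :=
  (UTG.sum _ fun i _ => (UTG.affine F.hA F.hb i).mul (hψ.pd i)).add
    ((UTG.const' (1 / 2 : ℝ)).mul (UTG.sum _ fun i _ => UTG.sum _ fun k _ =>
      (UTG.const fun l => F.ha l i k).mul ((hψ.pd k).pd i)))

/-- The derivatives in `γ` pass the generator one at a time, and `δ` collects those that have
passed. Each exchange of an index raises the weight by at most `2` and the reduced weight by at most
`1`, which is exactly what the step from `k` to `k + 1` permits. -/
lemma DO.comm_pdL (F : Frozen ϖ A a b B) {f : Λ → 𝔼 → ℝ} {m : ℕ} (hf : Van x m f)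
    (γ δ : List ι) (h1 : wt ϖ (δ ++ γ) ≤ 2 * k + m + 1) (h2 : wt (hw ϖ) (δ ++ γ) ≤ k + 2) :
    DO x ϖ (k + 1) fun l ψ ξ => f l ξ * (LDL.genL (A l) (a l) (b l) (pdL γ (pdL δ ψ)) ξ -
      pdL γ (LDL.genL (A l) (a l) (b l) (pdL δ ψ)) ξ) := by
  induction γ generalizing δ with
  | nil =>
    -- An empty sum serves as the zero operator.
    refine .congr _ _ (.sum (Q := fun (i : Empty) _ _ _ => (i.elim : ℝ)) ∅ (by simp))
      fun l ψ _ => ?_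
    simp [pdL]
  | cons i γ ih =>
    have e1 : δ ++ i :: γ = (δ ++ [i]) ++ γ := by simp
    refine .congr _ _ (.add _ _ (ih (δ ++ [i]) (by rwa [← e1]) (by rwa [← e1]))
      (.sum Finset.univ (Q := fun k l ψ ξ => (-A l k i * f l ξ) * pdL (δ ++ k :: γ) ψ ξ)
        fun j _ => .term _ _ m ?_ ?_ ?_)) fun l ψ hψ => ?_
    · exact Van.mul (UTG.const (C := B) fun l => by simpa using F.hA l j i) hf
    · rw [wt_append, wt_cons] at h1 ⊢
      rcases F.hϖ i with hi | hi <;> rcases F.hϖ j with hj | hj <;> rw [hi] at h1 <;> rw [hj] <;>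
        omega
    · rw [wt_append, wt_cons] at h2 ⊢
      rcases F.hϖ i with hi | hi <;> rcases F.hϖ j with hj | hj <;>
        simp only [hw, hi, hj] at h2 ⊢ <;> omega
    · have hδ := pdL_smooth δ hψ
      funext ξ
      have e2 : ∀ χ, pdL (i :: γ) χ = pdL γ (pd i χ) := fun _ => rfl
      have e3 : pdL (δ ++ [i]) ψ = pd i (pdL δ ψ) := pdL_append δ [i] ψ
      have e4 : ∀ j, pdL (δ ++ j :: γ) ψ = pdL γ (pd j (pdL δ ψ)) := fun j =>
        pdL_append δ (j :: γ) ψ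
      have hs : ∀ j ∈ (Finset.univ : Finset ι), ContDiff ℝ ∞ fun ξ => A l j i * pd j (pdL δ ψ) ξ :=
        fun j _ => contDiff_const.mul (pd_smooth hδ j)
      simp only [e2, e3, e4]
      rw [pd_genL _ _ _ hδ, pdL_add (genL_smooth _ _ _ (pd_smooth hδ i)) (ContDiff.sum hs),
        pdL_sum _ hs]
      simp only [pdL_const_mul _ (pd_smooth hδ _)]
      have e5 : ∀ j, -A l j i * f l ξ * pdL γ (pd j (pdL δ ψ)) ξ =
        -f l ξ * (A l j i * pdL γ (pd j (pdL δ ψ)) ξ) := fun j => by ring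
      simp only [e5, ← Finset.mul_sum]
      ring

/-- The commutator of `G` with `f ∂^γ` consists of `f [G, ∂^γ]`, of the terms in which the drift or
the diffusion part of `G` falls on `f` alone, and of the cross terms `a_{ij} ∂_i f ∂_j ∂^γ`. One or
two derivatives on `f` lower `m` by at most that number, which the increase of `2k` by two pays for.
A cross term adds one derivative, but only in a direction of weight `1`, since `a` vanishes
elsewhere; hence the reduced weight grows by at most one. -/
lemma DO.ad_gen (F : Frozen ϖ A a b B) (h : DO x ϖ k Q) :
    DO x ϖ (k + 1) fun l => ad (LDL.genL (A l) (a l) (b l)) (Q l) := by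
  induction h with
  | term f γ m hf h1 h2 =>
    refine .congr _ _ (.add _ _ (.add _ _ (.add _ _
      (DO.comm_pdL F hf γ [] h1 h2)
      (.sum Finset.univ (Q := fun i l ψ ξ =>
        (((A l *ᵥ ξ.ofLp) i + b l i) * pd i (f l) ξ) * pdL γ ψ ξ) fun i _ =>
          .term _ γ (m - 1) (Van.mul (UTG.affine F.hA F.hb i) (hf.pd i)) (by omega) (by omega)))
      (.sum Finset.univ (Q := fun i l ψ ξ => ∑ j, (1 / 2 * a l i j * pd i (pd j (f l)) ξ) *
        pdL γ ψ ξ) fun i _ => .sum Finset.univ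
          (Q := fun j l ψ ξ => (1 / 2 * a l i j * pd i (pd j (f l)) ξ) * pdL γ ψ ξ) fun j _ =>
          .term _ γ (m - 1 - 1) (Van.mul ((UTG.const' (1 / 2 : ℝ)).mul
            (UTG.const fun l => F.ha l i j)) ((hf.pd j).pd i)) (by omega) (by omega)))
      (.sum Finset.univ (Q := fun i l ψ ξ => ∑ j, (a l i j * pd i (f l) ξ) *
        pdL (γ ++ [j]) ψ ξ) fun i _ => .sum Finset.univ
          (Q := fun j l ψ ξ => (a l i j * pd i (f l) ξ) * pdL (γ ++ [j]) ψ ξ) fun j _ => ?_))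
      fun l ψ hψ => ?_
    · by_cases hj : ϖ j = 1
      · refine .term _ _ (m - 1) (Van.mul (UTG.const fun l => F.ha l i j) (hf.pd i)) ?_ ?_
        · rw [wt_append, wt_cons, hj]; simp only [wt, List.map_nil, List.sum_nil] at *; omega
        · rw [wt_append, wt_cons, hw, hj]; simp only [wt, List.map_nil, List.sum_nil] at *; omega
      · refine .congr _ _ (.sum (Q := fun (i : Empty) _ _ _ => (i.elim : ℝ)) ∅ (by simp))
          fun l ψ _ => ?_
        have : a l i j = 0 := by
          by_contra h0
          exact hj (F.hdeg l i j h0).2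
        simp [this]
    · have hg := pdL_smooth γ hψ
      have hfs := hf.utg.contDiff l
      funext ξ
      have e1 : ad (LDL.genL (A l) (a l) (b l)) (fun ψ ξ => f l ξ * pdL γ ψ ξ) ψ ξ =
        LDL.genL (A l) (a l) (b l) (fun ξ => f l ξ * pdL γ ψ ξ) ξ -
          f l ξ * pdL γ (LDL.genL (A l) (a l) (b l) ψ) ξ := rfl
      have e2 : ∀ j, pdL (γ ++ [j]) ψ = pd j (pdL γ ψ) := fun j => pdL_append γ [j] ψ
      have e3 : pdL [] ψ = ψ := rfl
      rw [e1, genL_mul _ _ (F.symm l) hfs hg]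
      simp only [e2, e3]
      have e4 : LDL.genL (A l) (a l) (b l) (f l) ξ * pdL γ ψ ξ =
          (∑ i, ((A l *ᵥ ξ.ofLp) i + b l i) * pd i (f l) ξ * pdL γ ψ ξ) +
          ∑ i, ∑ j, 1 / 2 * a l i j * pd i (pd j (f l)) ξ * pdL γ ψ ξ := by
        simp only [LDL.genL, add_mul, Finset.sum_mul, Finset.mul_sum, mul_assoc]
      have e5 : ∑ i, ∑ j, a l i j * (pd i (f l) ξ * pd j (pdL γ ψ) ξ) =
          ∑ i, ∑ j, a l i j * pd i (f l) ξ * pd j (pdL γ ψ) ξ := by simp only [mul_assoc]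
      rw [e4, e5]
      ring
  | add Q Q' h h' ih ih' =>
    refine .congr _ _ (.add _ _ ih ih') fun l ψ hψ => ?_
    funext ξ
    have := congrFun (genL_add (A l) (a l) (b l) (h.smooth l hψ) (h'.smooth l hψ)) ξ
    simp only [ad, Pi.sub_apply, this]
    ring
  | congr Q Q' h h' ih =>
    refine .congr _ _ ih fun l ψ hψ => ?_
    simp only [ad]
    rw [h' l ψ hψ, h' l _ (genL_smooth _ _ _ hψ)]

lemma DO.adIter (F : Frozen ϖ A a b B) (h : DO x ϖ 0 Q) (k : ℕ) :
    DO x ϖ k fun l => adIter (LDL.genL (A l) (a l) (b l)) k (Q l) := by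
  induction k with
  | zero => exact h
  | succ k ih => exact ih.ad_gen F

end Ad

section Param

variable {Z : Type} [NormedAddCommGroup Z] [NormedSpace ℝ Z] [MeasurableSpace Z] [BorelSpace Z]
  [SecondCountableTopology Z] {ν : Measure Z}

lemma slice_smooth {h : 𝔼 × Z → ℝ} (hh : ContDiff ℝ ∞ h) (z : Z) :
    ContDiff ℝ ∞ fun ξ => h (ξ, z) := hh.comp (by fun_prop)

lemma UTG.pd_slice {h : M → 𝔼 × Z → ℝ} (hh : UTG h) (i : ι) :
    UTG fun m (p : 𝔼 × Z) => LDL.pd i (fun ξ => h m (ξ, p.2)) p.1 := by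
  have := hh.fderiv.app (UTG.const' ((EuclideanSpace.single i (1 : ℝ), 0) : 𝔼 × Z))
  convert this using 3 with m p
  rw [LDL.pd, (hasFDerivAt_slice (hh.diff m) p.1 p.2).fderiv]
  rfl

lemma UTG.pdL_slice {h : M → 𝔼 × Z → ℝ} (hh : UTG h) (γ : List ι) :
    UTG fun m (p : 𝔼 × Z) => LDL.pdL γ (fun ξ => h m (ξ, p.2)) p.1 := by
  induction γ generalizing h with
  | nil => exact hh
  | cons i γ ih => exact ih (hh.pd_slice i)

lemma pd_integral (hν : Mom ν) {h : M → 𝔼 × Z → ℝ} (hh : UTG h) (i : ι) (m : M) :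
    pd i (fun ξ => ∫ z, h m (ξ, z) ∂ν) = fun ξ => ∫ z, pd i (fun ξ => h m (ξ, z)) ξ ∂ν := by
  funext ξ
  rw [pd, hh.fderiv_integral hν, ContinuousLinearMap.integral_apply]
  · rfl
  · refine (UB.integrable_slice hν ((hh 1).fderiv₁).ub (f := fderiv₁ h)
      ((hh 1).fderiv₁).cont m ξ).congr (.of_forall fun z => ?_)
    exact (hasFDerivAt_slice (hh.diff m) ξ z).fderiv.symm

lemma pdL_integral (hν : Mom ν) {h : M → 𝔼 × Z → ℝ} (hh : UTG h) (γ : List ι) (m : M) :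
    pdL γ (fun ξ => ∫ z, h m (ξ, z) ∂ν) = fun ξ => ∫ z, pdL γ (fun ξ => h m (ξ, z)) ξ ∂ν := by
  induction γ generalizing h with
  | nil => rfl
  | cons i γ ih =>
    simp only [pdL]
    rw [pd_integral hν hh]
    exact ih (hh.pd_slice i)

lemma DO.utg_slice (h : DO x ϖ k Q) (φ : M → Λ) {g : M → 𝔼 × Z → ℝ} (hg : UTG g) :
    UTG fun m (p : 𝔼 × Z) => Q (φ m) (fun ξ => g m (ξ, p.2)) p.1 := by
  induction h with
  | term f γ m hf h1 h2 => exact ((hf.utg.reindex φ).comp UTG.id.fst).mul (hg.pdL_slice γ)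
  | add Q Q' h h' ih ih' => exact ih.add ih'
  | congr Q Q' h h' ih => simpa only [h' _ _ (slice_smooth (hg.contDiff _) _)] using ih

lemma DO.integral (h : DO x ϖ k Q) (hν : Mom ν) (φ : M → Λ) {g : M → 𝔼 × Z → ℝ} (hg : UTG g)
    (m : M) (ξ : 𝔼) : Q (φ m) (fun ξ => ∫ z, g m (ξ, z) ∂ν) ξ =
      ∫ z, Q (φ m) (fun ξ => g m (ξ, z)) ξ ∂ν := by
  induction h with
  | term f γ m hf h1 h2 =>
    simp only [pdL_integral hν hg]
    rw [integral_const_mul]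
  | add Q Q' h h' ih ih' =>
    simp only [ih, ih']
    rw [integral_add]
    · exact UB.integrable_slice hν (h.utg_slice φ hg).ub (h.utg_slice φ hg).cont m ξ
    · exact UB.integrable_slice hν (h'.utg_slice φ hg).ub (h'.utg_slice φ hg).cont m ξ
  | congr Q Q' h h' ih =>
    rw [h' _ _ ((hg.integral hν).contDiff m), ih]
    congr with z
    rw [h' _ _ (slice_smooth (hg.contDiff _) _)]

end Param

end DO

end Operators


/-! ### The Gaussian semigroup and its small time expansion. -/

section Semigroup

variable {ι κ κ' : Type} [Fintype ι] [DecidableEq ι] [Fintype κ] [Fintype κ'] {M : Type}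

local notation "𝔼" => EuclideanSpace ℝ ι

/-- A square root of a positive semidefinite matrix. -/
def sqm (Q : Matrix ι ι ℝ) : Matrix ι ι ℝ :=
  open Classical in if h : ∃ C : Matrix ι ι ℝ, C * Cᵀ = Q then h.choose else 0

open scoped MatrixOrder Matrix.Norms.L2Operator in
lemma sqm_mul {Q : Matrix ι ι ℝ} (h : Q.PosSemidef) : sqm Q * (sqm Q)ᵀ = Q := by
  have : ∃ C : Matrix ι ι ℝ, C * Cᵀ = Q := by
    obtain ⟨C, hC⟩ := CStarAlgebra.nonneg_iff_eq_star_mul_self.mp h.nonneg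
    refine ⟨Cᵀ, ?_⟩
    rw [hC, Matrix.star_eq_conjTranspose, Matrix.conjTranspose_eq_transpose_of_trivial,
      Matrix.transpose_transpose]
  rw [sqm, dif_pos this]
  exact this.choose_spec

lemma sq_entry_le (L : Matrix ι κ ℝ) (i : ι) (k : κ) : L i k ^ 2 ≤ (L * Lᵀ) i i := by
  rw [Matrix.mul_apply]
  simp only [Matrix.transpose_apply, ← pow_two]
  exact Finset.single_le_sum (f := fun k => L i k ^ 2) (fun _ _ => sq_nonneg _) (Finset.mem_univ k)

lemma abs_entry_le_of_sq {L : Matrix ι κ ℝ} {C : ℝ} (h : ∀ i, (L * Lᵀ) i i ≤ C) (i : ι) (k : κ) :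
    |L i k| ≤ √C :=
  Real.abs_le_sqrt ((sq_entry_le L i k).trans (h i))

lemma UTG.of_coord {E : Type} [NormedAddCommGroup E] [NormedSpace ℝ E] {f : M → E → 𝔼}
    (h : ∀ i, UTG fun m x => f m x i) : UTG f := by
  have : f = fun m x => ∑ i, f m x i • EuclideanSpace.single i (1 : ℝ) := by
    funext m x
    ext k
    simp [Finset.sum_apply, Pi.single_apply]
  rw [this]
  exact UTG.sum _ fun i _ => (h i).smul (UTG.const' _)

lemma UTG.coord {E : Type} [NormedAddCommGroup E] [NormedSpace ℝ E] {f : M → E → 𝔼}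
    (h : UTG f) (i : ι) : UTG fun m x => f m x i :=
  h.left (EuclideanSpace.proj i : 𝔼 →L[ℝ] ℝ)

lemma UTG.mv {L : M → Matrix ι κ ℝ} {C : ℝ} (h : ∀ m i k, |L m i k| ≤ C) :
    UTG fun m z => mv (L m) z := UTG.clm fun m => norm_mv_le (h m)

lemma gmean_apply (A : Matrix ι ι ℝ) (b : ι → ℝ) (t : ℝ) (ξ : 𝔼) (i : ι) :
    gmean A b t ξ i = (fl A t *ᵥ ξ.ofLp) i + driftInt A b t i := congrFun (gmean_eq A b t ξ) i

lemma gmean_zero (A : Matrix ι ι ℝ) (b : ι → ℝ) (ξ : 𝔼) : gmean A b 0 ξ = ξ := by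
  ext i
  simp [gmean_apply, fl_zero, driftInt]

/-- The semigroup of the linear equation. -/
def sg (A a : Matrix ι ι ℝ) (b : ι → ℝ) (t : ℝ) : Op ι := fun ψ ξ =>
  ∫ z, ψ (gmean A b t ξ + mv (sqm (gcov A a t)) z) ∂gs ι

/-- Only the covariance of the Gaussian vector matters. The factor `L` may thus be rectangular and
adapted to a composition of steps. -/
lemma sg_eq {A a : Matrix ι ι ℝ} (b : ι → ℝ) (ha : a.PosSemidef) {t : ℝ} (ht : 0 ≤ t)
    {L : Matrix ι κ ℝ} (hL : L * Lᵀ = gcov A a t) {ψ : 𝔼 → ℝ} (hψ : Continuous ψ) (ξ : 𝔼) :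
    sg A a b t ψ ξ = ∫ z, ψ (gmean A b t ξ + mv L z) ∂gs κ :=
  integral_mv_congr (f := fun v => ψ (gmean A b t ξ + v))
    ((sqm_mul (gcov_posSemidef ha ht)).trans hL.symm) (by fun_prop)

lemma sg_zero {A a : Matrix ι ι ℝ} (b : ι → ℝ) (ha : a.PosSemidef) {ψ : 𝔼 → ℝ}
    (hψ : Continuous ψ) : sg A a b 0 ψ = ψ := by
  funext ξ
  rw [sg_eq (L := (0 : Matrix ι ι ℝ)) b ha le_rfl (by simp [gcov_zero]) hψ, gmean_zero]
  have : ∀ z, mv (0 : Matrix ι ι ℝ) z = 0 := fun z => by ext i; simp [mv_apply]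
  simp [this]

variable {x : EuclideanSpace ℝ ι} {ϖ : ι → ℕ} {A a : M → Matrix ι ι ℝ} {b : M → ι → ℝ} {B : ℝ}
  {t : M → ℝ}

/-- The entries of the square root are bounded through the diagonal of the covariance, so no
regularity of the chosen root in `m` or `t` is needed. -/
lemma Frozen.exists_bounds (F : Frozen ϖ A a b B) : ∃ C : ℝ, 0 ≤ C ∧ ∀ m, ∀ t ∈ Icc (0 : ℝ) 1,
    (∀ i k, |fl (A m) t i k| ≤ C) ∧ (∀ i, |driftInt (A m) (b m) t i| ≤ C) ∧
    (∀ i k, |gcov (A m) (a m) t i k| ≤ C) ∧ ∀ i k, |sqm (gcov (A m) (a m) t) i k| ≤ C := by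
  obtain ⟨K, hK0, hK⟩ := exists_small_time (ι := ι) B
  have e1 : ∀ m, ∀ t ∈ Icc (0 : ℝ) 1, ∀ i k, |gcov (A m) (a m) t i k| ≤ K + |B| := by
    intro m t ht i k
    have h1 := (hK (A m) (a m) (b m) (F.hA m) (F.ha m) (F.hb m) t ht i).2.1 k
    rw [Matrix.sub_apply, Matrix.smul_apply, smul_eq_mul] at h1
    have h2 : |t * a m i k| ≤ |B| := by
      rw [abs_mul, abs_of_nonneg ht.1]
      exact (mul_le_of_le_one_left (abs_nonneg _) ht.2).trans ((F.ha m i k).trans (le_abs_self B))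
    have h3 : K * t ^ 2 ≤ K := mul_le_of_le_one_right hK0 (pow_le_one₀ ht.1 ht.2)
    have := abs_add_le (gcov (A m) (a m) t i k - t * a m i k) (t * a m i k)
    rw [sub_add_cancel] at this
    linarith
  refine ⟨K + |B| + √(K + |B|), by positivity, fun m t ht => ?_⟩
  have hs := Real.sqrt_nonneg (K + |B|)
  have hB := abs_nonneg B
  refine ⟨fun i k => ?_, fun i => ?_, fun i k => (e1 m t ht i k).trans (by linarith),
    fun i k => ?_⟩
  · have := ((hK (A m) (a m) (b m) (F.hA m) (F.ha m) (F.hb m) t ht i).2.2.1 k).1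
    linarith
  · have h1 := (hK (A m) (a m) (b m) (F.hA m) (F.ha m) (F.hb m) t ht i).1
    rw [Pi.sub_apply, Pi.smul_apply, smul_eq_mul] at h1
    have h2 : |t * b m i| ≤ |B| := by
      rw [abs_mul, abs_of_nonneg ht.1]
      exact (mul_le_of_le_one_left (abs_nonneg _) ht.2).trans ((F.hb m i).trans (le_abs_self B))
    have h3 : K * t ^ 2 ≤ K := mul_le_of_le_one_right hK0 (pow_le_one₀ ht.1 ht.2)
    have := abs_add_le (driftInt (A m) (b m) t i - t * b m i) (t * b m i)
    rw [sub_add_cancel] at this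
    linarith
  · refine (abs_entry_le_of_sq (C := K + |B|) (fun i => ?_) i k).trans (by linarith)
    rw [sqm_mul (gcov_posSemidef (F.hpos m) ht.1)]
    exact (le_abs_self _).trans (e1 m t ht i i)

lemma UTG.gmean (F : Frozen ϖ A a b B) (ht : ∀ m, t m ∈ Icc (0 : ℝ) 1) :
    UTG fun m ξ => gmean (A m) (b m) (t m) ξ := by
  obtain ⟨C, -, hC⟩ := F.exists_bounds
  refine UTG.of_coord fun i => ?_
  simp only [gmean_apply]
  exact UTG.affine (fun m => (hC m _ (ht m)).1) (fun m => (hC m _ (ht m)).2.1) i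

lemma UTG.sg_integrand (F : Frozen ϖ A a b B) (ht : ∀ m, t m ∈ Icc (0 : ℝ) 1)
    {L : M → Matrix ι κ ℝ} {C : ℝ} (hL : ∀ m i k, |L m i k| ≤ C) {ψ : M → 𝔼 → ℝ} (hψ : UTG ψ) :
    UTG fun m (p : 𝔼 × (κ → ℝ)) => ψ m (LDL.gmean (A m) (b m) (t m) p.1 + LDL.mv (L m) p.2) :=
  hψ.comp (((UTG.gmean F ht).comp UTG.id.fst).add ((UTG.mv hL).comp UTG.id.snd))

lemma UTG.sg (F : Frozen ϖ A a b B) (ht : ∀ m, t m ∈ Icc (0 : ℝ) 1) {ψ : M → 𝔼 → ℝ}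
    (hψ : UTG ψ) : UTG fun m => sg (A m) (a m) (b m) (t m) (ψ m) := by
  obtain ⟨C, -, hC⟩ := F.exists_bounds
  exact (UTG.sg_integrand F ht (fun m => (hC m _ (ht m)).2.2.2) hψ).integral mom_gs

lemma sg_integrable (F : Frozen ϖ A a b B) (ht : ∀ m, t m ∈ Icc (0 : ℝ) 1) {ψ : M → 𝔼 → ℝ}
    (hψ : UTG ψ) (m : M) (ξ : 𝔼) :
    Integrable (fun z => ψ m (gmean (A m) (b m) (t m) ξ + mv (sqm (gcov (A m) (a m) (t m))) z))
      (gs ι) := by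
  obtain ⟨C, -, hC⟩ := F.exists_bounds
  have := UTG.sg_integrand F ht (fun m => (hC m _ (ht m)).2.2.2) hψ
  exact UB.integrable_slice mom_gs this.ub this.cont m ξ

lemma sg_add (F : Frozen ϖ A a b B) (ht : ∀ m, t m ∈ Icc (0 : ℝ) 1) {ψ χ : M → 𝔼 → ℝ}
    (hψ : UTG ψ) (hχ : UTG χ) (m : M) : sg (A m) (a m) (b m) (t m) (fun ξ => ψ m ξ + χ m ξ) =
      fun ξ => sg (A m) (a m) (b m) (t m) (ψ m) ξ + sg (A m) (a m) (b m) (t m) (χ m) ξ :=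
  funext fun ξ => integral_add (sg_integrable F ht hψ m ξ) (sg_integrable F ht hχ m ξ)

lemma sg_const_mul (A a : Matrix ι ι ℝ) (b : ι → ℝ) (t c : ℝ) (ψ : 𝔼 → ℝ) :
    sg A a b t (fun ξ => c * ψ ξ) = fun ξ => c * sg A a b t ψ ξ :=
  funext fun _ => integral_const_mul _ _

lemma mv_mul (N : Matrix ι ι ℝ) (L : Matrix ι κ ℝ) (z : κ → ℝ) :
    mv N (mv L z).ofLp = mv (N * L) z := by
  ext i
  change (N *ᵥ (L *ᵥ z)) i = ((N * L) *ᵥ z) i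
  rw [Matrix.mulVec_mulVec]

lemma mv_fromCols (L : Matrix ι κ ℝ) (L' : Matrix ι κ' ℝ) (z : κ → ℝ) (z' : κ' → ℝ) :
    mv (Matrix.fromCols L L') (Sum.elim z z') = mv L z + mv L' z' := by
  ext i
  simp [mv_apply]

lemma fromCols_mul_transpose (L : Matrix ι κ ℝ) (L' : Matrix ι κ' ℝ) :
    Matrix.fromCols L L' * (Matrix.fromCols L L')ᵀ = L * Lᵀ + L' * L'ᵀ := by
  rw [Matrix.transpose_fromCols, Matrix.fromCols_mul_fromRows]

/-- Two independent Gaussian steps have the joint factor `[e^{tA} C | C']`, and by `gcov_add` its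
product with its transpose is the covariance at time `u + t`. -/
lemma sg_sg (F : Frozen ϖ A a b B) {u t : ℝ} (hu : u ∈ Icc (0 : ℝ) 1) (ht : t ∈ Icc (0 : ℝ) 1)
    {ψ : M → 𝔼 → ℝ} (hψ : UTG ψ) (m : M) :
    sg (A m) (a m) (b m) u (sg (A m) (a m) (b m) t (ψ m)) = sg (A m) (a m) (b m) (u + t) (ψ m) := by
  funext ξ
  set C := sqm (gcov (A m) (a m) u)
  set C' := sqm (gcov (A m) (a m) t)
  have hC : C * Cᵀ = _ := sqm_mul (gcov_posSemidef (F.hpos m) hu.1)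
  have hC' : C' * C'ᵀ = _ := sqm_mul (gcov_posSemidef (F.hpos m) ht.1)
  have h1 : Matrix.fromCols (fl (A m) t * C) C' * (Matrix.fromCols (fl (A m) t * C) C')ᵀ =
      gcov (A m) (a m) (u + t) := by
    rw [fromCols_mul_transpose, hC', gcov_add, ← hC, Matrix.transpose_mul, add_comm]
    simp only [Matrix.mul_assoc]
  rw [sg_eq (b m) (F.hpos m) (add_nonneg hu.1 ht.1) h1 (hψ.cont m), integral_gs_sum]
  · refine integral_congr_ae (.of_forall fun z => ?_)
    refine integral_congr_ae (.of_forall fun z' => ?_)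
    simp only
    rw [gmean_add, gmean_gmean, mv_mul, mv_fromCols, add_assoc]
  · exact (UTG.comp (hψ.reindex fun _ : Unit => m) ((UTG.const' _).add (UTG.clm'
      (mv (Matrix.fromCols (fl (A m) t * C) C'))))).integrable mom_gs ()

lemma fderiv_eq_sum (ψ : 𝔼 → ℝ) (ξ v : 𝔼) : fderiv ℝ ψ ξ v = ∑ i, v i * pd i ψ ξ := by
  have : v = ∑ i, v i • EuclideanSpace.single i (1 : ℝ) := by
    ext k
    simp [Pi.single_apply]
  conv_lhs => rw [this]
  simp [pd]

/-- Here `f(s) = ∫₀ˢ r^n k(r) dr`. Rescaling the integral to the unit interval extracts `s^{n+1}`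
and leaves a quotient that is smooth up to `s = 0`, uniformly over the family. -/
lemma UTG.exists_pow_mul {E : Type} [NormedAddCommGroup E] [NormedSpace ℝ E] {n : ℕ}
    {f k : M → ℝ × E → ℝ} (hk : UTG k) (h0 : ∀ m x, f m (0, x) = 0)
    (hd : ∀ m s x, HasDerivAt (fun s => f m (s, x)) (s ^ n * k m (s, x)) s) :
    ∃ g : M → ℝ × E → ℝ, UTG g ∧ ∀ m s x, f m (s, x) = s ^ (n + 1) * g m (s, x) := by
  refine ⟨fun m p => ∫ r in Icc (0 : ℝ) 1, r ^ n * k m (r * p.1, p.2), ?_, fun m s x => ?_⟩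
  · have h1 : UTG fun (m : M) (q : (ℝ × E) × ℝ) => (q.2 * q.1.1, q.1.2) :=
      (UTG.id.snd.mul UTG.id.fst.fst).prodMk UTG.id.fst.snd
    have h2 : ∀ n : ℕ, UTG fun (_ : M) (q : (ℝ × E) × ℝ) => q.2 ^ n := fun n => by
      induction n with
      | zero => simpa using UTG.const' (1 : ℝ)
      | succ n ih => simpa only [pow_succ] using ih.mul UTG.id.snd
    exact ((h2 n).mul (hk.comp h1)).integral mom_unitInterval
  · have h1 : ∀ r ∈ uIcc (0 : ℝ) 1, HasDerivAt (fun r => f m (r * s, x))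
        ((r * s) ^ n * k m (r * s, x) * s) r := fun r _ => by
      have := (hd m (r * s) x).scomp r ((hasDerivAt_id r).mul_const s)
      simpa [Function.comp_def, mul_comm] using this
    have hc : Continuous fun r : ℝ => (r * s) ^ n * k m (r * s, x) * s := by
      have := hk.cont m
      fun_prop
    have h2 := intervalIntegral.integral_eq_sub_of_hasDerivAt h1 (hc.intervalIntegrable _ _)
    simp only [one_mul, zero_mul, h0, sub_zero] at h2
    rw [← h2, intervalIntegral.integral_of_le zero_le_one, ← integral_Icc_eq_integral_Ioc,
      ← integral_const_mul]
    refine integral_congr_ae (.of_forall fun r => ?_)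
    simp only
    ring

/-- Taylor's formula in `s` along the direction `v`, with a remainder that is tempered jointly in
all variables after division by `s³`. It is built from the top: the increment of the second
derivatives is divisible by `s`, and two integrations yield `s²` and `s³`. -/
lemma exists_taylor {ψ : M → 𝔼 → ℝ} (hψ : UTG ψ) : ∃ g : M → ℝ × (𝔼 × 𝔼) → ℝ, UTG g ∧
    ∀ m s ξ v, ψ m (ξ + s • v) = ψ m ξ + s * (∑ i, v i * pd i (ψ m) ξ) +
      s ^ 2 * (1 / 2 * ∑ i, ∑ k, v i * v k * pd i (pd k (ψ m)) ξ) + s ^ 3 * g m (s, (ξ, v)) := by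
  have hv : ∀ i, UTG fun (_ : M) (p : ℝ × (𝔼 × 𝔼)) => p.2.2 i := fun i => UTG.id.snd.snd.coord i
  have hξ : UTG fun (_ : M) (p : ℝ × (𝔼 × 𝔼)) => p.2.1 := UTG.id.snd.fst
  have hs : UTG fun (_ : M) (p : ℝ × (𝔼 × 𝔼)) => p.2.1 + p.1 • p.2.2 :=
    hξ.add (UTG.id.fst.smul UTG.id.snd.snd)
  have hd : ∀ {χ : M → 𝔼 → ℝ}, UTG χ → ∀ m s (x : 𝔼 × 𝔼),
      HasDerivAt (fun s : ℝ => χ m (x.1 + s • x.2)) (∑ i, x.2 i * pd i (χ m) (x.1 + s • x.2)) s := by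
    intro χ hχ m s x
    have h1 : HasDerivAt (fun s : ℝ => x.1 + s • x.2) x.2 s := by
      simpa using ((hasDerivAt_id s).smul_const x.2).const_add x.1
    have := (hχ.diff m (x.1 + s • x.2)).hasFDerivAt.comp_hasDerivAt s h1
    rwa [fderiv_eq_sum] at this
  let f2 : M → ℝ × (𝔼 × 𝔼) → ℝ := fun m p => ∑ i, ∑ k, p.2.2 i * p.2.2 k *
    (pd i (pd k (ψ m)) (p.2.1 + p.1 • p.2.2) - pd i (pd k (ψ m)) p.2.1)
  have hf2 : UTG f2 := UTG.sum _ fun i _ => UTG.sum _ fun k _ => ((hv i).mul (hv k)).mul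
    ((((hψ.pd k).pd i).comp hs).sub (((hψ.pd k).pd i).comp hξ))
  obtain ⟨g2, hg2, e2, -⟩ := hf2.exists_div fun m x => by simp [f2]
  let f1 : M → ℝ × (𝔼 × 𝔼) → ℝ := fun m p => ∑ k, p.2.2 k *
    (pd k (ψ m) (p.2.1 + p.1 • p.2.2) - pd k (ψ m) p.2.1 -
      p.1 * ∑ i, p.2.2 i * pd i (pd k (ψ m)) p.2.1)
  obtain ⟨g1, hg1, e1⟩ := UTG.exists_pow_mul (n := 1) (f := f1) hg2 (fun m x => by simp [f1])
    fun m s x => by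
      have h1 : HasDerivAt (fun s => f1 m (s, x)) (∑ k, x.2 k *
          ((∑ i, x.2 i * pd i (pd k (ψ m)) (x.1 + s • x.2)) -
            1 * ∑ i, x.2 i * pd i (pd k (ψ m)) x.1)) s := by
        refine HasDerivAt.fun_sum fun k _ => ?_
        exact (((hd (hψ.pd k) m s x).sub_const (pd k (ψ m) x.1)).fun_sub ((hasDerivAt_id' s).mul_const
          (∑ i, x.2 i * pd i (pd k (ψ m)) x.1))).const_mul (x.2 k)
      convert h1 using 1
      have := e2 m s x
      rw [smul_eq_mul] at this
      rw [pow_one, ← this]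
      simp only [f2, mul_sub, one_mul, Finset.mul_sum, Finset.sum_sub_distrib]
      rw [Finset.sum_comm]
      congr 1
      · exact Finset.sum_congr rfl fun i _ => Finset.sum_congr rfl fun k _ => by ring
      · rw [Finset.sum_comm]
        exact Finset.sum_congr rfl fun i _ => Finset.sum_congr rfl fun k _ => by ring
  let f0 : M → ℝ × (𝔼 × 𝔼) → ℝ := fun m p => ψ m (p.2.1 + p.1 • p.2.2) - ψ m p.2.1 -
    p.1 * (∑ i, p.2.2 i * pd i (ψ m) p.2.1) -
    p.1 ^ 2 * (1 / 2 * ∑ i, ∑ k, p.2.2 i * p.2.2 k * pd i (pd k (ψ m)) p.2.1)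
  obtain ⟨g, hg, e⟩ := UTG.exists_pow_mul (n := 2) (f := f0) hg1 (fun m x => by simp [f0])
    fun m s x => by
      have h1 : HasDerivAt (fun s => f0 m (s, x)) ((∑ i, x.2 i * pd i (ψ m) (x.1 + s • x.2)) -
          1 * (∑ i, x.2 i * pd i (ψ m) x.1) - (2 : ℕ) * s ^ (2 - 1) *
            (1 / 2 * ∑ i, ∑ k, x.2 i * x.2 k * pd i (pd k (ψ m)) x.1)) s :=
        (((hd hψ m s x).sub_const (ψ m x.1)).fun_sub ((hasDerivAt_id' s).mul_const
          (∑ i, x.2 i * pd i (ψ m) x.1))).fun_sub ((hasDerivAt_pow 2 s).mul_const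
            (1 / 2 * ∑ i, ∑ k, x.2 i * x.2 k * pd i (pd k (ψ m)) x.1))
      convert h1 using 1
      rw [← e1]
      simp only [f1, mul_sub, Finset.sum_sub_distrib, one_mul]
      congr 1
      rw [show (2 : ℕ) * s ^ (2 - 1) * (1 / 2 * ∑ i, ∑ k, x.2 i * x.2 k * pd i (pd k (ψ m)) x.1) =
        s * ∑ i, ∑ k, x.2 i * x.2 k * pd i (pd k (ψ m)) x.1 by push_cast; ring]
      simp only [Finset.mul_sum]
      rw [Finset.sum_comm]
      exact Finset.sum_congr rfl fun i _ => Finset.sum_congr rfl fun k _ => by ring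
  refine ⟨g, hg, fun m s ξ v => ?_⟩
  have := e m s (ξ, v)
  simp only [f0] at this
  linarith

/-- Small time expansion of the semigroup, uniformly over families. -/
lemma sg_expansion (F : Frozen ϖ A a b B) (ht : ∀ m, t m ∈ Ioc (0 : ℝ) 1) {ψ : M → 𝔼 → ℝ}
    (hψ : UTG ψ) : ∃ R : M → 𝔼 → ℝ, UTG R ∧ ∀ m, sg (A m) (a m) (b m) (t m) (ψ m) = fun ξ =>
      ψ m ξ + t m * genL (A m) (a m) (b m) (ψ m) ξ + t m * √(t m) * R m ξ := by
  have ht' : ∀ m, t m ∈ Icc (0 : ℝ) 1 := fun m => ⟨(ht m).1.le, (ht m).2⟩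
  obtain ⟨K, hK0, hK⟩ := exists_small_time (ι := ι) B
  have hK := fun m => hK (A m) (a m) (b m) (F.hA m) (F.ha m) (F.hb m) (t m) (ht' m)
  have hdiv : ∀ m (r C : ℝ) (n : ℕ), |r| ≤ C * t m ^ (n + 1) → |(t m)⁻¹ * r| ≤ C * t m ^ n := by
    intro m r C n h
    have h0 := (ht m).1
    rw [abs_mul, abs_inv, abs_of_pos h0, inv_mul_le_iff₀ h0]
    exact h.trans_eq (by ring)
  have hpow : ∀ m, K * t m ^ 1 ≤ K := fun m =>
    mul_le_of_le_one_right hK0 (pow_le_one₀ (ht m).1.le (ht m).2)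
  -- the error terms of mean and covariance
  have hA' : ∀ m i k, |((t m)⁻¹ • (fl (A m) (t m) - 1)) i k| ≤ K := fun m i k => by
    have := hdiv m _ K 0 (by simpa using ((hK m i).2.2.1 k).2.1)
    simpa using this
  have hb' : ∀ m i, |((t m)⁻¹ • driftInt (A m) (b m) (t m)) i| ≤ K + |B| := fun m i => by
    have h1 := hdiv m _ K 1 ((hK m i).1)
    have h2 : ((t m)⁻¹ • driftInt (A m) (b m) (t m)) i =
        (t m)⁻¹ * (driftInt (A m) (b m) (t m) - t m • b m) i + b m i := by
      have := (ht m).1.ne'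
      simp only [Pi.smul_apply, Pi.sub_apply, smul_eq_mul]
      field_simp
      ring
    rw [h2]
    exact (abs_add_le _ _).trans (add_le_add (h1.trans (hpow m))
      ((F.hb m i).trans (le_abs_self B)))
  -- The mean is `ξ + t μ(ξ)` with bounded affine `μ`, and the factor of the covariance is `√t C`
  -- with bounded `C`. The displacement is therefore `√t (√t μ + C z)`, and Taylor's formula of
  -- third order in `√t` applies to it.
  let μ : M → 𝔼 → 𝔼 := fun m ξ => WithLp.toLp 2 ((((t m)⁻¹ • (fl (A m) (t m) - 1)) *ᵥ ξ.ofLp) +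
    (t m)⁻¹ • driftInt (A m) (b m) (t m))
  have hμ : ∀ i, UTG fun m ξ => μ m ξ i := fun i =>
    UTG.affine (fun m i k => (hA' m i k).trans (by linarith [abs_nonneg B])) hb' i
  have hμ' : UTG μ := UTG.of_coord hμ
  let C : M → Matrix ι ι ℝ := fun m => (√(t m))⁻¹ • sqm (gcov (A m) (a m) (t m))
  have hsq : ∀ m, √(t m) ≠ 0 := fun m => (Real.sqrt_pos.2 (ht m).1).ne'
  have hCC : ∀ m, C m * (C m)ᵀ = (t m)⁻¹ • gcov (A m) (a m) (t m) := fun m => by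
    simp only [C, Matrix.transpose_smul, Matrix.smul_mul, Matrix.mul_smul, smul_smul]
    rw [sqm_mul (gcov_posSemidef (F.hpos m) (ht' m).1), ← mul_inv,
      Real.mul_self_sqrt (ht' m).1]
  have hg' : ∀ m i k, |(t m)⁻¹ * ((t m)⁻¹ * gcov (A m) (a m) (t m) i k - a m i k)| ≤ K := by
    intro m i k
    have h1 := hdiv m _ K 0 (hdiv m _ K 1 ((hK m i).2.1 k))
    have h2 : (t m)⁻¹ * ((t m)⁻¹ * gcov (A m) (a m) (t m) i k - a m i k) =
        (t m)⁻¹ * ((t m)⁻¹ * (gcov (A m) (a m) (t m) - t m • a m) i k) := by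
      have := (ht m).1.ne'
      simp only [Matrix.sub_apply, Matrix.smul_apply, smul_eq_mul]
      field_simp
    rw [h2]
    simpa using h1
  have hC : ∀ m i k, |C m i k| ≤ √(K + |B|) := fun m => abs_entry_le_of_sq fun i => by
    have h1 := hdiv m _ K 1 ((hK m i).2.1 i)
    have h2 : (C m * (C m)ᵀ) i i =
        (t m)⁻¹ * (gcov (A m) (a m) (t m) - t m • a m) i i + a m i i := by
      have := (ht m).1.ne'
      rw [hCC]
      simp only [Matrix.sub_apply, Matrix.smul_apply, smul_eq_mul]
      field_simp
      ring
    rw [h2]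
    exact add_le_add ((le_abs_self _).trans (h1.trans (hpow m)))
      ((le_abs_self _).trans ((F.ha m i i).trans (le_abs_self B)))
  obtain ⟨g, hg, e⟩ := exists_taylor hψ
  -- the remainder before integration
  have hsb : ∀ m, |√(t m)| ≤ 1 := fun m => by
    rw [abs_of_nonneg (Real.sqrt_nonneg _)]; exact Real.sqrt_le_one.2 (ht m).2
  have hw : UTG fun m (p : 𝔼 × (ι → ℝ)) => mv (C m) p.2 := (UTG.mv hC).comp UTG.id.snd
  have hμ1 : UTG fun m (p : 𝔼 × (ι → ℝ)) => μ m p.1 := hμ'.comp UTG.id.fst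
  have hst : UTG fun m (_ : 𝔼 × (ι → ℝ)) => √(t m) := UTG.const hsb
  have hp : ∀ {χ : M → 𝔼 → ℝ}, UTG χ → UTG fun m (p : 𝔼 × (ι → ℝ)) => χ m p.1 :=
    fun h => h.comp UTG.id.fst
  let r : M → 𝔼 × (ι → ℝ) → ℝ := fun m p =>
    1 / 2 * (∑ i, ∑ k, (μ m p.1 i * mv (C m) p.2 k + mv (C m) p.2 i * μ m p.1 k +
      √(t m) * (μ m p.1 i * μ m p.1 k)) * pd i (pd k (ψ m)) p.1) +
    g m (√(t m), (p.1, √(t m) • μ m p.1 + mv (C m) p.2))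
  have hr : UTG r := by
    refine ((UTG.const' (1 / 2 : ℝ)).mul (UTG.sum _ fun i _ => UTG.sum _ fun k _ => ?_)).add ?_
    · exact ((((hμ1.coord i).mul (hw.coord k)).add ((hw.coord i).mul (hμ1.coord k))).add
        (hst.mul ((hμ1.coord i).mul (hμ1.coord k)))).mul (hp ((hψ.pd k).pd i))
    · exact hg.comp (hst.prodMk (UTG.id.fst.prodMk ((hst.smul hμ1).add hw)))
  have hmain : ∀ m ξ z, ψ m (gmean (A m) (b m) (t m) ξ + mv (sqm (gcov (A m) (a m) (t m))) z) =
      ψ m ξ + √(t m) * (∑ i, mv (C m) z i * pd i (ψ m) ξ) +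
      t m * ((∑ i, μ m ξ i * pd i (ψ m) ξ) +
        1 / 2 * ∑ i, ∑ k, mv (C m) z i * mv (C m) z k * pd i (pd k (ψ m)) ξ) +
      t m * √(t m) * r m (ξ, z) := by
    intro m ξ z
    have h2 := Real.mul_self_sqrt (ht' m).1
    have h1 : gmean (A m) (b m) (t m) ξ + mv (sqm (gcov (A m) (a m) (t m))) z =
        ξ + √(t m) • (√(t m) • μ m ξ + mv (C m) z) := by
      ext i
      have h3 := (ht m).1.ne'
      have h4 := hsq m
      have h5 : mv (C m) z i = (√(t m))⁻¹ * mv (sqm (gcov (A m) (a m) (t m))) z i := by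
        simp only [mv_apply, C, Matrix.smul_apply, smul_eq_mul, Finset.mul_sum, mul_assoc]
      have h6 : μ m ξ i = (t m)⁻¹ * ((fl (A m) (t m) *ᵥ ξ.ofLp) i - ξ i +
          driftInt (A m) (b m) (t m) i) := by
        simp only [μ, Matrix.smul_mulVec, Matrix.sub_mulVec, Matrix.one_mulVec, Pi.add_apply,
          Pi.smul_apply, Pi.sub_apply, smul_eq_mul]
        ring
      simp only [PiLp.add_apply, PiLp.smul_apply, smul_eq_mul, h5, h6, gmean_apply]
      rw [mul_add, ← mul_assoc, h2, ← mul_assoc, mul_inv_cancel₀ h3, ← mul_assoc,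
        mul_inv_cancel₀ h4]
      ring
    rw [h1, e]
    have e1 : ∑ i, (√(t m) • μ m ξ + mv (C m) z) i * pd i (ψ m) ξ =
        √(t m) * (∑ i, μ m ξ i * pd i (ψ m) ξ) + ∑ i, mv (C m) z i * pd i (ψ m) ξ := by
      rw [Finset.mul_sum, ← Finset.sum_add_distrib]
      refine Finset.sum_congr rfl fun i _ => ?_
      simp only [PiLp.add_apply, PiLp.smul_apply, smul_eq_mul]
      ring
    have e2 : ∑ i, ∑ k, (√(t m) • μ m ξ + mv (C m) z) i * (√(t m) • μ m ξ + mv (C m) z) k *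
        pd i (pd k (ψ m)) ξ = (∑ i, ∑ k, mv (C m) z i * mv (C m) z k * pd i (pd k (ψ m)) ξ) +
        √(t m) * ∑ i, ∑ k, (μ m ξ i * mv (C m) z k + mv (C m) z i * μ m ξ k +
          √(t m) * (μ m ξ i * μ m ξ k)) * pd i (pd k (ψ m)) ξ := by
      simp only [Finset.mul_sum, ← Finset.sum_add_distrib]
      refine Finset.sum_congr rfl fun i _ => Finset.sum_congr rfl fun k _ => ?_
      simp only [PiLp.add_apply, PiLp.smul_apply, smul_eq_mul]
      ring
    rw [e1, e2]
    simp only [r]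
    have h7 : √(t m) ^ 2 = t m := by rw [pow_two, h2]
    have h8 : √(t m) ^ 3 = t m * √(t m) := by rw [pow_succ, h7]
    rw [h7, h8, mul_add (√(t m)), ← mul_assoc (√(t m)) (√(t m)), h2]
    ring
  -- The remainder has two sources. The errors in mean and covariance are `O(t²)`, that is `t √t`
  -- times `√t`; the rest consists of the Taylor terms of order three and more in `√t`.
  refine ⟨fun m ξ => √(t m) * ((∑ i, ((((t m)⁻¹ • ((t m)⁻¹ • (fl (A m) (t m) - 1 - t m • A m))) *ᵥ
      ξ.ofLp) i + ((t m)⁻¹ • ((t m)⁻¹ • (driftInt (A m) (b m) (t m) - t m • b m))) i) *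
      pd i (ψ m) ξ) + 1 / 2 * ∑ i, ∑ k, ((t m)⁻¹ * ((t m)⁻¹ * gcov (A m) (a m) (t m) i k -
        a m i k)) * pd i (pd k (ψ m)) ξ) + ∫ z, r m (ξ, z) ∂gs ι, ?_, fun m => ?_⟩
  · refine ((UTG.const hsb).mul ((UTG.sum _ fun i _ => (UTG.affine (B := K) ?_ ?_ i).mul
      (hψ.pd i)).add ((UTG.const' (1 / 2 : ℝ)).mul (UTG.sum _ fun i _ => UTG.sum _ fun k _ =>
      (UTG.const fun m => hg' m i k).mul ((hψ.pd k).pd i))))).add (hr.integral mom_gs)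
    · intro m i k
      have := hdiv m _ K 0 (hdiv m _ K 1 ((hK m i).2.2.1 k).2.2)
      simpa using this
    · intro m i
      have := hdiv m _ K 0 (hdiv m _ K 1 (hK m i).1)
      simpa using this
  · funext ξ
    have hz : ∀ i, Integrable (fun z => mv (C m) z i) (gs ι) := fun i =>
      (((UTG.mv hC).coord i).integrable mom_gs m)
    have hzz : ∀ i k, Integrable (fun z => mv (C m) z i * mv (C m) z k) (gs ι) := fun i k =>
      ((((UTG.mv hC).coord i).mul ((UTG.mv hC).coord k)).integrable mom_gs m)
    have hri : Integrable (fun z => r m (ξ, z)) (gs ι) :=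
      UB.integrable_slice mom_gs hr.ub hr.cont m ξ
    have hc1 : ∀ j : ι, Integrable (fun z : ι → ℝ => z j) (gs ι) := fun j =>
      (UTG.clm' (ContinuousLinearMap.proj (R := ℝ) (φ := fun _ : ι => ℝ) j)).integrable mom_gs ()
    have hc2 : ∀ j l : ι, Integrable (fun z : ι → ℝ => z j * z l) (gs ι) := fun j l =>
      ((UTG.clm' (ContinuousLinearMap.proj (R := ℝ) (φ := fun _ : ι => ℝ) j)).mul
        (UTG.clm' (ContinuousLinearMap.proj (R := ℝ) (φ := fun _ : ι => ℝ) l))).integrable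
          mom_gs ()
    -- The first moments vanish, so there is no term of order `√t`. The second moments of `C z` are
    -- the covariance divided by `t`, which is `a` up to `O(t)`.
    have hm1 : ∀ i, ∫ z, mv (C m) z i ∂gs ι = 0 := fun i => by
      simp only [mv_apply]
      rw [integral_finsetSum _ fun j _ => (hc1 j).const_mul _]
      simp [integral_const_mul, integral_coord_gs]
    have hm2 : ∀ i k, ∫ z, mv (C m) z i * mv (C m) z k ∂gs ι = (C m * (C m)ᵀ) i k := fun i k => by
      have h1 : ∀ z, mv (C m) z i * mv (C m) z k = ∑ j, ∑ l, C m i j * C m k l * (z j * z l) := by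
        intro z
        rw [mv_apply, mv_apply, Finset.sum_mul_sum]
        exact Finset.sum_congr rfl fun j _ => Finset.sum_congr rfl fun l _ => by ring
      simp only [h1]
      rw [integral_finsetSum _ fun j _ => integrable_finsetSum _ fun l _ => (hc2 j l).const_mul _]
      rw [Matrix.mul_apply]
      refine Finset.sum_congr rfl fun j _ => ?_
      rw [integral_finsetSum _ fun l _ => (hc2 j l).const_mul _]
      simp [integral_const_mul, integral_coord_mul_coord_gs]
    have i1 : Integrable (fun z => ∑ i, mv (C m) z i * pd i (ψ m) ξ) (gs ι) :=
      integrable_finsetSum _ fun i _ => (hz i).mul_const _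
    have i2 : Integrable (fun z => ∑ i, ∑ k, mv (C m) z i * mv (C m) z k * pd i (pd k (ψ m)) ξ)
      (gs ι) := integrable_finsetSum _ fun i _ => integrable_finsetSum _ fun k _ =>
        (hzz i k).mul_const _
    have j1 : ∫ z, ∑ i, mv (C m) z i * pd i (ψ m) ξ ∂gs ι = 0 := by
      rw [integral_finsetSum _ fun i _ => (hz i).mul_const _]
      simp only [integral_mul_const, hm1, zero_mul, Finset.sum_const_zero]
    have j2 : ∫ z, ∑ i, ∑ k, mv (C m) z i * mv (C m) z k * pd i (pd k (ψ m)) ξ ∂gs ι =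
        ∑ i, ∑ k, (t m)⁻¹ * gcov (A m) (a m) (t m) i k * pd i (pd k (ψ m)) ξ := by
      rw [integral_finsetSum _ fun i _ => integrable_finsetSum _ fun k _ => (hzz i k).mul_const _]
      refine Finset.sum_congr rfl fun i _ => ?_
      rw [integral_finsetSum _ fun k _ => (hzz i k).mul_const _]
      refine Finset.sum_congr rfl fun k _ => ?_
      rw [integral_mul_const, hm2, hCC]
      rfl
    rw [sg]
    simp only [hmain]
    have i3 : Integrable (fun z => √(t m) * ∑ i, mv (C m) z i * pd i (ψ m) ξ) (gs ι) :=
      i1.const_mul _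
    have i4 : Integrable (fun z => ψ m ξ + √(t m) * ∑ i, mv (C m) z i * pd i (ψ m) ξ) (gs ι) :=
      (integrable_const _).add i3
    have i5 : Integrable (fun z => 1 / 2 * ∑ i, ∑ k, mv (C m) z i * mv (C m) z k *
        pd i (pd k (ψ m)) ξ) (gs ι) := i2.const_mul _
    have i6 : Integrable (fun z => t m * ((∑ i, μ m ξ i * pd i (ψ m) ξ) +
        1 / 2 * ∑ i, ∑ k, mv (C m) z i * mv (C m) z k * pd i (pd k (ψ m)) ξ)) (gs ι) :=
      ((integrable_const _).add i5).const_mul _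
    have i7 : Integrable (fun z => ψ m ξ + √(t m) * (∑ i, mv (C m) z i * pd i (ψ m) ξ) +
        t m * ((∑ i, μ m ξ i * pd i (ψ m) ξ) +
        1 / 2 * ∑ i, ∑ k, mv (C m) z i * mv (C m) z k * pd i (pd k (ψ m)) ξ)) (gs ι) := i4.add i6
    rw [integral_add i7 (hri.const_mul _), integral_add i4 i6, integral_add (integrable_const _) i3,
      integral_const_mul, integral_const_mul, integral_const_mul,
      integral_add (integrable_const _) i5, integral_const_mul, j1, j2]
    simp only [integral_const, probReal_univ, one_smul, mul_zero, add_zero, genL]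
    have h3 := (ht m).1.ne'
    have k1 : ∑ i, μ m ξ i * pd i (ψ m) ξ = (∑ i, ((A m *ᵥ ξ.ofLp) i + b m i) * pd i (ψ m) ξ) +
        t m * ∑ i, ((((t m)⁻¹ • ((t m)⁻¹ • (fl (A m) (t m) - 1 - t m • A m))) *ᵥ
          ξ.ofLp) i + ((t m)⁻¹ • ((t m)⁻¹ • (driftInt (A m) (b m) (t m) - t m • b m))) i) *
          pd i (ψ m) ξ := by
      rw [Finset.mul_sum, ← Finset.sum_add_distrib]
      refine Finset.sum_congr rfl fun i _ => ?_
      simp only [μ, Matrix.smul_mulVec, Matrix.sub_mulVec, Matrix.one_mulVec, Pi.add_apply,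
          Pi.smul_apply, Pi.sub_apply, smul_eq_mul]
      field_simp
      ring
    have k2 : ∑ i, ∑ k, (t m)⁻¹ * gcov (A m) (a m) (t m) i k * pd i (pd k (ψ m)) ξ =
        (∑ i, ∑ k, a m i k * pd i (pd k (ψ m)) ξ) + t m * ∑ i, ∑ k, ((t m)⁻¹ * ((t m)⁻¹ *
          gcov (A m) (a m) (t m) i k - a m i k)) * pd i (pd k (ψ m)) ξ := by
      simp only [Finset.mul_sum, ← Finset.sum_add_distrib]
      refine Finset.sum_congr rfl fun i _ => Finset.sum_congr rfl fun k _ => ?_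
      field_simp
      ring
    rw [k1, k2]
    have h2 := Real.mul_self_sqrt (ht' m).1
    set q := √(t m)
    generalize (∑ i, ((A m *ᵥ ξ.ofLp) i + b m i) * pd i (ψ m) ξ) = X1
    generalize (∑ i, ((((t m)⁻¹ • ((t m)⁻¹ • (fl (A m) (t m) - 1 - t m • A m))) *ᵥ
          ξ.ofLp) i + ((t m)⁻¹ • ((t m)⁻¹ • (driftInt (A m) (b m) (t m) - t m • b m))) i) *
          pd i (ψ m) ξ) = X2
    generalize (∑ i, ∑ k, a m i k * pd i (pd k (ψ m)) ξ) = X3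
    generalize (∑ i, ∑ k, ((t m)⁻¹ * ((t m)⁻¹ *
          gcov (A m) (a m) (t m) i k - a m i k)) * pd i (pd k (ψ m)) ξ) = X4
    linear_combination (-(t m * X2) - t m * (1 / 2 * X4)) * h2

end Semigroup


/-! ### Taylor expansion of an operator conjugated by the semigroup. -/

section Taylor

open Filter Topology

/-- An error of order `3/2` in the increment is negligible against the increment. The small time
expansion of the semigroup provides precisely this order. -/
lemma hasDerivWithinAt_of_sqrt {F G : ℝ → ℝ} {s : Set ℝ} {C : ℝ}
    (h : ∀ u ∈ s, ∀ v ∈ s, |F v - F u - (v - u) * G u| ≤ C * (|v - u| * √|v - u|)) {u : ℝ}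
    (hu : u ∈ s) : HasDerivWithinAt F (G u) s u := by
  rw [hasDerivWithinAt_iff_isLittleO, Asymptotics.isLittleO_iff]
  intro c hc
  have h1 : Tendsto (fun v => C * √|v - u|) (𝓝[s] u) (𝓝 0) := by
    have : Continuous fun v => C * √|v - u| := by fun_prop
    have h2 := (this.tendsto u).mono_left (nhdsWithin_le_nhds (s := s))
    simpa using h2
  filter_upwards [h1.eventually (gt_mem_nhds hc), self_mem_nhdsWithin] with v hv hvs
  rw [Real.norm_eq_abs, Real.norm_eq_abs, smul_eq_mul]
  refine (h u hu v hvs).trans ?_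
  nlinarith [abs_nonneg (v - u)]

/-- The sequence `F k` plays the role of the successive derivatives. The remainder is bounded by
induction with the mean value inequality on the interval; the factor `1 / (n + 1)!` is not needed.
-/
lemma taylor_bound {n : ℕ} {F : ℕ → ℝ → ℝ} {β K : ℝ}
    (hd : ∀ k, ∀ u ∈ Icc (0 : ℝ) β, HasDerivWithinAt (F k) (F (k + 1) u) (Icc 0 β) u)
    (hK : ∀ u ∈ Icc (0 : ℝ) β, |F (n + 1) u| ≤ K) {s : ℝ} (hs : s ∈ Icc (0 : ℝ) β) :
    |F 0 s - ∑ k ∈ Finset.range (n + 1), s ^ k / k.factorial * F k 0| ≤ K * s ^ (n + 1) := by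
  have hK0 : 0 ≤ K := (abs_nonneg _).trans (hK s hs)
  have step : ∀ (F G : ℝ → ℝ) (L : ℝ), (∀ u ∈ Icc (0 : ℝ) s, HasDerivWithinAt F (G u) (Icc 0 s) u) →
      F 0 = 0 → (∀ u ∈ Icc (0 : ℝ) s, |G u| ≤ L) → |F s| ≤ L * s := by
    intro F G L h1 h2 h3
    have := (convex_Icc (0 : ℝ) s).norm_image_sub_le_of_norm_hasDerivWithin_le h1 h3
      ⟨le_rfl, hs.1⟩ ⟨hs.1, le_rfl⟩
    simpa [h2, abs_of_nonneg hs.1] using this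
  induction n generalizing F s with
  | zero =>
    have := step (fun u => F 0 u - F 0 0) (F 1) K (fun u hu => ((hd 0 u
      ⟨hu.1, hu.2.trans hs.2⟩).mono (Icc_subset_Icc_right hs.2)).sub_const _) (by simp)
      fun u hu => hK u ⟨hu.1, hu.2.trans hs.2⟩
    simpa using this
  | succ n ih =>
    have hder : ∀ u ∈ Icc (0 : ℝ) s, HasDerivWithinAt
        (fun s => F 0 s - ∑ k ∈ Finset.range (n + 2), s ^ k / k.factorial * F k 0)
        (F 1 u - ∑ k ∈ Finset.range (n + 1), u ^ k / k.factorial * F (k + 1) 0) (Icc 0 s) u := by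
      intro u hu
      refine ((hd 0 u ⟨hu.1, hu.2.trans hs.2⟩).mono (Icc_subset_Icc_right hs.2)).fun_sub ?_
      have h1 : HasDerivWithinAt
          (fun s => ∑ k ∈ Finset.range (n + 2), s ^ k / k.factorial * F k 0)
          (∑ k ∈ Finset.range (n + 2), (k : ℕ) * u ^ (k - 1) / k.factorial * F k 0) (Icc 0 s) u :=
        (HasDerivAt.fun_sum fun k _ => ((hasDerivAt_pow k u).div_const _).mul_const _).hasDerivWithinAt
      refine h1.congr_deriv ?_
      rw [Finset.sum_range_succ' _ (n + 1)]
      simp only [Nat.cast_zero, zero_mul, zero_div, add_zero]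
      refine Finset.sum_congr rfl fun k _ => ?_
      rw [Nat.factorial_succ, Nat.add_sub_cancel]
      push_cast
      have : (k.factorial : ℝ) ≠ 0 := by positivity
      have : (k : ℝ) + 1 ≠ 0 := by positivity
      field_simp
    have := step _ _ (K * s ^ (n + 1)) hder ?_ ?_
    · exact this.trans_eq (by ring)
    · rw [Finset.sum_range_succ']
      simp
    · intro u hu
      have hu' : u ∈ Icc (0 : ℝ) β := ⟨hu.1, hu.2.trans hs.2⟩
      have h1 := ih (F := fun k => F (k + 1)) (fun k => hd (k + 1)) hK hu' (by
        intro F G L h1 h2 h3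
        have := (convex_Icc (0 : ℝ) u).norm_image_sub_le_of_norm_hasDerivWithin_le h1 h3
          ⟨le_rfl, hu.1⟩ ⟨hu.1, le_rfl⟩
        simpa [h2, abs_of_nonneg hu.1] using this)
      refine h1.trans ?_
      have := hu.1
      have := hu.2
      gcongr

variable {ι : Type} [Fintype ι] [DecidableEq ι] {M N : Type}

local notation "𝔼" => EuclideanSpace ℝ ι

/-- Smooth functions of at most polynomial growth together with all derivatives. -/
def TG (ψ : EuclideanSpace ℝ ι → ℝ) : Prop := UTG fun _ : Unit => ψ

lemma UTG.tg {f : M → 𝔼 → ℝ} (h : UTG f) (m : M) : TG (f m) := h.reindex fun _ => m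

lemma TG.utg {ψ : 𝔼 → ℝ} (h : TG ψ) : UTG fun _ : M => ψ := UTG.reindex (fun _ => ()) h

/-- Families of linear operators that preserve families of functions of polynomial growth. -/
structure Nice (Q : M → Op ι) : Prop where
  utg : ∀ {N : Type} (φ : N → M) {ψ : N → 𝔼 → ℝ}, UTG ψ → UTG fun n => Q (φ n) (ψ n)
  add : ∀ m {ψ χ : 𝔼 → ℝ}, TG ψ → TG χ → Q m (fun ξ => ψ ξ + χ ξ) = fun ξ => Q m ψ ξ + Q m χ ξ
  const_mul : ∀ m (c : ℝ) {ψ : 𝔼 → ℝ}, TG ψ → Q m (fun ξ => c * ψ ξ) = fun ξ => c * Q m ψ ξ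

variable {x : EuclideanSpace ℝ ι} {ϖ : ι → ℕ} {A a : M → Matrix ι ι ℝ} {b : M → ι → ℝ} {B : ℝ}
  {t : M → ℝ} {Q Q' : M → Op ι} {k : ℕ}

lemma Nice.tg (h : Nice Q) (m : M) {ψ : 𝔼 → ℝ} (hψ : TG ψ) : TG (Q m ψ) := h.utg (fun _ => m) hψ

lemma Nice.reindex (h : Nice Q) (φ : N → M) : Nice fun n => Q (φ n) :=
  ⟨fun φ' _ hψ => h.utg (fun n => φ (φ' n)) hψ, fun _ => h.add _, fun _ => h.const_mul _⟩

lemma Nice.id : Nice fun (_ : M) (ψ : 𝔼 → ℝ) => ψ :=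
  ⟨fun _ _ h => h, fun _ _ _ _ _ => rfl, fun _ _ _ _ => rfl⟩

lemma Nice.comp (h : Nice Q) (h' : Nice Q') : Nice fun m ψ => Q m (Q' m ψ) :=
  ⟨fun φ _ hψ => h.utg φ (h'.utg φ hψ),
    fun m _ _ hψ hχ => by simp only [h'.add m hψ hχ, h.add m (h'.tg m hψ) (h'.tg m hχ)],
    fun m c _ hψ => by simp only [h'.const_mul m c hψ, h.const_mul m c (h'.tg m hψ)]⟩

lemma DO.nice (h : DO x ϖ k Q) : Nice Q :=
  ⟨fun φ _ hψ => h.utg φ hψ, fun m _ _ hψ hχ => h.map_add m (hψ.contDiff ()) (hχ.contDiff ()),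
    fun m c _ hψ => h.map_const_mul m c (hψ.contDiff ())⟩

lemma Frozen.nice_genL (F : Frozen ϖ A a b B) : Nice fun m => genL (A m) (a m) (b m) where
  utg φ _ hψ := UTG.genL (F.reindex φ) hψ
  add m _ _ hψ hχ := genL_add _ _ _ (hψ.contDiff ()) (hχ.contDiff ())
  const_mul m c ψ hψ := by
    funext ξ
    simp only [genL, pd_const_mul c (hψ.contDiff ()),
      pd_const_mul c (pd_smooth (hψ.contDiff ()) _), mul_add, Finset.mul_sum]
    congr 1
    · exact Finset.sum_congr rfl fun i _ => by ring
    · exact Finset.sum_congr rfl fun i _ => Finset.sum_congr rfl fun k _ => by ring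

lemma Frozen.nice_sg (F : Frozen ϖ A a b B) (ht : ∀ m, t m ∈ Icc (0 : ℝ) 1) :
    Nice fun m => sg (A m) (a m) (b m) (t m) where
  utg φ _ hψ := UTG.sg (F.reindex φ) (fun n => ht (φ n)) hψ
  add m _ _ hψ hχ := sg_add (F.reindex fun _ : Unit => m) (t := fun _ => t m) (fun _ => ht m) hψ hχ ()
  const_mul _ _ _ _ := sg_const_mul _ _ _ _ _ _

lemma Nice.ad (h : Nice Q) (h' : Nice Q') : Nice fun m => ad (Q m) (Q' m) where
  utg φ _ hψ := (h.utg φ (h'.utg φ hψ)).sub (h'.utg φ (h.utg φ hψ))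
  add m _ _ hψ hχ := by
    have h1 := (h.comp h').add m hψ hχ
    have h2 := (h'.comp h).add m hψ hχ
    funext ξ
    simp only [LDL.ad, Pi.sub_apply, h1, h2]
    ring
  const_mul m c ψ hψ := by
    have h1 := (h.comp h').const_mul m c hψ
    have h2 := (h'.comp h).const_mul m c hψ
    funext ξ
    simp only [LDL.ad, Pi.sub_apply, h1, h2]
    ring

lemma Nice.adIter (h : Nice Q) (h' : Nice Q') (k : ℕ) : Nice fun m => adIter (Q m) k (Q' m) := by
  induction k with
  | zero => exact h'
  | succ k ih => exact h.ad ih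

lemma Nice.exists_bound (h : Nice Q) (x : 𝔼) {ψ : M → 𝔼 → ℝ} (hψ : UTG ψ) :
    ∃ C : ℝ, 0 ≤ C ∧ ∀ m, |Q m (ψ m) x| ≤ C := by
  obtain ⟨C, k, hC, h⟩ := (h.utg _root_.id hψ).ub
  exact ⟨C * (1 + ‖x‖) ^ k, by positivity, fun m => h m x⟩

lemma abs_expansion_le {h p q r s c1 c2 c3 c4 : ℝ} (h0 : 0 ≤ h) (h1 : h ≤ 1) (hp : |p| ≤ c1)
    (hq : |q| ≤ c2) (hr : |r| ≤ c3) (hs : |s| ≤ c4) :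
    |h * √h * p - h * √h * q - h * (h * r + h * √h * s)| ≤ (c1 + c2 + c3 + c4) * (h * √h) := by
  have hss := Real.mul_self_sqrt h0
  have e : h * √h * p - h * √h * q - h * (h * r + h * √h * s) =
      (p - q - √h * r - h * s) * (h * √h) := by
    linear_combination h * r * hss
  have q1 : |√h * r| ≤ c3 := by
    rw [abs_mul, abs_of_nonneg (Real.sqrt_nonneg _)]
    exact (mul_le_of_le_one_left (abs_nonneg _) (Real.sqrt_le_one.2 h1)).trans hr
  have q2 : |h * s| ≤ c4 := by
    rw [abs_mul, abs_of_nonneg h0]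
    exact (mul_le_of_le_one_left (abs_nonneg _) h1).trans hs
  rw [e, abs_mul, abs_of_nonneg (mul_nonneg h0 (Real.sqrt_nonneg h))]
  gcongr
  rw [abs_le] at *
  constructor <;> linarith

-- For `u < v` put `h = v - u` and `χ = P_{β-v} Ψ`. The values at `v` and `u` are then `Q' P_u P_h Q
-- χ` and `Q' P_u Q P_h χ`, and the expansion of `P_h` leaves `h Q' P_u [G, Q] χ` up to
-- `O(h^{3/2})`. Passing from `χ` to the asserted derivative at either end is an error of higher
-- order, by the same expansion.
set_option maxHeartbeats 600000 in
lemma hasDerivWithinAt_conj (F : Frozen ϖ A a b B) (hQ : Nice Q) (hQ' : Nice Q') {Ψ : 𝔼 → ℝ}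
    (hΨ : TG Ψ) (x : 𝔼) (m : M) {β : ℝ} (hβ : β ≤ 1) {u : ℝ} (hu : u ∈ Icc (0 : ℝ) β) :
    HasDerivWithinAt
      (fun u => Q' m (sg (A m) (a m) (b m) u (Q m (sg (A m) (a m) (b m) (β - u) Ψ))) x)
      (Q' m (sg (A m) (a m) (b m) u (ad (genL (A m) (a m) (b m)) (Q m)
        (sg (A m) (a m) (b m) (β - u) Ψ))) x) (Icc 0 β) u := by
  -- The pairs `(u, v)` become the index of the families, so that the constants do not depend on
  -- them.
  let N := {p : ℝ × ℝ // 0 ≤ p.1 ∧ p.1 < p.2 ∧ p.2 ≤ β}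
  let P : ℝ → Op ι := sg (A m) (a m) (b m)
  let L : Op ι := genL (A m) (a m) (b m)
  have FN := F.reindex fun _ : N => m
  have hsg : ∀ {u v : ℝ}, u ∈ Icc (0 : ℝ) 1 → v ∈ Icc (0 : ℝ) 1 → ∀ {ψ}, TG ψ →
      P u (P v ψ) = P (u + v) ψ := fun hu hv _ hψ =>
    sg_sg (F.reindex fun _ : Unit => m) hu hv hψ ()
  have tu : ∀ n : N, n.1.1 ∈ Icc (0 : ℝ) 1 := fun n =>
    ⟨n.2.1, by linarith [n.2.2.1, n.2.2.2]⟩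
  have tv : ∀ n : N, β - n.1.2 ∈ Icc (0 : ℝ) 1 := fun n =>
    ⟨by linarith [n.2.2.2], by linarith [n.2.1, n.2.2.1]⟩
  have th : ∀ n : N, n.1.2 - n.1.1 ∈ Ioc (0 : ℝ) 1 := fun n =>
    ⟨by linarith [n.2.2.1], by linarith [n.2.1, n.2.2.2]⟩
  have th' : ∀ n : N, n.1.2 - n.1.1 ∈ Icc (0 : ℝ) 1 := fun n => ⟨(th n).1.le, (th n).2⟩
  let χ : N → 𝔼 → ℝ := fun n => P (β - n.1.2) Ψ
  have hχ : UTG χ := UTG.sg FN tv hΨ.utg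
  have nL : Nice fun _ : M => L := (F.reindex fun _ => m).nice_genL
  have nL : Nice fun _ : N => L := FN.nice_genL
  have nQ : Nice fun _ : N => Q m := hQ.reindex fun _ => m
  have nad : Nice fun _ : N => ad L (Q m) := nL.ad nQ
  have nJ : Nice fun (n : N) ψ => Q' m (P n.1.1 ψ) := (hQ'.reindex fun _ => m).comp (FN.nice_sg tu)
  obtain ⟨R1, hR1, e1⟩ := sg_expansion FN th hχ
  obtain ⟨R2, hR2, e2⟩ := sg_expansion FN th (nQ.utg _root_.id hχ)
  obtain ⟨R3, hR3, e3⟩ := sg_expansion FN th (nad.utg _root_.id hχ)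
  have hLQ : UTG fun n : N => L (Q m (χ n)) := nL.utg _root_.id (nQ.utg _root_.id hχ)
  have hLad : UTG fun n : N => L (ad L (Q m) (χ n)) := nL.utg _root_.id (nad.utg _root_.id hχ)
  have hL : UTG fun n : N => L (χ n) := nL.utg _root_.id hχ
  obtain ⟨C1, hC1, b1⟩ := nJ.exists_bound x (nQ.utg _root_.id hR1)
  obtain ⟨C2, hC2, b2⟩ := nJ.exists_bound x hR2
  obtain ⟨C3, hC3, b3⟩ := nJ.exists_bound x hR3
  obtain ⟨C4, hC4, b4⟩ := nJ.exists_bound x hLad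
  obtain ⟨C5, hC5, b5⟩ := nJ.exists_bound x (nad.utg _root_.id hL)
  obtain ⟨C6, hC6, b6⟩ := nJ.exists_bound x (nad.utg _root_.id hR1)
  set f : ℝ → ℝ := fun u => Q' m (P u (Q m (P (β - u) Ψ))) x with hf
  set g : ℝ → ℝ := fun u => Q' m (P u (ad L (Q m) (P (β - u) Ψ))) x with hg
  -- expansion of `J` along the three-term sums
  have hJ : ∀ (n : N) (c c' : ℝ) {ψ₁ ψ₂ ψ₃ : 𝔼 → ℝ}, TG ψ₁ → TG ψ₂ → TG ψ₃ →
      Q' m (P n.1.1 fun ξ => ψ₁ ξ + c * ψ₂ ξ + c' * ψ₃ ξ) x =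
        Q' m (P n.1.1 ψ₁) x + c * Q' m (P n.1.1 ψ₂) x + c' * Q' m (P n.1.1 ψ₃) x := by
    intro n c c' ψ₁ ψ₂ ψ₃ h1 h2 h3
    have k2 : TG fun ξ => c * ψ₂ ξ := (UTG.const' c).mul h2
    have k3 : TG fun ξ => c' * ψ₃ ξ := (UTG.const' c').mul h3
    have k12 : TG fun ξ => ψ₁ ξ + c * ψ₂ ξ := UTG.add h1 k2
    have := nJ.add n k12 k3
    rw [this, nJ.add n h1 k2, nJ.const_mul n c h2, nJ.const_mul n c' h3]
  have hsum : ∀ {D : Op ι}, Nice (fun _ : N => D) → ∀ (c c' : ℝ) {ψ₁ ψ₂ ψ₃ : 𝔼 → ℝ} (_ : N), TG ψ₁ →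
      TG ψ₂ → TG ψ₃ → D (fun ξ => ψ₁ ξ + c * ψ₂ ξ + c' * ψ₃ ξ) =
        fun ξ => D ψ₁ ξ + c * D ψ₂ ξ + c' * D ψ₃ ξ := by
    intro D hD c c' ψ₁ ψ₂ ψ₃ n h1 h2 h3
    have k2 : TG fun ξ => c * ψ₂ ξ := (UTG.const' c).mul h2
    have k3 : TG fun ξ => c' * ψ₃ ξ := (UTG.const' c').mul h3
    have k12 : TG fun ξ => ψ₁ ξ + c * ψ₂ ξ := UTG.add h1 k2
    have := hD.add n k12 k3
    rw [this, hD.add n h1 k2, hD.const_mul n c h2, hD.const_mul n c' h3]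
  have hPu : ∀ n : N, P (β - n.1.1) Ψ = fun ξ => χ n ξ + (n.1.2 - n.1.1) * L (χ n) ξ +
      (n.1.2 - n.1.1) * √(n.1.2 - n.1.1) * R1 n ξ := fun n => by
    rw [← e1 n]
    change _ = P _ (P _ Ψ)
    rw [hsg (th' n) (tv n) hΨ]
    congr 1
    ring
  have hPv : ∀ (n : N) {ψ}, TG ψ → P n.1.2 ψ = P n.1.1 (P (n.1.2 - n.1.1) ψ) := fun n ψ hψ => by
    rw [hsg (tu n) (th' n) hψ]
    congr 1
    ring
  have fv : ∀ n : N, f n.1.2 = Q' m (P n.1.1 (Q m (χ n))) x + (n.1.2 - n.1.1) *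
      Q' m (P n.1.1 (L (Q m (χ n)))) x + (n.1.2 - n.1.1) * √(n.1.2 - n.1.1) *
        Q' m (P n.1.1 (R2 n)) x := fun n => by
    have h0 := (nQ.utg _root_.id hχ).tg n
    rw [← hJ n _ _ h0 (hLQ.tg n) (hR2.tg n)]
    exact congrArg (fun ψ => Q' m ψ x) ((hPv n h0).trans (congrArg (P n.1.1) (e2 n)))
  have fu : ∀ n : N, f n.1.1 = Q' m (P n.1.1 (Q m (χ n))) x + (n.1.2 - n.1.1) *
      Q' m (P n.1.1 (Q m (L (χ n)))) x + (n.1.2 - n.1.1) * √(n.1.2 - n.1.1) *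
        Q' m (P n.1.1 (Q m (R1 n))) x := fun n => by
    rw [← hJ n _ _ ((nQ.utg _root_.id hχ).tg n) ((nQ.utg _root_.id hL).tg n)
      ((nQ.utg _root_.id hR1).tg n), ← hsum nQ _ _ n (hχ.tg n) (hL.tg n) (hR1.tg n), ← hPu]
  have gv : ∀ n : N, g n.1.2 = Q' m (P n.1.1 (ad L (Q m) (χ n))) x + (n.1.2 - n.1.1) *
      Q' m (P n.1.1 (L (ad L (Q m) (χ n)))) x + (n.1.2 - n.1.1) * √(n.1.2 - n.1.1) *
        Q' m (P n.1.1 (R3 n)) x := fun n => by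
    have h0 := (nad.utg _root_.id hχ).tg n
    rw [← hJ n _ _ h0 (hLad.tg n) (hR3.tg n)]
    exact congrArg (fun ψ => Q' m ψ x) ((hPv n h0).trans (congrArg (P n.1.1) (e3 n)))
  have gu : ∀ n : N, g n.1.1 = Q' m (P n.1.1 (ad L (Q m) (χ n))) x + (n.1.2 - n.1.1) *
      Q' m (P n.1.1 (ad L (Q m) (L (χ n)))) x + (n.1.2 - n.1.1) * √(n.1.2 - n.1.1) *
        Q' m (P n.1.1 (ad L (Q m) (R1 n))) x := fun n => by
    rw [← hJ n _ _ ((nad.utg _root_.id hχ).tg n) ((nad.utg _root_.id hL).tg n)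
      ((nad.utg _root_.id hR1).tg n), ← hsum nad _ _ n (hχ.tg n) (hL.tg n) (hR1.tg n), ← hPu]
  have had : ∀ n : N, Q' m (P n.1.1 (ad L (Q m) (χ n))) x =
      Q' m (P n.1.1 (L (Q m (χ n)))) x - Q' m (P n.1.1 (Q m (L (χ n)))) x := fun n => by
    have h1 : ad L (Q m) (χ n) = fun ξ => L (Q m (χ n)) ξ + (-1) * Q m (L (χ n)) ξ := by
      funext ξ
      simp only [ad, Pi.sub_apply]
      ring
    have k2 := (nQ.utg _root_.id hL).tg n
    have k3 : TG fun ξ => (-1 : ℝ) * Q m (L (χ n)) ξ := (UTG.const' (-1 : ℝ)).mul k2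
    rw [h1]
    have := congrFun (nJ.add n (hLQ.tg n) k3) x
    have h4 := congrFun (nJ.const_mul n (-1) k2) x
    change Q' m (P n.1.1 fun ξ => L (Q m (χ n)) ξ + (-1) * Q m (L (χ n)) ξ) x =
      Q' m (P n.1.1 (L (Q m (χ n)))) x + Q' m (P n.1.1 fun ξ => (-1) * Q m (L (χ n)) ξ) x at this
    change Q' m (P n.1.1 fun ξ => (-1) * Q m (L (χ n)) ξ) x =
      (-1) * Q' m (P n.1.1 (Q m (L (χ n)))) x at h4
    linarith
  -- Both endpoints are required, because the derivative at a point compares it with points on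
  -- either side.
  have main : ∀ n : N, |f n.1.2 - f n.1.1 - (n.1.2 - n.1.1) * g n.1.1| ≤
        (C1 + C2 + C3 + C4 + C5 + C6) * ((n.1.2 - n.1.1) * √(n.1.2 - n.1.1)) ∧
      |f n.1.2 - f n.1.1 - (n.1.2 - n.1.1) * g n.1.2| ≤
        (C1 + C2 + C3 + C4 + C5 + C6) * ((n.1.2 - n.1.1) * √(n.1.2 - n.1.1)) := by
    intro n
    have k1 := b1 n
    have k2 := b2 n
    have k3 := b3 n
    have k4 := b4 n
    have k5 := b5 n
    have k6 := b6 n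
    have fvn := fv n
    have fun' := fu n
    have gvn := gv n
    have gun := gu n
    have hadn := had n
    have h0 := (th n).1
    have h1 := (th n).2
    set h := n.1.2 - n.1.1
    have hs : √h ≤ 1 := Real.sqrt_le_one.2 h1
    have hs0 := Real.sqrt_nonneg h
    have hss := Real.mul_self_sqrt h0.le
    have hp : 0 ≤ h * √h := by positivity
    have comb : ∀ {p q r s c1 c2 c3 c4 : ℝ}, |p| ≤ c1 → |q| ≤ c2 → |r| ≤ c3 → |s| ≤ c4 →
        |h * √h * p - h * √h * q - h * (h * r + h * √h * s)| ≤ (c1 + c2 + c3 + c4) * (h * √h) :=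
      fun hp hq hr hs => abs_expansion_le h0.le h1 hp hq hr hs
    constructor
    · have e : f n.1.2 - f n.1.1 - h * g n.1.1 = h * √h * Q' m (P n.1.1 (R2 n)) x -
          h * √h * Q' m (P n.1.1 (Q m (R1 n))) x - h * (h * Q' m (P n.1.1 (ad L (Q m) (L (χ n)))) x +
            h * √h * Q' m (P n.1.1 (ad L (Q m) (R1 n))) x) := by
        rw [fvn, fun', gun, hadn]; ring
      rw [e]
      exact (comb k2 k1 k5 k6).trans (mul_le_mul_of_nonneg_right (by linarith) hp)
    · have e : f n.1.2 - f n.1.1 - h * g n.1.2 = h * √h * Q' m (P n.1.1 (R2 n)) x -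
          h * √h * Q' m (P n.1.1 (Q m (R1 n))) x - h * (h * Q' m (P n.1.1 (L (ad L (Q m) (χ n)))) x +
            h * √h * Q' m (P n.1.1 (R3 n)) x) := by
        rw [fvn, fun', gvn, hadn]; ring
      rw [e]
      exact (comb k2 k1 k4 k3).trans (mul_le_mul_of_nonneg_right (by linarith) hp)
  refine hasDerivWithinAt_of_sqrt (F := f) (G := g) (C := C1 + C2 + C3 + C4 + C5 + C6)
    (fun u hu v hv => ?_) hu
  rcases lt_trichotomy u v with h | h | h
  · have := (main ⟨(u, v), hu.1, h, hv.2⟩).1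
    rwa [abs_of_pos (by linarith : 0 < v - u)]
  · simp [h]
  · have := (main ⟨(v, u), hv.1, h, hu.2⟩).2
    rw [abs_sub_comm v u, abs_of_pos (by linarith : 0 < u - v)]
    simp only at this
    rw [← abs_neg]
    refine le_of_eq_of_le (congrArg _ ?_) this
    ring

/-- Taylor expansion of the conjugation of an operator by the semigroup. -/
lemma conj_taylor (F : Frozen ϖ A a b B) (hQ : Nice Q) (hQ' : Nice Q') {Ψ : 𝔼 → ℝ}
    (hΨ : TG Ψ) (x : 𝔼) (m : M) {s β K : ℝ} (hβ : β ≤ 1) (hs : s ∈ Icc (0 : ℝ) β) {n : ℕ}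
    (hK : ∀ u ∈ Icc (0 : ℝ) β, |Q' m (sg (A m) (a m) (b m) u
      (adIter (genL (A m) (a m) (b m)) (n + 1) (Q m) (sg (A m) (a m) (b m) (β - u) Ψ))) x| ≤ K) :
    |Q' m (sg (A m) (a m) (b m) s (Q m (sg (A m) (a m) (b m) (β - s) Ψ))) x -
      ∑ k ∈ Finset.range (n + 1), s ^ k / k.factorial *
        Q' m (adIter (genL (A m) (a m) (b m)) k (Q m) (sg (A m) (a m) (b m) β Ψ)) x| ≤
      K * s ^ (n + 1) := by
  have h1 := taylor_bound (n := n) (F := fun k u => Q' m (sg (A m) (a m) (b m) u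
    (adIter (genL (A m) (a m) (b m)) k (Q m) (sg (A m) (a m) (b m) (β - u) Ψ))) x)
    (fun k u hu => hasDerivWithinAt_conj F (F.nice_genL.adIter hQ k) hQ' hΨ x m hβ hu) hK hs
  refine le_of_eq_of_le ?_ h1
  congr 2
  refine Finset.sum_congr rfl fun k _ => ?_
  have h2 : TG (adIter (genL (A m) (a m) (b m)) k (Q m) (sg (A m) (a m) (b m) β Ψ)) :=
    (F.nice_genL.adIter hQ k).tg m (UTG.sg (F.reindex fun _ : Unit => m) (t := fun _ => β)
      (fun _ => ⟨hs.1.trans hs.2, hβ⟩) hΨ)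
  simp only [sub_zero]
  rw [sg_zero (b m) (F.hpos m) (h2.cont ())]

end Taylor


/-! ### Functionals with weighted derivatives, and their stability under composition. -/

section Functionals

variable {ι κ : Type} [Fintype ι] [DecidableEq ι] [Fintype κ] {M N : Type}

local notation "𝔼" => EuclideanSpace ℝ ι

/-- The point `m_τ(x) + Lz`. -/
def pt (x : 𝔼) (A : M → Matrix ι ι ℝ) (b : M → ι → ℝ) (τ : M → ℝ) (L : M → Matrix ι κ ℝ) (m : M)
    (z : κ → ℝ) : 𝔼 := gmean (A m) (b m) (τ m) x + mv (L m) z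

/-- Families of functionals `ψ ↦ ∑ ∫ Φ(z) δ^{|γ|} ∂^γ ψ (m_τ(x) + Lz)` with `z` standard Gaussian. -/
inductive Fn (x : EuclideanSpace ℝ ι) (ϖ : ι → ℕ) (δ : M → ℝ) (A : M → Matrix ι ι ℝ)
    (b : M → ι → ℝ) (τ : M → ℝ) (L : M → Matrix ι κ ℝ) :
    (M → (EuclideanSpace ℝ ι → ℝ) → ℝ) → Prop
  | base (Φ : M → (κ → ℝ) → ℝ) (hΦ : UTG Φ) (γ : List ι) : Fn x ϖ δ A b τ L fun m ψ =>
      ∫ z, Φ m z * (δ m ^ wt ϖ γ * pdL γ ψ (pt x A b τ L m z)) ∂gs κ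
  | add (ℓ ℓ' : M → (EuclideanSpace ℝ ι → ℝ) → ℝ) (h : Fn x ϖ δ A b τ L ℓ)
      (h' : Fn x ϖ δ A b τ L ℓ') : Fn x ϖ δ A b τ L fun m ψ => ℓ m ψ + ℓ' m ψ
  | congr (ℓ ℓ₂ : M → (EuclideanSpace ℝ ι → ℝ) → ℝ) (h : Fn x ϖ δ A b τ L ℓ)
      (h' : ∀ m ψ, TG ψ → ℓ₂ m ψ = ℓ m ψ) : Fn x ϖ δ A b τ L ℓ₂

/-- Coefficients that are of polynomial growth in the variable rescaled by `δ` around `x`. -/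
structure SC (x : EuclideanSpace ℝ ι) (δ : M → ℝ) (f : M → EuclideanSpace ℝ ι → ℝ) : Prop where
  tg : ∀ m, TG (f m)
  sc : UTG fun m w => f m (x + δ m • w)

/-- A scale `δ` together with a factorisation `L Lᵀ` of the covariance at the time `τ ≤ δ²`. -/
structure Leg (δ : M → ℝ) (A a : M → Matrix ι ι ℝ) (τ : M → ℝ) (L : M → Matrix ι κ ℝ) : Prop where
  hδ : ∀ m, δ m ∈ Ioc (0 : ℝ) 1
  hτ : ∀ m, τ m ∈ Icc (0 : ℝ) (δ m ^ 2)
  hL : ∀ m, L m * (L m)ᵀ = gcov (A m) (a m) (τ m)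

variable {x : EuclideanSpace ℝ ι} {ϖ : ι → ℕ} {A a : M → Matrix ι ι ℝ} {b : M → ι → ℝ} {B : ℝ}
  {δ τ : M → ℝ} {L : M → Matrix ι κ ℝ} {Q Q' : M → Op ι} {k : ℕ}
  {ℓ : M → (EuclideanSpace ℝ ι → ℝ) → ℝ}

lemma scale_pow_le (hδ : ∀ m, δ m ∈ Ioc (0 : ℝ) 1) (n : ℕ) (m : M) : |δ m ^ n| ≤ 1 := by
  rw [abs_of_nonneg (pow_nonneg (hδ m).1.le n)]
  exact pow_le_one₀ (hδ m).1.le (hδ m).2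

lemma pd_scale {f : 𝔼 → ℝ} (hf : Differentiable ℝ f) (x : 𝔼) (d : ℝ) (i : ι) (w : 𝔼) :
    pd i (fun w => f (x + d • w)) w = d * pd i f (x + d • w) := by
  have h1 : HasFDerivAt (fun w : 𝔼 => x + d • w) (d • ContinuousLinearMap.id ℝ 𝔼) w :=
    ((hasFDerivAt_id w).const_smul d).const_add x
  have := ((hf (x + d • w)).hasFDerivAt.comp w h1).fderiv
  have h2 : pd i (fun w => f (x + d • w)) w =
    fderiv ℝ (f ∘ fun w => x + d • w) w (EuclideanSpace.single i 1) := rfl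
  rw [h2, this]
  simp [pd]

lemma fderiv_eq_sum_smul (f : 𝔼 → ℝ) (w : 𝔼) :
    fderiv ℝ f w = ∑ i, pd i f w • (EuclideanSpace.proj i : 𝔼 →L[ℝ] ℝ) := by
  ext v
  rw [fderiv_eq_sum]
  simp [mul_comm]

/-- A derivative in the rescaled variable produces a single factor `δ`, and the surplus `δ ^ (ϖ i -
1)` is at most `1`. -/
lemma SC.pdh (hδ : ∀ m, δ m ∈ Ioc (0 : ℝ) 1) (hϖ : ∀ i, 1 ≤ ϖ i) {f : M → 𝔼 → ℝ} (h : SC x δ f)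
    (i : ι) : SC x δ fun m ξ => δ m ^ ϖ i * pd i (f m) ξ := by
  refine ⟨fun m => (UTG.const' _).mul (UTG.pd (h.tg m) i), ?_⟩
  have h1 := (h.sc.pd i).const_mul (c := fun m => δ m ^ (ϖ i - 1)) (scale_pow_le hδ _)
  convert h1 using 3 with m w
  rw [pd_scale ((h.tg m).diff ()), ← mul_assoc, ← pow_succ, Nat.sub_add_cancel (hϖ i)]

/-- The derivative of `w ↦ δ^{-(n+1)} f(x + δ w)` is `δ^{-n}` times the derivative of `f` at `x + δ
w`, and that derivative vanishes to order `n`. As the value at `w = 0` is zero, induction on the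
order applies. -/
lemma Van.exists_scaled {n : ℕ} (hδ : ∀ m, δ m ∈ Ioc (0 : ℝ) 1) {f : M → 𝔼 → ℝ} (h : Van x n f) :
    UTG fun m w => (δ m ^ n)⁻¹ * f m (x + δ m • w) := by
  have hsc : UTG fun m (w : 𝔼) => x + δ m • w :=
    (UTG.const' x).add ((UTG.const fun m => by simpa using scale_pow_le hδ 1 m).smul UTG.id)
  induction n generalizing f with
  | zero => simpa using h.comp hsc
  | succ n ih =>
    have hd : ∀ m, Differentiable ℝ fun w => f m (x + δ m • w) := fun m => (h.1.comp hsc).diff m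
    refine UTG.of_fderiv (C := 0) (fun m => (hd m).const_mul _) (fun m => by simp [h.2.1]) ?_
    have h1 : UTG fun m (w : 𝔼) => ∑ i, ((δ m ^ n)⁻¹ * LDL.pd i (f m) (x + δ m • w)) •
        (EuclideanSpace.proj i : 𝔼 →L[ℝ] ℝ) :=
      UTG.sum _ fun i _ => (ih (h.2.2 i)).smul (UTG.const' _)
    convert h1 using 3 with m w
    rw [fderiv_const_mul (hd m w), fderiv_eq_sum_smul, Finset.smul_sum]
    refine Finset.sum_congr rfl fun i _ => ?_
    rw [pd_scale (h.1.diff m), smul_smul]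
    congr 1
    have := (hδ m).1.ne'
    rw [pow_succ]
    field_simp

lemma Van.sc {n : ℕ} (hδ : ∀ m, δ m ∈ Ioc (0 : ℝ) 1) {f : M → 𝔼 → ℝ} (h : Van x n f) :
    SC x δ fun m ξ => (δ m ^ n)⁻¹ * f m ξ :=
  ⟨fun m => (UTG.const' _).mul (h.utg.tg m), h.exists_scaled hδ⟩

lemma Leg.time_le (hl : Leg δ A a τ L) (m : M) : τ m ∈ Icc (0 : ℝ) 1 :=
  ⟨(hl.hτ m).1, (hl.hτ m).2.trans (pow_le_one₀ (hl.hδ m).1.le (hl.hδ m).2)⟩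

/-- Up to time `δ²` the displacement from `x` is of order `δ`: the mean moves by `O(τ)` and the
covariance is `O(τ)`. The rescaled displacement is affine in `z` with bounded coefficients. -/
lemma Leg.exists_affine (F : Frozen ϖ A a b B) (hl : Leg δ A a τ L) (x : 𝔼) :
    ∃ w : M → (κ → ℝ) → 𝔼, UTG w ∧ ∀ m z, pt x A b τ L m z = x + δ m • w m z := by
  obtain ⟨K, hK0, hK⟩ := exists_small_time (ι := ι) B
  have hK := fun m => hK (A m) (a m) (b m) (F.hA m) (F.ha m) (F.hb m) (τ m) (hl.time_le m)
  have hdiv : ∀ m (r C : ℝ), 0 ≤ C → |r| ≤ C * τ m → |(δ m)⁻¹ * r| ≤ C := by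
    intro m r C hC h
    have h0 := (hl.hδ m).1
    have h1 := (hl.hδ m).2
    rw [abs_mul, abs_inv, abs_of_pos h0, inv_mul_le_iff₀ h0]
    have h2 : τ m ≤ δ m := (hl.hτ m).2.trans (by nlinarith)
    nlinarith
  have hτ1 : ∀ m, K * τ m ^ 2 ≤ K * τ m := fun m => by
    have := hl.time_le m
    exact mul_le_mul_of_nonneg_left (by nlinarith [this.1, this.2]) hK0
  have hA' : ∀ m i k, |((δ m)⁻¹ • (fl (A m) (τ m) - 1)) i k| ≤ K := fun m i k =>
    hdiv m _ K hK0 ((hK m i).2.2.1 k).2.1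
  have hb' : ∀ m i, |((δ m)⁻¹ • driftInt (A m) (b m) (τ m)) i| ≤ K + |B| := fun m i => by
    refine hdiv m _ _ (by positivity) ?_
    have h1 := (hK m i).1.trans (hτ1 m)
    rw [Pi.sub_apply, Pi.smul_apply, smul_eq_mul] at h1
    have h2 : |τ m * b m i| ≤ |B| * τ m := by
      rw [abs_mul, abs_of_nonneg (hl.hτ m).1, mul_comm]
      exact mul_le_mul_of_nonneg_right ((F.hb m i).trans (le_abs_self B)) (hl.hτ m).1
    have := abs_add_le (driftInt (A m) (b m) (τ m) i - τ m * b m i) (τ m * b m i)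
    rw [sub_add_cancel] at this
    linarith
  have hL' : ∀ m i k, |((δ m)⁻¹ • L m) i k| ≤ √(K + |B|) := fun m => abs_entry_le_of_sq fun i => by
    rw [Matrix.transpose_smul, Matrix.smul_mul, Matrix.mul_smul, smul_smul, hl.hL]
    have h1 := ((hK m i).2.1 i).trans (hτ1 m)
    rw [Matrix.sub_apply, Matrix.smul_apply, smul_eq_mul, abs_le] at h1
    have h2 : τ m * a m i i ≤ |B| * τ m := by
      rw [mul_comm]
      exact mul_le_mul_of_nonneg_right ((le_abs_self _).trans ((F.ha m i i).trans (le_abs_self B)))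
        (hl.hτ m).1
    have h0 := (hl.hδ m).1
    rw [Matrix.smul_apply, smul_eq_mul, ← mul_inv, ← pow_two, inv_mul_le_iff₀ (by positivity)]
    have h3 : (K + |B|) * τ m ≤ (K + |B|) * δ m ^ 2 :=
      mul_le_mul_of_nonneg_left (hl.hτ m).2 (by positivity)
    linarith
  refine ⟨fun m z => WithLp.toLp 2 ((((δ m)⁻¹ • (fl (A m) (τ m) - 1)) *ᵥ x.ofLp) +
    (δ m)⁻¹ • driftInt (A m) (b m) (τ m)) + mv ((δ m)⁻¹ • L m) z, ?_, fun m z => ?_⟩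
  · refine UTG.add (UTG.of_coord fun i => ?_) (UTG.mv hL')
    exact ((UTG.affine (fun m i k => (hA' m i k).trans (by linarith [abs_nonneg B])) hb' i).comp
      (UTG.const' x))
  · ext i
    have h0 := (hl.hδ m).1.ne'
    have h1 : mv ((δ m)⁻¹ • L m) z i = (δ m)⁻¹ * mv (L m) z i := by
      simp only [mv_apply, Matrix.smul_apply, smul_eq_mul, Finset.mul_sum, mul_assoc]
    simp only [pt, PiLp.add_apply, PiLp.smul_apply, smul_eq_mul, gmean_apply, h1, Pi.add_apply,
      Matrix.smul_mulVec, Matrix.sub_mulVec, Matrix.one_mulVec, Pi.smul_apply, Pi.sub_apply]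
    field_simp
    ring

lemma Leg.utg_pt (F : Frozen ϖ A a b B) (hl : Leg δ A a τ L) (x : 𝔼) :
    UTG fun m z => pt x A b τ L m z := by
  obtain ⟨w, hw, e⟩ := hl.exists_affine F x
  simp only [e]
  exact (UTG.const' x).add ((UTG.const fun m => by simpa using scale_pow_le hl.hδ 1 m).smul hw)

lemma Leg.integrable (F : Frozen ϖ A a b B) (hl : Leg δ A a τ L) {Φ : M → (κ → ℝ) → ℝ}
    (hΦ : UTG Φ) {ψ : 𝔼 → ℝ} (hψ : TG ψ) (m : M) (c : ℝ) :
    Integrable (fun z => Φ m z * (c * ψ (pt x A b τ L m z))) (gs κ) :=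
  UTG.integrable mom_gs ((hΦ.reindex fun _ : Unit => m).mul ((UTG.const' c).mul (hψ.comp
    ((hl.utg_pt F x).reindex fun _ => m)))) ()

lemma TG.pdL {ψ : 𝔼 → ℝ} (h : TG ψ) (γ : List ι) : TG (pdL γ ψ) := UTG.pdL h γ

lemma Fn.map_add (F : Frozen ϖ A a b B) (hl : Leg δ A a τ L) (h : Fn x ϖ δ A b τ L ℓ) (m : M)
    {ψ χ : 𝔼 → ℝ} (hψ : TG ψ) (hχ : TG χ) : ℓ m (fun ξ => ψ ξ + χ ξ) = ℓ m ψ + ℓ m χ := by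
  induction h with
  | base Φ hΦ γ =>
    rw [← integral_add (hl.integrable F hΦ (hψ.pdL γ) m _) (hl.integrable F hΦ (hχ.pdL γ) m _)]
    simp only [pdL_add (hψ.contDiff ()) (hχ.contDiff ()), mul_add]
  | add ℓ ℓ' h h' ih ih' => simp only [ih, ih']; ring
  | congr ℓ ℓ' h h' ih => rw [h' m _ (UTG.add hψ hχ), h' m _ hψ, h' m _ hχ, ih]

lemma Fn.map_const_mul (h : Fn x ϖ δ A b τ L ℓ) (m : M) (c : ℝ)
    {ψ : 𝔼 → ℝ} (hψ : TG ψ) : ℓ m (fun ξ => c * ψ ξ) = c * ℓ m ψ := by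
  induction h with
  | base Φ hΦ γ =>
    rw [← integral_const_mul]
    simp only [pdL_const_mul c (hψ.contDiff ())]
    refine integral_congr_ae (.of_forall fun z => ?_)
    simp only
    ring
  | add ℓ ℓ' h h' ih ih' => simp only [ih, ih']; ring
  | congr ℓ ℓ' h h' ih => rw [h' m _ ((UTG.const' c).mul hψ), h' m _ hψ, ih]

lemma Fn.const_mul {c : M → ℝ} {C : ℝ} (hc : ∀ m, |c m| ≤ C) (h : Fn x ϖ δ A b τ L ℓ) :
    Fn x ϖ δ A b τ L fun m ψ => c m * ℓ m ψ := by
  induction h with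
  | base Φ hΦ γ =>
    refine .congr _ _ (.base _ (hΦ.const_mul hc) γ) fun m ψ _ => ?_
    rw [← integral_const_mul]
    simp only [mul_assoc]
  | add ℓ ℓ' h h' ih ih' => exact .congr _ _ (.add _ _ ih ih') fun m ψ _ => mul_add _ _ _
  | congr ℓ ℓ' h h' ih => exact .congr _ _ ih fun m ψ hψ => by rw [h' m ψ hψ]

lemma Fn.zero : Fn x ϖ δ A b τ L fun _ _ => 0 :=
  .congr _ _ (.base _ (UTG.const' 0) []) fun m ψ _ => by simp

lemma Fn.sum {σ : Type} (s : Finset σ) {ℓ : σ → M → (𝔼 → ℝ) → ℝ}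
    (h : ∀ i ∈ s, Fn x ϖ δ A b τ L (ℓ i)) : Fn x ϖ δ A b τ L fun m ψ => ∑ i ∈ s, ℓ i m ψ := by
  classical
  induction s using Finset.induction_on with
  | empty => simpa using Fn.zero
  | insert a s ha ih =>
    simp only [Finset.sum_insert ha]
    exact .add _ _ (h a (by simp)) (ih fun i hi => h i (by simp [hi]))

lemma Fn.comp_pd (h : Fn x ϖ δ A b τ L ℓ) (i : ι) :
    Fn x ϖ δ A b τ L fun m ψ => ℓ m fun ξ => δ m ^ ϖ i * pd i ψ ξ := by
  induction h with
  | base Φ hΦ γ =>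
    refine .congr _ _ (.base Φ hΦ (i :: γ)) fun m ψ hψ => ?_
    simp only [pdL_const_mul _ (pd_smooth (hψ.contDiff ()) i), wt_cons, pow_add, pdL]
    refine integral_congr_ae (.of_forall fun z => ?_)
    simp only
    ring
  | add ℓ ℓ' h h' ih ih' => exact .add _ _ ih ih'
  | congr ℓ ℓ' h h' ih =>
    exact .congr _ _ ih fun m ψ hψ => h' m _ ((UTG.const' _).mul (UTG.pd hψ i))

lemma Fn.comp_pdL (h : Fn x ϖ δ A b τ L ℓ) (γ : List ι) :
    Fn x ϖ δ A b τ L fun m ψ => ℓ m fun ξ => δ m ^ wt ϖ γ * pdL γ ψ ξ := by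
  induction γ generalizing ℓ with
  | nil => simpa [wt, pdL] using h
  | cons i γ ih =>
    refine .congr _ _ ((ih h).comp_pd i) fun m ψ hψ => ?_
    simp only [pdL_const_mul _ (pd_smooth (hψ.contDiff ()) i), wt_cons, pow_add, pdL]
    congr 1
    funext ξ
    ring

/-- Leibniz' rule moves the coefficient past one weighted derivative at a time, and weighted
derivatives of a coefficient are again admissible (`SC.pdh`). When no derivative is left, the
coefficient, evaluated at `x + δ w(z)`, is absorbed into `Φ`. -/
lemma Fn.comp_mul (F : Frozen ϖ A a b B) (hl : Leg δ A a τ L) (h : Fn x ϖ δ A b τ L ℓ)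
    {f : M → 𝔼 → ℝ} (hf : SC x δ f) :
    Fn x ϖ δ A b τ L fun m ψ => ℓ m fun ξ => f m ξ * ψ ξ := by
  have hϖ : ∀ i, 1 ≤ ϖ i := fun i => by rcases F.hϖ i with h | h <;> omega
  induction h with
  | base Φ hΦ γ =>
    induction γ generalizing f with
    | nil =>
      obtain ⟨w, hw, e⟩ := hl.exists_affine F x
      refine .congr _ _ (.base (fun m z => Φ m z * f m (x + δ m • w m z))
        (hΦ.mul (hf.sc.comp hw)) []) fun m ψ hψ => ?_
      simp only [pdL, e]
      refine integral_congr_ae (.of_forall fun z => ?_)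
      simp only
      ring
    | cons i γ ih =>
      refine .congr _ _ (.add _ _ ((ih hf).comp_pd i) (ih (hf.pdh hl.hδ hϖ i))) fun m ψ hψ => ?_
      have h1 : TG fun ξ => f m ξ * (δ m ^ ϖ i * pd i ψ ξ) :=
        (hf.tg m).mul ((UTG.const' _).mul (UTG.pd hψ i))
      have h2 : TG fun ξ => δ m ^ ϖ i * pd i (f m) ξ * ψ ξ :=
        ((UTG.const' _).mul (UTG.pd (hf.tg m) i)).mul hψ
      rw [← integral_add (hl.integrable F hΦ (h1.pdL γ) m _)
        (hl.integrable F hΦ (h2.pdL γ) m _)]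
      refine integral_congr_ae (.of_forall fun z => ?_)
      have h3 := congrFun (pdL_add (h1.contDiff ()) (h2.contDiff ()) γ) (pt x A b τ L m z)
      have h4 : (fun ξ => f m ξ * (δ m ^ ϖ i * pd i ψ ξ) + δ m ^ ϖ i * pd i (f m) ξ * ψ ξ) =
          fun ξ => δ m ^ ϖ i * pd i (fun ξ => f m ξ * ψ ξ) ξ := by
        funext ξ
        rw [pd_mul ((hf.tg m).contDiff ()) (hψ.contDiff ())]
        ring
      rw [h4, pdL_const_mul _ (pd_smooth (((hf.tg m).contDiff ()).mul (hψ.contDiff ())) i)] at h3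
      simp only [wt_cons, pow_add, pdL]
      linear_combination (Φ m z * δ m ^ wt ϖ γ) * h3
  | add ℓ ℓ' h h' ih ih' => exact .add _ _ ih ih'
  | congr ℓ ℓ' h h' ih => exact .congr _ _ ih fun m ψ hψ => h' m _ (UTG.mul (hf.tg m) hψ)

/-- A term `f ∂^γ` brings `δ^n` from the vanishing of `f` and needs `δ^{|γ|}` for its derivatives.
By `hp` the prefactor `δ^p` covers the deficit for all admitted terms, and a surplus power of `δ` is
at most `1`. -/
lemma Fn.comp_DO (F : Frozen ϖ A a b B) (hl : Leg δ A a τ L) (h : Fn x ϖ δ A b τ L ℓ)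
    (hQ : DO x ϖ k Q) {p : ℕ} (hp : ∀ γ n, wt ϖ γ ≤ 2 * k + n + 1 → wt (hw ϖ) γ ≤ k + 2 →
      wt ϖ γ ≤ p + n) : Fn x ϖ δ A b τ L fun m ψ => δ m ^ p * ℓ m (Q m ψ) := by
  induction hQ with
  | term f γ n hf h1 h2 =>
    have hw := hp γ n h1 h2
    refine .congr _ _ (((h.comp_mul F hl (hf.sc hl.hδ)).comp_pdL γ).const_mul
      (scale_pow_le hl.hδ (p + n - wt ϖ γ))) fun m ψ hψ => ?_
    have h3 : (fun ξ => (δ m ^ n)⁻¹ * f m ξ * (δ m ^ wt ϖ γ * pdL γ ψ ξ)) =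
        fun ξ => ((δ m ^ n)⁻¹ * δ m ^ wt ϖ γ) * (f m ξ * pdL γ ψ ξ) := by
      funext ξ
      ring
    rw [h3, h.map_const_mul m _ (UTG.mul (hf.utg.tg m) (hψ.pdL γ)), ← mul_assoc]
    congr 1
    have h0 := (hl.hδ m).1.ne'
    rw [← mul_assoc, mul_comm (_ ^ _) (_ ⁻¹), mul_assoc, ← pow_add, Nat.sub_add_cancel hw, pow_add]
    field_simp
  | add Q Q' hq hq' ih ih' =>
    refine .congr _ _ (.add _ _ ih ih') fun m ψ hψ => ?_
    rw [h.map_add F hl m (hq.nice.tg m hψ) (hq'.nice.tg m hψ), mul_add]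
  | congr Q Q' hq hq' ih =>
    exact .congr _ _ ih fun m ψ hψ => by rw [hq' m ψ (hψ.contDiff ())]

lemma gmean_eq_add (A : Matrix ι ι ℝ) (b : ι → ℝ) (t : ℝ) (ξ : 𝔼) :
    gmean A b t ξ = gmean A b t 0 + mv (fl A t) ξ.ofLp := by
  rw [← gmean_add, zero_add]

/-- The starting point enters only through the mean, which is affine with linear part `e^{uA}`. -/
lemma pd_sg (F : Frozen ϖ A a b B) {u : ℝ} (hu : u ∈ Icc (0 : ℝ) 1) (m : M) {ψ : 𝔼 → ℝ}
    (hψ : TG ψ) (i : ι) : pd i (sg (A m) (a m) (b m) u ψ) =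
      fun ξ => ∑ j, fl (A m) u j i * sg (A m) (a m) (b m) u (pd j ψ) ξ := by
  have F' := F.reindex fun _ : Unit => m
  obtain ⟨C, -, hC⟩ := F'.exists_bounds
  have h1 := UTG.sg_integrand (t := fun _ => u) F' (fun _ => hu)
    (L := fun _ => sqm (gcov (A m) (a m) u)) (fun n => (hC n _ hu).2.2.2) hψ
  have h2 := pd_integral mom_gs h1 i ()
  refine h2.trans ?_
  funext ξ
  have hd : ∀ z, pd i (fun ξ => ψ (gmean (A m) (b m) u ξ + mv (sqm (gcov (A m) (a m) u)) z)) ξ =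
      ∑ j, fl (A m) u j i * pd j ψ (gmean (A m) (b m) u ξ + mv (sqm (gcov (A m) (a m) u)) z) := by
    intro z
    have h3 : HasFDerivAt (fun ξ : 𝔼 => gmean (A m) (b m) u ξ + mv (sqm (gcov (A m) (a m) u)) z)
        ((mv (fl (A m) u)).comp (EuclideanSpace.equiv ι ℝ).toContinuousLinearMap) ξ := by
      have h4 := ((((mv (fl (A m) u)).comp
        (EuclideanSpace.equiv ι ℝ).toContinuousLinearMap).hasFDerivAt (x := ξ)).const_add
        (gmean (A m) (b m) u 0)).add_const (mv (sqm (gcov (A m) (a m) u)) z)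
      refine h4.congr_of_eventuallyEq (.of_forall fun ξ => ?_)
      simp only
      rw [gmean_eq_add]
      rfl
    have h5 := ((hψ.diff () _).hasFDerivAt.comp ξ h3).fderiv
    have h6 : pd i (fun ξ => ψ (gmean (A m) (b m) u ξ + mv (sqm (gcov (A m) (a m) u)) z)) ξ =
      fderiv ℝ (ψ ∘ fun ξ : 𝔼 => gmean (A m) (b m) u ξ + mv (sqm (gcov (A m) (a m) u)) z) ξ
        (EuclideanSpace.single i 1) := rfl
    rw [h6, h5]
    change fderiv ℝ ψ _ (mv (fl (A m) u) (EuclideanSpace.single i (1 : ℝ)).ofLp) = _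
    rw [fderiv_eq_sum]
    refine Finset.sum_congr rfl fun j _ => ?_
    rw [mv_apply]
    simp
  simp only [hd]
  rw [integral_finsetSum _ fun j _ =>
    (sg_integrable (t := fun _ => u) F' (fun _ => hu) (UTG.pd hψ j) () ξ).const_mul _]
  simp only [integral_const_mul]
  rfl

/-- The factor of the covariance after a further step of the semigroup. -/
def stepL (A a : M → Matrix ι ι ℝ) (u : M → ℝ) (L : M → Matrix ι κ ℝ) (m : M) :
    Matrix ι (κ ⊕ ι) ℝ :=
  Matrix.fromCols (fl (A m) (u m) * L m) (sqm (gcov (A m) (a m) (u m)))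

lemma Leg.step (F : Frozen ϖ A a b B) (hl : Leg δ A a τ L) {u : M → ℝ} (hu : ∀ m, 0 ≤ u m)
    (hτu : ∀ m, τ m + u m ≤ δ m ^ 2) : Leg δ A a (fun m => τ m + u m) (stepL A a u L) where
  hδ := hl.hδ
  hτ m := ⟨add_nonneg (hl.hτ m).1 (hu m), hτu m⟩
  hL m := by
    rw [stepL, fromCols_mul_transpose, sqm_mul (gcov_posSemidef (F.hpos m) (hu m)), gcov_add,
      Matrix.transpose_mul, ← hl.hL, add_comm]
    simp only [Matrix.mul_assoc]

/-- Without derivatives this is the independence of successive Gaussian steps. A derivative passes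
through the semigroup with the coefficients of `e^{uA}`, and these respect the weights: the critical
entry, where a derivative of weight `1` becomes one of weight `3`, is off-diagonal, hence `O(u) =
O(δ²)`, which compensates the missing `δ²`. -/
lemma Fn.comp_sg (F : Frozen ϖ A a b B) (hl : Leg δ A a τ L) {u : M → ℝ} (hu : ∀ m, 0 ≤ u m)
    (hτu : ∀ m, τ m + u m ≤ δ m ^ 2) (h : Fn x ϖ δ A b τ L ℓ) :
    Fn x ϖ δ A b (fun m => τ m + u m) (stepL A a u L)
      fun m ψ => ℓ m (sg (A m) (a m) (b m) (u m) ψ) := by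
  have hu2 : ∀ m, u m ≤ δ m ^ 2 := fun m => by linarith [hτu m, (hl.hτ m).1]
  have hu1 : ∀ m, u m ∈ Icc (0 : ℝ) 1 := fun m =>
    ⟨hu m, (hu2 m).trans (pow_le_one₀ (hl.hδ m).1.le (hl.hδ m).2)⟩
  have nP := F.nice_sg hu1
  have hl' := hl.step F hu hτu
  induction h with
  | base Φ hΦ γ =>
    induction γ with
    | nil =>
      have hΦ' : UTG fun m (z : κ ⊕ ι → ℝ) => Φ m (fun k => z (Sum.inl k)) :=
        hΦ.comp (UTG.clm' (ContinuousLinearMap.pi fun k =>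
          ContinuousLinearMap.proj (R := ℝ) (φ := fun _ : κ ⊕ ι => ℝ) (Sum.inl k)))
      refine .congr _ _ (.base _ hΦ' []) fun m ψ hψ => ?_
      rw [integral_gs_sum (hl'.integrable F hΦ' (hψ.pdL []) m _)]
      refine integral_congr_ae (.of_forall fun z => ?_)
      simp only [Sum.elim_inl, pdL]
      rw [integral_const_mul, integral_const_mul]
      congr 2
      refine integral_congr_ae (.of_forall fun z' => ?_)
      simp only [pt]
      rw [gmean_add, gmean_gmean, mv_mul, stepL, mv_fromCols, add_assoc]
    | cons i γ ih =>
      obtain ⟨K, hK0, hK⟩ := exists_fl_bounds (ι := ι) B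
      have hc : ∀ j m, |(δ m ^ ϖ j)⁻¹ * δ m ^ ϖ i * fl (A m) (u m) j i| ≤ K := by
        intro j m
        have h1 := hK (A m) (F.hA m) (u m) (hu1 m) j i
        have h0 := (hl.hδ m).1
        have hd1 := (hl.hδ m).2
        by_cases hji : j = i
        · subst hji
          rw [inv_mul_cancel₀ (pow_pos h0 _).ne', one_mul]
          exact h1.1
        · have h2 := h1.2.1
          rw [Matrix.sub_apply, Matrix.one_apply_ne hji, sub_zero] at h2
          rw [mul_assoc, abs_mul, abs_mul, abs_inv, abs_of_pos (pow_pos h0 _),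
            abs_of_pos (pow_pos h0 _), inv_mul_le_iff₀ (pow_pos h0 _)]
          rcases F.hϖ i with hi | hi <;> rcases F.hϖ j with hj | hj <;> rw [hi, hj]
          · rw [mul_comm]
            exact (mul_le_mul_of_nonneg_right h1.1 (pow_pos h0 1).le).trans_eq (mul_comm _ _)
          · have h3 : |fl (A m) (u m) j i| ≤ K * δ m ^ 2 :=
              h2.trans (mul_le_mul_of_nonneg_left (hu2 m) hK0)
            calc δ m ^ 1 * |fl (A m) (u m) j i| ≤ δ m ^ 1 * (K * δ m ^ 2) :=
                  mul_le_mul_of_nonneg_left h3 (pow_pos h0 _).le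
              _ = δ m ^ 3 * K := by ring
          · calc δ m ^ 3 * |fl (A m) (u m) j i| ≤ δ m ^ 1 * K :=
                  mul_le_mul (pow_le_pow_of_le_one h0.le hd1 (by norm_num)) h1.1 (abs_nonneg _)
                    (pow_pos h0 _).le
              _ = _ := rfl
          · exact mul_le_mul_of_nonneg_left h1.1 (pow_pos h0 _).le
      refine .congr _ _ (Fn.sum Finset.univ fun j _ => ((ih.comp_pd j).const_mul (hc j)))
        fun m ψ hψ => ?_
      have hP : ∀ j, TG fun ξ => δ m ^ ϖ j * pd j ψ ξ := fun j =>
        (UTG.const' _).mul (UTG.pd hψ j)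
      simp only [← integral_const_mul]
      rw [← integral_finsetSum _ fun j _ =>
        (hl.integrable F hΦ ((nP.tg m (hP j)).pdL γ) m _).const_mul _]
      refine integral_congr_ae (.of_forall fun z => ?_)
      simp only [pdL]
      have hs : ∀ j ∈ (Finset.univ : Finset ι), ContDiff ℝ ∞ fun ξ =>
          fl (A m) (u m) j i * sg (A m) (a m) (b m) (u m) (pd j ψ) ξ := fun j _ =>
        contDiff_const.mul ((nP.tg m (UTG.pd hψ j)).contDiff ())
      rw [pd_sg F (hu1 m) m hψ, pdL_sum _ hs]
      simp only [sg_const_mul, pdL_const_mul _ ((nP.tg m (UTG.pd hψ _)).contDiff ()), wt_cons,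
        pow_add, Finset.mul_sum]
      refine Finset.sum_congr rfl fun j _ => ?_
      have h0 := (pow_pos (hl.hδ m).1 (ϖ j)).ne'
      field_simp
  | add ℓ ℓ' h h' ih ih' => exact .add _ _ ih ih'
  | congr ℓ ℓ' h h' ih => exact .congr _ _ ih fun m ψ hψ => h' m _ (nP.tg m hψ)

end Functionals


/-! ### Bounds for the remainders tested against a function. -/

section WeakBound

variable {ι κ : Type} [Fintype ι] [DecidableEq ι] [Fintype κ] {M N : Type}

local notation "𝔼" => EuclideanSpace ℝ ι

/-- Nondegeneracy of the covariance at time `δ²`, with the weights `ϖ`. -/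
structure NonDeg (ϖ : ι → ℕ) (δ : M → ℝ) (A a : M → Matrix ι ι ℝ) (c : ℝ) : Prop where
  hc : 0 < c
  nd : ∀ m u, c * ∑ i, δ m ^ (2 * ϖ i) * u i ^ 2 ≤ u ⬝ᵥ (gcov (A m) (a m) (δ m ^ 2) *ᵥ u)

lemma NonDeg.reindex {ϖ : ι → ℕ} {δ : M → ℝ} {A a : M → Matrix ι ι ℝ} {c : ℝ}
    (D : NonDeg ϖ δ A a c) (φ : N → M) :
    NonDeg ϖ (fun n => δ (φ n)) (fun n => A (φ n)) (fun n => a (φ n)) c :=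
  ⟨D.hc, fun n => D.nd (φ n)⟩

variable {x : EuclideanSpace ℝ ι} {ϖ : ι → ℕ} {A a : M → Matrix ι ι ℝ} {b : M → ι → ℝ} {B c : ℝ}
  {δ τ : M → ℝ} {L : M → Matrix ι κ ℝ} {Q : M → Op ι}
  {ℓ : M → (EuclideanSpace ℝ ι → ℝ) → ℝ} {T : M → ℕ → ℝ}

lemma NonDeg.posDef (D : NonDeg ϖ δ A a c) (F : Frozen ϖ A a b B) (hδ : ∀ m, δ m ∈ Ioc (0 : ℝ) 1)
    (m : M) : (gcov (A m) (a m) (δ m ^ 2)).PosDef := by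
  refine Matrix.PosDef.of_dotProduct_mulVec_pos
    (gcov_posSemidef (F.hpos m) (sq_nonneg _)).isHermitian fun u hu => ?_
  rw [star_trivial]
  refine lt_of_lt_of_le (mul_pos D.hc ?_) (D.nd m u)
  obtain ⟨i, hi⟩ := Function.ne_iff.1 hu
  have h0 := (hδ m).1
  have h1 : 0 < u i ^ 2 := by
    have : u i ≠ 0 := hi
    positivity
  exact Finset.sum_pos' (fun i _ => by positivity) ⟨i, Finset.mem_univ i, by positivity⟩

/-- The integral of `|φ|` against a Gaussian density with twice the covariance. -/
def gint (x : 𝔼) (δ : M → ℝ) (A a : M → Matrix ι ι ℝ) (b : M → ι → ℝ) (m : M) (φ : 𝔼 → ℝ) : ℝ :=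
  ∫ y, |φ y| * gker ((2 : ℝ) • gcov (A m) (a m) (δ m ^ 2))
    (y.ofLp - (gmean (A m) (b m) (δ m ^ 2) x).ofLp)

lemma gint_nonneg (x : 𝔼) (δ : M → ℝ) (A a : M → Matrix ι ι ℝ) (b : M → ι → ℝ) (m : M)
    (φ : 𝔼 → ℝ) : 0 ≤ gint x δ A a b m φ :=
  integral_nonneg fun _ => mul_nonneg (abs_nonneg _) (gker_nonneg _ _)

/-- The weighted direction lifts to the Gaussian space as `h = δ^{ϖ i} Lᵀ Γ⁻¹ e_i`, with `Γ` the
covariance at time `δ²`. Then `|h|² = δ^{2 ϖ i} (Γ⁻¹)_{ii}`, and nondegeneracy, applied to the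
vector `Γ⁻¹ e_i`, bounds this by `1 / c`. -/
lemma NonDeg.exists_direction (D : NonDeg ϖ δ A a c) (F : Frozen ϖ A a b B) (hl : Leg δ A a τ L)
    (hτ : ∀ m, τ m = δ m ^ 2) (i : ι) : ∃ h : M → κ → ℝ, (∀ m k, |h m k| ≤ √(1 / c)) ∧
      ∀ m, mv (L m) (h m) = δ m ^ ϖ i • EuclideanSpace.single i (1 : ℝ) := by
  let u : M → ι → ℝ := fun m => (gcov (A m) (a m) (τ m))⁻¹ *ᵥ Pi.single i 1
  have hu : ∀ m, gcov (A m) (a m) (τ m) *ᵥ u m = Pi.single i 1 := fun m => by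
    have hdet : IsUnit (gcov (A m) (a m) (τ m)).det := by
      rw [hτ]
      exact isUnit_iff_ne_zero.2 (D.posDef F hl.hδ m).det_pos.ne'
    rw [Matrix.mulVec_mulVec, Matrix.mul_nonsing_inv _ hdet, Matrix.one_mulVec]
  refine ⟨fun m => δ m ^ ϖ i • ((L m)ᵀ *ᵥ u m), fun m k => ?_, fun m => ?_⟩
  · have h1 : u m i = u m ⬝ᵥ (gcov (A m) (a m) (τ m) *ᵥ u m) := by
      rw [hu]; simp
    have h2 := D.nd m (u m)
    rw [← hτ, ← h1] at h2
    have h0 := (hl.hδ m).1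
    have h3 : δ m ^ (2 * ϖ i) * u m i ^ 2 ≤ ∑ i, δ m ^ (2 * ϖ i) * u m i ^ 2 :=
      Finset.single_le_sum (f := fun i => δ m ^ (2 * ϖ i) * u m i ^ 2)
        (fun i _ => by positivity) (Finset.mem_univ i)
    have h4 : c * (δ m ^ (2 * ϖ i) * u m i ^ 2) ≤ u m i :=
      (mul_le_mul_of_nonneg_left h3 D.hc.le).trans h2
    have h5 : δ m ^ (2 * ϖ i) * u m i ≤ 1 / c := by
      rw [le_div_iff₀ D.hc]
      by_contra! hcon
      have hd : 0 < δ m ^ (2 * ϖ i) := by positivity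
      have hc := D.hc
      have hui : 0 < u m i := by
        by_contra! hneg
        nlinarith [mul_nonneg hd.le hc.le]
      nlinarith
    refine Real.abs_le_sqrt ?_
    have h6 : ((L m)ᵀ *ᵥ u m) ⬝ᵥ ((L m)ᵀ *ᵥ u m) = u m i := by
      rw [h1, ← hl.hL, ← Matrix.mulVec_mulVec, Matrix.dotProduct_mulVec (u m),
        Matrix.mulVec_transpose]
    have h7 : ((L m)ᵀ *ᵥ u m) k ^ 2 ≤ u m i := by
      rw [← h6, dotProduct]
      simp only [← pow_two]
      exact Finset.single_le_sum (f := fun k => ((L m)ᵀ *ᵥ u m) k ^ 2) (fun _ _ => sq_nonneg _)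
        (Finset.mem_univ k)
    simp only [Pi.smul_apply, smul_eq_mul]
    rw [mul_pow, ← pow_mul, mul_comm (ϖ i) 2]
    exact (mul_le_mul_of_nonneg_left h7 (by positivity)).trans h5
  · ext j
    change (L m *ᵥ (δ m ^ ϖ i • ((L m)ᵀ *ᵥ u m))) j = _
    rw [Matrix.mulVec_smul, Matrix.mulVec_mulVec, hl.hL, hu]
    simp [Pi.single_apply]

/-- By the chain rule the derivative along the lifted direction `h` is the weighted derivative of
`χ`. Gaussian integration by parts then moves it onto `Φ`. -/
lemma Leg.integral_by_parts (F : Frozen ϖ A a b B) (hl : Leg δ A a τ L) {Φ : M → (κ → ℝ) → ℝ}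
    (hΦ : UTG Φ) {i : ι} {h : κ → ℝ} (m : M)
    (hh : mv (L m) h = δ m ^ ϖ i • EuclideanSpace.single i (1 : ℝ)) {χ : 𝔼 → ℝ} (hχ : TG χ) :
    ∫ z, Φ m z * (δ m ^ ϖ i * pd i χ (pt x A b τ L m z)) ∂gs κ =
      ∫ z, ((h ⬝ᵥ z) * Φ m z - fderiv ℝ (Φ m) z h) * χ (pt x A b τ L m z) ∂gs κ := by
  have hpt := (hl.utg_pt F x).reindex fun _ : Unit => m
  have hΦm := hΦ.reindex fun _ : Unit => m
  have hc : UTG fun (_ : Unit) z => χ (pt x A b τ L m z) := hχ.comp hpt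
  have h1 := integral_fderiv_gs (hΦm.mul hc) h
  have hlin : UTG fun (_ : Unit) (z : κ → ℝ) => h ⬝ᵥ z :=
    UTG.clm' (LinearMap.toContinuousLinearMap (dotProductBilin ℝ ℝ h))
  have hd : ∀ z, fderiv ℝ (fun z => Φ m z * χ (pt x A b τ L m z)) z h =
      Φ m z * (δ m ^ ϖ i * pd i χ (pt x A b τ L m z)) +
        fderiv ℝ (Φ m) z h * χ (pt x A b τ L m z) := by
    intro z
    have h2 : HasFDerivAt (fun z => pt x A b τ L m z) (mv (L m)) z :=
      ((mv (L m)).hasFDerivAt (x := z)).const_add _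
    have h3 : HasFDerivAt (fun z => χ (pt x A b τ L m z)) ((fderiv ℝ χ (pt x A b τ L m z)).comp
      (mv (L m))) z := (hχ.diff () _).hasFDerivAt.comp z h2
    rw [((hΦ.diff m z).hasFDerivAt.fun_mul h3).fderiv]
    simp only [add_apply, smul_apply,
      ContinuousLinearMap.comp_apply, hh, map_smul, smul_eq_mul, pd]
    ring
  simp only [hd] at h1
  have i1 : Integrable (fun z => Φ m z * (δ m ^ ϖ i * pd i χ (pt x A b τ L m z))) (gs κ) :=
    hl.integrable F hΦ (UTG.pd hχ i) m _
  have i2 : Integrable (fun z => fderiv ℝ (Φ m) z h * χ (pt x A b τ L m z)) (gs κ) :=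
    ((hΦm.fderiv.app (UTG.const' h)).mul hc).integrable mom_gs ()
  have i3 : Integrable (fun z => (h ⬝ᵥ z) * (Φ m z * χ (pt x A b τ L m z))) (gs κ) :=
    (hlin.mul (hΦm.mul hc)).integrable mom_gs ()
  rw [integral_add i1 i2] at h1
  have h4 : ∫ z, ((h ⬝ᵥ z) * Φ m z - fderiv ℝ (Φ m) z h) * χ (pt x A b τ L m z) ∂gs κ =
      ∫ z, ((h ⬝ᵥ z) * (Φ m z * χ (pt x A b τ L m z)) -
        fderiv ℝ (Φ m) z h * χ (pt x A b τ L m z)) ∂gs κ :=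
    integral_congr_ae (.of_forall fun z => by simp only; ring)
  rw [h4, integral_sub i3 i2]
  linarith

/-- At the final time integration by parts removes the derivatives one at a time. The lifted
directions are bounded, so each step replaces `Φ` by another weight of polynomial growth and no
negative power of `δ` appears. The last weight is absorbed by doubling the covariance. -/
lemma Fn.exists_bound (D : NonDeg ϖ δ A a c) (F : Frozen ϖ A a b B) (hl : Leg δ A a τ L)
    (hτ : ∀ m, τ m = δ m ^ 2) (h : Fn x ϖ δ A b τ L ℓ) :
    ∃ C : ℝ, 0 ≤ C ∧ ∀ m φ, TG φ → |ℓ m φ| ≤ C * gint x δ A a b m φ := by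
  induction h with
  | base Φ hΦ γ =>
    induction γ generalizing Φ with
    | nil =>
      obtain ⟨C, k, hC, hb⟩ := hΦ.ub
      obtain ⟨C', hC', hb'⟩ := integral_growth_mul_le κ k
      refine ⟨C * C', by positivity, fun m φ hφ => ?_⟩
      have hpt := (hl.utg_pt F x).reindex fun _ : Unit => m
      have hc : UTG fun (_ : Unit) z => φ (pt x A b τ L m z) := hφ.comp hpt
      have hc2 : UTG fun (_ : Unit) z => φ (pt x A b τ L m (√2 • z)) :=
        hc.comp ((UTG.const' √2).smul UTG.id)
      have hpd := D.posDef F hl.hδ m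
      have hG := sqm_mul (gcov_posSemidef (A := A m) (F.hpos m) (sq_nonneg (δ m)))
      set G := gcov (A m) (a m) (δ m ^ 2) with hGdef
      have h2 : (√2 • L m) * (√2 • L m)ᵀ = (√2 • sqm G) * (√2 • sqm G)ᵀ := by
        simp only [Matrix.transpose_smul, Matrix.smul_mul, Matrix.mul_smul]
        rw [hl.hL, hτ, hG]
      have hdet : (√2 • sqm G).det ≠ 0 := by
        rw [Matrix.det_smul]
        refine mul_ne_zero (by positivity) fun h0 => hpd.det_pos.ne' ?_
        rw [← hG, Matrix.det_mul, h0, zero_mul]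
      have h3 : (√2 • sqm G) * (√2 • sqm G)ᵀ = (2 : ℝ) • G := by
        simp only [Matrix.transpose_smul, Matrix.smul_mul, Matrix.mul_smul, smul_smul]
        rw [hG, Real.mul_self_sqrt (by norm_num)]
      have e1 : ∀ z, pt x A b τ L m (√2 • z) = gmean (A m) (b m) (δ m ^ 2) x +
          mv (√2 • L m) z := fun z => by
        rw [pt, hτ]
        congr 1
        ext i
        simp only [mv_apply, Matrix.smul_apply, Pi.smul_apply, smul_eq_mul]
        exact Finset.sum_congr rfl fun j _ => by ring
      have hcont : Continuous fun v => |φ (gmean (A m) (b m) (δ m ^ 2) x + v)| := by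
        have := hφ.cont ()
        fun_prop
      have i1 : Integrable (fun z => |φ (pt x A b τ L m (√2 • z))|) (gs κ) :=
        (hc2.integrable mom_gs ()).abs
      have hcpt : Continuous fun z => |φ (pt x A b τ L m z)| := (hc.cont ()).abs
      have hint : Integrable (fun z => (1 + ‖z‖) ^ k * |φ (pt x A b τ L m z)|) (gs κ) := by
        obtain ⟨C2, k2, hC2, hb2⟩ := hc.ub
        refine ((mom_gs (κ := κ) (k + k2)).const_mul C2).mono'
          (Continuous.aestronglyMeasurable (by fun_prop)) (.of_forall fun z => ?_)
        rw [Real.norm_of_nonneg (by positivity), pow_add]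
        have := hb2 () z
        rw [Real.norm_eq_abs] at this
        calc (1 + ‖z‖) ^ k * |φ (pt x A b τ L m z)| ≤ (1 + ‖z‖) ^ k * (C2 * (1 + ‖z‖) ^ k2) := by
              gcongr
          _ = _ := by ring
      have key : ∫ z, |φ (pt x A b τ L m (√2 • z))| ∂gs κ = gint x δ A a b m φ := by
        simp only [e1]
        rw [integral_mv_congr h2 hcont, integral_add_mv hdet _ (hφ.cont ()).abs, h3]
        rfl
      calc |∫ z, Φ m z * (δ m ^ wt ϖ [] * pdL [] φ (pt x A b τ L m z)) ∂gs κ|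
          ≤ ∫ z, C * ((1 + ‖z‖) ^ k * |φ (pt x A b τ L m z)|) ∂gs κ := by
            rw [← Real.norm_eq_abs]
            refine norm_integral_le_of_norm_le (hint.const_mul C) (.of_forall fun z => ?_)
            simp only [wt, List.map_nil, List.sum_nil, pow_zero, one_mul, pdL]
            rw [norm_mul, ← mul_assoc, Real.norm_eq_abs (φ _)]
            gcongr
            exact hb m z
        _ = C * ∫ z, (1 + ‖z‖) ^ k * |φ (pt x A b τ L m z)| ∂gs κ := integral_const_mul _ _
        _ ≤ C * (C' * ∫ z, |φ (pt x A b τ L m (√2 • z))| ∂gs κ) := by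
            gcongr
            exact hb' _ hcpt (fun _ => abs_nonneg _) i1
        _ = C * C' * gint x δ A a b m φ := by rw [key]; ring
    | cons i γ ih =>
      obtain ⟨h, hb, hh⟩ := D.exists_direction F hl hτ i
      have hΦ' : UTG fun m z => (h m ⬝ᵥ z) * Φ m z - fderiv ℝ (Φ m) z (h m) := by
        refine UTG.sub (UTG.mul ?_ hΦ) (hΦ.fderiv.app (UTG.const (C := √(1 / c)) fun m => ?_))
        · exact UTG.sum _ fun k _ => (UTG.const fun m => hb m k).mul
            (UTG.clm' (ContinuousLinearMap.proj (R := ℝ) (φ := fun _ : κ => ℝ) k))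
        · exact (pi_norm_le_iff_of_nonneg (Real.sqrt_nonneg _)).2 fun k => hb m k
      obtain ⟨C, hC, h1⟩ := ih _ hΦ'
      refine ⟨C, hC, fun m φ hφ => ?_⟩
      refine le_of_eq_of_le (congrArg _ ?_) (h1 m φ hφ)
      have hχ : TG fun ξ => δ m ^ wt ϖ γ * pdL γ φ ξ := (UTG.const' _).mul (hφ.pdL γ)
      refine Eq.trans ?_ (hl.integral_by_parts F hΦ m (hh m) hχ)
      simp only [pdL_cons (hφ.contDiff ()), pd_const_mul _ ((hφ.pdL γ).contDiff ())]
      refine integral_congr_ae (.of_forall fun z => ?_)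
      simp only [wt_cons, pow_add]
      ring
  | add ℓ ℓ' h h' ih ih' =>
    obtain ⟨C, hC, h1⟩ := ih
    obtain ⟨C', hC', h1'⟩ := ih'
    refine ⟨C + C', by positivity, fun m φ hφ => (abs_add_le _ _).trans ?_⟩
    rw [add_mul]
    exact add_le_add (h1 m φ hφ) (h1' m φ hφ)
  | congr ℓ ℓ' h h' ih =>
    obtain ⟨C, hC, h1⟩ := ih
    exact ⟨C, hC, fun m φ hφ => by rw [h' m φ hφ]; exact h1 m φ hφ⟩

/-- Evaluation at `x` involves no time and no noise, whence the empty Gaussian vector. It is the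
start of all compositions. -/
lemma Fn.point (x : 𝔼) (ϖ : ι → ℕ) (δ : M → ℝ) (A : M → Matrix ι ι ℝ) (b : M → ι → ℝ) :
    Fn x ϖ δ A b (fun _ => 0) (fun _ => (0 : Matrix ι Empty ℝ)) fun _ ψ => ψ x := by
  refine .congr _ _ (.base (fun _ _ => 1) (UTG.const' 1) []) fun m ψ _ => ?_
  have : ∀ z, mv (0 : Matrix ι Empty ℝ) z = 0 := fun z => by ext i; simp [mv_apply]
  simp [wt, pdL, pt, gmean_zero, this]

lemma Leg.start (A a : M → Matrix ι ι ℝ) (hδ : ∀ m, δ m ∈ Ioc (0 : ℝ) 1) :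
    Leg δ A a (fun _ => 0) fun _ => (0 : Matrix ι Empty ℝ) :=
  ⟨hδ, fun m => ⟨le_rfl, sq_nonneg _⟩, fun m => by simp [gcov_zero]⟩

/-- The composition `ad^{k_1}_{G}(Q) ⋯ ad^{k_n}_{G}(Q)` whose leftmost factor belongs to the last
entry of the list. -/
def opL (G Q : Op ι) : List ℕ → Op ι
  | [], ψ => ψ
  | k :: l, ψ => opL G Q l (adIter G k Q ψ)

lemma nice_opL (F : Frozen ϖ A a b B) (hQ : Nice Q) (l : List ℕ) :
    Nice fun m => opL (genL (A m) (a m) (b m)) (Q m) l := by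
  induction l with
  | nil => exact Nice.id
  | cons k l ih => exact ih.comp (F.nice_genL.adIter hQ k)

/-- Each factor `ad_G^k Q` costs `δ^{-(2k+1)}`; here the first weight count suffices. -/
lemma Fn.comp_opL (F : Frozen ϖ A a b B) (hl : Leg δ A a τ L) (h : Fn x ϖ δ A b τ L ℓ)
    (hQ : DO x ϖ 0 Q) (l : List ℕ) : Fn x ϖ δ A b τ L fun m ψ =>
      δ m ^ (2 * l.sum + l.length) * ℓ m (opL (genL (A m) (a m) (b m)) (Q m) l ψ) := by
  induction l with
  | nil => simpa [opL] using h
  | cons k l ih =>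
    refine .congr _ _ (ih.comp_DO F hl (hQ.adIter F k) (p := 2 * k + 1) fun γ n h1 h2 => by omega)
      fun m ψ _ => ?_
    rw [← mul_assoc, ← pow_add, List.sum_cons, List.length_cons]
    congr 2
    ring

/-- The functions `Ψ_n = Q P_{T_{n-1} - T_n} ⋯ Q P_{T_0 - T_1} φ`. -/
def wchain (A a : M → Matrix ι ι ℝ) (b : M → ι → ℝ) (Q : M → Op ι) (T : M → ℕ → ℝ) (m : M)
    (φ : 𝔼 → ℝ) : ℕ → 𝔼 → ℝ
  | 0 => φ
  | n + 1 => Q m (sg (A m) (a m) (b m) (T m n - T m (n + 1)) (wchain A a b Q T m φ n))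

lemma wchain_reindex (π : N → M) (p : N) (φ : 𝔼 → ℝ) (n : ℕ) :
    wchain (fun p => A (π p)) (fun p => a (π p)) (fun p => b (π p)) (fun p => Q (π p))
      (fun p => T (π p)) p φ n = wchain A a b Q T (π p) φ n := by
  induction n with
  | zero => rfl
  | succ n ih => simp only [wchain, ih]

/-- Decreasing times that start at `δ²`. -/
structure Times (δ : M → ℝ) (T : M → ℕ → ℝ) : Prop where
  hδ : ∀ m, δ m ∈ Ioc (0 : ℝ) 1
  zero : ∀ m, T m 0 = δ m ^ 2
  anti : ∀ m n, T m (n + 1) ≤ T m n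
  nonneg : ∀ m n, 0 ≤ T m n

lemma Times.reindex (h : Times δ T) (φ : N → M) :
    Times (fun n => δ (φ n)) (fun n => T (φ n)) :=
  ⟨fun _ => h.hδ _, fun _ => h.zero _, fun _ => h.anti _, fun _ => h.nonneg _⟩

lemma Times.le (h : Times δ T) (m : M) (n : ℕ) : T m n ≤ δ m ^ 2 := by
  induction n with
  | zero => exact (h.zero m).le
  | succ n ih => exact (h.anti m n).trans ih

lemma Times.mem (h : Times δ T) (m : M) (n : ℕ) : T m n ∈ Icc (0 : ℝ) 1 :=
  ⟨h.nonneg m n, (h.le m n).trans (pow_le_one₀ (h.hδ m).1.le (h.hδ m).2)⟩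

lemma Times.step_mem (h : Times δ T) (m : M) (n : ℕ) : T m n - T m (n + 1) ∈ Icc (0 : ℝ) 1 :=
  ⟨by linarith [h.anti m n], by linarith [(h.mem m n).2, h.nonneg m (n + 1)]⟩

lemma wchain_tg (F : Frozen ϖ A a b B) (hQ : Nice Q) (hT : Times δ T) (m : M) {φ : 𝔼 → ℝ}
    (hφ : TG φ) (n : ℕ) : TG (wchain A a b Q T m φ n) := by
  induction n with
  | zero => exact hφ
  | succ n ih => exact hQ.tg m ((F.nice_sg fun m => hT.step_mem m n).tg m ih)

/-- The chain is peeled off from the left. A factor `Q` costs one power of `δ`, and the semigroup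
behind it advances the time from `T (n + 1)` to `T n`, until `T 0 = δ²` is reached and the
derivatives can be integrated by parts. -/
lemma wchain_bound (D : NonDeg ϖ δ A a c) (F : Frozen ϖ A a b B) (hQ : DO x ϖ 0 Q)
    (hT : Times δ T) (n : ℕ) : ∀ {κ : Type} [Fintype κ] {τ : M → ℝ} {L : M → Matrix ι κ ℝ}
    {ℓ : M → (𝔼 → ℝ) → ℝ}, Leg δ A a τ L → (∀ m, τ m = T m n) → Fn x ϖ δ A b τ L ℓ →
    ∃ C : ℝ, 0 ≤ C ∧ ∀ m φ, TG φ →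
      δ m ^ n * |ℓ m (wchain A a b Q T m φ n)| ≤ C * gint x δ A a b m φ := by
  induction n with
  | zero =>
    intro κ _ τ L ℓ hl hτ h
    obtain ⟨C, hC, h1⟩ := h.exists_bound D F hl fun m => (hτ m).trans (hT.zero m)
    exact ⟨C, hC, fun m φ hφ => by simpa [wchain] using h1 m φ hφ⟩
  | succ n ih =>
    intro κ _ τ L ℓ hl hτ h
    have hu : ∀ m, 0 ≤ T m n - T m (n + 1) := fun m => (hT.step_mem m n).1
    have hτu : ∀ m, τ m + (T m n - T m (n + 1)) ≤ δ m ^ 2 := fun m => by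
      have := hT.le m n
      have := hτ m
      linarith
    have h1 := (h.comp_DO F hl hQ (p := 1) fun γ n h1 h2 => by omega).comp_sg F hl hu hτu
    obtain ⟨C, hC, h2⟩ := ih (hl.step F hu hτu) (fun m => by rw [hτ m]; ring) h1
    refine ⟨C, hC, fun m φ hφ => le_of_eq_of_le ?_ (h2 m φ hφ)⟩
    rw [abs_mul, abs_of_nonneg (pow_nonneg (hT.hδ m).1.le 1), ← mul_assoc, ← pow_add]
    rfl

/-- The Taylor expansion, of orders `β`, of `opL l P_{T_n} Ψ_n(x)`. -/
def wtaylor (x : 𝔼) (A a : M → Matrix ι ι ℝ) (b : M → ι → ℝ) (Q : M → Op ι) (T : M → ℕ → ℝ)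
    (β : ℕ → ℕ) (m : M) (φ : 𝔼 → ℝ) : ℕ → List ℕ → ℝ
  | 0, l => opL (genL (A m) (a m) (b m)) (Q m) l (sg (A m) (a m) (b m) (T m 0) φ) x
  | n + 1, l => ∑ k ∈ Finset.range (β n + 1), T m (n + 1) ^ k / k.factorial *
      wtaylor x A a b Q T β m φ n (k :: l)

/-- Expanding `P_{T (n+1)} Q P_{T n - T (n+1)}` in powers of `T (n + 1)` prepends a `k` to the list
in each polynomial term. These terms fall under the induction hypothesis, as `T (n + 1) ^ k ≤
δ^{2k}` pays for `k` commutators. In the remainder, `ad_G^{β n + 1} Q` costs by `hg` only `δ^{-(2 (β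
n + 1) + 1 - g)}`. The time power supplies `δ^{2 (β n + 1)}`, so `δ^g` is gained compared with the
cost `δ^{-1}` of a plain factor `Q`. -/
lemma wtaylor_bound (D : NonDeg ϖ δ A a c) (F : Frozen ϖ A a b B) (hQ : DO x ϖ 0 Q)
    (hT : Times δ T) {β : ℕ → ℕ} {g : ℕ} (hgβ : ∀ i, g ≤ β i)
    (hg : ∀ i γ n, wt ϖ γ ≤ 2 * (β i + 1) + n + 1 → wt (hw ϖ) γ ≤ β i + 1 + 2 →
      wt ϖ γ + g ≤ 2 * (β i + 1) + 1 + n) (n : ℕ) :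
    ∀ l : List ℕ, ∃ C : ℝ, 0 ≤ C ∧ ∀ m φ, TG φ → δ m ^ (2 * l.sum + l.length + n) *
      |opL (genL (A m) (a m) (b m)) (Q m) l (sg (A m) (a m) (b m) (T m n)
        (wchain A a b Q T m φ n)) x - wtaylor x A a b Q T β m φ n l| ≤
      C * δ m ^ g * gint x δ A a b m φ := by
  induction n with
  | zero => exact fun l => ⟨0, le_rfl, fun m φ hφ => by simp [wchain, wtaylor]⟩
  | succ n ih =>
    intro l
    choose C hC hCb using ih
    -- The intermediate time `u` of the remainder joins the index, so that `K` is uniform in it.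
    let M' := {p : M × ℝ // 0 ≤ p.2 ∧ p.2 ≤ T p.1 n}
    let π : M' → M := fun p => p.1.1
    have hp : β n + 1 + (β n + 1) + 1 = (2 * (β n + 1) + 1 - g) + g := by
      have := hgβ n; omega
    obtain ⟨K, hK, hKb⟩ : ∃ K : ℝ, 0 ≤ K ∧ ∀ m, ∀ u ∈ Icc (0 : ℝ) (T m n), ∀ φ, TG φ →
        δ m ^ (n + (2 * (β n + 1) + 1 - g) + (2 * l.sum + l.length)) *
        |opL (genL (A m) (a m) (b m)) (Q m) l (sg (A m) (a m) (b m) u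
          (adIter (genL (A m) (a m) (b m)) (β n + 1) (Q m) (sg (A m) (a m) (b m) (T m n - u)
            (wchain A a b Q T m φ n)))) x| ≤ K * gint x δ A a b m φ := by
      have F' := F.reindex π
      have hQ' := hQ.reindex π
      have hT' := hT.reindex π
      have hl0 := Leg.start (fun p => A (π p)) (fun p => a (π p)) hT'.hδ
      have h0 := (Fn.point x ϖ (fun p => δ (π p)) (fun p => A (π p)) (fun p => b (π p))).comp_opL
        F' hl0 hQ' l
      have hu : ∀ p : M', 0 ≤ p.1.2 := fun p => p.2.1
      have hτu : ∀ p : M', 0 + p.1.2 ≤ δ (π p) ^ 2 := fun p => by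
        rw [zero_add]; exact p.2.2.trans (hT.le _ _)
      have hl1 := hl0.step F' hu hτu
      have h1 := (h0.comp_sg F' hl0 hu hτu).comp_DO F' hl1 (hQ'.adIter F' (β n + 1))
        (p := 2 * (β n + 1) + 1 - g) fun γ i h1 h2 => by
          have := hg n γ i h1 h2
          omega
      have hu2 : ∀ p : M', 0 ≤ T (π p) n - p.1.2 := fun p => sub_nonneg.2 p.2.2
      have hτu2 : ∀ p : M', 0 + p.1.2 + (T (π p) n - p.1.2) ≤ δ (π p) ^ 2 := fun p => by
        have := hT.le (π p) n
        linarith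
      have h2 := h1.comp_sg F' hl1 hu2 hτu2
      obtain ⟨K, hK, hKb⟩ := wchain_bound (D.reindex π) F' hQ' hT' n (hl1.step F' hu2 hτu2)
        (fun p => by ring) h2
      refine ⟨K, hK, fun m u hu φ hφ => le_of_eq_of_le ?_ (hKb ⟨(m, u), hu⟩ φ hφ)⟩
      have hd := (hT.hδ m).1.le
      have e : ∀ (r : ℝ) (i j k : ℕ), δ m ^ (i + j + k) * |r| =
          δ m ^ i * |δ m ^ j * (δ m ^ k * r)| := fun r i j k => by
        rw [abs_mul, abs_mul, abs_of_nonneg (pow_nonneg hd j), abs_of_nonneg (pow_nonneg hd k),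
          pow_add, pow_add]
        ring
      rw [wchain_reindex (A := A) (a := a) (b := b) (Q := Q) (T := T) π ⟨(m, u), hu⟩ φ n]
      exact e _ _ _ _
    refine ⟨K + ∑ k ∈ Finset.range (β n + 1), C (k :: l), add_nonneg hK
      (Finset.sum_nonneg fun k _ => hC _), fun m φ hφ => ?_⟩
    have hd := (hT.hδ m).1
    have hI := gint_nonneg x δ A a b m φ
    set P := δ m ^ (2 * l.sum + l.length + (n + 1)) with hP
    have hP0 : 0 < P := pow_pos hd _
    set S := T m (n + 1) with hS
    have hS0 : 0 ≤ S := hT.nonneg m _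
    have hS1 : S ≤ δ m ^ 2 := hT.le m _
    have hSk : ∀ k, S ^ k ≤ δ m ^ (2 * k) := fun k => by
      rw [pow_mul]; exact pow_le_pow_left₀ hS0 hS1 k
    set E := n + (2 * (β n + 1) + 1 - g) + (2 * l.sum + l.length) with hE
    have h1 := conj_taylor F hQ.nice (nice_opL F hQ.nice l) (wchain_tg F hQ.nice hT m hφ n) x m
      (s := S) (n := β n) (K := K * gint x δ A a b m φ / δ m ^ E) (hT.mem m n).2
      ⟨hS0, hT.anti m n⟩ fun u hu => by
        rw [le_div_iff₀ (pow_pos hd _), mul_comm]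
        exact hKb m u hu φ hφ
    set X := ∑ k ∈ Finset.range (β n + 1), S ^ k / k.factorial *
        opL (genL (A m) (a m) (b m)) (Q m) l (adIter (genL (A m) (a m) (b m)) k (Q m)
          (sg (A m) (a m) (b m) (T m n) (wchain A a b Q T m φ n))) x with hX
    have h2 : P * (K * gint x δ A a b m φ / δ m ^ E * S ^ (β n + 1)) ≤
        K * δ m ^ g * gint x δ A a b m φ := by
      have h3 : P * δ m ^ (2 * (β n + 1)) = δ m ^ g * δ m ^ E := by
        rw [hP, ← pow_add, ← pow_add]
        congr 1
        have := hgβ n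
        omega
      calc P * (K * gint x δ A a b m φ / δ m ^ E * S ^ (β n + 1))
          ≤ P * (K * gint x δ A a b m φ / δ m ^ E * δ m ^ (2 * (β n + 1))) := by
            gcongr
            exact hSk _
        _ = (P * δ m ^ (2 * (β n + 1))) * (K * gint x δ A a b m φ / δ m ^ E) := by ring
        _ = _ := by
            rw [h3]
            have := (pow_pos hd E).ne'
            field_simp
    have h4 : P * |X - wtaylor x A a b Q T β m φ (n + 1) l| ≤
        (∑ k ∈ Finset.range (β n + 1), C (k :: l)) * δ m ^ g * gint x δ A a b m φ := by
      rw [hX, wtaylor, ← Finset.sum_sub_distrib, Finset.sum_mul, Finset.sum_mul]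
      refine (mul_le_mul_of_nonneg_left (Finset.abs_sum_le_sum_abs _ _) hP0.le).trans ?_
      rw [Finset.mul_sum]
      refine Finset.sum_le_sum fun k _ => ?_
      have h5 := hCb (k :: l) m φ hφ
      rw [← mul_sub, abs_mul, abs_of_nonneg (by positivity)]
      refine le_trans ?_ h5
      have hk1 : (1 : ℝ) ≤ k.factorial := by exact_mod_cast Nat.one_le_iff_ne_zero.2 k.factorial_ne_zero
      have hk : S ^ k / k.factorial ≤ δ m ^ (2 * k) :=
        (div_le_self (pow_nonneg hS0 k) hk1).trans (hSk k)
      have hpow : P * δ m ^ (2 * k) = δ m ^ (2 * (k :: l).sum + (k :: l).length + n) := by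
        rw [hP, ← pow_add, List.sum_cons, List.length_cons]
        congr 1
        ring
      rw [← mul_assoc, ← hpow]
      refine mul_le_mul_of_nonneg_right (mul_le_mul_of_nonneg_left hk hP0.le) (abs_nonneg _)
    calc P * |opL (genL (A m) (a m) (b m)) (Q m) l (sg (A m) (a m) (b m) S
          (wchain A a b Q T m φ (n + 1))) x - wtaylor x A a b Q T β m φ (n + 1) l|
        ≤ P * (K * gint x δ A a b m φ / δ m ^ E * S ^ (β n + 1)) +
          P * |X - wtaylor x A a b Q T β m φ (n + 1) l| := by
          rw [← mul_add]
          refine mul_le_mul_of_nonneg_left ?_ hP0.le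
          exact (abs_sub_le _ X _).trans (add_le_add h1 le_rfl)
      _ ≤ K * δ m ^ g * gint x δ A a b m φ +
          (∑ k ∈ Finset.range (β n + 1), C (k :: l)) * δ m ^ g * gint x δ A a b m φ :=
          add_le_add h2 h4
      _ = _ := by ring

end WeakBound


/-! ### Transition densities, compositions of them, and their tests against functions of `y`. -/

section Kernel

variable {ι : Type} [Fintype ι] [DecidableEq ι]

local notation "𝔼" => EuclideanSpace ℝ ι

/-- The derivative of the Gaussian is the Gaussian times a linear form, so the bounds propagate by
induction. The convention for the inverse of a singular matrix does no harm, because the exponent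
stays nonpositive. -/
lemma utg_gker {Q : Matrix ι ι ℝ} (hQ : Q.PosSemidef) :
    UTG fun (_ : Unit) (v : 𝔼) => gker Q v.ofLp := by
  let l : ι → 𝔼 →L[ℝ] ℝ := fun i => EuclideanSpace.proj i
  have hv : ∀ v : 𝔼, v.ofLp ⬝ᵥ (Q⁻¹ *ᵥ v.ofLp) = ∑ i, ∑ k, v i * (Q⁻¹ i k * v k) := fun v => by
    simp only [dotProduct, Matrix.mulVec, Finset.mul_sum]
  have hd : ∀ v : 𝔼, HasFDerivAt (fun v : 𝔼 => gker Q v.ofLp) (gker Q v.ofLp • (-(1 / 2 : ℝ) •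
      ∑ i, ∑ k, (v i • (Q⁻¹ i k • l k) + (Q⁻¹ i k * v k) • l i))) v := by
    intro v
    have h1 : HasFDerivAt (fun v : 𝔼 => ∑ i, ∑ k, v i * (Q⁻¹ i k * v k))
        (∑ i, ∑ k, (v i • (Q⁻¹ i k • l k) + (Q⁻¹ i k * v k) • l i)) v :=
      HasFDerivAt.fun_sum fun i _ => HasFDerivAt.fun_sum fun k _ =>
        ((l i).hasFDerivAt (x := v)).fun_mul (((l k).hasFDerivAt (x := v)).const_mul _)
    have h2 := ((h1.const_mul (-(1 / 2))).exp).const_mul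
      (√((2 * Real.pi) ^ Fintype.card ι * Q.det))⁻¹
    simp only [gker, hv]
    refine h2.congr_fderiv ?_
    rw [smul_smul]
  have hub : UB fun (_ : Unit) (v : 𝔼) => gker Q v.ofLp := by
    refine UB.of_bound (C := (√((2 * Real.pi) ^ Fintype.card ι * Q.det))⁻¹) fun _ v => ?_
    rw [Real.norm_of_nonneg (gker_nonneg _ _), gker]
    refine mul_le_of_le_one_right (by positivity) (Real.exp_le_one_iff.2 ?_)
    have := hQ.inv.dotProduct_mulVec_nonneg v.ofLp
    rw [star_trivial] at this
    linarith
  have hl : ∀ i, UTG fun (_ : Unit) (v : 𝔼) => v i := fun i => UTG.id.coord i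
  intro n
  induction n with
  | zero => exact ⟨fun _ => (continuous_gker Q).comp (PiLp.continuous_ofLp 2 _), hub⟩
  | succ n ih =>
    refine ⟨fun _ v => (hd v).differentiableAt, hub, ?_⟩
    have h3 : UTG fun (_ : Unit) (v : 𝔼) => (-(1 / 2 : ℝ) •
        ∑ i, ∑ k, (v i • (Q⁻¹ i k • l k) + (Q⁻¹ i k * v k) • l i) : 𝔼 →L[ℝ] ℝ) :=
      (UTG.const' (-(1 / 2) : ℝ)).smul (UTG.sum _ fun i _ => UTG.sum _ fun k _ =>
        ((hl i).smul (UTG.const' _)).add (((UTG.const' _).mul (hl k)).smul (UTG.const' _)))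
    have h4 := UTGn.bilin (ContinuousLinearMap.lsmul ℝ ℝ) ih (h3 n)
    convert h4 using 3 with _ v
    exact (hd v).fderiv

variable {x : EuclideanSpace ℝ ι} {ϖ : ι → ℕ} {A a : Matrix ι ι ℝ} {b : ι → ℝ} {B : ℝ} {Q : Op ι}

lemma sqm_det_ne {G : Matrix ι ι ℝ} (hG : G.PosDef) : (sqm G).det ≠ 0 := fun h0 =>
  hG.det_pos.ne' (by rw [← sqm_mul hG.posSemidef, Matrix.det_mul, h0, zero_mul])

lemma sg_eq_gker {t : ℝ} (hG : (gcov A a t).PosDef) {ψ : 𝔼 → ℝ} (hψ : Continuous ψ) (ξ : 𝔼) :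
    sg A a b t ψ ξ = ∫ y, ψ y * gker (gcov A a t) (y.ofLp - (gmean A b t ξ).ofLp) := by
  rw [sg, integral_add_mv (sqm_det_ne hG) _ hψ, sqm_mul hG.posSemidef]

lemma integrable_gker (F : Frozen ϖ (fun _ : Unit => A) (fun _ => a) (fun _ => b) B) {t : ℝ}
    (ht : t ∈ Icc (0 : ℝ) 1) (hG : (gcov A a t).PosDef) {ψ : 𝔼 → ℝ} (hψ : TG ψ) (ξ : 𝔼) :
    Integrable fun y => ψ y * gker (gcov A a t) (y.ofLp - (gmean A b t ξ).ofLp) := by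
  have h1 := sg_integrable (t := fun _ => t) F (fun _ => ht) hψ () ξ
  have h2 := integrable_mul_gker (sqm_det_ne hG) (gmean A b t ξ) (hψ.cont ()) h1
  rwa [sqm_mul hG.posSemidef] at h2

/-- The Gaussian transition density. -/
def tker (A a : Matrix ι ι ℝ) (b : ι → ℝ) (t : ℝ) (ξ y : 𝔼) : ℝ :=
  gker (gcov A a t) (y.ofLp - (gmean A b t ξ).ofLp)

lemma utg_tker (F : Frozen ϖ (fun _ : Unit => A) (fun _ => a) (fun _ => b) B) {t : ℝ}
    (ht : t ∈ Icc (0 : ℝ) 1) : UTG fun (_ : Unit) (p : 𝔼 × 𝔼) => tker A a b t p.1 p.2 := by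
  have h1 : UTG fun (_ : Unit) (p : 𝔼 × 𝔼) => p.2 - gmean A b t p.1 :=
    UTG.id.snd.sub ((UTG.gmean (t := fun _ => t) F fun _ => ht).comp UTG.id.fst)
  exact (utg_gker (gcov_posSemidef (F.hpos ()) ht.1)).comp h1

/-- The functions `P_{T_k - T_{k+1}} Q ⋯ P_{T_1 - T_2} Q p_{T_0 - T_1}(·, y)`. -/
def kchain (A a : Matrix ι ι ℝ) (b : ι → ℝ) (Q : Op ι) (T : ℕ → ℝ) (y : 𝔼) : ℕ → 𝔼 → ℝ
  | 0 => fun ξ => tker A a b (T 0 - T 1) ξ y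
  | n + 1 => sg A a b (T (n + 1) - T (n + 2)) (Q (kchain A a b Q T y n))

variable {T : ℕ → ℝ} {δ : ℝ}

lemma utg_sg_slice {Z : Type} [NormedAddCommGroup Z] [NormedSpace ℝ Z]
    (F : Frozen ϖ (fun _ : Unit => A) (fun _ => a) (fun _ => b) B) {t : ℝ}
    (ht : t ∈ Icc (0 : ℝ) 1) {g : Unit → 𝔼 × Z → ℝ} (hg : UTG g) :
    UTG fun (_ : Unit) (p : (𝔼 × Z) × (ι → ℝ)) =>
      g () (gmean A b t p.1.1 + mv (sqm (gcov A a t)) p.2, p.1.2) := by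
  have h1 : UTG fun (_ : Unit) (p : (𝔼 × Z) × (ι → ℝ)) =>
      (gmean A b t p.1.1 + mv (sqm (gcov A a t)) p.2, p.1.2) :=
    ((((UTG.gmean (t := fun _ => t) F fun _ => ht).comp UTG.id.fst.fst)).add
      ((UTG.clm' (mv (sqm (gcov A a t)))).comp UTG.id.snd)).prodMk UTG.id.fst.snd
  exact hg.comp h1

/-- Joint regularity in both points is what permits operators in `ξ` to be interchanged with
integration over `y`. -/
lemma utg_kchain (F : Frozen ϖ (fun _ : Unit => A) (fun _ => a) (fun _ => b) B)
    (hQ : DO x ϖ 0 fun _ : Unit => Q) (hT : Times (fun _ : Unit => δ) fun _ => T) (n : ℕ) :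
    UTG fun (_ : Unit) (p : 𝔼 × 𝔼) => kchain A a b Q T p.2 n p.1 := by
  induction n with
  | zero => exact utg_tker F (hT.step_mem () 0)
  | succ n ih =>
    exact (utg_sg_slice F (hT.step_mem () (n + 1)) (hQ.utg_slice _root_.id ih)).integral mom_gs

lemma Mom.prod {X Y : Type} [NormedAddCommGroup X] [NormedAddCommGroup Y]
    [MeasurableSpace X] [MeasurableSpace Y] [BorelSpace X] [BorelSpace Y]
    [SecondCountableTopology X] [SecondCountableTopology Y] {μ : Measure X} {ν : Measure Y}
    [SFinite ν] (hμ : Mom μ) (hν : Mom ν) : Mom (μ.prod ν) := by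
  intro k
  refine ((hμ k).mul_prod (hν k)).mono' (Continuous.aestronglyMeasurable (by fun_prop))
    (.of_forall fun p => ?_)
  rw [Real.norm_of_nonneg (by positivity), ← mul_pow]
  have h1 : ‖p‖ ≤ ‖p.1‖ + ‖p.2‖ := by
    rw [Prod.norm_def]; exact max_le (by simp) (by simp)
  have := mul_nonneg (norm_nonneg p.1) (norm_nonneg p.2)
  gcongr
  nlinarith

lemma mom_restrict {K : Set 𝔼} (hK : IsCompact K) : Mom ((volume : Measure 𝔼).restrict K) :=
  fun _ => (Continuous.continuousOn (by fun_prop)).integrableOn_compact hK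

lemma sg_integral {t : ℝ} {ν : Measure 𝔼} [SFinite ν] (hν : Mom ν) {g : Unit → 𝔼 × 𝔼 → ℝ}
    (hg : UTG g) (ξ : 𝔼) : sg A a b t (fun ξ => ∫ y, g () (ξ, y) ∂ν) ξ =
      ∫ y, sg A a b t (fun ξ => g () (ξ, y)) ξ ∂ν := by
  unfold sg
  rw [integral_integral_swap]
  have h1 : UTG fun (_ : Unit) (p : (ι → ℝ) × 𝔼) =>
      g () (gmean A b t ξ + mv (sqm (gcov A a t)) p.1, p.2) := by
    refine hg.comp (UTG.prodMk (UTG.add (UTG.const' _) ?_) UTG.id.snd)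
    exact (UTG.clm' (mv (sqm (gcov A a t)))).comp UTG.id.fst
  exact h1.integrable (Mom.prod mom_gs hν) ()

/-- Restricted to a compact set, Lebesgue measure has all moments, and the lemmas on parameter
integrals apply. -/
lemma exists_compact {φ : 𝔼 → ℝ} (hφ : HasCompactSupport φ) :
    ∃ K : Set 𝔼, IsCompact K ∧ ∀ f : 𝔼 → ℝ, ∫ y, φ y * f y = ∫ y in K, φ y * f y := by
  refine ⟨tsupport φ, hφ, fun f => (setIntegral_eq_integral_of_forall_compl_eq_zero fun y hy => ?_).symm⟩
  rw [image_eq_zero_of_notMem_tsupport hy, zero_mul]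

lemma TG.of_compactSupport {φ : 𝔼 → ℝ} (h : ContDiff ℝ ∞ φ) (hc : HasCompactSupport φ) : TG φ := by
  refine UTG.of_iteratedFDeriv (fun _ => h) fun n => ?_
  have h1 : Continuous (iteratedFDeriv ℝ n φ) := h.continuous_iteratedFDeriv (by
    exact_mod_cast le_top)
  obtain ⟨C, hC⟩ := (hc.iteratedFDeriv n).exists_bound_of_continuous h1
  exact ⟨C, 0, (norm_nonneg _).trans (hC 0), fun _ y => by simpa using hC y⟩

/-- By induction on the length: `Q` acts on `ξ` and passes under the integral over `y`, and so does
the semigroup, by Fubini. Only the innermost density has to be nondegenerate, in order to reproduce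
the semigroup applied to `φ`. -/
lemma integral_kchain (F : Frozen ϖ (fun _ : Unit => A) (fun _ => a) (fun _ => b) B)
    (hQ : DO x ϖ 0 fun _ : Unit => Q) (hT : Times (fun _ : Unit => δ) fun _ => T)
    (h01 : (gcov A a (T 0 - T 1)).PosDef) {φ : 𝔼 → ℝ} (hφ : TG φ) (hc : HasCompactSupport φ)
    (n : ℕ) (ξ : 𝔼) : ∫ y, φ y * kchain A a b Q T y n ξ = sg A a b (T n - T (n + 1))
      (wchain (fun _ : Unit => A) (fun _ => a) (fun _ => b) (fun _ => Q) (fun _ => T) () φ n) ξ := by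
  obtain ⟨K, hK, hKint⟩ := exists_compact hc
  have hν := mom_restrict hK
  induction n generalizing ξ with
  | zero => exact (sg_eq_gker h01 (hφ.cont ()) ξ).symm
  | succ n ih =>
    have h1 := utg_kchain F hQ hT n
    have h2 : UTG fun (_ : Unit) (p : 𝔼 × 𝔼) => φ p.2 * kchain A a b Q T p.2 n p.1 :=
      (hφ.comp UTG.id.snd).mul h1
    have h3 := hQ.utg_slice _root_.id h2
    have hsm : ∀ y, ContDiff ℝ ∞ (kchain A a b Q T y n) := fun y =>
      slice_smooth (h1.contDiff ()) y
    have h4 : ∀ y, Q (fun ξ => φ y * kchain A a b Q T y n ξ) =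
        fun ξ => φ y * Q (kchain A a b Q T y n) ξ := fun y =>
      hQ.map_const_mul () (φ y) (hsm y)
    have h5 : (fun ξ => ∫ y in K, Q (fun ξ => φ y * kchain A a b Q T y n ξ) ξ) =
        wchain (fun _ : Unit => A) (fun _ => a) (fun _ => b) (fun _ => Q) (fun _ => T) () φ
          (n + 1) := by
      funext ξ
      have := hQ.integral hν _root_.id h2 () ξ
      refine Eq.trans this.symm ?_
      rw [wchain]
      congr 1
      funext ξ
      rw [← ih ξ, hKint]
    rw [← h5, hKint]
    refine Eq.trans ?_ (sg_integral hν h3 ξ).symm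
    refine integral_congr_ae (.of_forall fun y => ?_)
    change φ y * sg A a b _ (Q (kchain A a b Q T y n)) ξ =
      sg A a b _ (Q fun ξ => φ y * kchain A a b Q T y n ξ) ξ
    rw [h4, sg_const_mul]

lemma utg_opL_slice (F : Frozen ϖ (fun _ : Unit => A) (fun _ => a) (fun _ => b) B)
    (hQ : DO x ϖ 0 fun _ : Unit => Q) (l : List ℕ) {g : Unit → 𝔼 × 𝔼 → ℝ} (hg : UTG g) :
    UTG fun (_ : Unit) (p : 𝔼 × 𝔼) => opL (genL A a b) Q l (fun ξ => g () (ξ, p.2)) p.1 := by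
  induction l generalizing g with
  | nil => exact hg
  | cons k l ih => exact ih ((hQ.adIter F k).utg_slice _root_.id hg)

lemma opL_integral (F : Frozen ϖ (fun _ : Unit => A) (fun _ => a) (fun _ => b) B)
    (hQ : DO x ϖ 0 fun _ : Unit => Q) (l : List ℕ) {ν : Measure 𝔼} (hν : Mom ν)
    {g : Unit → 𝔼 × 𝔼 → ℝ} (hg : UTG g) (ξ : 𝔼) :
    opL (genL A a b) Q l (fun ξ => ∫ y, g () (ξ, y) ∂ν) ξ =
      ∫ y, opL (genL A a b) Q l (fun ξ => g () (ξ, y)) ξ ∂ν := by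
  induction l generalizing g with
  | nil => rfl
  | cons k l ih =>
    have h1 := (hQ.adIter F k).utg_slice _root_.id hg
    refine Eq.trans ?_ (ih h1)
    simp only [opL]
    congr 1
    funext ξ
    exact (hQ.adIter F k).integral hν _root_.id hg () ξ

lemma integral_opL_tker (F : Frozen ϖ (fun _ : Unit => A) (fun _ => a) (fun _ => b) B)
    (hQ : DO x ϖ 0 fun _ : Unit => Q) {t : ℝ} (ht : t ∈ Icc (0 : ℝ) 1)
    (hG : (gcov A a t).PosDef) {φ : 𝔼 → ℝ} (hφ : TG φ) (hc : HasCompactSupport φ) (l : List ℕ)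
    (ξ : 𝔼) : ∫ y, φ y * opL (genL A a b) Q l (fun ξ => tker A a b t ξ y) ξ =
      opL (genL A a b) Q l (sg A a b t φ) ξ := by
  obtain ⟨K, hK, hKint⟩ := exists_compact hc
  have h1 := utg_tker F ht
  have h2 : UTG fun (_ : Unit) (p : 𝔼 × 𝔼) => φ p.2 * tker A a b t p.1 p.2 :=
    (hφ.comp UTG.id.snd).mul h1
  have h3 := opL_integral F hQ l (mom_restrict hK) h2 ξ
  have h4 : sg A a b t φ = fun ξ => ∫ y in K, φ y * tker A a b t ξ y := by
    funext ξ
    rw [← hKint, sg_eq_gker hG (hφ.cont ())]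
    rfl
  rw [h4, hKint]
  refine Eq.trans ?_ h3.symm
  refine integral_congr_ae (.of_forall fun y => ?_)
  exact (congrFun ((nice_opL F hQ.nice l).const_mul () (φ y)
    (ψ := fun ξ => tker A a b t ξ y) ((h1.comp (UTG.id.prodMk (UTG.const' y))))) ξ).symm

/-- The Taylor polynomial of the composition, applied to a function. -/
def taylorSum (G Q : Op ι) (T : ℕ → ℝ) (β : ℕ → ℕ) (x : 𝔼) (ψ : 𝔼 → ℝ) : ℕ → List ℕ → ℝ
  | 0, l => opL G Q l ψ x
  | n + 1, l => ∑ k ∈ Finset.range (β n + 1), T (n + 1) ^ k / k.factorial *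
      taylorSum G Q T β x ψ n (k :: l)

lemma wtaylor_eq {M : Type} (A a : M → Matrix ι ι ℝ) (b : M → ι → ℝ) (Q : M → Op ι)
    (T : M → ℕ → ℝ) (β : ℕ → ℕ) (x : 𝔼) (m : M) (φ : 𝔼 → ℝ) (n : ℕ) (l : List ℕ) :
    wtaylor x A a b Q T β m φ n l = taylorSum (genL (A m) (a m) (b m)) (Q m) (T m) β x
      (sg (A m) (a m) (b m) (T m 0) φ) n l := by
  induction n generalizing l with
  | zero => rfl
  | succ n ih => simp only [wtaylor, taylorSum, ih]

lemma continuous_taylorSum (F : Frozen ϖ (fun _ : Unit => A) (fun _ => a) (fun _ => b) B)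
    (hQ : DO x ϖ 0 fun _ : Unit => Q) {t : ℝ} (ht : t ∈ Icc (0 : ℝ) 1) (β : ℕ → ℕ) (n : ℕ)
    (l : List ℕ) : Continuous fun y => taylorSum (genL A a b) Q T β x
      (fun ξ => tker A a b t ξ y) n l := by
  induction n generalizing l with
  | zero => exact ((utg_opL_slice F hQ l (utg_tker F ht)).cont ()).comp (by fun_prop :
      Continuous fun y : 𝔼 => (x, y))
  | succ n ih => exact continuous_finsetSum _ fun k _ => continuous_const.mul (ih _)

lemma integral_taylorSum (F : Frozen ϖ (fun _ : Unit => A) (fun _ => a) (fun _ => b) B)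
    (hQ : DO x ϖ 0 fun _ : Unit => Q) {t : ℝ} (ht : t ∈ Icc (0 : ℝ) 1)
    (hG : (gcov A a t).PosDef) {φ : 𝔼 → ℝ} (hφ : TG φ) (hc : HasCompactSupport φ)
    (β : ℕ → ℕ) (n : ℕ) (l : List ℕ) :
    ∫ y, φ y * taylorSum (genL A a b) Q T β x (fun ξ => tker A a b t ξ y) n l =
      taylorSum (genL A a b) Q T β x (sg A a b t φ) n l := by
  induction n generalizing l with
  | zero => exact integral_opL_tker F hQ ht hG hφ hc l x
  | succ n ih =>
    have hi : ∀ k, Integrable fun y => φ y * (T (n + 1) ^ k / k.factorial *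
        taylorSum (genL A a b) Q T β x (fun ξ => tker A a b t ξ y) n (k :: l)) := fun k =>
      Continuous.integrable_of_hasCompactSupport ((hφ.cont ()).mul
        (continuous_const.mul (continuous_taylorSum F hQ ht β n _))) hc.mul_right
    simp only [taylorSum, Finset.mul_sum]
    rw [integral_finsetSum _ fun k _ => hi k]
    refine Finset.sum_congr rfl fun k _ => ?_
    rw [← ih, ← integral_const_mul]
    refine integral_congr_ae (.of_forall fun y => ?_)
    simp only
    ring

/-- If `f y > 0`, continuity gives a neighbourhood on which `f` is positive, and a bump supported
there has a positive integral against `f`. -/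
lemma le_zero_of_integral_bump {f : 𝔼 → ℝ} (hf : Continuous f)
    (h : ∀ φ : 𝔼 → ℝ, ContDiff ℝ ∞ φ → HasCompactSupport φ → (∀ y, 0 ≤ φ y) →
      ∫ y, φ y * f y ≤ 0) (y : 𝔼) : f y ≤ 0 := by
  by_contra! hy
  obtain ⟨r, hr, hball⟩ := Metric.continuous_iff.1 hf y (f y) hy
  let φ : ContDiffBump y := ⟨r / 4, r / 2, by positivity, by linarith⟩
  have h1 := h φ φ.contDiff φ.hasCompactSupport fun y => φ.nonneg
  have hpos : ∀ z, 0 ≤ φ z * f z := fun z => by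
    by_cases hz : dist z y < r
    · have := hball z hz
      rw [Real.dist_eq, abs_lt] at this
      exact mul_nonneg φ.nonneg (by linarith)
    · rw [φ.zero_of_le_dist (by show r / 2 ≤ dist z y; linarith), zero_mul]
  have hc : Continuous fun z => φ z * f z := φ.continuous.mul hf
  have h2 : 0 < ∫ z, φ z * f z := by
    refine Continuous.integral_pos_of_hasCompactSupport_nonneg_nonzero hc
      φ.hasCompactSupport.mul_right hpos (x := y) ?_
    rw [φ.one_of_mem_closedBall (Metric.mem_closedBall_self φ.rIn_pos.le), one_mul]
    exact hy.ne'
  linarith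

end Kernel


/-! ### From tested bounds to pointwise bounds. -/

section Pointwise

variable {M ι : Type} [Fintype ι] [DecidableEq ι]

local notation "𝔼" => EuclideanSpace ℝ ι

/-- The residual of the Taylor expansion of the composition of `n` semigroups. -/
def resid (A a : Matrix ι ι ℝ) (b : ι → ℝ) (Q : Op ι) (T : ℕ → ℝ) (β : ℕ → ℕ) (x : 𝔼) (n : ℕ)
    (y : 𝔼) : ℝ :=
  kchain A a b Q T y n x - taylorSum (genL A a b) Q T β x (fun ξ => tker A a b (T 0) ξ y) n []

variable {x : EuclideanSpace ℝ ι} {ϖ : ι → ℕ} {A a : M → Matrix ι ι ℝ} {b : M → ι → ℝ} {B c : ℝ}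
  {δ : M → ℝ} {Q : M → Op ι} {T : M → ℕ → ℝ}

/-- Tested against `φ ≥ 0`, the residual becomes the difference estimated in `wtaylor_bound`, while
`gint` becomes the integral of `φ` times the Gaussian density. Thus the residual and its negative
are both dominated weakly by a continuous function, hence pointwise. -/
lemma resid_bound (D : NonDeg ϖ δ A a c) (F : Frozen ϖ A a b B) (hQ : DO x ϖ 0 Q)
    (hT : Times δ T) {β : ℕ → ℕ} {g : ℕ} (hgβ : ∀ i, g ≤ β i)
    (hg : ∀ i γ n, wt ϖ γ ≤ 2 * (β i + 1) + n + 1 → wt (hw ϖ) γ ≤ β i + 1 + 2 →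
      wt ϖ γ + g ≤ 2 * (β i + 1) + 1 + n)
    (h01 : ∀ m, (gcov (A m) (a m) (T m 0 - T m 1)).PosDef) {n : ℕ} (hn : ∀ m, T m (n + 1) = 0) :
    ∃ C : ℝ, 0 ≤ C ∧ ∀ m y, δ m ^ n * |resid (A m) (a m) (b m) (Q m) (T m) β x n y| ≤
      C * δ m ^ g * gker ((2 : ℝ) • gcov (A m) (a m) (δ m ^ 2))
        (y.ofLp - (gmean (A m) (b m) (δ m ^ 2) x).ofLp) := by
  obtain ⟨C, hC, h⟩ := wtaylor_bound D F hQ hT hgβ hg n []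
  refine ⟨C, hC, fun m y => ?_⟩
  have F' := F.reindex fun _ : Unit => m
  have hQ' := hQ.reindex fun _ : Unit => m
  have hT' := hT.reindex fun _ : Unit => m
  have hd := (hT.hδ m).1
  have h00 : (gcov (A m) (a m) (T m 0)).PosDef := by
    rw [hT.zero]; exact D.posDef F hT.hδ m
  have c1 : Continuous fun y => kchain (A m) (a m) (b m) (Q m) (T m) y n x :=
    ((utg_kchain F' hQ' hT' n).cont ()).comp (by fun_prop : Continuous fun y : 𝔼 => (x, y))
  have c2 : Continuous fun y => taylorSum (genL (A m) (a m) (b m)) (Q m) (T m) β x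
      (fun ξ => tker (A m) (a m) (b m) (T m 0) ξ y) n [] :=
    continuous_taylorSum F' hQ' (hT.mem m 0) β n []
  have c3 : Continuous fun y : 𝔼 => gker ((2 : ℝ) • gcov (A m) (a m) (δ m ^ 2))
      (y.ofLp - (gmean (A m) (b m) (δ m ^ 2) x).ofLp) :=
    (continuous_gker _).comp ((PiLp.continuous_ofLp 2 _).sub continuous_const)
  have key : ∀ s : ℝ, |s| = 1 → s * (δ m ^ n * resid (A m) (a m) (b m) (Q m) (T m) β x n y) ≤
      C * δ m ^ g * gker ((2 : ℝ) • gcov (A m) (a m) (δ m ^ 2))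
        (y.ofLp - (gmean (A m) (b m) (δ m ^ 2) x).ofLp) := by
    intro s hs
    refine sub_nonpos.1 (le_zero_of_integral_bump
      (f := fun y => s * (δ m ^ n * resid (A m) (a m) (b m) (Q m) (T m) β x n y) -
        C * δ m ^ g * gker ((2 : ℝ) • gcov (A m) (a m) (δ m ^ 2))
          (y.ofLp - (gmean (A m) (b m) (δ m ^ 2) x).ofLp))
      ((continuous_const.mul (continuous_const.mul (c1.sub c2))).sub (continuous_const.mul c3))
      (fun φ hφ hc hpos => ?_) y)
    have htg := TG.of_compactSupport hφ hc
    have hcφ := htg.cont ()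
    have i1 : ∀ f : 𝔼 → ℝ, Continuous f → Integrable fun y => φ y * f y := fun f hf =>
      (hcφ.mul hf).integrable_of_hasCompactSupport hc.mul_right
    have e1 := integral_kchain F' hQ' hT' (h01 m) htg hc n x
    have e2 := integral_taylorSum (T := T m) F' hQ' (hT.mem m 0) h00 htg hc β n []
    have e3 : ∀ y, φ y * (s * (δ m ^ n * resid (A m) (a m) (b m) (Q m) (T m) β x n y) -
        C * δ m ^ g * gker ((2 : ℝ) • gcov (A m) (a m) (δ m ^ 2))
          (y.ofLp - (gmean (A m) (b m) (δ m ^ 2) x).ofLp)) =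
        s * δ m ^ n * (φ y * kchain (A m) (a m) (b m) (Q m) (T m) y n x -
          φ y * taylorSum (genL (A m) (a m) (b m)) (Q m) (T m) β x
            (fun ξ => tker (A m) (a m) (b m) (T m 0) ξ y) n []) -
        C * δ m ^ g * (φ y * gker ((2 : ℝ) • gcov (A m) (a m) (δ m ^ 2))
          (y.ofLp - (gmean (A m) (b m) (δ m ^ 2) x).ofLp)) := fun y => by
      rw [resid]; ring
    have e4 : ∫ y, φ y * gker ((2 : ℝ) • gcov (A m) (a m) (δ m ^ 2))
        (y.ofLp - (gmean (A m) (b m) (δ m ^ 2) x).ofLp) = gint x δ A a b m φ := by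
      simp only [gint, abs_of_nonneg (hpos _)]
    have i12 : Integrable fun y => φ y * kchain (A m) (a m) (b m) (Q m) (T m) y n x -
        φ y * taylorSum (genL (A m) (a m) (b m)) (Q m) (T m) β x
          (fun ξ => tker (A m) (a m) (b m) (T m 0) ξ y) n [] := (i1 _ c1).sub (i1 _ c2)
    simp only [e3]
    rw [integral_sub (i12.const_mul _) ((i1 _ c3).const_mul _),
      integral_const_mul, integral_const_mul, integral_sub (i1 _ c1) (i1 _ c2), e1, e2, e4, hn,
      sub_zero]
    have h1 := h m φ htg
    rw [wtaylor_eq] at h1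
    simp only [opL, List.sum_nil, List.length_nil, mul_zero, zero_add] at h1
    have e5 : wchain (fun _ : Unit => A m) (fun _ => a m) (fun _ => b m) (fun _ => Q m)
        (fun _ => T m) () φ n = wchain A a b Q T m φ n :=
      wchain_reindex (A := A) (a := a) (b := b) (Q := Q) (T := T) (fun _ : Unit => m) () φ n
    rw [e5]
    have h2 : ∀ r : ℝ, s * δ m ^ n * r ≤ δ m ^ n * |r| := fun r => by
      refine (le_abs_self _).trans ?_
      rw [abs_mul, abs_mul, hs, one_mul, abs_of_nonneg (pow_nonneg hd.le n)]
    linarith [h2 (sg (A m) (a m) (b m) (T m n) (wchain A a b Q T m φ n) x -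
      taylorSum (genL (A m) (a m) (b m)) (Q m) (T m) β x (sg (A m) (a m) (b m) (T m 0) φ) n [])]
  have h1 := key 1 (by simp)
  have h2 := key (-1) (by simp)
  have h3 : δ m ^ n * |resid (A m) (a m) (b m) (Q m) (T m) β x n y| =
      |δ m ^ n * resid (A m) (a m) (b m) (Q m) (T m) β x n y| := by
    rw [abs_mul, abs_of_nonneg (pow_nonneg hd.le n)]
  rw [h3]
  exact abs_le'.2 ⟨by linarith, by linarith⟩

end Pointwise

/-! ### Explicit upper bounds for the Gaussian density. -/

section KernelBound

variable {M ι : Type} [Fintype ι] [DecidableEq ι]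

lemma le_det_of_le_quadratic {G : Matrix ι ι ℝ} (hG : G.PosSemidef) {c : ℝ} (hc : 0 ≤ c)
    (h : ∀ u, c * (u ⬝ᵥ u) ≤ u ⬝ᵥ (G *ᵥ u)) : c ^ Fintype.card ι ≤ G.det := by
  rw [hG.isHermitian.det_eq_prod_eigenvalues, ← Finset.card_univ, ← Finset.prod_const]
  refine Finset.prod_le_prod (fun _ _ => hc) fun i _ => ?_
  have h1 := h (hG.isHermitian.eigenvectorBasis i).ofLp
  have h2 := hG.isHermitian.eigenvalues_eq i
  have h3 : (hG.isHermitian.eigenvectorBasis i).ofLp ⬝ᵥ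
      (hG.isHermitian.eigenvectorBasis i).ofLp = 1 := by
    have := hG.isHermitian.eigenvectorBasis.orthonormal.1 i
    rw [EuclideanSpace.norm_eq, Real.sqrt_eq_one] at this
    simpa [dotProduct, pow_two] using this
  rw [h3, mul_one] at h1
  simpa using h1.trans_eq h2.symm

/-- Conjugation by the diagonal matrix of the `1 / l i` reduces this to a multiple of the identity
as lower bound, where every eigenvalue is at least `c`. -/
lemma le_det_of_le_diagonal {G : Matrix ι ι ℝ} (hG : G.PosSemidef) {c : ℝ} (hc : 0 ≤ c)
    {l : ι → ℝ} (hl : ∀ i, 0 < l i) (h : ∀ u, c * ∑ i, l i ^ 2 * u i ^ 2 ≤ u ⬝ᵥ (G *ᵥ u)) :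
    c ^ Fintype.card ι * ∏ i, l i ^ 2 ≤ G.det := by
  let D : Matrix ι ι ℝ := Matrix.diagonal fun i => (l i)⁻¹
  have hps : (D * G * D).PosSemidef := by
    have := hG.mul_mul_conjTranspose_same D
    rwa [Matrix.diagonal_conjTranspose, star_trivial] at this
  have h1 := le_det_of_le_quadratic hps hc fun u => by
    have h2 := h (D *ᵥ u)
    have h3 : u ⬝ᵥ (D * G * D) *ᵥ u = (D *ᵥ u) ⬝ᵥ (G *ᵥ (D *ᵥ u)) := by
      rw [← Matrix.mulVec_mulVec, ← Matrix.mulVec_mulVec, Matrix.dotProduct_mulVec,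
        ← Matrix.mulVec_transpose, Matrix.diagonal_transpose]
    rw [h3]
    refine le_of_eq_of_le ?_ h2
    congr 1
    refine Finset.sum_congr rfl fun i _ => ?_
    have := (hl i).ne'
    rw [Matrix.mulVec_diagonal]
    field_simp
  have hD : D.det * ∏ i, l i = 1 := by
    rw [Matrix.det_diagonal, ← Finset.prod_mul_distrib]
    exact Finset.prod_eq_one fun i _ => inv_mul_cancel₀ (hl i).ne'
  have h4 := mul_le_mul_of_nonneg_right h1
    (Finset.prod_nonneg fun i _ => sq_nonneg (l i) : 0 ≤ ∏ i, l i ^ 2)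
  rw [Matrix.det_mul, Matrix.det_mul] at h4
  refine h4.trans_eq ?_
  rw [Finset.prod_pow]
  calc D.det * G.det * D.det * (∏ i, l i) ^ 2 = G.det * (D.det * ∏ i, l i) ^ 2 := by ring
    _ = G.det := by rw [hD]; ring

/-- With `G = L Lᵀ` this is the Cauchy–Schwarz inequality in each column of `L`. -/
lemma quadratic_le_sum_diag {G : Matrix ι ι ℝ} (hG : G.PosSemidef) (u : ι → ℝ) :
    u ⬝ᵥ (G *ᵥ u) ≤ Fintype.card ι * ∑ i, G i i * u i ^ 2 := by
  have h0 := sqm_mul hG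
  set L := sqm G
  have h1 : u ⬝ᵥ (G *ᵥ u) = ∑ k, (∑ i, L i k * u i) ^ 2 := by
    rw [← h0, ← Matrix.mulVec_mulVec, Matrix.dotProduct_mulVec, ← Matrix.mulVec_transpose]
    simp [dotProduct, Matrix.mulVec, Matrix.transpose_apply, pow_two]
  have h2 : ∀ i, G i i = ∑ k, L i k ^ 2 := fun i => by
    rw [← h0]; simp [Matrix.mul_apply, pow_two]
  rw [h1]
  simp only [h2, Finset.sum_mul]
  rw [Finset.sum_comm, Finset.mul_sum]
  refine Finset.sum_le_sum fun k _ => ?_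
  have := sq_sum_le_card_mul_sum_sq (s := Finset.univ) (f := fun i => L i k * u i)
  simpa [mul_pow] using this

/-- Duality of quadratic forms: an upper bound for `G` is a lower bound for `G⁻¹`. It follows by
expanding the nonnegative form of `G` at `w - C G⁻¹ v` with `w i = v i / l i`. -/
lemma sum_div_le_quadratic_inv {G : Matrix ι ι ℝ} (hG : G.PosDef) {C : ℝ} (hC : 0 < C)
    {l : ι → ℝ} (hl : ∀ i, 0 < l i) (h : ∀ u, u ⬝ᵥ (G *ᵥ u) ≤ C * ∑ i, l i * u i ^ 2)
    (v : ι → ℝ) : ∑ i, v i ^ 2 / l i ≤ C * (v ⬝ᵥ (G⁻¹ *ᵥ v)) := by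
  have hdet : IsUnit G.det := isUnit_iff_ne_zero.2 hG.det_pos.ne'
  set q := G⁻¹ *ᵥ v with hq
  have hGq : G *ᵥ q = v := by
    rw [hq, Matrix.mulVec_mulVec, Matrix.mul_nonsing_inv _ hdet, Matrix.one_mulVec]
  set w : ι → ℝ := fun i => v i / l i with hw
  have h1 := hG.posSemidef.dotProduct_mulVec_nonneg (w - C • q)
  have hs : w ⬝ᵥ v = ∑ i, v i ^ 2 / l i := Finset.sum_congr rfl fun i _ => by
    simp only [hw]; ring
  have hsym : q ⬝ᵥ (G *ᵥ w) = w ⬝ᵥ v := by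
    rw [Matrix.dotProduct_mulVec, ← Matrix.mulVec_transpose,
      show Gᵀ = G from hG.isHermitian, hGq, dotProduct_comm]
  have h2 : w ⬝ᵥ (G *ᵥ w) ≤ C * ∑ i, v i ^ 2 / l i := by
    refine (h w).trans_eq ?_
    congr 1
    refine Finset.sum_congr rfl fun i _ => ?_
    have := (hl i).ne'
    simp only [hw]
    field_simp
  rw [star_trivial, Matrix.mulVec_sub, sub_dotProduct, dotProduct_sub, dotProduct_sub,
    Matrix.mulVec_smul, hGq, smul_dotProduct, dotProduct_smul, smul_dotProduct, dotProduct_smul,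
    hsym, hs, dotProduct_comm q v] at h1
  simp only [smul_eq_mul] at h1
  have h3 : 0 ≤ C * (C * (v ⬝ᵥ q) - ∑ i, v i ^ 2 / l i) := by linarith
  have := nonneg_of_mul_nonneg_right h3 hC
  linarith

variable {x : EuclideanSpace ℝ ι} {ϖ : ι → ℕ} {A a : M → Matrix ι ι ℝ} {b : M → ι → ℝ} {B c : ℝ}
  {δ : M → ℝ}

lemma Frozen.exists_gcov_diag_le (F : Frozen ϖ A a b B) : ∃ C : ℝ, 0 < C ∧ ∀ m,
    ∀ t ∈ Ioc (0 : ℝ) 1, ∀ i, gcov (A m) (a m) t i i ≤ C * t ^ ϖ i := by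
  obtain ⟨K, hK0, hK⟩ := exists_small_time (ι := ι) B
  refine ⟨K + |B| + 1, by positivity, fun m t ht i => ?_⟩
  have ht' : t ∈ Icc (0 : ℝ) 1 := ⟨ht.1.le, ht.2⟩
  obtain ⟨-, h2, -, h4⟩ := hK (A m) (a m) (b m) (F.hA m) (F.ha m) (F.hb m) t ht' i
  have ht0 := ht.1
  have hB := abs_nonneg B
  rcases F.hϖ i with hi | hi <;> rw [hi]
  · have h5 := (abs_le.1 (h2 i)).2
    rw [Matrix.sub_apply, Matrix.smul_apply, smul_eq_mul] at h5
    have h6 : a m i i ≤ |B| := (le_abs_self _).trans ((F.ha m i i).trans (le_abs_self B))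
    have h7 : t ^ 2 ≤ t := by nlinarith [ht.2]
    nlinarith
  · have h5 := h4 fun k l hkl => by
      have := F.hdeg m k l hkl
      exact ⟨fun e => by rw [e] at this; omega, fun e => by rw [e] at this; omega⟩
    have h6 := (abs_le.1 h5).2
    nlinarith [pow_pos ht0 3]

lemma Frozen.exists_gmean_sub_le (F : Frozen ϖ A a b B) (x : EuclideanSpace ℝ ι) :
    ∃ C : ℝ, 0 ≤ C ∧ ∀ m, ∀ t ∈ Ioc (0 : ℝ) 1, ∀ i,
      |gmean (A m) (b m) t x i - x i - t * ((A m *ᵥ x.ofLp) i + b m i)| ≤ C * t ^ 2 := by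
  obtain ⟨K, hK0, hK⟩ := exists_small_time (ι := ι) B
  refine ⟨K * ∑ k, |x k| + K, by positivity, fun m t ht i => ?_⟩
  have ht' : t ∈ Icc (0 : ℝ) 1 := ⟨ht.1.le, ht.2⟩
  obtain ⟨h1, -, h3, -⟩ := hK (A m) (a m) (b m) (F.hA m) (F.ha m) (F.hb m) t ht' i
  rw [gmean_apply]
  have e : (fl (A m) t *ᵥ x.ofLp) i + driftInt (A m) (b m) t i - x i -
      t * ((A m *ᵥ x.ofLp) i + b m i) =
      ((fl (A m) t - 1 - t • A m) *ᵥ x.ofLp) i + (driftInt (A m) (b m) t - t • b m) i := by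
    rw [Matrix.sub_mulVec, Matrix.sub_mulVec, Matrix.smul_mulVec, Matrix.one_mulVec]
    simp only [Pi.sub_apply, Pi.smul_apply, smul_eq_mul]
    ring
  rw [e, add_mul]
  refine (abs_add_le _ _).trans (add_le_add ?_ h1)
  rw [Matrix.mulVec, dotProduct, mul_assoc, mul_comm _ (t ^ 2), ← mul_assoc, Finset.mul_sum]
  refine (Finset.abs_sum_le_sum_abs _ _).trans (Finset.sum_le_sum fun k _ => ?_)
  rw [abs_mul]
  exact mul_le_mul_of_nonneg_right (h3 k).2.2 (abs_nonneg _)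

/-- Nondegeneracy bounds the determinant from below and yields the prefactor. The upper bound of the
diagonal of the covariance yields the decay. Replacing the exact mean by `x + t V₀(x)` costs only a
constant factor. -/
lemma NonDeg.exists_gker_le (D : NonDeg ϖ δ A a c) (F : Frozen ϖ A a b B)
    (hδ : ∀ m, δ m ∈ Ioc (0 : ℝ) 1) (x : EuclideanSpace ℝ ι) : ∃ C c' : ℝ, 0 < C ∧ 0 < c' ∧
    ∀ m (y : EuclideanSpace ℝ ι), gker ((2 : ℝ) • gcov (A m) (a m) (δ m ^ 2))
      (y.ofLp - (gmean (A m) (b m) (δ m ^ 2) x).ofLp) ≤ C * (∏ i, δ m ^ ϖ i)⁻¹ *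
      Real.exp (-c' * ∑ i, (y i - x i - (δ m ^ 2) * ((A m *ᵥ x.ofLp) i + b m i)) ^ 2 /
        (δ m ^ 2) ^ ϖ i) := by
  obtain ⟨K, hK, hdiag⟩ := F.exists_gcov_diag_le
  obtain ⟨K', hK', hmean⟩ := F.exists_gmean_sub_le x
  have hc := D.hc
  obtain ⟨n, hn⟩ : ∃ n : ℝ, n = (Fintype.card ι : ℝ) := ⟨_, rfl⟩
  have hn0 : 0 ≤ n := hn ▸ Nat.cast_nonneg _
  set R : ℝ := 2 * (n * K + 1) with hR
  have hR0 : 0 < R := by positivity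
  refine ⟨(√(c ^ Fintype.card ι))⁻¹ * Real.exp (n * K' ^ 2 / (2 * R)), 1 / (4 * R),
    by positivity, by positivity, fun m y => ?_⟩
  have hd := (hδ m).1
  set t := δ m ^ 2 with ht
  have ht1 : t ∈ Ioc (0 : ℝ) 1 := ⟨by positivity, pow_le_one₀ hd.le (hδ m).2⟩
  have ht0 := ht1.1
  set G := gcov (A m) (a m) t with hGdef
  have hG : G.PosDef := D.posDef F hδ m
  have hG2 : ((2 : ℝ) • G).PosDef := hG.smul (by norm_num)
  set v : ι → ℝ := y.ofLp - (gmean (A m) (b m) t x).ofLp with hv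
  have hdet : c ^ Fintype.card ι * ∏ i, (δ m ^ ϖ i) ^ 2 ≤ (2 * Real.pi) ^ Fintype.card ι *
      ((2 : ℝ) • G).det := by
    have h1 := le_det_of_le_diagonal hG2.posSemidef hc.le (l := fun i => δ m ^ ϖ i)
      (fun i => by positivity) fun u => by
        rw [Matrix.smul_mulVec, dotProduct_smul, smul_eq_mul]
        have h2 := D.nd m u
        have h3 : 0 ≤ c * ∑ i, δ m ^ (2 * ϖ i) * u i ^ 2 := by positivity
        simp only [← pow_mul, mul_comm (ϖ _) 2]
        linarith
    refine h1.trans (le_mul_of_one_le_left hG2.det_pos.le ?_)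
    exact one_le_pow₀ (by linarith [Real.pi_gt_three])
  have hq := sum_div_le_quadratic_inv hG2 hR0 (l := fun i => t ^ ϖ i) (fun i => by positivity)
    (fun u => by
      rw [Matrix.smul_mulVec, dotProduct_smul, smul_eq_mul, hR, mul_assoc]
      refine mul_le_mul_of_nonneg_left ?_ (by norm_num)
      refine (quadratic_le_sum_diag hG.posSemidef u).trans ?_
      have h1 : ∑ i, G i i * u i ^ 2 ≤ K * ∑ i, t ^ ϖ i * u i ^ 2 := by
        rw [Finset.mul_sum]
        refine Finset.sum_le_sum fun i _ => ?_
        rw [← mul_assoc]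
        exact mul_le_mul_of_nonneg_right (hdiag m t ht1 i) (sq_nonneg _)
      have h2 : 0 ≤ ∑ i, t ^ ϖ i * u i ^ 2 := by positivity
      rw [← hn]
      nlinarith) v
  have hdiff : ∑ i, (y i - x i - t * ((A m *ᵥ x.ofLp) i + b m i)) ^ 2 / t ^ ϖ i ≤
      2 * (∑ i, v i ^ 2 / t ^ ϖ i) + 2 * (n * K' ^ 2) := by
    have h1 : n * K' ^ 2 = ∑ _ : ι, K' ^ 2 := by simp [hn]
    rw [h1, Finset.mul_sum, Finset.mul_sum, ← Finset.sum_add_distrib]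
    refine Finset.sum_le_sum fun i _ => ?_
    have h2 := hmean m t ht1 i
    set e := gmean (A m) (b m) t x i - x i - t * ((A m *ᵥ x.ofLp) i + b m i) with he
    have h3 : y i - x i - t * ((A m *ᵥ x.ofLp) i + b m i) = v i + e := by
      rw [he, hv]; simp only [Pi.sub_apply]; ring
    have hp : 0 < t ^ ϖ i := by positivity
    -- The error of the mean is `O(t²)`, and `t⁴ ≤ t ^ ϖ i` because the weights are at most `3`.
    have h4 : e ^ 2 ≤ K' ^ 2 * t ^ ϖ i := by
      have h5 : e ^ 2 ≤ (K' * t ^ 2) ^ 2 := sq_le_sq' (by linarith [(abs_le.1 h2).1]) (abs_le.1 h2).2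
      refine h5.trans ?_
      rw [mul_pow, ← pow_mul]
      refine mul_le_mul_of_nonneg_left (pow_le_pow_of_le_one ht0.le ht1.2 ?_) (sq_nonneg _)
      rcases F.hϖ i with hi | hi <;> omega
    rw [h3]
    have h6 : (v i + e) ^ 2 ≤ 2 * v i ^ 2 + 2 * (K' ^ 2 * t ^ ϖ i) := by
      nlinarith [sq_nonneg (v i - e)]
    rw [div_le_iff₀ hp]
    refine h6.trans_eq ?_
    field_simp
  rw [gker, mul_assoc, mul_right_comm]
  have hprod : 0 < ∏ i, δ m ^ ϖ i := Finset.prod_pos fun i _ => by positivity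
  have hfac : (√((2 * Real.pi) ^ Fintype.card ι * ((2 : ℝ) • G).det))⁻¹ ≤
      (√(c ^ Fintype.card ι))⁻¹ * (∏ i, δ m ^ ϖ i)⁻¹ := by
    rw [← mul_inv]
    refine inv_anti₀ (by positivity) (Real.le_sqrt_of_sq_le ?_)
    rw [mul_pow, Real.sq_sqrt (by positivity), ← Finset.prod_pow]
    exact hdet
  have hexp : Real.exp (-(1 / 2) * (v ⬝ᵥ ((2 : ℝ) • G)⁻¹ *ᵥ v)) ≤
      Real.exp (n * K' ^ 2 / (2 * R)) * Real.exp (-(1 / (4 * R)) *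
        ∑ i, (y i - x i - t * ((A m *ᵥ x.ofLp) i + b m i)) ^ 2 / t ^ ϖ i) := by
    rw [← Real.exp_add]
    refine Real.exp_le_exp.2 ?_
    have h1 : ∑ i, (y i - x i - t * ((A m *ᵥ x.ofLp) i + b m i)) ^ 2 / t ^ ϖ i ≤
        2 * (R * (v ⬝ᵥ ((2 : ℝ) • G)⁻¹ *ᵥ v)) + 2 * (n * K' ^ 2) := hdiff.trans (by linarith)
    have h2 := mul_le_mul_of_nonneg_left h1 (by positivity : 0 ≤ 1 / (4 * R))
    have h3 : 1 / (4 * R) * (2 * (R * (v ⬝ᵥ ((2 : ℝ) • G)⁻¹ *ᵥ v)) + 2 * (n * K' ^ 2)) =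
        1 / 2 * (v ⬝ᵥ ((2 : ℝ) • G)⁻¹ *ᵥ v) + n * K' ^ 2 / (2 * R) := by
      field_simp; ring
    linarith
  refine (mul_le_mul hfac hexp (Real.exp_pos _).le (by positivity)).trans_eq ?_
  ring

end KernelBound


/-! ### Measurability of the residual in the times. -/

section Measurability

variable {Λ ι : Type} [Fintype ι] [DecidableEq ι] [MeasurableSpace Λ]

local notation "𝔼" => EuclideanSpace ℝ ι

/-- A partial derivative is a pointwise limit of difference quotients, so no continuity in the
parameter is required. -/
lemma measurable_pd {f : Λ → 𝔼 → ℝ} (hd : ∀ l, Differentiable ℝ (f l))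
    (hm : Measurable fun p : Λ × 𝔼 => f p.1 p.2) (i : ι) :
    Measurable fun p : Λ × 𝔼 => pd i (f p.1) p.2 := by
  refine measurable_of_tendsto_metrizable (f := fun (n : ℕ) (p : Λ × 𝔼) =>
    ((n : ℝ) + 1) • (f p.1 (p.2 + ((n : ℝ) + 1)⁻¹ • EuclideanSpace.single i (1 : ℝ)) - f p.1 p.2))
    (fun n => ?_) (tendsto_pi_nhds.2 fun p => ?_)
  · have h1 : Measurable fun p : Λ × 𝔼 =>
        (p.1, p.2 + ((n : ℝ) + 1)⁻¹ • EuclideanSpace.single i (1 : ℝ)) :=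
      measurable_fst.prodMk (measurable_snd.add_const _)
    exact ((hm.comp h1).sub hm).const_mul ((n : ℝ) + 1)
  · refine (hd p.1 p.2).hasFDerivAt.lim _ ?_
    refine Filter.tendsto_atTop_mono (fun n : ℕ => ?_) tendsto_natCast_atTop_atTop
    rw [Real.norm_of_nonneg (by positivity)]
    linarith

lemma measurable_pdL {f : Λ → 𝔼 → ℝ} (hd : ∀ l, ContDiff ℝ ∞ (f l))
    (hm : Measurable fun p : Λ × 𝔼 => f p.1 p.2) (γ : List ι) :
    Measurable fun p : Λ × 𝔼 => pdL γ (f p.1) p.2 := by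
  induction γ generalizing f with
  | nil => exact hm
  | cons i γ ih =>
    exact ih (fun l => pd_smooth (hd l) i) (measurable_pd (fun l => smooth_diff (hd l)) hm i)

variable {x : EuclideanSpace ℝ ι} {ϖ : ι → ℕ}

lemma DO.measurable {k : ℕ} {Q : Unit → Op ι} (h : DO x ϖ k Q) {f : Λ → 𝔼 → ℝ}
    (hd : ∀ l, ContDiff ℝ ∞ (f l)) (hm : Measurable fun p : Λ × 𝔼 => f p.1 p.2) :
    Measurable fun p : Λ × 𝔼 => Q () (f p.1) p.2 := by
  induction h with
  | term g γ m hg h1 h2 =>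
    exact ((hg.utg.cont ()).measurable.comp measurable_snd).mul (measurable_pdL hd hm γ)
  | add Q Q' h h' ih ih' => exact ih.add ih'
  | congr Q Q' h h' ih =>
    have : (fun p : Λ × 𝔼 => Q' () (f p.1) p.2) = fun p => Q () (f p.1) p.2 := by
      funext p; rw [h' () _ (hd p.1)]
    rw [this]; exact ih

variable {A a : Matrix ι ι ℝ} {b : ι → ℝ} {B : ℝ} {Q : Op ι}

/-- Writing the inverse covariance as the adjugate divided by the determinant gives measurability in
`t`, across singular matrices as well. -/
lemma measurable_tker :
    Measurable fun p : ℝ × 𝔼 × 𝔼 => tker A a b p.1 p.2.1 p.2.2 := by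
  have hG : Continuous fun p : ℝ × 𝔼 × 𝔼 => gcov A a p.1 :=
    (continuous_gcov A a).comp continuous_fst
  have hv : Continuous fun p : ℝ × 𝔼 × 𝔼 => p.2.2.ofLp - (gmean A b p.1 p.2.1).ofLp := by
    refine ((PiLp.continuous_ofLp 2 _).comp continuous_snd.snd).sub
      ((PiLp.continuous_ofLp 2 _).comp ((continuous_gmean A b).comp
        (continuous_fst.prodMk continuous_snd.fst)))
  have hadj : Continuous fun p : ℝ × 𝔼 × 𝔼 => (p.2.2.ofLp - (gmean A b p.1 p.2.1).ofLp) ⬝ᵥ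
      ((gcov A a p.1).adjugate *ᵥ (p.2.2.ofLp - (gmean A b p.1 p.2.1).ofLp)) :=
    hv.dotProduct (hG.matrix_adjugate.matrix_mulVec hv)
  have hdet := hG.matrix_det
  unfold tker gker
  simp only [Matrix.inv_def, Ring.inverse_eq_inv', Matrix.smul_mulVec, dotProduct_smul, smul_eq_mul]
  exact ((hdet.measurable.const_mul _).sqrt.inv).mul
    (((hdet.measurable.inv).mul hadj.measurable).const_mul _).exp

/-- The semigroup is written with its density here, since the square root in the definition of `sg`
is chosen without any measurability in time. This is why all the time steps must be nondegenerate.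
-/
lemma measurable_kchain (F : Frozen ϖ (fun _ : Unit => A) (fun _ => a) (fun _ => b) B)
    (hQ : DO x ϖ 0 fun _ : Unit => Q) {δ : ℝ} {T : Λ → ℕ → ℝ}
    (hT : Times (fun _ : Λ => δ) T) (hTm : ∀ n, Measurable fun l => T l n) (y : 𝔼) (n : ℕ)
    (hpos : ∀ k ≤ n, ∀ l, (gcov A a (T l k - T l (k + 1))).PosDef) :
    Measurable fun p : Λ × 𝔼 => kchain A a b Q (T p.1) y n p.2 := by
  induction n with
  | zero =>
    have h1 : Measurable fun p : Λ × 𝔼 => (T p.1 0 - T p.1 1, p.2, y) :=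
      (((hTm 0).sub (hTm 1)).comp measurable_fst).prodMk (measurable_snd.prodMk measurable_const)
    have h2 := (measurable_tker (A := A) (a := a) (b := b)).comp h1
    simpa only [kchain, Function.comp_def] using h2
  | succ n ih =>
    have hs : ∀ l : Λ, ContDiff ℝ ∞ (kchain A a b Q (T l) y n) := fun l =>
      slice_smooth ((utg_kchain F hQ (hT.reindex fun _ : Unit => l) n).contDiff ()) y
    have h1 := hQ.measurable hs (ih fun k hk => hpos k (by omega))
    have h2 : (fun p : Λ × 𝔼 => kchain A a b Q (T p.1) y (n + 1) p.2) = fun p => ∫ z,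
        Q (kchain A a b Q (T p.1) y n) z * tker A a b (T p.1 (n + 1) - T p.1 (n + 2)) p.2 z := by
      funext p
      rw [kchain, sg_eq_gker (hpos (n + 1) le_rfl p.1) (hQ.smooth () (hs p.1)).continuous]
      rfl
    rw [h2]
    have h3 : Measurable fun q : (Λ × 𝔼) × 𝔼 =>
        Q (kchain A a b Q (T q.1.1) y n) q.2 *
          tker A a b (T q.1.1 (n + 1) - T q.1.1 (n + 2)) q.1.2 q.2 := by
      have m1 : Measurable fun q : (Λ × 𝔼) × 𝔼 => (q.1.1, q.2) :=
        (measurable_fst.comp measurable_fst).prodMk measurable_snd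
      have m2 : Measurable fun q : (Λ × 𝔼) × 𝔼 =>
          (T q.1.1 (n + 1) - T q.1.1 (n + 2), q.1.2, q.2) :=
        (((hTm _).sub (hTm _)).comp (measurable_fst.comp measurable_fst)).prodMk
          ((measurable_snd.comp measurable_fst).prodMk measurable_snd)
      have h4 := h1.comp m1
      have h5 := (measurable_tker (A := A) (a := a) (b := b)).comp m2
      simp only [Function.comp_def] at h4 h5
      exact h4.mul h5
    exact h3.stronglyMeasurable.integral_prod_right.measurable

lemma measurable_taylorSum {G : Op ι} {T : Λ → ℕ → ℝ} (hTm : ∀ n, Measurable fun l => T l n)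
    (β : ℕ → ℕ) (ψ : 𝔼 → ℝ) (n : ℕ) (k : List ℕ) :
    Measurable fun l => taylorSum G Q (T l) β x ψ n k := by
  induction n generalizing k with
  | zero => exact measurable_const
  | succ n ih =>
    exact Finset.measurable_sum _ fun i _ =>
      (((hTm _).pow_const _).div_const _).mul (ih _)

end Measurability

/-! ### Integration over the simplex. -/

section Simplex

variable {j : ℕ} {Δ : ℝ}

lemma measurableSet_openSimplex : MeasurableSet (openSimplex j Δ) := by
  have : openSimplex j Δ = (⋂ i, ⋂ k, ⋂ _ : i < k, {s | s k < s i}) ∩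
      ⋂ k, {s | 0 < s k ∧ s k < Δ} := by
    ext s
    simp [openSimplex, StrictAnti]
  rw [this]
  refine .inter (.iInter fun i => .iInter fun k => .iInter fun _ => ?_) (.iInter fun k => ?_)
  · exact measurableSet_lt (measurable_pi_apply k) (measurable_pi_apply i)
  · exact (measurableSet_lt measurable_const (measurable_pi_apply k)).inter
      (measurableSet_lt (measurable_pi_apply k) measurable_const)

lemma openSimplex_subset : openSimplex j Δ ⊆ simplex j Δ := fun _ h =>
  ⟨h.1.antitone, fun k => ⟨(h.2 k).1.le, (h.2 k).2.le⟩⟩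

/-- The boundary is contained in finitely many hyperplanes. Only the open simplex matters, where all
steps of the semigroup have positive length. -/
lemma simplex_ae_eq : simplex j Δ =ᵐ[volume] openSimplex j Δ := by
  refine (ae_le_set.2 ?_).antisymm openSimplex_subset.eventuallyLE
  have h1 : ∀ (i : Fin j) (r : ℝ), volume {s : Fin j → ℝ | s i = r} = 0 := fun i r =>
    Measure.pi_hyperplane (fun _ : Fin j => (volume : Measure ℝ)) i r
  have h2 : ∀ i k : Fin j, i ≠ k → volume {s : Fin j → ℝ | s i = s k} = 0 := fun i k hik => by
    let p : Submodule ℝ (Fin j → ℝ) := LinearMap.ker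
      ((LinearMap.proj i : (Fin j → ℝ) →ₗ[ℝ] ℝ) - LinearMap.proj k)
    have hp : p ≠ ⊤ := fun h => by
      have : (Pi.single i 1 : Fin j → ℝ) ∈ p := h ▸ Submodule.mem_top
      simp [p, LinearMap.mem_ker, hik.symm] at this
    have := Measure.addHaar_submodule volume p hp
    convert this using 2
    ext s
    simp [p, LinearMap.mem_ker, sub_eq_zero]
  refine measure_mono_null (t := (⋃ i, ⋃ k, ⋃ _ : i ≠ k, {s : Fin j → ℝ | s i = s k}) ∪
    ((⋃ i, {s | s i = 0}) ∪ ⋃ i, {s | s i = Δ})) (fun s hs => ?_) ?_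
  · by_contra hcon
    simp only [mem_union, mem_iUnion, mem_ofPred_eq, not_or, not_exists] at hcon
    obtain ⟨c1, c2, c3⟩ := hcon
    exact hs.2 ⟨fun i k hik => (hs.1.1 hik.le).lt_of_ne fun e => c1 i k hik.ne e.symm,
      fun k => ⟨(hs.1.2 k).1.lt_of_ne' (c2 k), (hs.1.2 k).2.lt_of_ne (c3 k)⟩⟩
  · refine measure_union_null (measure_iUnion_null fun i => measure_iUnion_null fun k =>
      measure_iUnion_null fun hik => h2 i k hik) (measure_union_null ?_ ?_)
    · exact measure_iUnion_null fun i => h1 i 0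
    · exact measure_iUnion_null fun i => h1 i Δ

lemma volume_openSimplex_le (hΔ : 0 ≤ Δ) : volume (openSimplex j Δ) ≤ ENNReal.ofReal (Δ ^ j) := by
  refine (measure_mono (t := Icc 0 fun _ => Δ) fun s hs =>
    ⟨fun k => (hs.2 k).1.le, fun k => (hs.2 k).2.le⟩).trans_eq ?_
  rw [Real.volume_Icc_pi]
  simp [ENNReal.ofReal_pow hΔ]

lemma integrableOn_simplex {f : (Fin j → ℝ) → ℝ}
    (hm : Measurable fun s : openSimplex j Δ => f s) (hΔ : 0 ≤ Δ) {C : ℝ}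
    (hC : ∀ s ∈ openSimplex j Δ, |f s| ≤ C) (hC0 : 0 ≤ C) :
    IntegrableOn f (simplex j Δ) ∧ |∫ s in simplex j Δ, f s| ≤ C * Δ ^ j := by
  have hfin : volume (openSimplex j Δ) < ⊤ :=
    (volume_openSimplex_le hΔ).trans_lt ENNReal.ofReal_lt_top
  have hmeas : AEStronglyMeasurable f (volume.restrict (openSimplex j Δ)) := by
    refine AEMeasurable.aestronglyMeasurable ?_
    rw [aemeasurable_restrict_iff_comap_subtype measurableSet_openSimplex]
    exact hm.aemeasurable
  refine ⟨?_, ?_⟩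
  · rw [integrableOn_congr_set_ae simplex_ae_eq]
    have : IsFiniteMeasure (volume.restrict (openSimplex j Δ)) :=
      ⟨by rwa [Measure.restrict_apply_univ]⟩
    exact Integrable.of_bound hmeas C
      ((ae_restrict_iff' measurableSet_openSimplex).2 (.of_forall hC))
  · rw [setIntegral_congr_set simplex_ae_eq]
    refine (norm_setIntegral_le_of_norm_le_const (f := f) hfin hC).trans ?_
    refine mul_le_mul_of_nonneg_left ?_ hC0
    exact ENNReal.toReal_le_of_le_ofReal (by positivity) (volume_openSimplex_le hΔ)

end Simplex

/-! ### The recursive Taylor polynomial as a sum over multi-indices. -/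

section TaylorSum

variable {ι : Type} [Fintype ι] [DecidableEq ι]

local notation "𝔼" => EuclideanSpace ℝ ι

lemma sum_Iic_snoc {n : ℕ} (β : Fin (n + 1) → ℕ) (f : (Fin (n + 1) → ℕ) → ℝ) :
    ∑ α ∈ Finset.Iic β, f α = ∑ k ∈ Finset.range (β (Fin.last n) + 1),
      ∑ α ∈ Finset.Iic (fun i => β i.castSucc), f (Fin.snoc α k) := by
  rw [← Finset.sum_product']
  symm
  refine Finset.sum_bij' (fun p _ => Fin.snoc p.2 p.1)
    (fun α _ => (α (Fin.last n), fun i => α i.castSucc)) ?_ ?_ ?_ ?_ ?_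
  · rintro ⟨k, α⟩ h
    simp only [Finset.mem_product, Finset.mem_range, Finset.mem_Iic, Pi.le_def] at h ⊢
    intro i
    refine Fin.lastCases ?_ (fun i => ?_) i
    · simp only [Fin.snoc_last]; omega
    · simpa using h.2 i
  · intro α h
    simp only [Finset.mem_product, Finset.mem_range, Finset.mem_Iic, Pi.le_def] at h ⊢
    exact ⟨by have := h (Fin.last n); omega, fun i => h _⟩
  · rintro ⟨k, α⟩ _
    simp
  · intro α _
    exact Fin.snoc_init_self α
  · intros; rfl

/-- The recursion splits off the last entry of the multi-index, whose factor acts last; the list `l`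
holds the factors to its left. -/
lemma taylorSum_eq_sum (G Q : Op ι) (T : ℕ → ℝ) (β : ℕ → ℕ) (x : 𝔼) (ψ : 𝔼 → ℝ) (n : ℕ)
    (l : List ℕ) : taylorSum G Q T β x ψ n l =
      ∑ α ∈ Finset.Iic (fun i : Fin n => β i), (∏ i : Fin n, T (i + 1) ^ α i) /
        (∏ i, ((α i).factorial : ℝ)) *
        opL G Q l (Fin.foldl n (fun ψ i => adIter G (α i) Q ψ) ψ) x := by
  induction n generalizing l with
  | zero =>
    rw [taylorSum, Finset.sum_eq_single (fun i : Fin 0 => β i)]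
    · simp
    · exact fun α _ h => absurd (Subsingleton.elim _ _) h
    · simp
  | succ n ih =>
    rw [taylorSum, sum_Iic_snoc]
    refine Finset.sum_congr (by simp) fun k _ => ?_
    rw [ih, Finset.mul_sum]
    refine Finset.sum_congr rfl fun α _ => ?_
    rw [Fin.foldl_succ_last, Fin.prod_univ_castSucc, Fin.prod_univ_castSucc]
    simp only [Fin.snoc_castSucc, Fin.snoc_last, Fin.val_castSucc, Fin.val_last, opL]
    ring

end TaylorSum


/-! ### The times of the simplex as a decreasing sequence. -/

section TimeAt

variable {j : ℕ} {Δ : ℝ} {s : Fin j → ℝ}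

lemma timeAt_succ (i : Fin j) : timeAt Δ s (i + 1) = s i := by simp [timeAt]

lemma timeAt_of_lt {k : ℕ} (hk : j < k) : timeAt Δ s k = 0 := by
  rw [timeAt, if_neg (by omega), dif_neg (by omega)]

lemma timeAt_nonneg (hΔ : 0 < Δ) (hs : s ∈ openSimplex j Δ) (k : ℕ) : 0 ≤ timeAt Δ s k := by
  unfold timeAt
  split_ifs
  exacts [hΔ.le, (hs.2 _).1.le, le_rfl]

lemma timeAt_lt (hΔ : 0 < Δ) (hs : s ∈ openSimplex j Δ) {k : ℕ} (hk : k ≤ j) :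
    timeAt Δ s (k + 1) < timeAt Δ s k := by
  rcases k with _ | k
  · rcases Nat.eq_zero_or_pos j with h | h
    · rw [timeAt_of_lt (by omega)]; exact hΔ
    · rw [timeAt_succ (⟨0, h⟩ : Fin j)]; exact (hs.2 _).2
  · rw [timeAt_succ (⟨k, hk⟩ : Fin j)]
    rcases hk.lt_or_eq with h | h
    · rw [timeAt_succ (⟨k + 1, h⟩ : Fin j)]
      exact hs.1 (Fin.mk_lt_mk.2 k.lt_succ_self)
    · rw [timeAt_of_lt (by omega)]; exact (hs.2 _).1

lemma timeAt_anti (hΔ : 0 < Δ) (hs : s ∈ openSimplex j Δ) (k : ℕ) :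
    timeAt Δ s (k + 1) ≤ timeAt Δ s k := by
  rcases le_or_gt k j with h | h
  · exact (timeAt_lt hΔ hs h).le
  · rw [timeAt_of_lt (by omega), timeAt_of_lt h]

lemma measurable_timeAt (k : ℕ) : Measurable fun s : Fin j → ℝ => timeAt Δ s k := by
  unfold timeAt
  split_ifs
  exacts [measurable_const, measurable_pi_apply _, measurable_const]

end TimeAt

/-! ### The remainder bound under abstract hypotheses on the frozen coefficients. -/

namespace SDE

variable {ι : Type} [Fintype ι] [DecidableEq ι] {d Nθ j : ℕ}

lemma gen0_eq (S : SDE ι d Nθ) (z : EuclideanSpace ℝ ι) (θ : EuclideanSpace ℝ (Fin Nθ)) :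
    S.gen0 z θ = genL (S.A z θ) (S.a z θ) (S.b z θ) := by
  funext φ ξ
  simp only [gen0, genL, SDE.a, Matrix.of_apply, Finset.sum_mul]

lemma mulVec_add_b (S : SDE ι d Nθ) (z : EuclideanSpace ℝ ι) (θ : EuclideanSpace ℝ (Fin Nθ))
    (i : ι) : (S.A z θ *ᵥ z.ofLp) i + S.b z θ i = S.V0 z θ i := by simp [b]

/-- Bounded frozen coefficients, a difference of generators that vanishes at `x` to the order
prescribed by the weights, and a lower bound for the covariance. -/
structure Admissible (S : SDE ι d Nθ) (Θ : Set (EuclideanSpace ℝ (Fin Nθ)))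
    (x : EuclideanSpace ℝ ι) (ϖ : ι → ℕ) (B c : ℝ) : Prop where
  frozen : Frozen ϖ (fun θ : Θ => S.A x θ) (fun θ => S.a x θ) (fun θ => S.b x θ) B
  diff : DO x ϖ 0 fun θ : Θ => S.genDiff x θ
  pos : 0 < c
  nondeg : ∀ θ : Θ, ∀ t ∈ Ioc (0 : ℝ) 1, ∀ u : ι → ℝ,
    c * ∑ i, t ^ ϖ i * u i ^ 2 ≤ u ⬝ᵥ (gcov (S.A x θ) (S.a x θ) t *ᵥ u)

variable {S : SDE ι d Nθ} {Θ : Set (EuclideanSpace ℝ (Fin Nθ))} {x : EuclideanSpace ℝ ι}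
  {ϖ : ι → ℕ} {B c Δ : ℝ} {s : Fin j → ℝ}

lemma Admissible.posDef (H : S.Admissible Θ x ϖ B c) (θ : Θ) {t : ℝ} (ht : t ∈ Ioc (0 : ℝ) 1) :
    (gcov (S.A x θ) (S.a x θ) t).PosDef := by
  have h1 : NonDeg ϖ (fun _ : Unit => √t) (fun _ => S.A x θ) (fun _ => S.a x θ) c := by
    refine ⟨H.pos, fun _ u => ?_⟩
    simp only [pow_mul, Real.sq_sqrt ht.1.le]
    exact H.nondeg θ t ht u
  have h2 := h1.posDef (H.frozen.reindex fun _ : Unit => θ)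
    (fun _ => ⟨Real.sqrt_pos.2 ht.1, Real.sqrt_le_one.2 ht.2⟩) ()
  rwa [Real.sq_sqrt ht.1.le] at h2

lemma times_timeAt {M : Type} {Δ : M → ℝ} {s : M → Fin j → ℝ} (hΔ : ∀ m, Δ m ∈ Ioo (0 : ℝ) 1)
    (hs : ∀ m, s m ∈ openSimplex j (Δ m)) : Times (fun m => √(Δ m)) fun m => timeAt (Δ m) (s m) :=
  ⟨fun m => ⟨Real.sqrt_pos.2 (hΔ m).1, Real.sqrt_le_one.2 (hΔ m).2.le⟩,
    fun m => by rw [Real.sq_sqrt (hΔ m).1.le]; simp [timeAt],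
    fun m => timeAt_anti (hΔ m).1 (hs m), fun m => timeAt_nonneg (hΔ m).1 (hs m)⟩

lemma Admissible.step_posDef (H : S.Admissible Θ x ϖ B c) (θ : Θ) (hΔ : Δ ∈ Ioo (0 : ℝ) 1)
    (hs : s ∈ openSimplex j Δ) {k : ℕ} (hk : k ≤ j) :
    (gcov (S.A x θ) (S.a x θ) (timeAt Δ s k - timeAt Δ s (k + 1))).PosDef :=
  H.posDef θ ⟨sub_pos.2 (timeAt_lt hΔ.1 hs hk), ((times_timeAt (M := Unit) (fun _ => hΔ)
    fun _ => hs).step_mem () k).2⟩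

/-- The semigroups defined by densities and by Gaussian averages agree because all time steps are
positive in the open simplex. -/
lemma Admissible.chain_eq (H : S.Admissible Θ x ϖ B c) (θ : Θ) (hΔ : Δ ∈ Ioo (0 : ℝ) 1)
    (hs : s ∈ openSimplex j Δ) (y : EuclideanSpace ℝ ι) {k : ℕ} (hk : k ≤ j) :
    S.chain x θ Δ s y k =
      kchain (S.A x θ) (S.a x θ) (S.b x θ) (S.genDiff x θ) (timeAt Δ s) y k := by
  induction k with
  | zero => rfl
  | succ k ih =>
    have hQ := H.diff.reindex fun _ : Unit => θ
    have h1 := utg_kchain (H.frozen.reindex fun _ : Unit => θ) hQ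
      (times_timeAt (M := Unit) (fun _ => hΔ) fun _ => hs) k
    funext ξ
    rw [chain, ih (by omega), kchain, sg_eq_gker (H.step_posDef θ hΔ hs hk)
      (hQ.smooth () (slice_smooth (h1.contDiff ()) y)).continuous]
    rfl

lemma Admissible.E_eq (H : S.Admissible Θ x ϖ B c) (θ : Θ) (hΔ : Δ ∈ Ioo (0 : ℝ) 1)
    (hs : s ∈ openSimplex j Δ) (y : EuclideanSpace ℝ ι) {β' : ℕ → ℕ} :
    S.E (fun i : Fin j => β' i) s Δ x y θ =
      resid (S.A x θ) (S.a x θ) (S.b x θ) (S.genDiff x θ) (timeAt Δ (s : Fin j → ℝ)) β' x j y := by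
  rw [E, resid, taylorSum_eq_sum, T, H.chain_eq θ hΔ hs y le_rfl]
  congr 1
  refine Finset.sum_congr rfl fun α _ => ?_
  simp only [timeAt_succ, D, opL, gen0_eq]
  rfl

lemma Admissible.chain_wellDefined (H : S.Admissible Θ x ϖ B c) (θ : Θ)
    (hΔ : Δ ∈ Ioo (0 : ℝ) 1) (hs : s ∈ openSimplex j Δ) (y : EuclideanSpace ℝ ι) {k : ℕ}
    (hk : k < j) : ContDiff ℝ ∞ (S.chain x θ Δ s y k) ∧ ∀ ξ, Integrable fun η =>
      S.genDiff x θ (S.chain x θ Δ s y k) η *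
        S.kernel x θ (timeAt Δ s (k + 1) - timeAt Δ s (k + 2)) ξ η := by
  have hQ := H.diff.reindex fun _ : Unit => θ
  have F := H.frozen.reindex fun _ : Unit => θ
  have hT := times_timeAt (M := Unit) (fun _ => hΔ) fun _ => hs
  have h1 := utg_kchain F hQ hT k
  rw [H.chain_eq θ hΔ hs y hk.le]
  refine ⟨slice_smooth (h1.contDiff ()) y, fun ξ => ?_⟩
  have h2 : TG (kchain (S.A x θ) (S.a x θ) (S.b x θ) (S.genDiff x θ) (timeAt Δ s) y k) :=
    h1.comp (UTG.id.prodMk (UTG.const' y))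
  exact integrable_gker F (hT.step_mem () (k + 1)) (H.step_posDef θ hΔ hs hk)
    (hQ.utg _root_.id h2) ξ

lemma Admissible.measurable_resid (H : S.Admissible Θ x ϖ B c) (θ : Θ)
    (hΔ : Δ ∈ Ioo (0 : ℝ) 1) (y : EuclideanSpace ℝ ι) (β' : ℕ → ℕ) :
    Measurable fun s : openSimplex j Δ => resid (S.A x θ) (S.a x θ) (S.b x θ) (S.genDiff x θ)
      (timeAt Δ (s : Fin j → ℝ)) β' x j y := by
  have hT := times_timeAt (M := openSimplex j Δ) (fun _ => hΔ) fun s => s.2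
  have hm : ∀ n, Measurable fun s : openSimplex j Δ => timeAt Δ (s : Fin j → ℝ) n := fun n =>
    (measurable_timeAt n).comp measurable_subtype_coe
  have h1 := measurable_kchain (H.frozen.reindex fun _ : Unit => θ)
    (H.diff.reindex fun _ : Unit => θ) hT hm y j fun k hk s => H.step_posDef θ hΔ s.2 hk
  have h2 : Measurable fun s : openSimplex j Δ => (s, x) := measurable_id.prodMk measurable_const
  have h3 := h1.comp h2
  simp only [Function.comp_def] at h3
  have h4 : ∀ s : Fin j → ℝ, timeAt Δ s 0 = Δ := fun s => by simp [timeAt]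
  simp only [resid, h4]
  exact h3.sub (measurable_taylorSum hm β' _ j [])

/-- The triples `(θ, Δ, s)` form the index of the families, so the constants of the pointwise bound
are uniform in all three. The residual is at most `δ^{g - j}` times a Gaussian that does not depend
on `s`, and the volume of the simplex is at most `δ^{2j}`. This leaves `δ^{j + g}`. -/
theorem Admissible.exists_R2_bound (H : S.Admissible Θ x ϖ B c) {β' : ℕ → ℕ} {g : ℕ}
    (hgβ : ∀ i, g ≤ β' i)
    (hg : ∀ i γ n, wt ϖ γ ≤ 2 * (β' i + 1) + n + 1 → wt (hw ϖ) γ ≤ β' i + 1 + 2 →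
      wt ϖ γ + g ≤ 2 * (β' i + 1) + 1 + n) (j : ℕ) :
    ∃ C c' : ℝ, 0 < C ∧ 0 < c' ∧ ∀ Δ ∈ Ioo (0 : ℝ) 1, ∀ y, ∀ θ ∈ Θ,
      S.R2WellDefined (fun i : Fin j => β' i) Δ x y θ ∧
      |S.R2 (fun i : Fin j => β' i) Δ x y θ| ≤ C * Δ ^ (((j : ℝ) + g) / 2) *
        (Δ ^ (-(((∑ i, ϖ i : ℕ) : ℝ) / 2)) * Real.exp (-c' *
          ∑ i, (y i - x i - Δ * S.V0 x θ i) ^ 2 / Δ ^ ϖ i)) := by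
  let M := {p : Θ × ℝ × (Fin j → ℝ) // p.2.1 ∈ Ioo (0 : ℝ) 1 ∧ p.2.2 ∈ openSimplex j p.2.1}
  let π : M → Θ := fun p => p.1.1
  have hΔM : ∀ m : M, m.1.2.1 ∈ Ioo (0 : ℝ) 1 := fun m => m.2.1
  have hT : Times (fun m : M => √m.1.2.1) fun m => timeAt m.1.2.1 m.1.2.2 :=
    times_timeAt hΔM fun m => m.2.2
  have D : NonDeg ϖ (fun m : M => √m.1.2.1) (fun m => S.A x (π m)) (fun m => S.a x (π m)) c := by
    refine ⟨H.pos, fun m u => ?_⟩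
    simp only [pow_mul, Real.sq_sqrt (hΔM m).1.le]
    exact H.nondeg (π m) _ ⟨(hΔM m).1, (hΔM m).2.le⟩ u
  have F := H.frozen.reindex π
  obtain ⟨C, hC, hb⟩ := resid_bound D F (H.diff.reindex π) hT hgβ hg (n := j)
    (fun m => H.step_posDef (π m) m.2.1 m.2.2 (Nat.zero_le j)) fun m => timeAt_of_lt j.lt_succ_self
  obtain ⟨K, c', hK, hc', hk⟩ := D.exists_gker_le F hT.hδ x
  refine ⟨C * K + 1, c', by positivity, hc', fun Δ hΔ y θ hθ => ?_⟩
  set P := (∏ i, √Δ ^ ϖ i)⁻¹ * Real.exp (-c' *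
    ∑ i, (y i - x i - Δ * S.V0 x θ i) ^ 2 / Δ ^ ϖ i) with hP
  have hd : 0 < √Δ := Real.sqrt_pos.2 hΔ.1
  have hP0 : 0 < P := mul_pos (inv_pos.2 (Finset.prod_pos fun i _ => by positivity))
    (Real.exp_pos _)
  have hE : ∀ s ∈ openSimplex j Δ, |S.E (fun i : Fin j => β' i) s Δ x y θ| ≤
      C * √Δ ^ g * (K * P) / √Δ ^ j := fun s hs => by
    rw [H.E_eq ⟨θ, hθ⟩ hΔ hs, le_div_iff₀ (by positivity), mul_comm]
    let m : M := ⟨(⟨θ, hθ⟩, Δ, s), hΔ, hs⟩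
    refine (hb m y).trans ?_
    refine mul_le_mul_of_nonneg_left ?_ (by positivity)
    have h1 := hk m y
    rw [mul_assoc] at h1
    refine h1.trans_eq ?_
    simp only [mulVec_add_b, π, m, Real.sq_sqrt hΔ.1.le, hP]
  have hm : Measurable fun s : openSimplex j Δ => S.E (fun i : Fin j => β' i) s Δ x y θ := by
    have h1 : (fun s : openSimplex j Δ => S.E (fun i : Fin j => β' i) s Δ x y θ) =
        fun s : openSimplex j Δ =>
        resid (S.A x θ) (S.a x θ) (S.b x θ) (S.genDiff x θ) (timeAt Δ (s : Fin j → ℝ)) β' x j y :=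
      funext fun s => H.E_eq ⟨θ, hθ⟩ hΔ s.2 y
    rw [h1]
    exact H.measurable_resid ⟨θ, hθ⟩ hΔ y β'
  obtain ⟨h1, h2⟩ := integrableOn_simplex hm hΔ.1.le hE (by positivity)
  refine ⟨⟨fun s hs k hk => H.chain_wellDefined ⟨θ, hθ⟩ hΔ hs y hk, h1⟩, h2.trans ?_⟩
  have e1 : Δ ^ j = √Δ ^ j * √Δ ^ j := by
    rw [← mul_pow, Real.mul_self_sqrt hΔ.1.le]
  have e2 : Δ ^ (((j : ℝ) + g) / 2) = √Δ ^ j * √Δ ^ g := by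
    rw [Real.rpow_div_two_eq_sqrt _ hΔ.1.le, Real.rpow_add hd, Real.rpow_natCast,
      Real.rpow_natCast]
  have e3 : Δ ^ (-(((∑ i, ϖ i : ℕ) : ℝ) / 2)) = (∏ i, √Δ ^ ϖ i)⁻¹ := by
    rw [Real.rpow_neg hΔ.1.le, Real.rpow_div_two_eq_sqrt _ hΔ.1.le, Real.rpow_natCast,
      Finset.prod_pow_eq_pow_sum]
  rw [e1, e2, e3, ← hP]
  have e4 : C * √Δ ^ g * (K * P) / √Δ ^ j * (√Δ ^ j * √Δ ^ j) =
      C * K * (√Δ ^ j * √Δ ^ g) * P := by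
    field_simp
  rw [e4]
  gcongr
  linarith

end SDE


/-! ### Uniform bounds for the coefficients of the SDE. -/

lemma exists_uniform_bound {κ Λ : Type} [Fintype κ] {f : κ → Λ → ℝ}
    (h : ∀ k, ∃ C, ∀ l, |f k l| ≤ C) : ∃ C, 0 ≤ C ∧ ∀ k l, |f k l| ≤ C := by
  choose C hC using h
  refine ⟨∑ k, |C k|, by positivity, fun k l => (hC k l).trans ((le_abs_self _).trans ?_)⟩
  exact Finset.single_le_sum (f := fun k => |C k|) (fun _ _ => abs_nonneg _) (Finset.mem_univ k)

lemma UTG.exists_bound_at {Λ E F : Type} [NormedAddCommGroup E] [NormedSpace ℝ E]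
    [NormedAddCommGroup F] [NormedSpace ℝ F] {f : Λ → E → F} (h : UTG f) (x : E) :
    ∃ C, ∀ l, ‖f l x‖ ≤ C := by
  obtain ⟨C, k, -, hb⟩ := h.ub
  exact ⟨_, fun l => hb l x⟩

namespace SDE

variable {ι : Type} [Fintype ι] [DecidableEq ι] {d Nθ : ℕ}
  {S : SDE ι d Nθ} {Θ : Set (EuclideanSpace ℝ (Fin Nθ))} {x : EuclideanSpace ℝ ι}

local notation "𝔼" => EuclideanSpace ℝ ι

lemma CoeffBounded.utg_V (hB : S.CoeffBounded Θ x) (hS : S.IsSmooth Θ) (l : Fin d) :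
    UTG fun (θ : Θ) (y : 𝔼) => S.V l y θ := by
  refine UTG.of_iteratedFDeriv (fun θ => (hS θ θ.2).2 l) fun n => ?_
  rcases n.eq_zero_or_pos with rfl | hn
  · obtain ⟨C, hC, h⟩ := hB.2.1
    exact ⟨C, 0, hC.le, fun θ y => by simpa using h l y θ θ.2⟩
  · obtain ⟨C, hC, h⟩ := hB.2.2 n hn
    refine ⟨C, 0, hC.le, fun θ y => ?_⟩
    rw [pow_zero, mul_one]
    refine le_trans ?_ (h y θ θ.2)
    have h1 := Finset.single_le_sum
      (f := fun l => ‖iteratedFDeriv ℝ n (fun x => S.V l x (θ : EuclideanSpace ℝ (Fin Nθ))) y‖)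
      (fun _ _ => norm_nonneg _) (Finset.mem_univ l)
    have := norm_nonneg (iteratedFDeriv ℝ n (fun x => S.V0 x (θ : EuclideanSpace ℝ (Fin Nθ))) y)
    linarith

lemma CoeffBounded.norm_iteratedFDeriv_V0_le (hB : S.CoeffBounded Θ x) {n : ℕ} (hn : 1 ≤ n) :
    ∃ C > 0, ∀ y, ∀ θ ∈ Θ, ‖iteratedFDeriv ℝ n (fun x => S.V0 x θ) y‖ ≤ C := by
  obtain ⟨C, hC, h⟩ := hB.2.2 n hn
  refine ⟨C, hC, fun y θ hθ => le_trans ?_ (h y θ hθ)⟩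
  exact le_add_of_nonneg_right (Finset.sum_nonneg fun _ _ => norm_nonneg _)

/-- The drift itself may be unbounded. Its value at the origin is controlled by its value at `x` and
the bound of its first derivative, and its growth by the derivatives. -/
lemma CoeffBounded.utg_V0 (hB : S.CoeffBounded Θ x) (hS : S.IsSmooth Θ) :
    UTG fun (θ : Θ) (y : 𝔼) => S.V0 y θ := by
  obtain ⟨κ, -, hκ⟩ := hB.1
  obtain ⟨C, hC, h⟩ := hB.norm_iteratedFDeriv_V0_le le_rfl
  have hd : ∀ θ : Θ, Differentiable ℝ fun y => S.V0 y θ := fun θ =>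
    (hS θ θ.2).1.differentiable (by simp)
  refine UTG.of_fderiv hd (C := κ + C * ‖x‖) (fun θ => ?_)
    (UTG.of_iteratedFDeriv (fun θ => (hS θ θ.2).1.fderiv_right (by simp)) fun n => ?_)
  · have h1 : ∀ y ∈ (univ : Set 𝔼),
        ‖fderiv ℝ (fun y => S.V0 y (θ : EuclideanSpace ℝ (Fin Nθ))) y‖ ≤ C := fun y _ => by
      rw [← norm_iteratedFDeriv_one]
      exact h y θ θ.2
    have h2 := convex_univ.norm_image_sub_le_of_norm_fderiv_le (fun y _ => hd θ y) h1
      (mem_univ x) (mem_univ 0)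
    rw [zero_sub, norm_neg] at h2
    have h3 := hκ θ θ.2
    have h4 := norm_le_insert' (S.V0 0 (θ : EuclideanSpace ℝ (Fin Nθ))) (S.V0 x θ)
    linarith [norm_nonneg x]
  · obtain ⟨C, hC, h⟩ := hB.norm_iteratedFDeriv_V0_le (Nat.le_add_left 1 n)
    refine ⟨C, 0, hC.le, fun θ y => ?_⟩
    rw [norm_iteratedFDeriv_fderiv]
    simpa using h y θ θ.2

lemma posSemidef_a (S : SDE ι d Nθ) (y : 𝔼) (θ : EuclideanSpace ℝ (Fin Nθ)) :
    (S.a y θ).PosSemidef := by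
  have h : S.a y θ = (Matrix.of fun i l => S.V l y θ i) *
      (Matrix.of fun i l => S.V l y θ i)ᴴ := by
    ext i k
    simp [SDE.a, Matrix.mul_apply]
  rw [h]
  exact Matrix.posSemidef_self_mul_conjTranspose _

lemma CoeffBounded.utg_a (hB : S.CoeffBounded Θ x) (hS : S.IsSmooth Θ) (i k : ι) :
    UTG fun (θ : Θ) (y : 𝔼) => S.a y θ i k := by
  have h1 : UTG fun (θ : Θ) (y : 𝔼) => ∑ l, S.V l y θ i * S.V l y θ k :=
    UTG.sum _ fun l _ => ((hB.utg_V hS l).coord i).mul ((hB.utg_V hS l).coord k)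
  exact h1

variable {ϖ : ι → ℕ}

lemma CoeffBounded.exists_frozen (hB : S.CoeffBounded Θ x) (hS : S.IsSmooth Θ)
    (hϖ : ∀ i, ϖ i = 1 ∨ ϖ i = 3) (hV : ∀ θ ∈ Θ, ∀ l y i, ϖ i ≠ 1 → S.V l y θ i = 0) :
    ∃ B, Frozen ϖ (fun θ : Θ => S.A x θ) (fun θ => S.a x θ) (fun θ => S.b x θ) B := by
  obtain ⟨BA, hBA0, hBA⟩ := exists_uniform_bound
    (f := fun (p : ι × ι) (θ : Θ) => S.A x θ p.1 p.2) fun p =>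
      (((hB.utg_V0 hS).coord p.1).pd p.2).exists_bound_at x
  obtain ⟨Ba, hBa0, hBa⟩ := exists_uniform_bound
    (f := fun (p : ι × ι) (θ : Θ) => S.a x θ p.1 p.2) fun p =>
      (hB.utg_a hS p.1 p.2).exists_bound_at x
  obtain ⟨Bb, hBb0, hBb⟩ := exists_uniform_bound
    (f := fun (i : ι) (θ : Θ) => S.b x θ i) fun i => by
      obtain ⟨C, hC⟩ := ((hB.utg_V0 hS).coord i).exists_bound_at x
      refine ⟨C + ∑ k, BA * |x k|, fun θ => ?_⟩
      refine (abs_sub _ _).trans (add_le_add (hC θ) ?_)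
      refine (Finset.abs_sum_le_sum_abs _ _).trans (Finset.sum_le_sum fun k _ => ?_)
      rw [abs_mul]
      exact mul_le_mul_of_nonneg_right (hBA (i, k) θ) (abs_nonneg _)
  have hz : ∀ (θ : Θ) i k, ϖ i ≠ 1 ∨ ϖ k ≠ 1 → S.a x θ i k = 0 := fun θ i k h => by
    rw [SDE.a, Matrix.of_apply]
    refine Finset.sum_eq_zero fun l _ => ?_
    rcases h with h | h <;> simp [hV θ θ.2 l x _ h]
  refine ⟨BA + Ba + Bb, hϖ, fun θ i k => (hBA (i, k) θ).trans (by linarith),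
    fun θ i k => (hBa (i, k) θ).trans (by linarith), fun θ i => (hBb i θ).trans (by linarith),
    fun θ => S.posSemidef_a x θ, fun θ i k h => ?_⟩
  by_contra hcon
  exact h (hz θ i k (by tauto))

/-- By the linearisation of the drift, the difference of drifts vanishes to order two at `x`, which
allows a derivative of weight up to `3`. The difference `a(ξ) - a(x)` vanishes to order one, which
allows two derivatives of weight `1`. -/
lemma CoeffBounded.genDiff_mem (hB : S.CoeffBounded Θ x) (hS : S.IsSmooth Θ)
    (hϖ : ∀ i, ϖ i = 1 ∨ ϖ i = 3) (hV : ∀ θ ∈ Θ, ∀ l y i, ϖ i ≠ 1 → S.V l y θ i = 0) :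
    DO x ϖ 0 fun θ : Θ => S.genDiff x θ := by
  obtain ⟨B, F⟩ := hB.exists_frozen hS hϖ hV
  have h0 : ∀ i, DO x ϖ 0 fun (θ : Θ) ψ ξ =>
      (S.V0 ξ θ i - ((S.A x θ *ᵥ ξ.ofLp) i + S.b x θ i)) * pdL [i] ψ ξ := fun i => by
    have h1 := (hB.utg_V0 hS).coord i
    have h2 := UTG.affine F.hA F.hb i
    have hp : ∀ k (θ : Θ), pd k (fun ξ : 𝔼 => S.V0 ξ θ i -
        ((S.A x θ *ᵥ ξ.ofLp) i + S.b x θ i)) x = 0 := fun k θ => by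
      have e : pd k (fun ξ : 𝔼 => S.V0 ξ θ i - ((S.A x θ *ᵥ ξ.ofLp) i + S.b x θ i)) x =
          pd k (fun ξ : 𝔼 => S.V0 ξ θ i) x -
            pd k (fun ξ : 𝔼 => (S.A x θ *ᵥ ξ.ofLp) i + S.b x θ i) x := by
        unfold pd
        rw [fderiv_fun_sub (h1.diff θ x) (h2.diff θ x)]
        rfl
      rw [e, pd_affine]
      simp [SDE.A]
    refine .term _ [i] 2 ⟨h1.sub h2, fun θ => by simp only [mulVec_add_b, sub_self], fun k =>
      ⟨(h1.sub h2).pd k, hp k, fun k' => ((h1.sub h2).pd k).pd k'⟩⟩ ?_ ?_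
    · simp only [wt, List.map_cons, List.map_nil, List.sum_cons, List.sum_nil]
      rcases hϖ i with h | h <;> omega
    · simp only [wt, hw, List.map_cons, List.map_nil, List.sum_cons, List.sum_nil]
      rcases hϖ i with h | h <;> omega
  have h1 : ∀ i k, DO x ϖ 0 fun (θ : Θ) ψ ξ =>
      (1 / 2 * (S.a ξ θ i k - S.a x θ i k)) * pdL [k, i] ψ ξ := fun i k => by
    have hu : UTG fun (θ : Θ) (ξ : 𝔼) => 1 / 2 * (S.a ξ θ i k - S.a x θ i k) := by
      refine (UTG.const' _).mul ((hB.utg_a hS i k).sub ?_)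
      exact UTG.const fun θ => F.ha θ i k
    by_cases h : ϖ i = 1 ∧ ϖ k = 1
    · refine .term _ [k, i] 1 ⟨hu, fun θ => by simp, fun k' => hu.pd k'⟩ ?_ ?_
      · simp [wt, h.1, h.2]
      · simp [wt, hw, h.1, h.2]
    · have hz : ∀ (θ : Θ) (y : 𝔼), S.a y θ i k = 0 := fun θ y => by
        rw [SDE.a, Matrix.of_apply]
        refine Finset.sum_eq_zero fun l _ => ?_
        rcases not_and_or.1 h with h | h <;> simp [hV θ θ.2 l y _ h]
      refine .congr _ _ (.term (fun _ _ => 0) [] 1 ⟨UTG.const' 0, fun _ => rfl, fun k' => ?_⟩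
        (by simp [wt]) (by simp [wt])) fun θ ψ _ => ?_
      · have := (UTG.const' (0 : ℝ) : UTG fun (_ : Θ) (_ : 𝔼) => (0 : ℝ)).pd k'
        exact this
      · funext ξ
        simp [hz]
  refine .congr _ _ (.add _ _ (DO.sum Finset.univ fun i _ => h0 i)
    (DO.sum Finset.univ fun i _ => DO.sum Finset.univ fun k _ => h1 i k)) fun θ ψ _ => ?_
  funext ξ
  change S.gen θ ψ ξ - S.gen0 x θ ψ ξ = _
  simp only [gen, gen0, SDE.a, Matrix.of_apply, pdL, sub_mul, Finset.sum_sub_distrib, mul_sub,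
    Finset.mul_sum, Finset.sum_mul, mul_assoc]
  ring

end SDE


/-! ### Lower bounds for the covariance. -/

lemma exists_pos_le_quadratic {X κ : Type} [TopologicalSpace X] [Fintype κ] {Θ : Set X}
    (hΘ : IsCompact Θ) {G : X → Matrix κ κ ℝ} (hG : ∀ i k, ContinuousOn (fun θ => G θ i k) Θ)
    (hpos : ∀ θ ∈ Θ, ∀ u, u ≠ 0 → 0 < u ⬝ᵥ (G θ *ᵥ u)) :
    ∃ c > 0, ∀ θ ∈ Θ, ∀ u, c * ∑ i, u i ^ 2 ≤ u ⬝ᵥ (G θ *ᵥ u) := by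
  classical
  let f : X × EuclideanSpace ℝ κ → ℝ := fun p => p.2.ofLp ⬝ᵥ (G p.1 *ᵥ p.2.ofLp)
  -- By homogeneity unit vectors suffice, and the form attains a positive minimum on the compact
  -- product.
  set K : Set (X × EuclideanSpace ℝ κ) := Θ ×ˢ Metric.sphere 0 1 with hK
  have hKc : IsCompact K := hΘ.prod (isCompact_sphere _ _)
  have hf : ContinuousOn f K := by
    have h1 : ∀ i, ContinuousOn (fun p : X × EuclideanSpace ℝ κ => p.2 i) K := fun i =>
      ((EuclideanSpace.proj i : EuclideanSpace ℝ κ →L[ℝ] ℝ).continuous.comp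
        continuous_snd).continuousOn
    have h2 : ∀ i k, ContinuousOn (fun p : X × EuclideanSpace ℝ κ => G p.1 i k) K := fun i k =>
      (hG i k).comp continuousOn_fst fun p hp => hp.1
    exact continuousOn_finsetSum _ fun i _ =>
      (h1 i).mul (continuousOn_finsetSum _ fun k _ => (h2 i k).mul (h1 k))
  obtain ⟨c, hc, hcb⟩ : ∃ c > 0, ∀ p ∈ K, c ≤ f p := by
    rcases K.eq_empty_or_nonempty with h | h
    · exact ⟨1, one_pos, fun p hp => by simp [h] at hp⟩
    · obtain ⟨p, hp, hmin⟩ := hKc.exists_isMinOn h hf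
      refine ⟨f p, hpos p.1 hp.1 _ fun h0 => ?_, fun q hq => hmin hq⟩
      have h1 := hp.2
      rw [mem_sphere_zero_iff_norm, EuclideanSpace.norm_eq, h0] at h1
      simp at h1
  refine ⟨c, hc, fun θ hθ u => ?_⟩
  by_cases hu : u = 0
  · simp [hu]
  set v : EuclideanSpace ℝ κ := WithLp.toLp 2 u with hv
  have hv0 : ‖v‖ ≠ 0 := by
    rw [norm_ne_zero_iff]
    intro h
    exact hu (by simpa [hv] using congrArg (fun w : EuclideanSpace ℝ κ => w.ofLp) h)
  have hsum : ∑ i, u i ^ 2 = ‖v‖ ^ 2 := by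
    rw [EuclideanSpace.real_norm_sq_eq]
  have h1 := hcb (θ, ‖v‖⁻¹ • v) ⟨hθ, by
    rw [mem_sphere_zero_iff_norm, norm_smul, norm_inv, norm_norm, inv_mul_cancel₀ hv0]⟩
  have h2 : f (θ, ‖v‖⁻¹ • v) = (‖v‖ ^ 2)⁻¹ * (u ⬝ᵥ (G θ *ᵥ u)) := by
    simp only [f, WithLp.ofLp_smul, hv, smul_dotProduct, dotProduct_smul, Matrix.mulVec_smul, smul_eq_mul]
    rw [← mul_assoc, ← mul_inv, pow_two]
  rw [h2] at h1
  rw [hsum]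
  have h3 : 0 < ‖v‖ ^ 2 := by positivity
  calc c * ‖v‖ ^ 2 ≤ (‖v‖ ^ 2)⁻¹ * (u ⬝ᵥ (G θ *ᵥ u)) * ‖v‖ ^ 2 := by gcongr
    _ = _ := by field_simp

/-- In the variables `u` and `h q` the integral is `h` times a fixed positive definite form, namely
that of the Gram matrix of `1` and `r` in `L²(0, 1)`. The constant `1/16` lies just below its
smallest eigenvalue. -/
lemma le_integral_add_mul_sq (u q : ℝ) {h : ℝ} (hh : 0 ≤ h) :
    h * (u ^ 2 + h ^ 2 * q ^ 2) / 16 ≤ ∫ r in (0 : ℝ)..h, (u + r * q) ^ 2 := by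
  have hd : ∀ r ∈ uIcc 0 h, HasDerivAt (fun r => r * u ^ 2 + r ^ 2 * (u * q) + r ^ 3 * (q ^ 2 / 3))
      ((u + r * q) ^ 2) r := fun r _ => by
    refine ((((hasDerivAt_id r).mul_const (u ^ 2)).add ((hasDerivAt_pow 2 r).mul_const (u * q))).add
      ((hasDerivAt_pow 3 r).mul_const (q ^ 2 / 3))).congr_deriv ?_
    norm_num
    ring
  rw [intervalIntegral.integral_eq_sub_of_hasDerivAt hd
    (Continuous.intervalIntegrable (by fun_prop) _ _)]
  have h1 : 0 ≤ 15 / 16 * u ^ 2 + u * (h * q) + 13 / 48 * (h * q) ^ 2 := by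
    nlinarith [sq_nonneg (u + 8 / 15 * (h * q)), sq_nonneg (h * q), sq_nonneg u]
  nlinarith [mul_nonneg hh h1]

variable {M ι : Type} [Fintype ι] [DecidableEq ι]
  {ϖ : ι → ℕ} {A a : M → Matrix ι ι ℝ} {b : M → ι → ℝ} {B : ℝ}

/-- The expansion is graded by weight: a coordinate of weight `1` is needed only up to `O(r)`, but a
coordinate of weight `3` acts on the others first through its linear term, which must be kept, with
an error of `O(r²)`. -/
lemma Frozen.exists_flow_expansion (F : Frozen ϖ A a b B) : ∃ K : ℝ, 0 ≤ K ∧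
    ∀ m, ∀ r ∈ Icc (0 : ℝ) 1, ∀ u k, |((fl (A m) r)ᵀ *ᵥ u) k - (u k + r * ∑ i with ϖ i ≠ 1, A m i k * u i)| ≤
      K * (r * (∑ i with ϖ i = 1, |u i|) + r ^ 2 * ∑ i with ϖ i ≠ 1, |u i|) := by
  obtain ⟨C, hC, h⟩ := exists_fl_bounds (ι := ι) B
  refine ⟨|B| + C, by positivity, fun m r hr u k => ?_⟩
  have e1 : ((fl (A m) r)ᵀ *ᵥ u) k = u k + r * (∑ i, A m i k * u i) +
      ∑ i, (fl (A m) r - 1 - r • A m) i k * u i := by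
    have : u k = ∑ i, (1 : Matrix ι ι ℝ) i k * u i := by simp [Matrix.one_apply]
    rw [Matrix.mulVec, dotProduct, this, Finset.mul_sum, ← Finset.sum_add_distrib,
      ← Finset.sum_add_distrib]
    refine Finset.sum_congr rfl fun i _ => ?_
    simp only [Matrix.transpose_apply, Matrix.sub_apply, Matrix.smul_apply, smul_eq_mul]
    ring
  have e2 := Finset.sum_filter_add_sum_filter_not Finset.univ (fun i => ϖ i = 1)
    fun i => A m i k * u i
  have e3 := Finset.sum_filter_add_sum_filter_not Finset.univ (fun i => ϖ i = 1) fun i => |u i|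
  have b1 : |∑ i with ϖ i = 1, A m i k * u i| ≤ |B| * ∑ i with ϖ i = 1, |u i| := by
    rw [Finset.mul_sum]
    refine (Finset.abs_sum_le_sum_abs _ _).trans (Finset.sum_le_sum fun i _ => ?_)
    rw [abs_mul]
    exact mul_le_mul_of_nonneg_right ((F.hA m i k).trans (le_abs_self B)) (abs_nonneg _)
  have b2 : |∑ i, (fl (A m) r - 1 - r • A m) i k * u i| ≤ C * r ^ 2 * ∑ i, |u i| := by
    rw [Finset.mul_sum]
    refine (Finset.abs_sum_le_sum_abs _ _).trans (Finset.sum_le_sum fun i _ => ?_)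
    rw [abs_mul]
    exact mul_le_mul_of_nonneg_right (h (A m) (F.hA m) r hr i k).2.2 (abs_nonneg _)
  set X := ∑ i with ϖ i = 1, |u i|
  set Y := ∑ i with ϖ i ≠ 1, |u i|
  have hX : 0 ≤ X := by positivity
  have hY : 0 ≤ Y := by positivity
  rw [e1, ← e2]
  have e4 : u k + r * ((∑ i with ϖ i = 1, A m i k * u i) + ∑ i with ¬ϖ i = 1, A m i k * u i) +
      (∑ i, (fl (A m) r - 1 - r • A m) i k * u i) -
      (u k + r * ∑ i with ϖ i ≠ 1, A m i k * u i) =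
      r * (∑ i with ϖ i = 1, A m i k * u i) + ∑ i, (fl (A m) r - 1 - r • A m) i k * u i := by
    ring
  rw [e4]
  refine (abs_add_le _ _).trans ?_
  rw [abs_mul, abs_of_nonneg hr.1]
  have b3 := mul_le_mul_of_nonneg_left b1 hr.1
  rw [← e3] at b2
  have b4 : r ^ 2 ≤ r := by nlinarith [hr.1, hr.2]
  have b5 := mul_le_mul_of_nonneg_right b4 (mul_nonneg hC hX)
  have b6 : 0 ≤ |B| * (r ^ 2 * Y) := by positivity
  have b7 : C * r ^ 2 * (X + ∑ i with ¬ϖ i = 1, |u i|) = C * r ^ 2 * (X + Y) := rfl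
  rw [b7] at b2
  nlinarith

-- The form of the covariance is `∫₀ᵗ ⟨e^{rAᵀ} u, a e^{rAᵀ} u⟩ dr`. By `h₀` it suffices to bound the
-- weight `1` coordinates of `e^{rAᵀ} u` from below. They are `u k + r q k` up to an error, where
-- `q` is controlled from below by the coordinates of weight `3` through `h₁`. The integral of `(u k
-- + r q k)²` is comparable to `h u² + h³ q²`, which is the required scaling, and on a short
-- interval of length `h = ε t` the error is absorbed.
set_option maxHeartbeats 800000 in
lemma Frozen.exists_nondeg (F : Frozen ϖ A a b B) {c₀ c₁ : ℝ} (hc₀ : 0 < c₀) (hc₁ : 0 < c₁)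
    (h₀ : ∀ m v, c₀ * ∑ i with ϖ i = 1, v i ^ 2 ≤ v ⬝ᵥ (a m *ᵥ v))
    (h₁ : ∀ m (u : ι → ℝ), c₁ * ∑ i with ϖ i ≠ 1, u i ^ 2 ≤
      ∑ k with ϖ k = 1, (∑ i with ϖ i ≠ 1, A m i k * u i) ^ 2) :
    ∃ c > 0, ∀ m, ∀ t ∈ Ioc (0 : ℝ) 1, ∀ u : ι → ℝ,
      c * ∑ i, t ^ ϖ i * u i ^ 2 ≤ u ⬝ᵥ (gcov (A m) (a m) t *ᵥ u) := by
  obtain ⟨K, hK, hexp⟩ := F.exists_flow_expansion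
  obtain ⟨n, hn⟩ : ∃ n : ℝ, n = (Fintype.card ι : ℝ) := ⟨_, rfl⟩
  have hn0 : 0 ≤ n := hn ▸ Nat.cast_nonneg _
  have hcard : ∀ s : Finset ι, (s.card : ℝ) ≤ n := fun s => by
    rw [hn]; exact_mod_cast Finset.card_le_univ s
  set L : ℝ := 2 * K ^ 2 * n ^ 2 with hL
  have hL0 : 0 ≤ L := by positivity
  set μ : ℝ := min 1 c₁ with hμ
  have hμ0 : 0 < μ := lt_min one_pos hc₁
  -- The choice gives `L ε ≤ μ / 64`, so the error is at most half of the main term, which carries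
  -- the constant `μ / 32`.
  set ε : ℝ := μ / (μ + 64 * L) with hε
  have hε0 : 0 < ε := by positivity
  have hε1 : ε ≤ 1 := (div_le_one (by positivity)).2 (by linarith)
  have hLε : L * ε ≤ μ / 64 := by
    rw [hε, mul_div_assoc', div_le_iff₀ (by positivity)]
    nlinarith
  refine ⟨c₀ * μ * ε ^ 3 / 64, by positivity, fun m t ht u => ?_⟩
  set X := ∑ i with ϖ i = 1, u i ^ 2 with hX
  set Y := ∑ i with ϖ i ≠ 1, u i ^ 2 with hY
  have hX0 : 0 ≤ X := by positivity
  have hY0 : 0 ≤ Y := by positivity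
  have ht0 := ht.1
  set h := ε * t with hh
  have hh0 : 0 < h := by positivity
  have hhε : h ≤ ε := mul_le_of_le_one_right hε0.le ht.2
  have hht : h ≤ t := mul_le_of_le_one_left ht0.le hε1
  have hh1 : h ≤ 1 := hhε.trans hε1
  have hsum : ∑ i, t ^ ϖ i * u i ^ 2 = t * X + t ^ 3 * Y := by
    rw [← Finset.sum_filter_add_sum_filter_not Finset.univ (fun i => ϖ i = 1), hX, hY,
      Finset.mul_sum, Finset.mul_sum]
    congr 1
    · exact Finset.sum_congr rfl fun i hi => by rw [(Finset.mem_filter.1 hi).2, pow_one]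
    · exact Finset.sum_congr rfl fun i hi => by
        rw [(F.hϖ i).resolve_left (Finset.mem_filter.1 hi).2]
  set q : ι → ℝ := fun k => ∑ i with ϖ i ≠ 1, A m i k * u i with hq
  set E : ℝ := 2 * K ^ 2 * n * (h ^ 2 * X + h ^ 4 * Y) with hE
  let f : ℝ → ℝ := fun r => ((fl (A m) r)ᵀ *ᵥ u) ⬝ᵥ (a m *ᵥ ((fl (A m) r)ᵀ *ᵥ u))
  have hfc : Continuous f := by
    have h1 : Continuous fun r => (fl (A m) r)ᵀ *ᵥ u :=
      (continuous_fl (A m)).matrix_transpose.matrix_mulVec continuous_const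
    exact h1.dotProduct (continuous_const.matrix_mulVec h1)
  have hf0 : ∀ r, 0 ≤ f r := fun r => by
    have := (F.hpos m).dotProduct_mulVec_nonneg ((fl (A m) r)ᵀ *ᵥ u)
    rwa [star_trivial] at this
  have hlow : ∀ r ∈ Icc 0 h, c₀ * ∑ k with ϖ k = 1, (1 / 2 * (u k + r * q k) ^ 2 - E) ≤ f r := by
    intro r hr
    refine le_trans (mul_le_mul_of_nonneg_left (Finset.sum_le_sum fun k _ => ?_) hc₀.le)
      (h₀ m ((fl (A m) r)ᵀ *ᵥ u))
    set p := ((fl (A m) r)ᵀ *ᵥ u) k with hp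
    have h1 := hexp m r ⟨hr.1, hr.2.trans hh1⟩ u k
    set ρ := ∑ i with ϖ i = 1, |u i| with hρ
    set σ := ∑ i with ϖ i ≠ 1, |u i| with hσ
    have hρ0 : 0 ≤ ρ := by positivity
    have hσ0 : 0 ≤ σ := by positivity
    have h2 : ρ ^ 2 ≤ n * X := by
      have := sq_sum_le_card_mul_sum_sq (s := Finset.univ.filter fun i => ϖ i = 1)
        (f := fun i => |u i|)
      simp only [sq_abs] at this
      exact this.trans (mul_le_mul_of_nonneg_right (hcard _) hX0)
    have h3 : σ ^ 2 ≤ n * Y := by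
      have := sq_sum_le_card_mul_sum_sq (s := Finset.univ.filter fun i => ϖ i ≠ 1)
        (f := fun i => |u i|)
      simp only [sq_abs] at this
      exact this.trans (mul_le_mul_of_nonneg_right (hcard _) hY0)
    have h4 : (p - (u k + r * q k)) ^ 2 ≤ E := by
      have hr0 := hr.1
      have hrh := hr.2
      have h5 : K * (r * ρ + r ^ 2 * σ) ≤ K * (h * ρ + h ^ 2 * σ) := by gcongr
      have h6 := sq_le_sq' (by linarith [(abs_le.1 h1).1]) ((abs_le.1 h1).2.trans h5)
      refine h6.trans ?_
      have h7 : (K * (h * ρ + h ^ 2 * σ)) ^ 2 ≤ 2 * K ^ 2 * (h ^ 2 * ρ ^ 2 + h ^ 4 * σ ^ 2) := by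
        have := mul_nonneg (sq_nonneg K) (sq_nonneg (h * ρ - h ^ 2 * σ))
        nlinarith
      refine h7.trans ?_
      have h8 : h ^ 2 * ρ ^ 2 + h ^ 4 * σ ^ 2 ≤ n * (h ^ 2 * X + h ^ 4 * Y) := by
        have := mul_le_mul_of_nonneg_left h2 (sq_nonneg h)
        have := mul_le_mul_of_nonneg_left h3 (pow_nonneg hh0.le 4)
        linarith
      rw [hE, mul_assoc _ n]
      exact mul_le_mul_of_nonneg_left h8 (by positivity)
    nlinarith [sq_nonneg (p + p - (u k + r * q k))]
  have hint : ∀ k, IntervalIntegrable (fun r => 1 / 2 * (u k + r * q k) ^ 2 - E) volume 0 h :=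
    fun k => Continuous.intervalIntegrable (by fun_prop) _ _
  rw [gcov_quadratic, hsum]
  calc c₀ * μ * ε ^ 3 / 64 * (t * X + t ^ 3 * Y)
      ≤ c₀ * (h * (X + h ^ 2 * (c₁ * Y)) / 32 - h * (n * E)) := by
        have g1 : μ ≤ 1 := min_le_left _ _
        have g2 : μ ≤ c₁ := min_le_right _ _
        have g3 : ε ^ 3 * (t * X + t ^ 3 * Y) ≤ h * (X + h ^ 2 * Y) := by
          have : ε ^ 3 ≤ ε := by
            have := pow_le_pow_of_le_one hε0.le hε1 (show 1 ≤ 3 by norm_num)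
            simpa using this
          have := mul_le_mul_of_nonneg_right this (mul_nonneg ht0.le hX0)
          have e : h * (X + h ^ 2 * Y) = ε * (t * X) + ε ^ 3 * (t ^ 3 * Y) := by rw [hh]; ring
          rw [e]
          linarith
        have g4 : n * E = L * h ^ 2 * (X + h ^ 2 * Y) := by rw [hE, hL]; ring
        have g5 : L * h ^ 2 ≤ μ / 64 := by
          have : h ^ 2 ≤ ε := by nlinarith
          exact (mul_le_mul_of_nonneg_left this hL0).trans hLε
        have hW : 0 ≤ X + h ^ 2 * Y := by positivity
        have g6 : μ * (X + h ^ 2 * Y) ≤ X + h ^ 2 * (c₁ * Y) := by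
          have := mul_le_mul_of_nonneg_right g1 hX0
          have := mul_le_mul_of_nonneg_right g2 (mul_nonneg (sq_nonneg h) hY0)
          linarith
        have g7 := mul_le_mul_of_nonneg_right g5 hW
        have g8 : μ / 64 * (h * (X + h ^ 2 * Y)) ≤
            h * (X + h ^ 2 * (c₁ * Y)) / 32 - h * (n * E) := by
          rw [g4]
          have := mul_le_mul_of_nonneg_left (sub_le_sub (div_le_div_of_nonneg_right g6
            (by norm_num : (0 : ℝ) ≤ 32)) g7) hh0.le
          linarith
        have g9 := mul_le_mul_of_nonneg_left g3 (by positivity : 0 ≤ μ / 64)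
        have := mul_le_mul_of_nonneg_left (g9.trans g8) hc₀.le
        linarith
    _ ≤ c₀ * ∑ k with ϖ k = 1, (1 / 2 * (h * (u k ^ 2 + h ^ 2 * q k ^ 2) / 16) - h * E) := by
        refine mul_le_mul_of_nonneg_left ?_ hc₀.le
        rw [Finset.sum_sub_distrib, Finset.sum_const, nsmul_eq_mul]
        have g1 := h₁ m u
        have g2 : ∑ k with ϖ k = 1, 1 / 2 * (h * (u k ^ 2 + h ^ 2 * q k ^ 2) / 16) =
            h * (X + h ^ 2 * ∑ k with ϖ k = 1, q k ^ 2) / 32 := by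
          rw [hX, Finset.mul_sum, ← Finset.sum_add_distrib, Finset.mul_sum, Finset.sum_div]
          exact Finset.sum_congr rfl fun k _ => by ring
        have hE0 : 0 ≤ E := by positivity
        have g3 := mul_le_mul_of_nonneg_right (hcard (Finset.univ.filter fun k => ϖ k = 1))
          (mul_nonneg hh0.le hE0)
        rw [g2]
        have g4 := mul_le_mul_of_nonneg_left g1 (mul_nonneg hh0.le (sq_nonneg h))
        have g5 : h * h ^ 2 * (c₁ * Y) ≤ h * h ^ 2 * ∑ k with ϖ k = 1, q k ^ 2 := g4
        linarith
    _ ≤ c₀ * ∑ k with ϖ k = 1, ∫ r in (0 : ℝ)..h, (1 / 2 * (u k + r * q k) ^ 2 - E) := by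
        refine mul_le_mul_of_nonneg_left (Finset.sum_le_sum fun k _ => ?_) hc₀.le
        rw [intervalIntegral.integral_sub (Continuous.intervalIntegrable (by fun_prop) _ _)
          (by simp), intervalIntegral.integral_const_mul, intervalIntegral.integral_const,
          sub_zero, smul_eq_mul]
        have := le_integral_add_mul_sq (u k) (q k) hh0.le
        linarith
    _ = ∫ r in (0 : ℝ)..h, c₀ * ∑ k with ϖ k = 1, (1 / 2 * (u k + r * q k) ^ 2 - E) := by
        rw [intervalIntegral.integral_const_mul,
          intervalIntegral.integral_finsetSum fun k _ => hint k]
    _ ≤ ∫ r in (0 : ℝ)..h, f r :=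
        intervalIntegral.integral_mono_on hh0.le
          (Continuous.intervalIntegrable (by fun_prop) _ _) (hfc.intervalIntegrable _ _) hlow
    _ ≤ ∫ r in (0 : ℝ)..t, f r :=
        intervalIntegral.integral_mono_interval le_rfl hh0.le hht
          (.of_forall fun r => hf0 r) (hfc.intervalIntegrable _ _)


/-! ### Both classes of equations are admissible. -/

lemma fderiv_coord {E ι : Type} [NormedAddCommGroup E] [NormedSpace ℝ E] [Fintype ι]
    {f : E → EuclideanSpace ℝ ι} {x : E} (hf : DifferentiableAt ℝ f x) (v : E) (i : ι) :
    fderiv ℝ f x v i = fderiv ℝ (fun y => f y i) x v := by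
  have h := ((EuclideanSpace.proj i : EuclideanSpace ℝ ι →L[ℝ] ℝ).hasFDerivAt.comp x
    hf.hasFDerivAt).fderiv
  exact (congrArg (fun L : E →L[ℝ] ℝ => L v) h).symm

lemma exists_ne_zero_of_span_eq_top {κ : Type} [Fintype κ] {s : Set (EuclideanSpace ℝ κ)}
    (hs : Submodule.span ℝ s = ⊤) {u : κ → ℝ} (hu : u ≠ 0) : ∃ v ∈ s, ∑ i, v i * u i ≠ 0 := by
  by_contra! h
  let φ : EuclideanSpace ℝ κ →ₗ[ℝ] ℝ :=
    (∑ i, u i • (EuclideanSpace.proj i : EuclideanSpace ℝ κ →L[ℝ] ℝ) : EuclideanSpace ℝ κ →L[ℝ] ℝ)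
  have hφ : ∀ v, φ v = ∑ i, v i * u i := fun v => by
    simp [φ, mul_comm]
  have h0 : φ = 0 := LinearMap.ext_on hs fun v hv => by rw [hφ, h v hv]; rfl
  have h1 := hφ (WithLp.toLp 2 u)
  rw [h0] at h1
  refine hu (funext fun i => ?_)
  have h2 := (Finset.sum_eq_zero_iff_of_nonneg fun i _ => mul_self_nonneg (u i)).1 h1.symm i
    (Finset.mem_univ i)
  exact mul_self_eq_zero.1 h2

lemma quadratic_sum_mul {κ κ' : Type} [Fintype κ] [Fintype κ'] (W : κ' → κ → ℝ) (u : κ → ℝ) :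
    u ⬝ᵥ ((Matrix.of fun i k => ∑ l, W l i * W l k) *ᵥ u) = ∑ l, (∑ i, W l i * u i) ^ 2 := by
  have h1 : u ⬝ᵥ ((Matrix.of fun i k => ∑ l, W l i * W l k) *ᵥ u) =
      ∑ i, ∑ k, ∑ l, u i * (W l i * W l k * u k) := by
    simp only [dotProduct, Matrix.mulVec, Matrix.of_apply, Finset.sum_mul, Finset.mul_sum]
  have h2 : ∑ l, (∑ i, W l i * u i) ^ 2 = ∑ l, ∑ i, ∑ k, W l i * u i * (W l k * u k) := by
    simp only [pow_two, Finset.sum_mul_sum]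
  rw [h1, h2, Finset.sum_comm (s := (Finset.univ : Finset κ'))]
  refine Finset.sum_congr rfl fun i _ => ?_
  rw [Finset.sum_comm (s := (Finset.univ : Finset κ'))]
  exact Finset.sum_congr rfl fun k _ => Finset.sum_congr rfl fun l _ => by ring

namespace SDE

variable {ι : Type} [Fintype ι] [DecidableEq ι] {d Nθ : ℕ}
  {S : SDE ι d Nθ} {Θ : Set (EuclideanSpace ℝ (Fin Nθ))} {x : EuclideanSpace ℝ ι}

local notation "𝔼" => EuclideanSpace ℝ ι

lemma continuousOn_a (hP : S.ParamRegular Θ) (i k : ι) :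
    ContinuousOn (fun θ => S.a x θ i k) Θ := by
  have h : ∀ l i, ContinuousOn (fun θ => S.V l x θ i) Θ := fun l i =>
    (EuclideanSpace.proj i : 𝔼 →L[ℝ] ℝ).continuous.comp_continuousOn ((hP.2 x).2 l)
  have h1 : ContinuousOn (fun θ => ∑ l, S.V l x θ i * S.V l x θ k) Θ :=
    continuousOn_finsetSum _ fun l _ => (h l i).mul (h l k)
  exact h1

/-- Continuity in `θ` is assumed for the drift only, not for its derivative. The bound of the second
derivative makes the difference quotients converge uniformly in `θ`, and uniform limits of
continuous functions are continuous. -/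
lemma CoeffBounded.continuousOn_A (hB : S.CoeffBounded Θ x) (hS : S.IsSmooth Θ)
    (hP : S.ParamRegular Θ) (i k : ι) : ContinuousOn (fun θ => S.A x θ i k) Θ := by
  obtain ⟨C, hC, h⟩ := hB.norm_iteratedFDeriv_V0_le (show 1 ≤ 2 by norm_num)
  have hcont : ∀ y, ContinuousOn (fun θ => S.V0 y θ i) Θ := fun y =>
    (EuclideanSpace.proj i : 𝔼 →L[ℝ] ℝ).continuous.comp_continuousOn (hP.2 y).1
  let e : 𝔼 := EuclideanSpace.single k 1
  have hu : TendstoUniformlyOn (fun (n : ℕ) θ => ((n : ℝ) + 1) *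
      (S.V0 (x + ((n : ℝ) + 1)⁻¹ • e) θ i - S.V0 x θ i)) (fun θ => S.A x θ i k) Filter.atTop Θ := by
    rw [Metric.tendstoUniformlyOn_iff]
    intro ε hε
    have hlim : Filter.Tendsto (fun n : ℕ => C / ((n : ℝ) + 1)) Filter.atTop (nhds 0) :=
      tendsto_const_div_atTop_nhds_zero_nat C |>.comp (Filter.tendsto_add_atTop_nat 1) |>.congr
        fun n => by simp
    filter_upwards [hlim.eventually (gt_mem_nhds hε)] with n hn θ hθ
    refine lt_of_le_of_lt ?_ hn
    have hn0 : (0 : ℝ) < (n : ℝ) + 1 := by positivity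
    set f := fun y => S.V0 y θ with hf
    have hsm : ContDiff ℝ ∞ f := (hS θ hθ).1
    have hd : Differentiable ℝ f := hsm.differentiable (by simp)
    have hd2 : Differentiable ℝ (fderiv ℝ f) :=
      (hsm.fderiv_right (m := ∞) (by simp)).differentiable (by simp)
    set y := x + ((n : ℝ) + 1)⁻¹ • e with hy
    have hyx : ‖y - x‖ = ((n : ℝ) + 1)⁻¹ := by
      rw [hy, add_sub_cancel_left, norm_smul, Real.norm_of_nonneg (by positivity)]
      simp [e]
    have h2 : ∀ z ∈ (univ : Set 𝔼), ‖fderiv ℝ (fderiv ℝ f) z‖ ≤ C := fun z _ => by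
      rw [← norm_iteratedFDeriv_one, norm_iteratedFDeriv_fderiv]
      exact h z θ hθ
    have h3 : ∀ z ∈ segment ℝ x y, ‖fderiv ℝ f z - fderiv ℝ f x‖ ≤ C * ((n : ℝ) + 1)⁻¹ := by
      intro z hz
      have h4 := convex_univ.norm_image_sub_le_of_norm_fderiv_le (fun z _ => hd2 z) h2
        (mem_univ x) (mem_univ z)
      refine h4.trans (mul_le_mul_of_nonneg_left ?_ hC.le)
      rw [← hyx]
      exact norm_sub_le_of_mem_segment hz
    have h5 := (convex_segment x y).norm_image_sub_le_of_norm_fderiv_le' (fun z _ => hd z) h3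
      (left_mem_segment ℝ x y) (right_mem_segment ℝ x y)
    rw [hyx] at h5
    have h6 : S.A x θ i k = ((n : ℝ) + 1) * fderiv ℝ f x (y - x) i := by
      rw [hy, add_sub_cancel_left, map_smul, PiLp.smul_apply, smul_eq_mul, ← mul_assoc,
        mul_inv_cancel₀ hn0.ne', one_mul, fderiv_coord (hd x)]
      rfl
    rw [dist_comm, Real.dist_eq, h6, ← mul_sub, abs_mul, abs_of_pos hn0]
    have h7 := (PiLp.norm_apply_le (f y - f x - fderiv ℝ f x (y - x)) i).trans h5
    rw [Real.norm_eq_abs] at h7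
    refine (mul_le_mul_of_nonneg_left h7 hn0.le).trans_eq ?_
    field_simp
  refine hu.continuousOn (Filter.Frequently.of_forall fun n => ?_)
  exact continuousOn_const.mul ((hcont _).sub (hcont _))

lemma IsElliptic.exists_admissible (hE : S.IsElliptic Θ) (hS : S.IsSmooth Θ)
    (hP : S.ParamRegular Θ) (hB : S.CoeffBounded Θ x) :
    ∃ B c, S.Admissible Θ x (fun _ => 1) B c := by
  have hϖ : ∀ i : ι, (fun _ => 1 : ι → ℕ) i = 1 ∨ (fun _ => 1 : ι → ℕ) i = 3 := fun _ => .inl rfl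
  have hV : ∀ θ ∈ Θ, ∀ l y i, (fun _ => 1 : ι → ℕ) i ≠ 1 → S.V l y θ i = 0 :=
    fun _ _ _ _ _ h => absurd rfl h
  obtain ⟨B, F⟩ := hB.exists_frozen hS hϖ hV
  obtain ⟨c₀, hc₀, h₀⟩ := exists_pos_le_quadratic (G := S.a x) hP.1
    (continuousOn_a hP) fun θ hθ u hu => by
      have := (hE x θ hθ).dotProduct_mulVec_pos hu
      rwa [star_trivial] at this
  obtain ⟨c, hc, h⟩ := F.exists_nondeg hc₀ one_pos (fun θ v => by simpa using h₀ θ θ.2 v)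
    fun θ u => by simp
  exact ⟨B, c, F, hB.genDiff_mem hS hϖ hV, hc, h⟩

section Hypo

variable {NS NR : ℕ} {S : SDE (Fin NS ⊕ Fin NR) d Nθ}
  {x : EuclideanSpace ℝ (Fin NS ⊕ Fin NR)} {θ : EuclideanSpace ℝ (Fin Nθ)}

/-- The weights of the smooth and of the rough coordinates. -/
def hypoWeight (NS NR : ℕ) : Fin NS ⊕ Fin NR → ℕ := Sum.elim (fun _ => 3) fun _ => 1

lemma sum_hypoWeight_eq_one (f : Fin NS ⊕ Fin NR → ℝ) :
    ∑ i with hypoWeight NS NR i = 1, f i = ∑ k, f (Sum.inr k) := by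
  rw [Finset.sum_filter, Fintype.sum_sum_type]
  simp [hypoWeight]

lemma sum_hypoWeight_ne_one (f : Fin NS ⊕ Fin NR → ℝ) :
    ∑ i with hypoWeight NS NR i ≠ 1, f i = ∑ k, f (Sum.inl k) := by
  rw [Finset.sum_filter, Fintype.sum_sum_type]
  simp [hypoWeight]

/-- The smooth components of the `V_l` vanish identically, and so do those of their derivatives and
of the Stratonovich correction. What survives is the derivative of the smooth drift along the rough
vector `V_l`. -/
lemma lieBracket_inl (hS : S.IsSmooth Θ) (hH : S.IsHypoelliptic Θ) (hθ : θ ∈ Θ) (l : Fin d)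
    (i : Fin NS) : VectorField.lieBracket ℝ (S.stratDrift θ) (fun x' => S.V l x' θ) x (Sum.inl i) =
      -∑ k, S.A x θ (Sum.inl i) (Sum.inr k) * S.V l x θ (Sum.inr k) := by
  have hsm := hS θ hθ
  have h0 : ∀ l y i, S.V l y θ (Sum.inl i) = 0 := fun l y i => (hH y θ hθ).1 l i
  have h1 : ∀ l y w i, fderiv ℝ (fun x' => S.V l x' θ) y w (Sum.inl i) = 0 := fun l y w i => by
    rw [fderiv_coord ((hsm.2 l).differentiable (by simp) y)]
    simp [h0]
  have h2 : DifferentiableAt ℝ (S.stratDrift θ) x := by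
    have h3 : ∀ l, ContDiff ℝ ∞ fun y => fderiv ℝ (fun x' => S.V l x' θ) y (S.V l y θ) := fun l =>
      ((hsm.2 l).fderiv_right (by simp)).clm_apply (hsm.2 l)
    have h4 : ContDiff ℝ ∞ (S.stratDrift θ) :=
      hsm.1.sub ((ContDiff.sum fun l _ => h3 l).const_smul (1 / 2 : ℝ))
    exact h4.differentiable (by simp) x
  have h3 : (fun y => S.stratDrift θ y (Sum.inl i)) = fun y => S.V0 y θ (Sum.inl i) := by
    funext y
    simp [stratDrift, h1]
  rw [VectorField.lieBracket, PiLp.sub_apply, h1, zero_sub, fderiv_coord h2, h3, fderiv_eq_sum]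
  simp [h0, SDE.A, mul_comm]

/-- If the transpose of the smooth–rough block of `A` annihilated some `u ≠ 0`, then `(u, 0)` would
be orthogonal to all `V_l` and, by `lieBracket_inl`, to all brackets, against the spanning
condition. Compactness turns this injectivity and that of the rough diffusion block into the
constants required by `Frozen.exists_nondeg`. -/
lemma IsHypoelliptic.exists_admissible (hH : S.IsHypoelliptic Θ) (hS : S.IsSmooth Θ)
    (hP : S.ParamRegular Θ) (hB : S.CoeffBounded Θ x) :
    ∃ B c, S.Admissible Θ x (hypoWeight NS NR) B c := by
  have hϖ : ∀ i, hypoWeight NS NR i = 1 ∨ hypoWeight NS NR i = 3 := by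
    rintro (i | i) <;> simp [hypoWeight]
  have hV : ∀ θ ∈ Θ, ∀ l y i, hypoWeight NS NR i ≠ 1 → S.V l y θ i = 0 := by
    rintro θ hθ l y (i | i) h
    · exact (hH y θ hθ).1 l i
    · exact absurd rfl h
  obtain ⟨B, F⟩ := hB.exists_frozen hS hϖ hV
  obtain ⟨c₀, hc₀, h₀⟩ := exists_pos_le_quadratic (κ := Fin NR)
    (G := fun θ => Matrix.of fun i k => ∑ l, S.VR l x θ i * S.VR l x θ k) hP.1
    (fun i k => continuousOn_a hP (Sum.inr i) (Sum.inr k)) fun θ hθ u hu => by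
      rw [quadratic_sum_mul (fun l i => S.VR l x θ i)]
      obtain ⟨_, ⟨l, rfl⟩, h⟩ := exists_ne_zero_of_span_eq_top (hH x θ hθ).2.1 hu
      exact Finset.sum_pos' (fun _ _ => sq_nonneg _) ⟨l, Finset.mem_univ l, by positivity⟩
  obtain ⟨c₁, hc₁, h₁⟩ := exists_pos_le_quadratic (κ := Fin NS)
    (G := fun θ => Matrix.of fun i i' => ∑ k : Fin NR,
      S.A x θ (Sum.inl i) (Sum.inr k) * S.A x θ (Sum.inl i') (Sum.inr k)) hP.1
    (fun i i' => by
      have h1 : ContinuousOn (fun θ => ∑ k : Fin NR,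
          S.A x θ (Sum.inl i) (Sum.inr k) * S.A x θ (Sum.inl i') (Sum.inr k)) Θ :=
        continuousOn_finsetSum _ fun k _ =>
          (hB.continuousOn_A hS hP _ _).mul (hB.continuousOn_A hS hP _ _)
      exact h1) fun θ hθ u hu => by
      rw [quadratic_sum_mul (fun (k : Fin NR) i => S.A x θ (Sum.inl i) (Sum.inr k))]
      have hu' : (Sum.elim u fun _ => 0 : Fin NS ⊕ Fin NR → ℝ) ≠ 0 := fun h =>
        hu (funext fun i => congrFun h (Sum.inl i))
      obtain ⟨v, hv, h⟩ := exists_ne_zero_of_span_eq_top (hH x θ hθ).2.2 hu'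
      rw [Fintype.sum_sum_type] at h
      simp only [Sum.elim_inl, Sum.elim_inr, mul_zero, Finset.sum_const_zero, add_zero] at h
      by_contra hcon
      have hz : ∀ k, ∑ i, S.A x θ (Sum.inl i) (Sum.inr k) * u i = 0 := fun k => by
        by_contra hk
        exact hcon (Finset.sum_pos' (fun _ _ => sq_nonneg _)
          ⟨k, Finset.mem_univ k, by positivity⟩)
      refine h ?_
      rcases hv with ⟨l, rfl⟩ | ⟨l, rfl⟩
      · exact Finset.sum_eq_zero fun i _ => by simp [(hH x θ hθ).1 l i]
      · simp only [lieBracket_inl hS hH hθ, neg_mul, Finset.sum_neg_distrib, Finset.sum_mul]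
        rw [Finset.sum_comm, neg_eq_zero]
        refine Finset.sum_eq_zero fun k _ => ?_
        have := congrArg (fun r => S.V l x θ (Sum.inr k) * r) (hz k)
        simp only [mul_zero, Finset.mul_sum] at this
        rw [← this]
        exact Finset.sum_congr rfl fun i _ => by ring
  obtain ⟨c, hc, h⟩ := F.exists_nondeg hc₀ hc₁ (fun θ v => by
    rw [sum_hypoWeight_eq_one]
    refine (h₀ θ θ.2 fun k => v (Sum.inr k)).trans_eq ?_
    rw [quadratic_sum_mul (fun l i => S.VR l x θ i), SDE.a,
      quadratic_sum_mul (fun l i => S.V l x θ i)]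
    refine Finset.sum_congr rfl fun l _ => ?_
    rw [Fintype.sum_sum_type]
    simp [(hH x θ θ.2).1, VR]) fun θ u => by
    simp only [sum_hypoWeight_eq_one, sum_hypoWeight_ne_one]
    refine (h₁ θ θ.2 fun i => u (Sum.inl i)).trans_eq ?_
    rw [quadratic_sum_mul (fun (k : Fin NR) i => S.A x θ (Sum.inl i) (Sum.inr k))]
  exact ⟨B, c, F, hB.genDiff_mem hS hϖ hV, hc, h⟩

end Hypo

end SDE


/-- The extension of a finite sequence by its value at `i₀`. -/
def extendBy {j : ℕ} (β : Fin j → ℕ) (i₀ : Fin j) (i : ℕ) : ℕ :=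
  if h : i < j then β ⟨i, h⟩ else β i₀

/-! ### The exponents, and the bounds in the two classes. -/

lemma extendBy_fin {j : ℕ} (β : Fin j → ℕ) (i₀ : Fin j) : (fun i : Fin j => extendBy β i₀ i) = β := by
  funext i
  simp [extendBy]

lemma le_extendBy {j : ℕ} {β : Fin j → ℕ} {i₀ : Fin j} (h : ∀ i, β i₀ ≤ β i) (i : ℕ) :
    β i₀ ≤ extendBy β i₀ i := by
  unfold extendBy
  split_ifs
  exacts [h _, le_rfl]

lemma ciInf_eq_of_forall_le {j : ℕ} {f : Fin j → ℝ} {i₀ : Fin j} (h : ∀ i, f i₀ ≤ f i) :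
    ⨅ i, f i = f i₀ := by
  have : Nonempty (Fin j) := ⟨i₀⟩
  exact le_antisymm (ciInf_le (finite_range f).bddBelow i₀) (le_ciInf h)

lemma expE_eq {j : ℕ} {β : Fin j → ℕ} {i₀ : Fin j} (h : ∀ i, β i₀ ≤ β i) :
    expE β = ((j : ℝ) + (β i₀ : ℕ)) / 2 := by
  rw [expE, ciInf_eq_of_forall_le (i₀ := i₀) fun i => ?_]
  · ring
  · have : (β i₀ : ℝ) ≤ β i := by exact_mod_cast h i
    linarith

/-- Truncated subtraction reproduces the indicator of `2 ≤ n`, so the gain in class (H) is a natural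
number. -/
lemma floor_half_sub (n : ℕ) : ((⌊(n : ℝ) / 2⌋ : ℝ) - if 2 ≤ n then 1 else 0) =
    ((n / 2 - 1 : ℕ) : ℝ) := by
  have h : ⌊(n : ℝ) / 2⌋ = ((n / 2 : ℕ) : ℤ) := by
    have h1 : (2 : ℝ) * (n / 2 : ℕ) ≤ n := by exact_mod_cast (by omega : 2 * (n / 2) ≤ n)
    have h2 : (n : ℝ) < 2 * (n / 2 : ℕ) + 2 := by
      exact_mod_cast (by omega : n < 2 * (n / 2) + 2)
    rw [Int.floor_eq_iff, Int.cast_natCast]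
    exact ⟨by linarith, by linarith⟩
  rw [h, Int.cast_natCast]
  split_ifs with h2
  · rw [Nat.cast_sub (by omega)]
    simp
  · have : n / 2 = 0 := by omega
    simp [this]

lemma expH_eq {j : ℕ} {β : Fin j → ℕ} {i₀ : Fin j} (h : ∀ i, β i₀ ≤ β i) :
    expH β = ((j : ℝ) + (β i₀ / 2 - 1 : ℕ)) / 2 := by
  simp only [expH, floor_half_sub]
  rw [ciInf_eq_of_forall_le (i₀ := i₀) fun i => ?_]
  · ring
  · have h1 : ((β i₀ / 2 - 1 : ℕ) : ℝ) ≤ ((β i / 2 - 1 : ℕ) : ℝ) := by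
      exact_mod_cast (by have := h i; omega : β i₀ / 2 - 1 ≤ β i / 2 - 1)
    linarith

/-- The worst ratio of weight to reduced weight is `3 / 2`, attained in the smooth directions. This
ratio limits the gain in class (H). -/
lemma two_mul_wt_hypoWeight_le {NS NR : ℕ} (γ : List (Fin NS ⊕ Fin NR)) :
    2 * wt (SDE.hypoWeight NS NR) γ ≤ 3 * wt (hw (SDE.hypoWeight NS NR)) γ := by
  induction γ with
  | nil => simp [wt]
  | cons i γ ih =>
    have h : 2 * SDE.hypoWeight NS NR i ≤ 3 * hw (SDE.hypoWeight NS NR) i := by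
      rcases i with i | i <;> simp [hw, SDE.hypoWeight]
    rw [wt_cons, wt_cons]
    omega

/-- Replacing the exponent of a Gaussian bound by a comparable one. -/
lemma gaussian_bound_congr {R C c κ Δ K m q Q : ℝ} (hΔ : Δ ∈ Ioo (0 : ℝ) 1) (hC : 0 < C)
    (hc : 0 < c) (hq : 0 ≤ q) (hqQ : q / 2 - κ ≤ Q)
    (hR : |R| ≤ C * Δ ^ K * (Δ ^ (-(m / 2)) * Real.exp (-c * Q))) :
    |R| ≤ C * Real.exp (c * κ) * Δ ^ K * |Δ ^ (-(m / 2)) * Real.exp (-(c / 2) * q)| ∧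
    C * Real.exp (c * κ) * Δ ^ K * |Δ ^ (-(m / 2)) * Real.exp (-(c / 2) * q)| ≤
      C * Real.exp (c * κ) * Δ ^ (K - m / 2) := by
  have h0 := hΔ.1
  rw [abs_of_pos (a := Δ ^ (-(m / 2)) * _) (by positivity)]
  constructor
  · refine hR.trans ?_
    have h1 : Real.exp (-c * Q) ≤ Real.exp (c * κ) * Real.exp (-(c / 2) * q) := by
      rw [← Real.exp_add]
      refine Real.exp_le_exp.2 ?_
      nlinarith [mul_le_mul_of_nonneg_left hqQ hc.le]
    calc C * Δ ^ K * (Δ ^ (-(m / 2)) * Real.exp (-c * Q))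
        ≤ C * Δ ^ K * (Δ ^ (-(m / 2)) * (Real.exp (c * κ) * Real.exp (-(c / 2) * q))) := by gcongr
      _ = _ := by ring
  · rw [sub_eq_add_neg, Real.rpow_add h0, mul_assoc, mul_assoc]
    have h1 : Real.exp (-(c / 2) * q) ≤ 1 := Real.exp_le_one_iff.2 (by nlinarith)
    have h2 : Δ ^ (-(m / 2)) * Real.exp (-(c / 2) * q) ≤ Δ ^ (-(m / 2)) :=
      mul_le_of_le_one_right (by positivity) h1
    rw [mul_assoc]
    gcongr

/-- In the rough coordinates the drift displaces by `O(Δ)`, which is small compared with the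
standard deviation `√Δ`. It can be dropped at the cost of half the exponent and a bounded term. -/
lemma half_sum_sq_le {n : ℕ} (v w : Fin n → ℝ) {Δ : ℝ} (hΔ : Δ ∈ Ioo (0 : ℝ) 1) :
    (∑ i, v i ^ 2) / Δ / 2 - ∑ i, w i ^ 2 ≤ ∑ i, (v i - Δ * w i) ^ 2 / Δ ^ 1 := by
  have h0 := hΔ.1
  rw [Finset.sum_div, Finset.sum_div, ← Finset.sum_sub_distrib]
  refine Finset.sum_le_sum fun i _ => ?_
  rw [pow_one, le_div_iff₀ h0]
  have h1 : (v i ^ 2 / Δ / 2 - w i ^ 2) * Δ = v i ^ 2 / 2 - w i ^ 2 * Δ := by field_simp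
  rw [h1]
  have h2 : 0 ≤ w i ^ 2 * Δ * (1 - Δ) :=
    mul_nonneg (mul_nonneg (sq_nonneg _) h0.le) (by linarith [hΔ.2])
  nlinarith [sq_nonneg (v i - 2 * (Δ * w i))]

namespace SDE

variable {d Nθ j : ℕ} {Θ : Set (EuclideanSpace ℝ (Fin Nθ))}

theorem exists_R2_bound_elliptic {N : ℕ} {S : SDE (Fin N) d Nθ} {x : EuclideanSpace ℝ (Fin N)}
    (hj : 1 ≤ j) (β : Fin j → ℕ) (hS : S.IsSmooth Θ) (hE : S.IsElliptic Θ)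
    (hP : S.ParamRegular Θ) (hB : S.CoeffBounded Θ x) :
    ∃ G : ℝ → EuclideanSpace ℝ (Fin N) → EuclideanSpace ℝ (Fin N) →
        EuclideanSpace ℝ (Fin Nθ) → ℝ,
      GaussianBoundE Θ G ∧
      ∃ C₁ > 0, ∃ C₂ > 0, ∀ Δ ∈ Set.Ioo (0 : ℝ) 1, ∀ y, ∀ θ ∈ Θ,
        S.R2WellDefined β Δ x y θ ∧
        |S.R2 β Δ x y θ| ≤ C₁ * Δ ^ expE β * |G Δ x y θ| ∧
        C₁ * Δ ^ expE β * |G Δ x y θ| ≤ C₂ * Δ ^ (expE β - (N : ℝ) / 2) := by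
  have : Nonempty (Fin j) := ⟨⟨0, hj⟩⟩
  obtain ⟨i₀, hi₀⟩ := Finite.exists_min β
  obtain ⟨B, c, H⟩ := hE.exists_admissible hS hP hB
  -- All weights are `1` and coincide with the reduced ones, so the second count bounds the number
  -- of derivatives by `β i + 3` and leaves the gain `β i`, hence the minimum of the `β i`.
  obtain ⟨C, c', hC, hc', h⟩ := H.exists_R2_bound (β' := extendBy β i₀) (g := β i₀)
    (le_extendBy hi₀) (fun i γ n _ h2 => by
      have h3 : hw (fun _ : Fin N => 1) = fun _ => 1 := by funext; simp [hw]
      rw [h3] at h2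
      have := le_extendBy hi₀ i
      omega) j
  obtain ⟨κ, hκ, hκb⟩ := hB.1
  rw [extendBy_fin, ← expE_eq hi₀] at h
  -- The Gaussian bound itself serves as `G`. Its rate is `c' / 2`, since removing the drift from
  -- the exponent uses up half of the rate.
  refine ⟨fun t x y θ => t ^ (-((N : ℝ) / 2)) * Real.exp (-(c' / 2) * (‖y - x‖ ^ 2 / t)),
    ⟨1, one_pos, c' / 2, by positivity, fun t ht x y θ _ => ?_⟩,
    C * Real.exp (c' * κ ^ 2), by positivity, C * Real.exp (c' * κ ^ 2), by positivity,
    fun Δ hΔ y θ hθ => ?_⟩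
  · rw [abs_of_pos (by positivity), one_mul]
  · obtain ⟨h1, h2⟩ := h Δ hΔ y θ hθ
    have h0 := hΔ.1
    refine ⟨h1, ?_⟩
    have e : ((∑ _ : Fin N, 1 : ℕ) : ℝ) = N := by simp
    rw [e] at h2
    refine gaussian_bound_congr hΔ hC hc' (by positivity) ?_ h2
    have h3 := half_sum_sq_le (fun i => y i - x i) (fun i => S.V0 x θ i) hΔ
    have h4 : ‖y - x‖ ^ 2 = ∑ i, (y i - x i) ^ 2 := by
      rw [EuclideanSpace.real_norm_sq_eq]; rfl
    have h5 : ∑ i, S.V0 x θ i ^ 2 ≤ κ ^ 2 := by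
      rw [← EuclideanSpace.real_norm_sq_eq]
      have := hκb θ hθ
      have := norm_nonneg x
      exact pow_le_pow_left₀ (norm_nonneg _) (by linarith) 2
    rw [h4]
    linarith

theorem exists_R2_bound_hypoelliptic {NS NR : ℕ} {S : SDE (Fin NS ⊕ Fin NR) d Nθ}
    {x : EuclideanSpace ℝ (Fin NS ⊕ Fin NR)} (hNS : NS = d) (hNR : NR = d)
    (hj : 1 ≤ j) (β : Fin j → ℕ) (hS : S.IsSmooth Θ) (hH : S.IsHypoelliptic Θ)
    (hP : S.ParamRegular Θ) (hB : S.CoeffBounded Θ x) :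
    ∃ G : ℝ → EuclideanSpace ℝ (Fin NS ⊕ Fin NR) → EuclideanSpace ℝ (Fin NS ⊕ Fin NR) →
        EuclideanSpace ℝ (Fin Nθ) → ℝ,
      S.GaussianBoundH Θ G ∧
      ∃ C₁ > 0, ∃ C₂ > 0, ∀ Δ ∈ Set.Ioo (0 : ℝ) 1, ∀ y, ∀ θ ∈ Θ,
        S.R2WellDefined β Δ x y θ ∧
        |S.R2 β Δ x y θ| ≤ C₁ * Δ ^ expH β * |G Δ x y θ| ∧
        C₁ * Δ ^ expH β * |G Δ x y θ| ≤ C₂ * Δ ^ (expH β - (4 * d : ℝ) / 2) := by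
  have : Nonempty (Fin j) := ⟨⟨0, hj⟩⟩
  obtain ⟨i₀, hi₀⟩ := Finite.exists_min β
  obtain ⟨B, c, H⟩ := hH.exists_admissible hS hP hB
  -- The reduced weight is at most `β i + 3`, hence the weight at most `3 (β i + 3) / 2`. Compared
  -- with `2 β i + 3` this leaves `⌊β i / 2⌋ - 1`. When the truncated gain is zero, the first weight
  -- count suffices.
  obtain ⟨C, c', hC, hc', h⟩ := H.exists_R2_bound (β' := extendBy β i₀) (g := β i₀ / 2 - 1)
    (fun i => by have := le_extendBy hi₀ i; omega) (fun i γ n h1 h2 => by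
      have h3 := two_mul_wt_hypoWeight_le γ
      have := le_extendBy hi₀ i
      omega) j
  obtain ⟨κ, hκ, hκb⟩ := hB.1
  rw [extendBy_fin, ← expH_eq hi₀] at h
  refine ⟨fun t x y θ => t ^ (-((4 * d : ℝ) / 2)) * Real.exp (-(c' / 2) *
      ((∑ i, (y (Sum.inl i) - x (Sum.inl i) - S.V0 x θ (Sum.inl i) * t) ^ 2) / t ^ 3 +
        (∑ i, (y (Sum.inr i) - x (Sum.inr i)) ^ 2) / t)),
    ⟨1, one_pos, c' / 2, by positivity, fun t ht x y θ _ => ?_⟩,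
    C * Real.exp (c' * κ ^ 2), by positivity, C * Real.exp (c' * κ ^ 2), by positivity,
    fun Δ hΔ y θ hθ => ?_⟩
  · rw [abs_of_pos (by positivity), one_mul]
  · obtain ⟨h1, h2⟩ := h Δ hΔ y θ hθ
    have h0 := hΔ.1
    refine ⟨h1, ?_⟩
    have e : ((∑ i, hypoWeight NS NR i : ℕ) : ℝ) = 4 * d := by
      rw [Fintype.sum_sum_type]
      simp [hypoWeight, hNS, hNR]
      ring
    rw [e] at h2
    refine gaussian_bound_congr hΔ hC hc' (by positivity) ?_ h2
    rw [Fintype.sum_sum_type]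
    have h3 := half_sum_sq_le (fun i => y (Sum.inr i) - x (Sum.inr i))
      (fun i => S.V0 x θ (Sum.inr i)) hΔ
    have h5 : ∑ i, S.V0 x θ (Sum.inr i) ^ 2 ≤ κ ^ 2 := by
      have h6 : ∑ i, S.V0 x θ (Sum.inr i) ^ 2 ≤ ‖S.V0 x θ‖ ^ 2 := by
        rw [EuclideanSpace.real_norm_sq_eq, Fintype.sum_sum_type]
        exact le_add_of_nonneg_left (Finset.sum_nonneg fun _ _ => sq_nonneg _)
      have := hκb θ hθ
      have := norm_nonneg x
      exact h6.trans (pow_le_pow_left₀ (norm_nonneg _) (by linarith) 2)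
    have h7 : ∑ i, (y (Sum.inl i) - x (Sum.inl i) - Δ * S.V0 x θ (Sum.inl i)) ^ 2 /
        Δ ^ hypoWeight NS NR (Sum.inl i) =
        (∑ i, (y (Sum.inl i) - x (Sum.inl i) - S.V0 x θ (Sum.inl i) * Δ) ^ 2) / Δ ^ 3 := by
      rw [Finset.sum_div]
      exact Finset.sum_congr rfl fun i _ => by rw [mul_comm Δ]; rfl
    have h8 : 0 ≤ (∑ i, (y (Sum.inl i) - x (Sum.inl i) - S.V0 x θ (Sum.inl i) * Δ) ^ 2) /
        Δ ^ 3 := by positivity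
    have h9 : ∑ i, (y (Sum.inr i) - x (Sum.inr i) - Δ * S.V0 x θ (Sum.inr i)) ^ 2 /
        Δ ^ hypoWeight NS NR (Sum.inr i) = ∑ i, (y (Sum.inr i) - x (Sum.inr i) -
          Δ * S.V0 x θ (Sum.inr i)) ^ 2 / Δ ^ 1 := rfl
    rw [h7, h9]
    linarith

end SDE

end LDL

end

theorem theorem2 {Nθ d j : ℕ} (hj : 1 ≤ j) (β : Fin j → ℕ)
    (Θ : Set (EuclideanSpace ℝ (Fin Nθ))) :
    -- class (E)
    (∀ (N : ℕ), 1 ≤ N → ∀ (S : LDL.SDE (Fin N) d Nθ) (x : EuclideanSpace ℝ (Fin N)),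
      S.IsSmooth Θ → S.IsElliptic Θ → S.ParamRegular Θ → S.CoeffBounded Θ x →
      ∃ G : ℝ → EuclideanSpace ℝ (Fin N) → EuclideanSpace ℝ (Fin N) →
          EuclideanSpace ℝ (Fin Nθ) → ℝ,
        LDL.SDE.GaussianBoundE Θ G ∧
        ∃ C₁ > 0, ∃ C₂ > 0, ∀ Δ ∈ Set.Ioo (0 : ℝ) 1, ∀ y, ∀ θ ∈ Θ,
          S.R2WellDefined β Δ x y θ ∧
          |S.R2 β Δ x y θ| ≤ C₁ * Δ ^ LDL.expE β * |G Δ x y θ| ∧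
          C₁ * Δ ^ LDL.expE β * |G Δ x y θ| ≤ C₂ * Δ ^ (LDL.expE β - (N : ℝ) / 2)) ∧
    -- class (H)
    (∀ (NS NR : ℕ), 1 ≤ NS → 1 ≤ NR → NS = d → NR = d →
      ∀ (S : LDL.SDE (Fin NS ⊕ Fin NR) d Nθ) (x : EuclideanSpace ℝ (Fin NS ⊕ Fin NR)),
      S.IsSmooth Θ → S.IsHypoelliptic Θ → S.ParamRegular Θ → S.CoeffBounded Θ x →
      ∃ G : ℝ → EuclideanSpace ℝ (Fin NS ⊕ Fin NR) → EuclideanSpace ℝ (Fin NS ⊕ Fin NR) →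
          EuclideanSpace ℝ (Fin Nθ) → ℝ,
        S.GaussianBoundH Θ G ∧
        ∃ C₁ > 0, ∃ C₂ > 0, ∀ Δ ∈ Set.Ioo (0 : ℝ) 1, ∀ y, ∀ θ ∈ Θ,
          S.R2WellDefined β Δ x y θ ∧
          |S.R2 β Δ x y θ| ≤ C₁ * Δ ^ LDL.expH β * |G Δ x y θ| ∧
          C₁ * Δ ^ LDL.expH β * |G Δ x y θ| ≤
            C₂ * Δ ^ (LDL.expH β - (4 * d : ℝ) / 2)) :=
  ⟨fun _ _ _ _ hS hE hP hB => LDL.SDE.exists_R2_bound_elliptic hj β hS hE hP hB,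
    fun _ _ _ _ hNS hNR _ _ hS hH hP hB =>
      LDL.SDE.exists_R2_bound_hypoelliptic hNS hNR hj β hS hH hP hB⟩
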